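/- Let $V=\mathbb R^{n|m}$. Indices $A,B$ run over the coordinates of $V$; a tilde denotes parity; all derivatives are left derivatives; repeated indices are summed; functions of supermatrices are smooth functions on the corresponding superdomains (elements of $C^\infty(U)\otimes\Lambda[\text{odd entries}]$), and identities between them that involve matrix arguments are identities at all points over Grassmann algebras. The space $\mathrm{Vol}\,V=\mathrm{Ber}\,V^*$ is identified with $\mathbb R$ by the coordinate volume form. A *straight $r|s$-form* is a smooth function $L(v)$ of $v=(v_F{}^A)$, whose rows are $r$ even and $s$ odd vectors (the odd ones linearly independent), such that $L(gv)=L(v)\,\mathrm{Ber}\,g$ for $g\in GL(r|s)$ and $$\frac{\partial^2L}{\partial v_F{}^A\partial v_G{}^B}+(-1)^{\tilde F\tilde G+(\tilde F+\tilde G)\tilde B}\frac{\partial^2L}{\partial v_G{}^A\partial v_F{}^B}=0 .$$ A *mixed form* of codegree $p|q$ and additional degree $r|s$ (an element of $\mathcal E^{r|s}_{p|q}$) is a smooth function $\mathcal L\binom pw$ of $p$ even and $q$ odd covectors on $V\oplus\mathbb R^{r|s}$, the columns of $\binom pw$, $p=(p_A{}^K)$, $w=(w_F{}^K)$ (the odd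 columns and the odd rows of $w$ being linearly independent), such that $\mathcal L(ph,wh)=\mathcal L(p,w)\,\mathrm{Ber}\,h$ for $h\in GL(p|q)$, $\mathcal L(p+aw,gw)=\mathcal L(p,w)\,\mathrm{Ber}\,g$ for $g\in GL(r|s)$ and all even supermatrices $a$ of the appropriate size, and $\mathcal L$ satisfies the same system of second order equations with respect to the rows and columns of $\binom pw$. The stability isomorphism $\sigma=\sigma_{k|l}:\mathcal E^{r|s}_{p|q}\to\mathcal E^{r+k|s+l}_{p+k|q+l}$ and its inverse are given by $$(\sigma\mathcal L)\begin{pmatrix}p_1&p_2\\w_{11}&w_{12}\\w_{21}&w_{22}\end{pmatrix}=\mathcal L\begin{pmatrix}p_1-p_2w_{22}^{-1}w_{21}\\w_{11}-w_{12}w_{22}^{-1}w_{21}\end{pmatrix}\mathrm{Ber}\,w_{22},\qquad(\sigma^{-1}\mathcal L^*)\begin{pmatrix}p\\w\end{pmatrix}=\mathcal L^*\begin{pmatrix}p&0\\w&0\\0&1\end{pmatrix}$$ (the first formula where $w_{22}$ is invertible), and the isomorphism $\tau$ between straight $r|s$-forms and $\mathcal E^{r|s}_{n|m}$ by $(\tau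 L)\binom pw=L(wp^{-1})\,\mathrm{Ber}\,p$ (where $p$ is invertible), $(\tau^{-1}\mathcal L)(v)=\mathcal L\binom1v$. A relation $\mathcal L^*=\sigma\mathcal L$ or $\mathcal L=\tau L$ between given forms means that the respective formula holds at all admissible arguments where $w_{22}$, respectively $p$, is invertible. For a covector $\alpha=(\alpha_A)\in V^*$ and a vector $u=(u^A)\in V$ put $$e(\alpha)\mathcal L=(-1)^r\alpha_Aw_{r+1}^K(-1)^{\tilde\alpha\tilde A}\frac{\partial\mathcal L}{\partial p_A{}^K},$$ $$e(u)\mathcal L=(-1)^ru^A\Bigl(p_A^{p+1}-(-1)^{\tilde B\tilde K}p_A{}^Kp_B^{p+1}\frac{\partial}{\partial p_B{}^K}-(-1)^{\tilde F\tilde K}p_A{}^Kw_F^{p+1}\frac{\partial}{\partial w_F{}^K}\Bigr)\mathcal L$$ (for $\alpha$ homogeneous, extended linearly). Then: 1. $e(\alpha)$ maps $\mathcal E^{r|s}_{p|q}$ to $\mathcal E^{r+1|s}_{p|q}$ and $e(u)$ maps $\mathcal E^{r|s}_{p|q}$ to $\mathcal E^{r|s}_{p+1|q}$. They are stable: if $\mathcal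 L^*=\sigma_{k|l}\mathcal L$, then $e(\alpha)\mathcal L^*=\sigma_{k|l}e(\alpha)\mathcal L$ and $e(u)\mathcal L^*=\sigma_{k|l}e(u)\mathcal L$; and $\sigma_{k|l}^{-1}e(\alpha)=e(\alpha)\sigma_{k|l}^{-1}$, $\sigma_{k|l}^{-1}e(u)=e(u)\sigma_{k|l}^{-1}$ on all of $\mathcal E^{r+k|s+l}_{p+k|q+l}$. 2. Under $\tau$, $e(\alpha)$ corresponds to the operator $$e_\alpha=(-1)^r\Bigl(v_{r+1}^A\alpha_A-(-1)^{\tilde\alpha\tilde F}v_F{}^A\alpha_A\,v_{r+1}^B\frac{\partial}{\partial v_F{}^B}\Bigr)$$ from straight $r|s$-forms to straight $r+1|s$-forms: if $\mathcal L=\tau L$, then $e(\alpha)\mathcal L=\tau e_\alpha L$; and $\tau^{-1}e(\alpha)=e_\alpha\tau^{-1}$ on $\mathcal E^{r|s}_{n|m}$. 3. For $r>0$, under $\tau$ the operator $\sigma_{1|0}^{-1}e(u):\mathcal E^{r|s}_{n|m}\to\mathcal E^{r-1|s}_{n|m}$ corresponds to the operator $$i_u=(-1)^{r-1}u^A\frac{\partial}{\partial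 v_r{}^A}$$ from straight $r|s$-forms to straight $r-1|s$-forms: if $\mathcal L=\tau L$, then $\sigma_{1|0}^{-1}e(u)\mathcal L=\tau i_uL$; and $\tau^{-1}\sigma_{1|0}^{-1}e(u)=i_u\tau^{-1}$ on $\mathcal E^{r|s}_{n|m}$. On straight forms $i_uL$ does not depend on $v_r$, and up to the factor $(-1)^{r-1}$ it is the substitution of $u$ into the last even slot: for homogeneous $u$ and a parameter $c$ of the same parity, $L|_{v_r=cu}=(-1)^{r-1}c\,i_uL$ (in particular $L|_{v_r=u}=(-1)^{r-1}i_uL$ for even $u$). -/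

import Mathlib

open scoped ContDiff TensorProduct

noncomputable section

namespace SuperForms

/-! ### Superfunctions on superdomains -/

open Classical in
/-- Extension by zero of a function on `U`. -/
def extendZero {I : Type} (U : TopologicalSpace.Opens (I → ℝ)) (g : U → ℝ) : (I → ℝ) → ℝ :=
  fun x => if h : x ∈ U then g ⟨x, h⟩ else 0

theorem extendZero_of_mem {I : Type} (U : TopologicalSpace.Opens (I → ℝ)) (g : U → ℝ)
    {x : I → ℝ} (h : x ∈ U) : extendZero U g x = g ⟨x, h⟩ := by
  simp [extendZero, h]

/-- The algebra `C^∞(U)` of real smooth functions on the open set `U ⊆ ℝ^I`. -/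
def Smooth {I : Type} [Fintype I] (U : TopologicalSpace.Opens (I → ℝ)) :
    Subalgebra ℝ (U → ℝ) where
  carrier := {g | ContDiffOn ℝ ∞ (extendZero U g) U}
  mul_mem' := by
    intro a b ha hb
    refine (ContDiffOn.mul ha hb).congr fun x hx => ?_
    have hx' : x ∈ U := hx
    simp [extendZero_of_mem _ _ hx']
  add_mem' := by
    intro a b ha hb
    refine (ContDiffOn.add ha hb).congr fun x hx => ?_
    have hx' : x ∈ U := hx
    simp [extendZero_of_mem _ _ hx']
  algebraMap_mem' := by
    intro c
    refine (contDiffOn_const (c := c)).congr fun x hx => ?_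
    have hx' : x ∈ U := hx
    simp [extendZero_of_mem _ _ hx']

/-- The coordinate function `x_i` on `U`. -/
def Smooth.coord {I : Type} [Fintype I] (U : TopologicalSpace.Opens (I → ℝ)) (i : I) :
    Smooth U :=
  ⟨fun x => x.1 i, by
    refine ((contDiff_apply ℝ ℝ i).contDiffOn (n := ∞)).congr fun x hx => ?_
    have hx' : x ∈ U := hx
    simp [extendZero_of_mem _ _ hx']⟩

theorem Smooth.contDiffAt {I : Type} [Fintype I] {U : TopologicalSpace.Opens (I → ℝ)}
    (g : Smooth U) {x : I → ℝ} (hx : x ∈ U) : ContDiffAt ℝ ∞ (extendZero U g.1) x :=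
  ContDiffOn.contDiffAt g.2 (U.isOpen.mem_nhds hx)

theorem Smooth.extendZero_add {I : Type} [Fintype I] {U : TopologicalSpace.Opens (I → ℝ)}
    (f g : Smooth U) :
    extendZero U (f + g).1 = extendZero U f.1 + extendZero U g.1 := by
  funext x
  by_cases h : x ∈ U <;> simp [extendZero, h]

theorem Smooth.extendZero_smul {I : Type} [Fintype I] {U : TopologicalSpace.Opens (I → ℝ)}
    (c : ℝ) (g : Smooth U) :
    extendZero U (c • g).1 = c • extendZero U g.1 := by
  funext x
  by_cases h : x ∈ U <;> simp [extendZero, h]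

open Classical in
/-- The partial derivative `∂/∂x_i` on `C^∞(U)`. -/
def Smooth.pderiv {I : Type} [Fintype I] (U : TopologicalSpace.Opens (I → ℝ)) (i : I) :
    Smooth U →ₗ[ℝ] Smooth U where
  toFun g := ⟨fun x => fderiv ℝ (extendZero U g.1) x.1 (Pi.single i 1), by
    have h : ContDiffOn ℝ ∞ (fun x => fderiv ℝ (extendZero U g.1) x (Pi.single i 1)) U :=
      (ContDiffOn.fderiv_of_isOpen (m := ∞) g.2 U.isOpen (by simp)).clm_apply contDiffOn_const
    refine h.congr fun x hx => ?_
    have hx' : x ∈ U := hx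
    simp [extendZero_of_mem _ _ hx']⟩
  map_add' f g := by
    ext x
    have hf := (Smooth.contDiffAt f x.2).differentiableAt (by simp)
    have hg := (Smooth.contDiffAt g x.2).differentiableAt (by simp)
    simp only [Smooth.extendZero_add, fderiv_add hf hg]
    rfl
  map_smul' c g := by
    ext x
    have hg := (Smooth.contDiffAt g x.2).differentiableAt (by simp)
    simp only [Smooth.extendZero_smul, fderiv_const_smul hg]
    rfl

/-- Composition with a smooth map `b` that maps `U'` into `U`. -/
def Smooth.comp {I I' : Type} [Fintype I] [Fintype I'] {U : TopologicalSpace.Opens (I → ℝ)}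
    {U' : TopologicalSpace.Opens (I' → ℝ)} (b : (I' → ℝ) → (I → ℝ)) (hb : ContDiff ℝ ∞ b)
    (hU : ∀ x ∈ U', b x ∈ U) : Smooth U →ₐ[ℝ] Smooth U' where
  toFun g := ⟨fun x => g.1 ⟨b x.1, hU x.1 x.2⟩, by
    refine (ContDiffOn.comp g.2 hb.contDiffOn hU).congr fun x hx => ?_
    have hx' : x ∈ U' := hx
    simp [extendZero_of_mem _ _ hx', extendZero_of_mem _ _ (hU x hx')]⟩
  map_one' := rfl
  map_mul' _ _ := rfl
  map_zero' := rfl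
  map_add' _ _ := rfl
  commutes' _ := rfl

/-- The superalgebra `C^∞(U) ⊗ Λ[ξ_j : j ∈ J]` of smooth functions on the superdomain with
even coordinates `x_i`, `i ∈ I`, ranging over `U`, and odd coordinates `ξ_j`, `j ∈ J`. -/
abbrev SFun {I : Type} [Fintype I] (U : TopologicalSpace.Opens (I → ℝ)) (J : Type) : Type :=
  Smooth U ⊗[ℝ] ExteriorAlgebra ℝ (J →₀ ℝ)

/-- The Grassmann algebra with `N` odd generators. -/
abbrev Gr (N : ℕ) : Type := ExteriorAlgebra ℝ (Fin N → ℝ)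

/-- The body (the component of degree zero) of an element of a Grassmann algebra. -/
abbrev body {N : ℕ} : Gr N →ₐ[ℝ] ℝ := ExteriorAlgebra.algebraMapInv

open Classical in
/-- The value of a smooth function `g` at even elements `X_i = x_i + n_i` of a Grassmann algebra,
with `x_i` real and `n_i` nilpotent, by the Taylor expansion in the nilpotent parts,
`∑_k 1/k! ∑_{i_1,…,i_k} (∂_{i_1}⋯∂_{i_k} g)(x) n_{i_1}⋯n_{i_k}`. Terms with `k > N` vanish.
The value is zero by convention when `x ∉ U`. -/
def taylor {I : Type} [Fintype I] (U : TopologicalSpace.Opens (I → ℝ)) {N : ℕ} (X : I → Gr N) :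
    Smooth U →ₗ[ℝ] Gr N where
  toFun g :=
    if (fun i => body (X i)) ∈ U then
      ∑ k ∈ Finset.range (N + 1), ∑ idx : Fin k → I,
        ((k.factorial : ℝ)⁻¹ * iteratedFDeriv ℝ k (extendZero U g.1) (fun i => body (X i))
            (fun a => Pi.single (idx a) 1)) •
          (List.ofFn fun a => X (idx a) - algebraMap ℝ (Gr N) (body (X (idx a)))).prod
    else 0
  map_add' f g := by
    split_ifs with h
    · rw [← Finset.sum_add_distrib]
      refine Finset.sum_congr rfl fun k _ => ?_
      rw [← Finset.sum_add_distrib]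
      refine Finset.sum_congr rfl fun idx _ => ?_
      have hk : ((k : ℕ∞) : WithTop ℕ∞) ≤ ∞ := by exact_mod_cast le_top
      rw [Smooth.extendZero_add, iteratedFDeriv_add_apply ((Smooth.contDiffAt f h).of_le hk)
        ((Smooth.contDiffAt g h).of_le hk), add_apply, mul_add, add_smul]
    · simp
  map_smul' c g := by
    split_ifs with h
    · rw [RingHom.id_apply, Finset.smul_sum]
      refine Finset.sum_congr rfl fun k _ => ?_
      rw [Finset.smul_sum]
      refine Finset.sum_congr rfl fun idx _ => ?_
      have hk : ((k : ℕ∞) : WithTop ℕ∞) ≤ ∞ := by exact_mod_cast le_top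
      rw [Smooth.extendZero_smul, iteratedFDeriv_const_smul_apply ((Smooth.contDiffAt g h).of_le hk),
        smul_apply, smul_eq_mul, smul_smul]
      congr 1
      ring
    · simp

open Classical in
/-- The algebra homomorphism `Λ[ξ_j] → Gr N`, `ξ_j ↦ Ξ_j`, for odd elements `Ξ_j`; it exists
because linear combinations of odd elements square to zero. (Families for which this fails
have the value zero by convention.) -/
def oddEval {J : Type} {N : ℕ} (Ξ : J → Gr N) : ExteriorAlgebra ℝ (J →₀ ℝ) →ₗ[ℝ] Gr N :=
  if h : ∀ v, Finsupp.linearCombination ℝ Ξ v * Finsupp.linearCombination ℝ Ξ v = 0 then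
    (ExteriorAlgebra.lift ℝ ⟨Finsupp.linearCombination ℝ Ξ, h⟩).toLinearMap
  else 0

/-- The value `f(X, Ξ)` of a superfunction `f` at the point of its superdomain over the
Grassmann algebra `Gr N` with even coordinates `X` and odd coordinates `Ξ`:
`(g ⊗ ξ_{j_1}⋯ξ_{j_k})(X, Ξ) = g(X) Ξ_{j_1}⋯Ξ_{j_k}`. -/
def SFun.eval {I J : Type} [Fintype I] {U : TopologicalSpace.Opens (I → ℝ)} {N : ℕ}
    (f : SFun U J) (X : I → Gr N) (Ξ : J → Gr N) : Gr N :=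
  TensorProduct.lift ((LinearMap.mul ℝ (Gr N)).compl₁₂ (taylor U X) (oddEval Ξ)) f

/-! ### Supermatrices and functions of a supermatrix

Rows are indexed by `R0 ⊕ R1` and columns by `C0 ⊕ C1`: the left summands are the even rows and
columns, the right summands the odd ones. -/

/-- The parity of a row or column index: `0` for even, `1` for odd. -/
def par {α β : Type} : α ⊕ β → ℕ := Sum.elim (fun _ => 0) (fun _ => 1)

/-- The even coordinates of a supermatrix: its even-even and odd-odd entries. -/
abbrev Ev (R0 R1 C0 C1 : Type) : Type := (R0 × C0) ⊕ (R1 × C1)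

/-- The odd coordinates of a supermatrix: its even-odd and odd-even entries. -/
abbrev Od (R0 R1 C0 C1 : Type) : Type := (R0 × C1) ⊕ (R1 × C0)

/-- The entry in row `a` and column `k` of a supermatrix, as a superfunction. -/
def coord {R0 R1 C0 C1 : Type} [Fintype R0] [Fintype R1] [Fintype C0] [Fintype C1]
    (U : TopologicalSpace.Opens (Ev R0 R1 C0 C1 → ℝ)) :
    R0 ⊕ R1 → C0 ⊕ C1 → SFun U (Od R0 R1 C0 C1)
  | .inl a, .inl k => Smooth.coord U (.inl (a, k)) ⊗ₜ 1
  | .inr a, .inr k => Smooth.coord U (.inr (a, k)) ⊗ₜ 1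
  | .inl a, .inr k => 1 ⊗ₜ ExteriorAlgebra.ι ℝ (Finsupp.single (.inl (a, k)) 1)
  | .inr a, .inl k => 1 ⊗ₜ ExteriorAlgebra.ι ℝ (Finsupp.single (.inr (a, k)) 1)

/-- The left derivative `∂/∂ξ_j` of the exterior algebra, the antiderivation of degree `-1` with
`∂ξ_i/∂ξ_j = δ_{ij}`. -/
def oddDeriv {J : Type} (j : J) :
    ExteriorAlgebra ℝ (J →₀ ℝ) →ₗ[ℝ] ExteriorAlgebra ℝ (J →₀ ℝ) :=
  CliffordAlgebra.contractLeft (Q := (0 : QuadraticForm ℝ (J →₀ ℝ))) (Finsupp.lapply j)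

/-- The (left) partial derivative with respect to the entry in row `a` and column `k` of a
supermatrix. -/
def pd {R0 R1 C0 C1 : Type} [Fintype R0] [Fintype R1] [Fintype C0] [Fintype C1]
    (U : TopologicalSpace.Opens (Ev R0 R1 C0 C1 → ℝ)) :
    R0 ⊕ R1 → C0 ⊕ C1 → SFun U (Od R0 R1 C0 C1) →ₗ[ℝ] SFun U (Od R0 R1 C0 C1)
  | .inl a, .inl k => TensorProduct.map (Smooth.pderiv U (.inl (a, k))) LinearMap.id
  | .inr a, .inr k => TensorProduct.map (Smooth.pderiv U (.inr (a, k))) LinearMap.id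
  | .inl a, .inr k => TensorProduct.map LinearMap.id (oddDeriv (.inl (a, k)))
  | .inr a, .inl k => TensorProduct.map LinearMap.id (oddDeriv (.inr (a, k)))

/-- The system of differential equations
`∂²f/∂v_a^k ∂v_b^l + (-1)^{ab + (a+b)l} ∂²f/∂v_b^k ∂v_a^l = 0` (with parities of indices in the
exponent), for all pairs of rows `a`, `b` and all pairs of columns `k`, `l`. -/
def SecondOrderSystem {R0 R1 C0 C1 : Type} [Fintype R0] [Fintype R1] [Fintype C0] [Fintype C1]
    {U : TopologicalSpace.Opens (Ev R0 R1 C0 C1 → ℝ)} (f : SFun U (Od R0 R1 C0 C1)) : Prop :=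
  ∀ (a b : R0 ⊕ R1) (k l : C0 ⊕ C1),
    pd U a k (pd U b l f) +
      ((-1 : ℝ) ^ (par a * par b + (par a + par b) * par l)) • pd U b k (pd U a l f) = 0

/-- A matrix over a Grassmann algebra is an even supermatrix if each entry has the parity
prescribed by the parities of its row and column. -/
def IsSuper {R0 R1 C0 C1 : Type} {N : ℕ} (M : Matrix (R0 ⊕ R1) (C0 ⊕ C1) (Gr N)) : Prop :=
  ∀ a k, M a k ∈ CliffordAlgebra.evenOdd (0 : QuadraticForm ℝ (Fin N → ℝ))
    ((par a + par k : ℕ) : ZMod 2)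

/-- The even entries of a supermatrix. -/
def evPart {R0 R1 C0 C1 : Type} {N : ℕ} (M : Matrix (R0 ⊕ R1) (C0 ⊕ C1) (Gr N)) :
    Ev R0 R1 C0 C1 → Gr N
  | .inl (a, k) => M (.inl a) (.inl k)
  | .inr (a, k) => M (.inr a) (.inr k)

/-- The odd entries of a supermatrix. -/
def odPart {R0 R1 C0 C1 : Type} {N : ℕ} (M : Matrix (R0 ⊕ R1) (C0 ⊕ C1) (Gr N)) :
    Od R0 R1 C0 C1 → Gr N
  | .inl (a, k) => M (.inl a) (.inr k)
  | .inr (a, k) => M (.inr a) (.inl k)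

/-- `M` is a point over `Gr N` of the superdomain of supermatrices with body in `U`. -/
def IsPoint {R0 R1 C0 C1 : Type} {N : ℕ} (U : TopologicalSpace.Opens (Ev R0 R1 C0 C1 → ℝ))
    (M : Matrix (R0 ⊕ R1) (C0 ⊕ C1) (Gr N)) : Prop :=
  IsSuper M ∧ (fun i => body (evPart M i)) ∈ U

/-- The value `f(M)` of a superfunction at a supermatrix `M` over `Gr N`. -/
def value {R0 R1 C0 C1 : Type} [Fintype R0] [Fintype R1] [Fintype C0] [Fintype C1] {N : ℕ}
    {U : TopologicalSpace.Opens (Ev R0 R1 C0 C1 → ℝ)} (f : SFun U (Od R0 R1 C0 C1))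
    (M : Matrix (R0 ⊕ R1) (C0 ⊕ C1) (Gr N)) : Gr N :=
  f.eval (evPart M) (odPart M)

/-- The determinant by the Leibniz formula; it is used for matrices whose entries commute. -/
def ldet {A : Type} [Ring A] {d : ℕ} (M : Matrix (Fin d) (Fin d) A) : A :=
  ∑ π : Equiv.Perm (Fin d), ((Equiv.Perm.sign π : ℤˣ) : ℤ) • (List.ofFn fun i => M (π i) i).prod

/-- The Berezinian of an invertible even supermatrix `(A B; C D)`,
`Ber = det(A - B D⁻¹ C) · (det D)⁻¹`. -/
def Ber {A : Type} [Ring A] {a b : ℕ} (M : Matrix (Fin a ⊕ Fin b) (Fin a ⊕ Fin b) A) : A :=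
  ldet (M.toBlocks₁₁ - M.toBlocks₁₂ * Ring.inverse M.toBlocks₂₂ * M.toBlocks₂₁) *
    Ring.inverse (ldet M.toBlocks₂₂)

/-- `h ∈ GL(a|b)(Gr N)`. -/
def IsGL {a b N : ℕ} (h : Matrix (Fin a ⊕ Fin b) (Fin a ⊕ Fin b) (Gr N)) : Prop :=
  IsSuper h ∧ IsUnit h

/-! ### Substitutions of coordinates and constants -/

/-- A supermatrix with rows `R0 ⊕ R1` and columns `C0 ⊕ C1`, each of whose entries is an entry
(of the right parity) of a generic supermatrix with rows `R0' ⊕ R1'` and columns `C0' ⊕ C1'`, or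
a real constant (only zero, in odd places). -/
structure Subst (R0 R1 C0 C1 R0' R1' C0' C1' : Type) where
  /-- even row, even column -/
  ee : R0 → C0 → (R0' × C0') ⊕ ℝ
  /-- odd row, odd column -/
  oo : R1 → C1 → (R1' × C1') ⊕ ℝ
  /-- even row, odd column -/
  eo : R0 → C1 → Option (R0' × C1')
  /-- odd row, even column -/
  oe : R1 → C0 → Option (R1' × C0')

namespace Subst

variable {R0 R1 C0 C1 R0' R1' C0' C1' : Type}

/-- The even entries. -/
def even (φ : Subst R0 R1 C0 C1 R0' R1' C0' C1') (x : Ev R0' R1' C0' C1' → ℝ) :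
    Ev R0 R1 C0 C1 → ℝ
  | .inl (a, k) => Sum.elim (fun c => x (.inl c)) id (φ.ee a k)
  | .inr (a, k) => Sum.elim (fun c => x (.inr c)) id (φ.oo a k)

/-- The odd entries. -/
def odd (φ : Subst R0 R1 C0 C1 R0' R1' C0' C1') :
    Od R0 R1 C0 C1 → (Od R0' R1' C0' C1' →₀ ℝ)
  | .inl (a, k) => (φ.eo a k).elim 0 (fun c => Finsupp.single (.inl c) 1)
  | .inr (a, k) => (φ.oe a k).elim 0 (fun c => Finsupp.single (.inr c) 1)

theorem contDiff_even [Fintype R0] [Fintype R1] [Fintype C0] [Fintype C1] [Fintype R0']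
    [Fintype R1'] [Fintype C0'] [Fintype C1'] (φ : Subst R0 R1 C0 C1 R0' R1' C0' C1') :
    ContDiff ℝ ∞ φ.even := by
  rw [contDiff_pi]
  rintro (⟨a, k⟩ | ⟨a, k⟩)
  · rcases h : φ.ee a k with c | t
    · simpa [even, h] using contDiff_apply ℝ ℝ (n := ∞) (Sum.inl c : Ev R0' R1' C0' C1')
    · simpa [even, h] using contDiff_const
  · rcases h : φ.oo a k with c | t
    · simpa [even, h] using contDiff_apply ℝ ℝ (n := ∞) (Sum.inr c : Ev R0' R1' C0' C1')
    · simpa [even, h] using contDiff_const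

/-- The superfunction `f(φ(v))` of a generic supermatrix `v`. -/
def pull [Fintype R0] [Fintype R1] [Fintype C0] [Fintype C1] [Fintype R0'] [Fintype R1']
    [Fintype C0'] [Fintype C1'] (φ : Subst R0 R1 C0 C1 R0' R1' C0' C1')
    {U : TopologicalSpace.Opens (Ev R0 R1 C0 C1 → ℝ)}
    {U' : TopologicalSpace.Opens (Ev R0' R1' C0' C1' → ℝ)} (hU : ∀ x ∈ U', φ.even x ∈ U) :
    SFun U (Od R0 R1 C0 C1) →ₐ[ℝ] SFun U' (Od R0' R1' C0' C1') :=
  Algebra.TensorProduct.map (Smooth.comp φ.even φ.contDiff_even hU)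
    (ExteriorAlgebra.map (Finsupp.linearCombination ℝ φ.odd))

end Subst

/-! ### Straight forms on `V = ℝ^{n|m}` -/

/-- The admissible arguments `v` of straight `r|s`-forms: the `s` odd vectors are linearly
independent, i.e. the rows of the body of the odd-odd block of `v` are. -/
def straightDom (n m r s : ℕ) :
    TopologicalSpace.Opens (Ev (Fin r) (Fin s) (Fin n) (Fin m) → ℝ) where
  carrier := {x | LinearIndependent ℝ (fun F : Fin s => fun B : Fin m => x (.inr (F, B)))}
  is_open' := by
    refine isOpen_setOfPred_linearIndependent.preimage (f := fun (x : Ev (Fin r) (Fin s) (Fin n)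
      (Fin m) → ℝ) => fun F : Fin s => fun B : Fin m => x (.inr (F, B))) ?_
    fun_prop

/-- Smooth functions `L(v)` of `r` even and `s` odd vectors `v_F = (v_F^A)` of `ℝ^{n|m}`. -/
abbrev StraightFun (n m r s : ℕ) : Type :=
  SFun (straightDom n m r s) (Od (Fin r) (Fin s) (Fin n) (Fin m))

/-- A straight form of degree `r|s` on `ℝ^{n|m}`. -/
structure IsStraight {n m r s : ℕ} (L : StraightFun n m r s) : Prop where
  ber : ∀ (N : ℕ) (v : Matrix (Fin r ⊕ Fin s) (Fin n ⊕ Fin m) (Gr N))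
    (g : Matrix (Fin r ⊕ Fin s) (Fin r ⊕ Fin s) (Gr N)),
    IsPoint (straightDom n m r s) v → IsGL g → value L (g * v) = value L v * Ber g
  system : SecondOrderSystem L

/-! ### Mixed forms on `V = ℝ^{n|m}` -/

/-- The rows of the argument of a mixed form: those of `p` (indexed by the coordinates of
`ℝ^{n|m}`) and those of `w` (indexed by the coordinates of `ℝ^{r|s}`). -/
abbrev MRow (n m r s : ℕ) : Type := (Fin n ⊕ Fin r) ⊕ (Fin m ⊕ Fin s)

/-- The rows of `p`. -/
def pRow {n m r s : ℕ} : Fin n ⊕ Fin m → MRow n m r s := Sum.map .inl .inl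

/-- The rows of `w`. -/
def wRow {n m r s : ℕ} : Fin r ⊕ Fin s → MRow n m r s := Sum.map .inr .inr

/-- The matrix with `P` placed over `W`. -/
def stack {n m r s : ℕ} {κ A : Type} (P : Matrix (Fin n ⊕ Fin m) κ A)
    (W : Matrix (Fin r ⊕ Fin s) κ A) : Matrix (MRow n m r s) κ A
  | .inl (.inl a) => P (.inl a)
  | .inl (.inr f) => W (.inl f)
  | .inr (.inl a) => P (.inr a)
  | .inr (.inr f) => W (.inr f)

/-- The admissible arguments `(p, w)` of mixed forms of codegree `p|q` and additional degree
`r|s`: the `q` odd covectors on `ℝ^{n|m} ⊕ ℝ^{r|s}` are linearly independent, and so are the `s`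
odd rows of `w`; both are conditions on the body of the odd-odd block. -/
def mixedDom (n m p q r s : ℕ) :
    TopologicalSpace.Opens (Ev (Fin n ⊕ Fin r) (Fin m ⊕ Fin s) (Fin p) (Fin q) → ℝ) where
  carrier := {x |
    LinearIndependent ℝ (fun K : Fin q => fun a : Fin m ⊕ Fin s => x (.inr (a, K))) ∧
    LinearIndependent ℝ (fun F : Fin s => fun K : Fin q => x (.inr (.inr F, K)))}
  is_open' := by
    refine IsOpen.inter ?_ ?_
    · refine isOpen_setOfPred_linearIndependent.preimage (f := fun (x : Ev (Fin n ⊕ Fin r)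
        (Fin m ⊕ Fin s) (Fin p) (Fin q) → ℝ) =>
          fun K : Fin q => fun a : Fin m ⊕ Fin s => x (.inr (a, K))) ?_
      fun_prop
    · refine isOpen_setOfPred_linearIndependent.preimage (f := fun (x : Ev (Fin n ⊕ Fin r)
        (Fin m ⊕ Fin s) (Fin p) (Fin q) → ℝ) =>
          fun F : Fin s => fun K : Fin q => x (.inr (.inr F, K))) ?_
      fun_prop

/-- Smooth functions `L(p, w)` of `p` even and `q` odd covectors on `ℝ^{n|m} ⊕ ℝ^{r|s}`, which
are the columns of the matrix with `p` placed over `w`. The values lie in `Vol ℝ^{n|m}`, which is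
identified with `ℝ` by means of the coordinate volume form. -/
abbrev MixedFun (n m p q r s : ℕ) : Type :=
  SFun (mixedDom n m p q r s) (Od (Fin n ⊕ Fin r) (Fin m ⊕ Fin s) (Fin p) (Fin q))

/-- A mixed form on `ℝ^{n|m}` of codegree `p|q` and additional degree `r|s`. -/
structure IsMixed {n m p q r s : ℕ} (L : MixedFun n m p q r s) : Prop where
  ber_right : ∀ (N : ℕ) (M : Matrix (MRow n m r s) (Fin p ⊕ Fin q) (Gr N))
    (h : Matrix (Fin p ⊕ Fin q) (Fin p ⊕ Fin q) (Gr N)),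
    IsPoint (mixedDom n m p q r s) M → IsGL h → value L (M * h) = value L M * Ber h
  ber_left : ∀ (N : ℕ) (P : Matrix (Fin n ⊕ Fin m) (Fin p ⊕ Fin q) (Gr N))
    (W : Matrix (Fin r ⊕ Fin s) (Fin p ⊕ Fin q) (Gr N))
    (a : Matrix (Fin n ⊕ Fin m) (Fin r ⊕ Fin s) (Gr N))
    (g : Matrix (Fin r ⊕ Fin s) (Fin r ⊕ Fin s) (Gr N)),
    IsPoint (mixedDom n m p q r s) (stack P W) → IsSuper a → IsGL g →
      value L (stack (P + a * W) (g * W)) = value L (stack P W) * Ber g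
  system : SecondOrderSystem L

/-! ### The stability isomorphisms -/

/-- The first `r` of `r' = r + k` indices. -/
def firstIdx {r k r' : ℕ} (h : r' = r + k) (i : Fin r) : Fin r' := Fin.cast h.symm (Fin.castAdd k i)

/-- The last `k` of `r' = r + k` indices. -/
def lastIdx {r k r' : ℕ} (h : r' = r + k) (i : Fin k) : Fin r' := Fin.cast h.symm (Fin.natAdd r i)

/-- Division of `r' = r + k` indices into the first `r` and the last `k`. -/
def splitIdx {r k r' : ℕ} (h : r' = r + k) (i : Fin r') : Fin r ⊕ Fin k :=
  finSumFinEquiv.symm (Fin.cast h i)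

/-- `L' = σ_{k|l} L`: at all points of its domain at which the `k|l × k|l`-block `w₂₂` is
invertible, `L'` is given by
`L'(p₁ p₂; w₁₁ w₁₂; w₂₁ w₂₂) = L(p₁ - p₂ w₂₂⁻¹ w₂₁; w₁₁ - w₁₂ w₂₂⁻¹ w₂₁) · Ber w₂₂`.
Such points are dense, so that `L'` is determined by `L`. -/
def IsSigma {n m p q r s k l p' q' r' s' : ℕ} (hp : p' = p + k) (hq : q' = q + l)
    (hr : r' = r + k) (hs : s' = s + l) (L : MixedFun n m p q r s)
    (L' : MixedFun n m p' q' r' s') : Prop :=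
  let row₁ : MRow n m r s → MRow n m r' s' :=
    Sum.map (Sum.map id (firstIdx hr)) (Sum.map id (firstIdx hs))
  let row₂ : Fin k ⊕ Fin l → MRow n m r' s' :=
    Sum.map (fun i => .inr (lastIdx hr i)) (fun i => .inr (lastIdx hs i))
  let col₁ : Fin p ⊕ Fin q → Fin p' ⊕ Fin q' := Sum.map (firstIdx hp) (firstIdx hq)
  let col₂ : Fin k ⊕ Fin l → Fin p' ⊕ Fin q' := Sum.map (lastIdx hp) (lastIdx hq)
  ∀ (N : ℕ) (M : Matrix (MRow n m r' s') (Fin p' ⊕ Fin q') (Gr N)),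
    IsPoint (mixedDom n m p' q' r' s') M → IsUnit (M.submatrix row₂ col₂) →
      value L' M =
        value L (M.submatrix row₁ col₁ - M.submatrix row₁ col₂ *
            Ring.inverse (M.submatrix row₂ col₂) * M.submatrix row₂ col₁) *
          Ber (M.submatrix row₂ col₂)

/-- The even entries of the block matrix `(X 0; 0 1)`, where `X` is generic. -/
def blockDiag {α β κ : Type} [DecidableEq κ] : α ⊕ κ → β ⊕ κ → (α × β) ⊕ ℝ
  | .inl a, .inl b => .inl (a, b)
  | .inr i, .inr j => .inr (if i = j then 1 else 0)
  | _, _ => .inr 0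

/-- The odd entries of the block matrix `(X 0; 0 1)`, where `X` is generic. -/
def blockOff {α β κ κ' : Type} : α ⊕ κ → β ⊕ κ' → Option (α × β)
  | .inl a, .inl b => some (a, b)
  | _, _ => none

/-- Division of the rows of one parity of `(p, w)` into those of `(p, w₁)` and those of `w₂`. -/
def splitRow {n r k r' : ℕ} (h : r' = r + k) : Fin n ⊕ Fin r' → (Fin n ⊕ Fin r) ⊕ Fin k
  | .inl a => .inl (.inl a)
  | .inr f => Sum.map .inr id (splitIdx h f)

/-- The substitution `(p; w) ↦ (p 0; w 0; 0 1)`. -/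
def sigmaSubst (n m : ℕ) {p q r s k l p' q' r' s' : ℕ} (hp : p' = p + k) (hq : q' = q + l)
    (hr : r' = r + k) (hs : s' = s + l) :
    Subst (Fin n ⊕ Fin r') (Fin m ⊕ Fin s') (Fin p') (Fin q')
      (Fin n ⊕ Fin r) (Fin m ⊕ Fin s) (Fin p) (Fin q) where
  ee a K := blockDiag (splitRow hr a) (splitIdx hp K)
  oo a K := blockDiag (splitRow hs a) (splitIdx hq K)
  eo a K := blockOff (splitRow hr a) (splitIdx hq K)
  oe a K := blockOff (splitRow hs a) (splitIdx hp K)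

theorem sigmaSubst_mem {n m p q r s k l p' q' r' s' : ℕ} (hp : p' = p + k) (hq : q' = q + l)
    (hr : r' = r + k) (hs : s' = s + l)
    (x : Ev (Fin n ⊕ Fin r) (Fin m ⊕ Fin s) (Fin p) (Fin q) → ℝ)
    (hx : x ∈ mixedDom n m p q r s) :
    (sigmaSubst n m hp hq hr hs).even x ∈ mixedDom n m p' q' r' s' := by
  subst hp hq hr hs
  obtain ⟨h1, h2⟩ := hx
  rw [Fintype.linearIndependent_iff] at h1 h2
  refine ⟨?_, ?_⟩
  · rw [Fintype.linearIndependent_iff]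
    intro c hc
    have hlast : ∀ j : Fin l, c (Fin.natAdd q j) = 0 := by
      intro j
      have := congrFun hc (.inr (Fin.natAdd s j))
      simpa [Fin.sum_univ_add, Subst.even, sigmaSubst, splitRow, splitIdx, blockDiag] using this
    have hfirst : ∀ j : Fin q, c (Fin.castAdd l j) = 0 := by
      refine h1 _ ?_
      funext a
      rcases a with a | a
      · have := congrFun hc (.inl a)
        simpa [Fin.sum_univ_add, Subst.even, sigmaSubst, splitRow, splitIdx, blockDiag,
          hlast] using this
      · have := congrFun hc (.inr (Fin.castAdd l a))
        simpa [Fin.sum_univ_add, Subst.even, sigmaSubst, splitRow, splitIdx, blockDiag,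
          hlast] using this
    intro i
    induction i using Fin.addCases with
    | left i => exact hfirst i
    | right i => exact hlast i
  · rw [Fintype.linearIndependent_iff]
    intro c hc
    have hlast : ∀ j : Fin l, c (Fin.natAdd s j) = 0 := by
      intro j
      have := congrFun hc (Fin.natAdd q j)
      simpa [Fin.sum_univ_add, Subst.even, sigmaSubst, splitRow, splitIdx, blockDiag] using this
    have hfirst : ∀ j : Fin s, c (Fin.castAdd l j) = 0 := by
      refine h2 _ ?_
      funext a
      have := congrFun hc (Fin.castAdd l a)
      simpa [Fin.sum_univ_add, Subst.even, sigmaSubst, splitRow, splitIdx, blockDiag,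
        hlast] using this
    intro i
    induction i using Fin.addCases with
    | left i => exact hfirst i
    | right i => exact hlast i

/-- The map `σ_{k|l}⁻¹`, `(σ⁻¹ L)(p; w) = L(p 0; w 0; 0 1)`. -/
def sigmaInv {n m p q r s k l p' q' r' s' : ℕ} (hp : p' = p + k) (hq : q' = q + l)
    (hr : r' = r + k) (hs : s' = s + l) :
    MixedFun n m p' q' r' s' →ₗ[ℝ] MixedFun n m p q r s :=
  ((sigmaSubst n m hp hq hr hs).pull (sigmaSubst_mem hp hq hr hs)).toLinearMap

/-! ### The isomorphism between straight forms and mixed forms of codegree `n|m` -/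

/-- `L' = τ L`: at all points of its domain at which `p` is invertible, `L'` is given by
`L'(p; w) = L(w p⁻¹) · Ber p`. Such points are dense, so that `L'` is determined by `L`. -/
def IsTau {n m r s : ℕ} (L : StraightFun n m r s) (L' : MixedFun n m n m r s) : Prop :=
  ∀ (N : ℕ) (P : Matrix (Fin n ⊕ Fin m) (Fin n ⊕ Fin m) (Gr N))
    (W : Matrix (Fin r ⊕ Fin s) (Fin n ⊕ Fin m) (Gr N)),
    IsPoint (mixedDom n m n m r s) (stack P W) → IsUnit P →
      value L' (stack P W) = value L (W * Ring.inverse P) * Ber P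

/-- The substitution `v ↦ (1; v)`. -/
def tauSubst (n m r s : ℕ) :
    Subst (Fin n ⊕ Fin r) (Fin m ⊕ Fin s) (Fin n) (Fin m) (Fin r) (Fin s) (Fin n) (Fin m) where
  ee a K := a.elim (fun A => .inr (if A = K then 1 else 0)) (fun F => .inl (F, K))
  oo a K := a.elim (fun A => .inr (if A = K then 1 else 0)) (fun F => .inl (F, K))
  eo a K := a.elim (fun _ => none) (fun F => some (F, K))
  oe a K := a.elim (fun _ => none) (fun F => some (F, K))

theorem tauSubst_mem {n m r s : ℕ} (x : Ev (Fin r) (Fin s) (Fin n) (Fin m) → ℝ)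
    (hx : x ∈ straightDom n m r s) : (tauSubst n m r s).even x ∈ mixedDom n m n m r s := by
  refine ⟨?_, ?_⟩
  · rw [Fintype.linearIndependent_iff]
    intro c hc i
    have := congrFun hc (.inl i)
    simpa [Subst.even, tauSubst] using this
  · exact hx

/-- The map `τ⁻¹`, `(τ⁻¹ L)(v) = L(1; v)`. -/
def tauInv {n m r s : ℕ} : MixedFun n m n m r s →ₗ[ℝ] StraightFun n m r s :=
  ((tauSubst n m r s).pull tauSubst_mem).toLinearMap

/-! ### The operators `e(α)` and `e(u)` on mixed forms -/

/-- `L`, considered as a function on which the additional even row `w_{r+1}` is allowed but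
does not enter. -/
def addRow {n m p q r s : ℕ} : MixedFun n m p q r s →ₐ[ℝ] MixedFun n m p q (r + 1) s :=
  Subst.pull
    { ee := fun a K => .inl (Sum.map id Fin.castSucc a, K)
      oo := fun a K => .inl (a, K)
      eo := fun a K => some (Sum.map id Fin.castSucc a, K)
      oe := fun a K => some (a, K) } (fun _ hx => hx)

/-- `L`, considered as a function on which the additional even column (number `p + 1`) is
allowed but does not enter. -/
def addCol {n m p q r s : ℕ} : MixedFun n m p q r s →ₐ[ℝ] MixedFun n m (p + 1) q r s :=
  Subst.pull
    { ee := fun a K => .inl (a, Fin.castSucc K)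
      oo := fun a K => .inl (a, K)
      eo := fun a K => some (a, K)
      oe := fun a K => some (a, Fin.castSucc K) } (fun _ hx => hx)

/-- The operator
`e(α) L = (-1)^r α_A w_{r+1}^K (-1)^{A} ∂L/∂p_A^K` (summation over `A`, `K`) for a covector
`α = (α_A)`. The components `α_A` are real numbers, so for `α` homogeneous `α_A = 0` unless `α` and
`A` have the same parity, and `(-1)^{A}` is the same as `(-1)^{α A}`. For general `α`, this is the
linear extension. -/
def eCov {n m p q r s : ℕ} (α : Fin n ⊕ Fin m → ℝ) (L : MixedFun n m p q r s) :
    MixedFun n m p q (r + 1) s :=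
  ((-1 : ℝ) ^ r) • ∑ A : Fin n ⊕ Fin m, ∑ K : Fin p ⊕ Fin q,
    (α A * (-1 : ℝ) ^ par A) •
      (coord (mixedDom n m p q (r + 1) s) (wRow (.inl (Fin.last r))) K *
        addRow (pd (mixedDom n m p q r s) (pRow A) K L))

/-- The operator
`e(u) L = (-1)^r u^A (p_A^{p+1} - (-1)^{BK} p_A^K p_B^{p+1} ∂/∂p_B^K`
`- (-1)^{FK} p_A^K w_F^{p+1} ∂/∂w_F^K) L` (summation over `A`, `B`, `F`, `K`) for a vector
`u = (u^A)`. -/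
def eVec {n m p q r s : ℕ} (u : Fin n ⊕ Fin m → ℝ) (L : MixedFun n m p q r s) :
    MixedFun n m (p + 1) q r s :=
  let x := coord (mixedDom n m (p + 1) q r s)
  let new : Fin (p + 1) ⊕ Fin q := .inl (Fin.last p)
  let old : Fin p ⊕ Fin q → Fin (p + 1) ⊕ Fin q := Sum.map Fin.castSucc id
  ((-1 : ℝ) ^ r) • ∑ A : Fin n ⊕ Fin m, u A •
    (x (pRow A) new * addCol L
      - ∑ B : Fin n ⊕ Fin m, ∑ K : Fin p ⊕ Fin q, ((-1 : ℝ) ^ (par B * par K)) •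
          (x (pRow A) (old K) * x (pRow B) new *
            addCol (pd (mixedDom n m p q r s) (pRow B) K L))
      - ∑ F : Fin r ⊕ Fin s, ∑ K : Fin p ⊕ Fin q, ((-1 : ℝ) ^ (par F * par K)) •
          (x (pRow A) (old K) * x (wRow F) new *
            addCol (pd (mixedDom n m p q r s) (wRow F) K L)))

/-! ### The operators `e_α` and `i_u` on straight forms -/

/-- `L`, considered as a function on which the additional even vector `v_{r+1}` is allowed but
does not enter. -/
def addVec {n m r s : ℕ} : StraightFun n m r s →ₐ[ℝ] StraightFun n m (r + 1) s :=
  Subst.pull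
    { ee := fun F A => .inl (Fin.castSucc F, A)
      oo := fun F A => .inl (F, A)
      eo := fun F A => some (Fin.castSucc F, A)
      oe := fun F A => some (F, A) } (fun _ hx => hx)

/-- The function obtained from `L` by setting the last even vector `v_{r+1}` to zero. -/
def zeroVec {n m r s : ℕ} : StraightFun n m (r + 1) s →ₐ[ℝ] StraightFun n m r s :=
  Subst.pull
    { ee := fun F A => Fin.lastCases (motive := fun _ => (Fin r × Fin n) ⊕ ℝ)
        (.inr 0) (fun F' => .inl (F', A)) F
      oo := fun F A => .inl (F, A)
      eo := fun F A => Fin.lastCases (motive := fun _ => Option (Fin r × Fin m))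
        none (fun F' => some (F', A)) F
      oe := fun F A => some (F, A) } (fun _ hx => hx)

/-- The operator
`e_α L = (-1)^r (v_{r+1}^A α_A - (-1)^{α F} v_F^A α_A v_{r+1}^B ∂/∂v_F^B) L` (summation over
`A`, `B`, `F`) for a covector `α`. As for `e(α)`, the parity of `α` in the exponent is that of `A`,
and for general `α` this is the linear extension. -/
def eStraight {n m r s : ℕ} (α : Fin n ⊕ Fin m → ℝ) (L : StraightFun n m r s) :
    StraightFun n m (r + 1) s :=
  let x := coord (straightDom n m (r + 1) s)
  let new : Fin (r + 1) ⊕ Fin s := .inl (Fin.last r)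
  let old : Fin r ⊕ Fin s → Fin (r + 1) ⊕ Fin s := Sum.map Fin.castSucc id
  ((-1 : ℝ) ^ r) •
    (∑ A : Fin n ⊕ Fin m, α A • (x new A * addVec L)
      - ∑ F : Fin r ⊕ Fin s, ∑ A : Fin n ⊕ Fin m, ∑ B : Fin n ⊕ Fin m,
          ((-1 : ℝ) ^ (par A * par F) * α A) •
            (x (old F) A * x new B * addVec (pd (straightDom n m r s) F B L)))

/-- The derivative `(-1)^r u^A ∂L/∂v_{r+1}^A` of a function of `r + 1` even and `s` odd vectors,
as a function of the same arguments. -/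
def iDeriv {n m r s : ℕ} (u : Fin n ⊕ Fin m → ℝ) (L : StraightFun n m (r + 1) s) :
    StraightFun n m (r + 1) s :=
  ((-1 : ℝ) ^ r) • ∑ A : Fin n ⊕ Fin m,
    u A • pd (straightDom n m (r + 1) s) (.inl (Fin.last r)) A L

/-- The operator `i_u = (-1)^r u^A ∂/∂v_{r+1}^A` from forms of degree `r+1|s` to forms of degree
`r|s`. The derivative of a form does not depend on `v_{r+1}`, which is set to zero here. -/
def iVec {n m r s : ℕ} (u : Fin n ⊕ Fin m → ℝ) (L : StraightFun n m (r + 1) s) :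
    StraightFun n m r s :=
  zeroVec (iDeriv u L)

/-- The array of vectors `v` with the vector `c u` inserted as the last even one. -/
def insertVec {n m r s N : ℕ} (v : Matrix (Fin r ⊕ Fin s) (Fin n ⊕ Fin m) (Gr N)) (c : Gr N)
    (u : Fin n ⊕ Fin m → ℝ) : Matrix (Fin (r + 1) ⊕ Fin s) (Fin n ⊕ Fin m) (Gr N)
  | .inl F => Fin.lastCases (motive := fun _ => Fin n ⊕ Fin m → Gr N)
      (fun A => u A • c) (fun F' => v (.inl F')) F
  | .inr F => v (.inr F)

end SuperForms

end

open SuperForms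

/-!
Mixed forms, and the operators `e(α)`, `e(u)`, `e_α`, `i_u` on mixed and straight forms.

A superfunction is determined by its values at points over Grassmann algebras (`eq_of_value`), and
two values are equal if they are equal after multiplication by an infinitesimal `η` adjoined to the
Grassmann algebra (`eq_of_eps_mul`). The values `value f (M + E)` for a matrix `E` with infinitesimal
entries give the differential of `f`, so that statements on first order operators become statements
on values of superfunctions.

The operators are sums of two kinds of elementary operators. `rowD` is the derivative in the
direction of the addition of one row to another one; its application to the additional row of `w`
and a row of `p` gives `e(α)` (`eCov_eq`). `crossD` is the product with an entry of the matrix minus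
the derivative along the corresponding rank one transformation `x ↦ x + x^j η x_i`; it gives `e(u)`
with an additional column and `e_α` with an additional row (`eVec_eq`, `eStraight_eq`). Both kinds
preserve the system of second order equations (`SecondOrderSystem.rowD`,
`SecondOrderSystem.crossD`), by commutation of derivatives.

For the Berezinian conditions on the result, the elimination lemmas `row_induction` and
`col_induction` reduce a general transformation to two kinds. If a transformation does not add the
additional row or column to the others, then it transforms the infinitesimal rank one
transformations into one another, up to transformations under which the given form is multiplied by
a Berezinian `1 + η τ` (`ber_one_add_infMat`), and the condition follows from that for the given
form. If a transformation adds multiples of the additional row or column to the others, then the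
result must not change. Here the system is used: a solution that is linear in one even row or column
is invariant under such transformations (`rowD_eq_zero`, `colD_eq_zero`, `value_add_row`,
`value_add_col`), since the second order terms are antisymmetric by the system and symmetric by the
linearity.

The maps `σ⁻¹` and `τ⁻¹` are substitutions of coordinates, so the chain rule computes the
derivatives of their results. In the proof of stability (`sigmaInv_eCov`, `sigmaInv_eVec`) the
additional row or column has to be moved past `k` others, and the sign `(-1)^k` is the difference of
the factors `(-1)^r` in the definitions of the operators. For `τ` (`tauInv_eCov`), an infinitesimal
change of the unit matrix in `(1; v)` is compensated by a transformation of the columns. The claims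
on `σ` and `τ` themselves follow, because for forms the relation `L' = σ L` is equivalent to
`L = σ⁻¹ L'` (`IsSigma.eq_sigmaInv`, `isSigma_sigmaInv`), and likewise for `τ`.

For `i_u`, the system gives `∂²L/∂v_r^A∂v_r^B = 0`, so a straight form is affine in `v_r`. It is
homogeneous of degree one by the Berezinian condition, hence linear. This proves the formula for
the substitution of `c u` (`IsStraight.value_insertVec`), and the Berezinian condition on `i_u L` is
that of `L` for matrices `(g 0; 0 1)`. At the matrices `(1 0; v 0; 0 1)` all terms of `e(u)` except
the derivative with respect to the last even row vanish (`tauInv_sigmaInv_eVec`).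
-/

noncomputable section

namespace SuperForms

set_option linter.unusedSectionVars false
set_option linter.unusedSimpArgs false

/-! ### Grassmann algebras -/

/-- The homogeneous part of `Gr N` of parity `i`. -/
abbrev Par (N i : ℕ) : Submodule ℝ (Gr N) :=
  CliffordAlgebra.evenOdd (0 : QuadraticForm ℝ (Fin N → ℝ)) (i : ZMod 2)

/-- The sign `(-1)^n`, as a real number. -/
abbrev sg (n : ℕ) : ℝ := (-1) ^ n

theorem sg_zero : sg 0 = 1 := pow_zero _

theorem sg_one : sg 1 = -1 := pow_one _

theorem sg_congr {m n : ℕ} (h : m % 2 = n % 2) : sg m = sg n := by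
  rw [sg, sg, neg_one_pow_eq_pow_mod_two, h, ← neg_one_pow_eq_pow_mod_two]

theorem sg_mul_self (n : ℕ) : sg n * sg n = 1 := by
  rw [← mul_pow]; simp

theorem Par_congr {N i j : ℕ} (h : i % 2 = j % 2) : Par N i = Par N j := by
  have : (i : ZMod 2) = (j : ZMod 2) := (ZMod.natCast_eq_natCast_iff' i j 2).2 h
  rw [Par, Par, this]

theorem Par.mul {N i j : ℕ} {x y : Gr N} (hx : x ∈ Par N i) (hy : y ∈ Par N j) :
    x * y ∈ Par N (i + j) := by
  have := SetLike.mul_mem_graded (A := CliffordAlgebra.evenOdd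
    (0 : QuadraticForm ℝ (Fin N → ℝ))) hx hy
  rw [Par, Nat.cast_add]
  exact this

theorem Par.mul_of {N i j k : ℕ} (h : (i + j) % 2 = k % 2) {x y : Gr N} (hx : x ∈ Par N i)
    (hy : y ∈ Par N j) : x * y ∈ Par N k :=
  Par_congr (N := N) h ▸ Par.mul hx hy

theorem Par.algebraMap_mem {N : ℕ} (r : ℝ) : algebraMap ℝ (Gr N) r ∈ Par N 0 := by
  have := SetLike.algebraMap_mem_graded (CliffordAlgebra.evenOdd
    (0 : QuadraticForm ℝ (Fin N → ℝ))) r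
  simpa [Par] using this

theorem Par.one_mem {N : ℕ} : (1 : Gr N) ∈ Par N 0 := by
  simpa using Par.algebraMap_mem (N := N) 1

section
variable {M : Type*} [AddCommGroup M] [Module ℝ M]

theorem mul_ι (x : ExteriorAlgebra ℝ M) (v : M) :
    x * ExteriorAlgebra.ι ℝ v = ExteriorAlgebra.ι ℝ v * CliffordAlgebra.involute x := by
  induction x using ExteriorAlgebra.induction with
  | algebraMap r => simp [Algebra.commutes]
  | ι w =>
    rw [CliffordAlgebra.involute_ι, mul_neg, eq_neg_iff_add_eq_zero]
    exact ExteriorAlgebra.ι_add_mul_swap w v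
  | mul a b ha hb => rw [mul_assoc, hb, ← mul_assoc, ha, map_mul, mul_assoc]
  | add a b ha hb => rw [add_mul, ha, hb, map_add, mul_add]

theorem ι_ι_mul_comm (y : ExteriorAlgebra ℝ M) (v w : M) :
    y * (ExteriorAlgebra.ι ℝ v * ExteriorAlgebra.ι ℝ w) =
      ExteriorAlgebra.ι ℝ v * ExteriorAlgebra.ι ℝ w * y := by
  rw [← mul_assoc, mul_ι y v, mul_assoc, mul_ι _ w, CliffordAlgebra.involute_involute, ← mul_assoc]
end

theorem even_comm {N : ℕ} {x : Gr N} (hx : x ∈ Par N 0) (y : Gr N) : x * y = y * x := by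
  have hx' : x ∈ CliffordAlgebra.evenOdd (0 : QuadraticForm ℝ (Fin N → ℝ)) 0 := by
    simpa [Par] using hx
  clear hx
  induction x, hx' using CliffordAlgebra.even_induction with
  | algebraMap r => exact Algebra.commutes r y
  | add a b _ _ ha hb => rw [add_mul, mul_add, ha, hb]
  | ι_mul_ι_mul m₁ m₂ x _ ih =>
    rw [mul_assoc, ih, ← mul_assoc, ← mul_assoc]
    congr 1
    exact (ι_ι_mul_comm y m₁ m₂).symm

theorem odd_mul {N : ℕ} {x : Gr N} (hx : x ∈ Par N 1) (y : Gr N) :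
    y * x = x * CliffordAlgebra.involute y := by
  have hx' : x ∈ CliffordAlgebra.evenOdd (0 : QuadraticForm ℝ (Fin N → ℝ)) 1 := by
    simpa [Par] using hx
  clear hx
  induction x, hx' using CliffordAlgebra.odd_induction with
  | ι v => exact mul_ι y v
  | add a b _ _ ha hb => rw [add_mul, mul_add, ha, hb]
  | ι_mul_ι_mul m₁ m₂ x _ ih =>
    rw [mul_assoc _ x, ← ih, ← mul_assoc, ← mul_assoc, ← mul_assoc]
    exact congrArg (· * x) ((mul_assoc _ _ _).trans (ι_ι_mul_comm y m₁ m₂))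

theorem involute_of_mem {N i : ℕ} {x : Gr N} (hx : x ∈ Par N i) :
    CliffordAlgebra.involute x = sg i • x := by
  rcases Nat.mod_two_eq_zero_or_one i with h | h
  · rw [Par_congr (show i % 2 = 0 % 2 from h)] at hx
    rw [sg_congr (show i % 2 = 0 % 2 from h), sg_zero, one_smul]
    exact CliffordAlgebra.involute_eq_of_mem_even (by simpa [Par] using hx)
  · rw [Par_congr (show i % 2 = 1 % 2 from h)] at hx
    rw [sg_congr (show i % 2 = 1 % 2 from h), sg_one, neg_one_smul]
    exact CliffordAlgebra.involute_eq_of_mem_odd (by simpa [Par] using hx)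

theorem super_comm {N i j : ℕ} {x y : Gr N} (hx : x ∈ Par N i) (hy : y ∈ Par N j) :
    x * y = sg (i * j) • (y * x) := by
  rcases Nat.mod_two_eq_zero_or_one j with h | h
  · rw [Par_congr (show j % 2 = 0 % 2 from h)] at hy
    rw [sg_congr (show (i * j) % 2 = 0 % 2 by simp [Nat.mul_mod, h]), sg_zero, one_smul,
      even_comm hy]
  · rw [Par_congr (show j % 2 = 1 % 2 from h)] at hy
    rw [sg_congr (show (i * j) % 2 = i % 2 by simp [Nat.mul_mod, h]), odd_mul hy,
      involute_of_mem hx, mul_smul_comm]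

theorem exists_even_add_odd {N : ℕ} (x : Gr N) :
    ∃ y ∈ Par N 0, ∃ z ∈ Par N 1, y + z = x := by
  have h := (CliffordAlgebra.evenOdd_isCompl (0 : QuadraticForm ℝ (Fin N → ℝ))).sup_eq_top
  have hx : x ∈ (⊤ : Submodule ℝ (Gr N)) := Submodule.mem_top
  rw [← h] at hx
  obtain ⟨y, hy, z, hz, e⟩ := Submodule.mem_sup.1 hx
  exact ⟨y, by simpa [Par] using hy, z, by simpa [Par] using hz, e⟩

theorem mem_Par_iff {N i : ℕ} {x : Gr N} :
    x ∈ Par N i ↔ CliffordAlgebra.involute x = sg i • x := by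
  refine ⟨involute_of_mem, fun h => ?_⟩
  obtain ⟨y, hy, z, hz, rfl⟩ := exists_even_add_odd x
  rw [map_add, involute_of_mem hy, involute_of_mem hz] at h
  rcases Nat.mod_two_eq_zero_or_one i with hi | hi
  · rw [sg_congr (show i % 2 = 0 % 2 from hi)] at h
    have : z = 0 := by
      have h2 : (2 : ℝ) • z = 0 := by
        rw [two_smul]
        simp only [sg, pow_zero, pow_one, one_smul, neg_smul] at h
        have := add_left_cancel h
        nth_rewrite 1 [← this]
        exact neg_add_cancel z
      simpa using h2
    rw [this, add_zero, Par_congr (show i % 2 = 0 % 2 from hi)]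
    exact hy
  · rw [sg_congr (show i % 2 = 1 % 2 from hi)] at h
    have : y = 0 := by
      have h2 : (2 : ℝ) • y = 0 := by
        rw [two_smul]
        simp only [sg, pow_zero, pow_one, one_smul, neg_smul, neg_add] at h
        have := add_right_cancel h
        nth_rewrite 1 [this]
        exact neg_add_cancel y
      simpa using h2
    rw [this, zero_add, Par_congr (show i % 2 = 1 % 2 from hi)]
    exact hz

theorem odd_mul_self {N : ℕ} {x : Gr N} (hx : x ∈ Par N 1) : x * x = 0 := by
  have h := super_comm hx hx
  simp only [sg, mul_one, pow_one, neg_smul, one_smul] at h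
  have h2 : (2 : ℝ) • (x * x) = 0 := by
    rw [two_smul]; nth_rewrite 1 [h]; exact neg_add_cancel _
  simpa using h2

theorem body_algebraMap {N : ℕ} (r : ℝ) : body (algebraMap ℝ (Gr N) r) = r := by
  simp

theorem body_involute {N : ℕ} (x : Gr N) : body (CliffordAlgebra.involute x) = body x := by
  have : (body (N := N)).comp (CliffordAlgebra.involute (Q := (0 : QuadraticForm ℝ (Fin N → ℝ))))
      = body := by
    ext v
    simp [ExteriorAlgebra.algebraMapInv]
  exact DFunLike.congr_fun this x

theorem body_odd {N : ℕ} {x : Gr N} (hx : x ∈ Par N 1) : body x = 0 := by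
  have h := body_involute x
  rw [involute_of_mem hx, map_smul] at h
  simp only [sg, pow_one, smul_eq_mul] at h
  linarith

/-- The `k`-th power of the augmentation ideal of a Grassmann algebra. -/
def augPow (N k : ℕ) : Submodule ℝ (Gr N) :=
  LinearMap.range (ExteriorAlgebra.ι ℝ (M := Fin N → ℝ)) ^ k * ⊤

theorem top_mul_range_ι_le {N : ℕ} :
    (⊤ : Submodule ℝ (Gr N)) * LinearMap.range (ExteriorAlgebra.ι ℝ (M := Fin N → ℝ)) ≤
      LinearMap.range (ExteriorAlgebra.ι ℝ (M := Fin N → ℝ)) * ⊤ := by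
  rw [Submodule.mul_le]
  rintro x - _ ⟨v, rfl⟩
  rw [mul_ι]
  exact Submodule.mul_mem_mul ⟨v, rfl⟩ Submodule.mem_top

theorem augPow_mul_le {N k : ℕ} : augPow N k * augPow N 1 ≤ augPow N (k + 1) := by
  unfold augPow
  rw [pow_one, pow_succ, mul_assoc, mul_assoc]
  refine mul_le_mul' le_rfl ?_
  rw [← mul_assoc]
  refine (mul_le_mul' top_mul_range_ι_le le_rfl).trans ?_
  rw [mul_assoc]
  exact mul_le_mul' le_rfl le_top

theorem augPow_zero (N : ℕ) : augPow N 0 = ⊤ := by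
  rw [augPow, pow_zero, one_mul]

theorem augPow_eq_bot {N k : ℕ} (h : N < k) : augPow N k = ⊥ := by
  have : (LinearMap.range (ExteriorAlgebra.ι ℝ (M := Fin N → ℝ)) ^ k) = ⊥ := by
    apply Submodule.finrank_eq_zero.1
    have := exteriorPower.finrank_eq (R := ℝ) (M := Fin N → ℝ) (n := k)
    rw [this]
    simpa [Nat.choose_eq_zero_iff] using h
  rw [augPow, this, Submodule.bot_mul]

theorem mul_mem_augPow {N j k : ℕ} {x y : Gr N} (hx : x ∈ augPow N j) (hy : y ∈ augPow N k) :
    x * y ∈ augPow N (j + k) := by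
  have key : augPow N j * augPow N k ≤ augPow N (j + k) := by
    clear hx hy
    induction k generalizing j with
    | zero =>
      rw [augPow_zero, augPow, mul_assoc]
      exact mul_le_mul' le_rfl le_top
    | succ k ih =>
      have h : augPow N (k + 1) ≤ augPow N 1 * augPow N k := by
        unfold augPow
        rw [pow_one, pow_succ', mul_assoc, mul_assoc]
        refine mul_le_mul' le_rfl ?_
        refine Submodule.mul_le.2 fun a ha b hb => ?_
        rw [← one_mul (a * b)]
        exact Submodule.mul_mem_mul Submodule.mem_top (Submodule.mul_mem_mul ha hb)
      refine (mul_le_mul' le_rfl h).trans ?_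
      rw [← mul_assoc]
      refine (mul_le_mul' augPow_mul_le le_rfl).trans ?_
      rw [show j + (k + 1) = j + 1 + k by ring]
      exact ih
  exact key (Submodule.mul_mem_mul hx hy)

theorem mem_augPow_one_iff {N : ℕ} {x : Gr N} : x ∈ augPow N 1 ↔ body x = 0 := by
  constructor
  · intro hx
    rw [augPow, pow_one] at hx
    induction hx using Submodule.mul_induction_on' with
    | mem_mul_mem a ha b _ =>
      obtain ⟨v, rfl⟩ := ha
      rw [map_mul]
      simp [ExteriorAlgebra.algebraMapInv]
    | add a _ b _ ha hb => rw [map_add, ha, hb, add_zero]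
  · intro hx
    have key : ∀ x : Gr N, x - algebraMap ℝ _ (body x) ∈ augPow N 1 := by
      intro x
      induction x using ExteriorAlgebra.induction with
      | algebraMap r => simp [ExteriorAlgebra.algebraMapInv]
      | ι v =>
        have : (body (N := N)) (ExteriorAlgebra.ι ℝ v) = 0 := by
          simp [ExteriorAlgebra.algebraMapInv]
        rw [this, map_zero, sub_zero, augPow, pow_one, ← mul_one (ExteriorAlgebra.ι ℝ v)]
        exact Submodule.mul_mem_mul ⟨v, rfl⟩ Submodule.mem_top
      | mul a b ha hb =>
        have h1 := mul_mem_augPow ha (show b ∈ augPow N 0 by rw [augPow_zero]; trivial)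
        have h2 := Submodule.smul_mem _ (body a) hb
        have h3 := Submodule.add_mem _ h1 h2
        convert h3 using 1
        rw [map_mul, map_mul, Algebra.smul_def]
        noncomm_ring
      | add a b ha hb =>
        convert Submodule.add_mem _ ha hb using 1
        rw [map_add, map_add]
        abel
    simpa [hx] using key x

theorem isNilpotent_of_body {N : ℕ} {x : Gr N} (h : body x = 0) : IsNilpotent x := by
  refine ⟨N + 1, ?_⟩
  have key : ∀ k, x ^ k ∈ augPow N k := by
    intro k
    induction k with
    | zero => rw [augPow_zero]; trivial
    | succ k ih => rw [pow_succ]; exact mul_mem_augPow ih (mem_augPow_one_iff.2 h)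
  have := key (N + 1)
  rwa [augPow_eq_bot (Nat.lt_succ_self N), Submodule.mem_bot] at this

theorem isUnit_iff_body {N : ℕ} {x : Gr N} : IsUnit x ↔ body x ≠ 0 := by
  constructor
  · intro h
    exact (h.map body).ne_zero
  · intro h
    have hn : IsNilpotent (x - algebraMap ℝ _ (body x)) :=
      isNilpotent_of_body (by rw [map_sub]; simp [ExteriorAlgebra.algebraMapInv])
    have hu : IsUnit (algebraMap ℝ (Gr N) (body x)) := (IsUnit.mk0 _ h).map _
    have := hn.isUnit_add_right_of_commute hu (Algebra.commutes _ _).symm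
    rwa [sub_add_cancel] at this

instance (N : ℕ) : Module.Finite ℝ (Gr N) :=
  Module.Finite.of_basis (Pi.basisFun ℝ (Fin N)).ExteriorAlgebra

/-! ### Taylor expansion at even elements of a Grassmann algebra -/

section Smooth
variable {I : Type} [Fintype I] {U : TopologicalSpace.Opens (I → ℝ)}

theorem Smooth.extendZero_mul (f g : Smooth U) :
    extendZero U (f * g).1 = extendZero U f.1 * extendZero U g.1 := by
  funext x
  by_cases h : x ∈ U <;> simp [extendZero, h]

theorem Smooth.ext_extendZero {f g : Smooth U}
    (h : ∀ x ∈ U, extendZero U f.1 x = extendZero U g.1 x) : f = g := by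
  ext x
  have := h x.1 x.2
  rwa [extendZero_of_mem _ _ x.2, extendZero_of_mem _ _ x.2] at this

open Classical in
theorem Smooth.extendZero_pderiv (i : I) (g : Smooth U) {x : I → ℝ} (hx : x ∈ U) :
    extendZero U (Smooth.pderiv U i g).1 x =
      fderiv ℝ (extendZero U g.1) x (Pi.single i 1) := by
  rw [extendZero_of_mem _ _ hx]; rfl

theorem Smooth.differentiableAt (g : Smooth U) {x : I → ℝ} (hx : x ∈ U) :
    DifferentiableAt ℝ (extendZero U g.1) x :=
  (Smooth.contDiffAt g hx).differentiableAt (by simp)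

theorem Smooth.pderiv_mul (i : I) (f g : Smooth U) :
    Smooth.pderiv U i (f * g) = Smooth.pderiv U i f * g + f * Smooth.pderiv U i g := by
  refine Smooth.ext_extendZero fun x hx => ?_
  rw [Smooth.extendZero_pderiv i _ hx, Smooth.extendZero_mul,
    fderiv_mul (Smooth.differentiableAt f hx) (Smooth.differentiableAt g hx),
    Smooth.extendZero_add, Pi.add_apply, Smooth.extendZero_mul, Smooth.extendZero_mul,
    Pi.mul_apply, Pi.mul_apply, Smooth.extendZero_pderiv i _ hx, Smooth.extendZero_pderiv i _ hx]
  simp only [add_apply, smul_apply, smul_eq_mul]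
  ring

theorem Smooth.pderiv_eventuallyEq (i : I) (g : Smooth U) {x : I → ℝ} (hx : x ∈ U) :
    extendZero U (Smooth.pderiv U i g).1 =ᶠ[nhds x] fun y =>
      fderiv ℝ (extendZero U g.1) y (open Classical in Pi.single i 1) := by
  filter_upwards [U.isOpen.mem_nhds hx] with y hy
  exact Smooth.extendZero_pderiv i g hy

theorem Smooth.pderiv_comm (i j : I) (g : Smooth U) :
    Smooth.pderiv U i (Smooth.pderiv U j g) = Smooth.pderiv U j (Smooth.pderiv U i g) := by
  classical
  have key : ∀ (i j : I) (x : I → ℝ), x ∈ U →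
      extendZero U (Smooth.pderiv U i (Smooth.pderiv U j g)).1 x =
        fderiv ℝ (fderiv ℝ (extendZero U g.1)) x (Pi.single i 1) (Pi.single j 1) := by
    intro i j x hx
    rw [Smooth.extendZero_pderiv i _ hx, (Smooth.pderiv_eventuallyEq j g hx).fderiv_eq]
    have hd : DifferentiableAt ℝ (fderiv ℝ (extendZero U g.1)) x :=
      ((Smooth.contDiffAt g hx).fderiv_right (m := 1) (by norm_cast)).differentiableAt
        (by simp)
    have := (hd.hasFDerivAt.clm_apply (hasFDerivAt_const (Pi.single j (1 : ℝ) : I → ℝ) x)).fderiv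
    rw [this]
    simp
  refine Smooth.ext_extendZero fun x hx => ?_
  rw [key i j x hx, key j i x hx]
  exact ((Smooth.contDiffAt g hx).isSymmSndFDerivAt (by
    simp only [minSmoothness_of_isRCLikeNormedField]; exact WithTop.coe_le_coe.2 (le_top : (2 : ℕ∞) ≤ ⊤))).eq _ _

theorem Smooth.pderiv_coord [DecidableEq I] (i j : I) :
    Smooth.pderiv U i (Smooth.coord U j) = if i = j then 1 else 0 := by
  refine Smooth.ext_extendZero fun x hx => ?_
  rw [Smooth.extendZero_pderiv i _ hx]
  have h : extendZero U (Smooth.coord U j).1 =ᶠ[nhds x]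
      (ContinuousLinearMap.proj j : (I → ℝ) →L[ℝ] ℝ) := by
    filter_upwards [U.isOpen.mem_nhds hx] with y hy
    have hy' : y ∈ U := hy
    simp [extendZero, hy', Smooth.coord]
  rw [h.fderiv_eq, ContinuousLinearMap.fderiv]
  by_cases hij : i = j
  · subst hij
    simp [extendZero, hx]
  · simp [extendZero, hx, hij, Ne.symm hij]

theorem Smooth.pderiv_one (i : I) : Smooth.pderiv U i 1 = 0 := by
  have h := Smooth.pderiv_mul i (1 : Smooth U) 1
  rw [mul_one, mul_one, one_mul] at h
  exact left_eq_add.1 h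

end Smooth

section Jet
variable {I : Type} [Fintype I] {N : ℕ}

/-- Evaluation at a point, extended by zero outside `U`. -/
def evalZero (U : TopologicalSpace.Opens (I → ℝ)) (x : I → ℝ) : Smooth U →ₗ[ℝ] ℝ where
  toFun g := extendZero U g.1 x
  map_add' f g := by rw [Smooth.extendZero_add]; rfl
  map_smul' c g := by rw [Smooth.extendZero_smul]; rfl

/-- `k!` times the homogeneous part of degree `k` in `n` of the Taylor expansion of `g(x + n)`,
by the recursion `(∑ nᵢ ∂ᵢ)^{k+1} = (∑ nᵢ ∂ᵢ)^k ∘ (∑ nᵢ ∂ᵢ)`. -/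
def jet (U : TopologicalSpace.Opens (I → ℝ)) (x : I → ℝ) (n : I → Gr N) :
    ℕ → Smooth U →ₗ[ℝ] Gr N
  | 0 => (Algebra.linearMap ℝ (Gr N)).comp (evalZero U x)
  | k + 1 => ∑ i, (LinearMap.mulRight ℝ (n i)) ∘ₗ jet U x n k ∘ₗ Smooth.pderiv U i

variable {U : TopologicalSpace.Opens (I → ℝ)}

theorem jet_zero (x : I → ℝ) (n : I → Gr N) (g : Smooth U) :
    jet U x n 0 g = algebraMap ℝ _ (extendZero U g.1 x) := rfl

theorem jet_succ (x : I → ℝ) (n : I → Gr N) (k : ℕ) (g : Smooth U) :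
    jet U x n (k + 1) g = ∑ i, jet U x n k (Smooth.pderiv U i g) * n i := by
  simp [jet]

theorem jet_mem (x : I → ℝ) {n : I → Gr N} (hn : ∀ i, body (n i) = 0) (k : ℕ) (g : Smooth U) :
    jet U x n k g ∈ augPow N k := by
  induction k generalizing g with
  | zero => rw [augPow_zero]; trivial
  | succ k ih =>
    rw [jet_succ]
    exact Submodule.sum_mem _ fun i _ => mul_mem_augPow (ih _) (mem_augPow_one_iff.2 (hn i))

theorem jet_eq_zero (x : I → ℝ) {n : I → Gr N} (hn : ∀ i, body (n i) = 0) {k : ℕ} (hk : N < k)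
    (g : Smooth U) : jet U x n k g = 0 := by
  have := jet_mem x hn k g
  rwa [augPow_eq_bot hk, Submodule.mem_bot] at this

theorem jet_even (x : I → ℝ) {n : I → Gr N} (hn : ∀ i, n i ∈ Par N 0) (k : ℕ) (g : Smooth U) :
    jet U x n k g ∈ Par N 0 := by
  induction k generalizing g with
  | zero => exact Par.algebraMap_mem _
  | succ k ih =>
    rw [jet_succ]
    exact Submodule.sum_mem _ fun i _ => Par.mul_of (i := 0) (j := 0) rfl (ih _) (hn i)

theorem jet_mul (x : I → ℝ) {n : I → Gr N} (hn : ∀ i, n i ∈ Par N 0) (k : ℕ) (f g : Smooth U) :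
    jet U x n k (f * g) = ∑ ij ∈ Finset.HasAntidiagonal.antidiagonal k,
      k.choose ij.1 • (jet U x n ij.1 f * jet U x n ij.2 g) := by
  induction k generalizing f g with
  | zero =>
    simp only [jet_zero, Finset.HasAntidiagonal.antidiagonal_zero, Finset.sum_singleton, Nat.choose_self, one_smul,
      Smooth.extendZero_mul, Pi.mul_apply, map_mul]
  | succ k ih =>
    rw [Finset.sum_antidiagonal_choose_succ_nsmul
      (f := fun i j => jet U x n i f * jet U x n j g), jet_succ]
    simp only [Smooth.pderiv_mul, map_add, ih, add_mul, Finset.sum_add_distrib]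
    rw [add_comm]
    congr 1
    · simp only [Finset.sum_mul, jet_succ, Finset.mul_sum, Finset.smul_sum]
      rw [Finset.sum_comm]
      refine Finset.sum_congr rfl fun ij _ => Finset.sum_congr rfl fun i _ => ?_
      rw [smul_mul_assoc, mul_assoc]
    · simp only [Finset.sum_mul, jet_succ, Finset.smul_sum]
      rw [Finset.sum_comm]
      refine Finset.sum_congr rfl fun ij hij => Finset.sum_congr rfl fun i _ => ?_
      rw [smul_mul_assoc, mul_assoc, mul_assoc, even_comm (hn i)]
      congr 1
      rw [← Finset.HasAntidiagonal.mem_antidiagonal.1 hij, Nat.choose_symm_add]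

theorem jet_eq_sum_iteratedFDeriv {x : I → ℝ} (hx : x ∈ U) (n : I → Gr N) (k : ℕ)
    (g : Smooth U) :
    jet U x n k g = ∑ idx : Fin k → I,
      (iteratedFDeriv ℝ k (extendZero U g.1) x
        (fun a => open Classical in Pi.single (idx a) 1)) •
          (List.ofFn fun a => n (idx a)).prod := by
  classical
  induction k generalizing g with
  | zero =>
    rw [jet_zero]
    simp [Algebra.algebraMap_eq_smul_one]
  | succ k ih =>
    rw [jet_succ, ← (Fin.snocEquiv (fun _ => I)).sum_comp, Fintype.sum_prod_type]
    refine Finset.sum_congr rfl fun i _ => ?_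
    rw [ih, Finset.sum_mul]
    refine Finset.sum_congr rfl fun idx _ => ?_
    rw [smul_mul_assoc, List.ofFn_succ', List.concat_eq_append, List.prod_append]
    simp only [Fin.snocEquiv_apply, Fin.snoc_castSucc, Fin.snoc_last, List.prod_cons,
      List.prod_nil, mul_one]
    congr 1
    rw [((Smooth.pderiv_eventuallyEq i g hx).iteratedFDeriv ℝ k).eq_of_nhds,
      iteratedFDeriv_succ_apply_right]
    have hk : ((k : ℕ∞) : WithTop ℕ∞) ≤ ∞ := by exact_mod_cast le_top
    have hc : ContDiffAt ℝ ∞ (fun y => fderiv ℝ (extendZero U g.1) y) x :=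
      (Smooth.contDiffAt g hx).fderiv_right (by simp)
    have := (ContinuousLinearMap.apply ℝ ℝ
      (Pi.single i (1 : ℝ) : I → ℝ)).iteratedFDeriv_comp_left hc (i := k) hk
    have h2 := congrArg (fun φ => φ (fun a => (Pi.single (idx a) (1 : ℝ) : I → ℝ))) this
    have e1 : (Fin.init fun a : Fin (k + 1) =>
        (Pi.single (Fin.snoc (α := fun _ => I) idx i a) (1 : ℝ) : I → ℝ)) =
          fun a => Pi.single (idx a) 1 := by
      funext a; simp [Fin.init]
    rw [e1, Fin.snoc_last]
    exact h2

end Jet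

section Taylor
variable {I : Type} [Fintype I] {N : ℕ} {U : TopologicalSpace.Opens (I → ℝ)}

/-- The body of a family of elements of a Grassmann algebra. -/
abbrev bodies (X : I → Gr N) : I → ℝ := fun i => body (X i)

/-- The nilpotent part of a family of elements of a Grassmann algebra. -/
abbrev souls (X : I → Gr N) : I → Gr N := fun i => X i - algebraMap ℝ (Gr N) (body (X i))

theorem body_souls (X : I → Gr N) (i : I) : body (souls X i) = 0 := by
  rw [map_sub]; simp [ExteriorAlgebra.algebraMapInv]

theorem souls_even {X : I → Gr N} (hX : ∀ i, X i ∈ Par N 0) (i : I) : souls X i ∈ Par N 0 :=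
  Submodule.sub_mem _ (hX i) (Par.algebraMap_mem _)

theorem taylor_eq {X : I → Gr N} (hx : bodies X ∈ U) {K : ℕ} (hK : N < K) (g : Smooth U) :
    taylor U X g = ∑ k ∈ Finset.range K,
      ((k.factorial : ℝ)⁻¹) • jet U (bodies X) (souls X) k g := by
  have h1 : taylor U X g = ∑ k ∈ Finset.range (N + 1),
      ((k.factorial : ℝ)⁻¹) • jet U (bodies X) (souls X) k g := by
    rw [taylor]
    simp only [LinearMap.coe_mk, AddHom.coe_mk]
    rw [if_pos hx]
    refine Finset.sum_congr rfl fun k _ => ?_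
    rw [jet_eq_sum_iteratedFDeriv hx, Finset.smul_sum]
    refine Finset.sum_congr rfl fun idx _ => ?_
    rw [mul_smul]
  rw [h1]
  refine Finset.sum_subset (by simpa using hK) fun k _ hk => ?_
  rw [jet_eq_zero _ (body_souls X) (by simpa using hk), smul_zero]

theorem taylor_even {X : I → Gr N} (hX : ∀ i, X i ∈ Par N 0) (hx : bodies X ∈ U)
    (g : Smooth U) : taylor U X g ∈ Par N 0 := by
  rw [taylor_eq hx (Nat.lt_succ_self N)]
  exact Submodule.sum_mem _ fun k _ => Submodule.smul_mem _ _ (jet_even _ (souls_even hX) _ _)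

theorem taylor_mul {X : I → Gr N} (hX : ∀ i, X i ∈ Par N 0) (hx : bodies X ∈ U)
    (f g : Smooth U) : taylor U X (f * g) = taylor U X f * taylor U X g := by
  rw [taylor_eq hx (Nat.lt_succ_self N), taylor_eq hx (Nat.lt_succ_self N),
    taylor_eq hx (Nat.lt_succ_self N), Finset.sum_mul_sum]
  set F : ℕ → ℕ → Gr N := fun i j =>
    (((i.factorial : ℝ)⁻¹) • jet U (bodies X) (souls X) i f) *
      (((j.factorial : ℝ)⁻¹) • jet U (bodies X) (souls X) j g) with hF
  have h1 : ∀ k, ((k.factorial : ℝ)⁻¹) • jet U (bodies X) (souls X) k (f * g) =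
      ∑ i ∈ Finset.range (k + 1), F i (k - i) := by
    intro k
    rw [jet_mul _ (souls_even hX), ← Nat.succ_eq_add_one,
      ← Finset.Nat.sum_antidiagonal_eq_sum_range_succ, Finset.smul_sum]
    refine Finset.sum_congr rfl fun ij hij => ?_
    simp only [hF, smul_mul_smul_comm]
    rw [← Nat.cast_smul_eq_nsmul ℝ, smul_smul]
    congr 1
    rw [← Finset.HasAntidiagonal.mem_antidiagonal.1 hij, Nat.cast_add_choose]
    have := Nat.factorial_ne_zero (ij.1 + ij.2)
    field_simp
  simp only [h1]
  rw [Finset.sum_range_diag_flip]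
  refine Finset.sum_congr rfl fun i hi => ?_
  refine Finset.sum_subset (by
    intro j; simp only [Finset.mem_range]; omega) fun j _ hj => ?_
  simp only [Finset.mem_range] at hj hi
  have := mul_mem_augPow (jet_mem (bodies X) (body_souls X) i f)
    (jet_mem (bodies X) (body_souls X) j g)
  rw [augPow_eq_bot (by omega), Submodule.mem_bot] at this
  simp only [hF, smul_mul_smul_comm]
  rw [this, smul_zero]

theorem jet_one_of_pos (x : I → ℝ) (n : I → Gr N) (k : ℕ) : jet U x n (k + 1) 1 = 0 := by
  rw [jet_succ]; simp [Smooth.pderiv_one]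

theorem taylor_one {X : I → Gr N} (hx : bodies X ∈ U) : taylor U X 1 = 1 := by
  rw [taylor_eq hx (Nat.lt_succ_self N), Finset.sum_range_succ']
  simp [jet_one_of_pos, jet_zero, extendZero_of_mem _ _ hx]

theorem taylor_coord {X : I → Gr N} (hx : bodies X ∈ U) (i : I) :
    taylor U X (Smooth.coord U i) = X i := by
  classical
  rw [taylor_eq hx (show N < N + 2 by omega), Finset.sum_range_succ', Finset.sum_range_succ']
  have h0 : extendZero U (Smooth.coord U i).1 (bodies X) = body (X i) := by
    rw [extendZero_of_mem _ _ hx]; rfl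
  have h1 : jet U (bodies X) (souls X) 1 (Smooth.coord U i) = souls X i := by
    rw [jet_succ, Finset.sum_eq_single i]
    · rw [Smooth.pderiv_coord, if_pos rfl, jet_zero, extendZero_of_mem _ _ hx]
      simp
    · intro j _ hj
      rw [Smooth.pderiv_coord, if_neg hj]; simp
    · simp
  have h2 : ∀ k, jet U (bodies X) (souls X) (k + 1 + 1) (Smooth.coord U i) = 0 := by
    intro k
    rw [jet_succ]
    refine Finset.sum_eq_zero fun j _ => ?_
    rw [Smooth.pderiv_coord]
    split_ifs
    · rw [jet_one_of_pos, zero_mul]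
    · simp
  simp [h0, h1, h2, jet_zero]

/-- The Taylor expansion at a real point is the value there. -/
theorem taylor_real {x : I → ℝ} (hx : x ∈ U) (g : Smooth U) :
    taylor U (fun i => algebraMap ℝ (Gr N) (x i)) g = algebraMap ℝ _ (extendZero U g.1 x) := by
  have hb : bodies (fun i => algebraMap ℝ (Gr N) (x i)) = x := by
    funext i; simp [bodies, ExteriorAlgebra.algebraMapInv]
  rw [taylor_eq (by rwa [hb]) (Nat.lt_succ_self N), Finset.sum_range_succ', hb]
  have : ∀ k, jet U x (souls fun i => algebraMap ℝ (Gr N) (x i)) (k + 1) g = 0 := by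
    intro k
    rw [jet_succ]
    refine Finset.sum_eq_zero fun i _ => ?_
    have : souls (fun i => algebraMap ℝ (Gr N) (x i)) i = 0 := by
      simp [souls, ExteriorAlgebra.algebraMapInv]
    rw [this, mul_zero]
  simp [this, jet_zero]

theorem jet_map {N' : ℕ} (j : Gr N →ₐ[ℝ] Gr N') (x : I → ℝ) (n : I → Gr N) (k : ℕ)
    (g : Smooth U) : jet U x (fun i => j (n i)) k g = j (jet U x n k g) := by
  induction k generalizing g with
  | zero => rw [jet_zero, jet_zero, AlgHom.commutes]
  | succ k ih => rw [jet_succ, jet_succ, map_sum]; simp [ih]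

theorem taylor_map {N' : ℕ} (j : Gr N →ₐ[ℝ] Gr N') (hj : ∀ x, body (j x) = body x) {X : I → Gr N}
    (hx : bodies X ∈ U) (g : Smooth U) : taylor U (fun i => j (X i)) g = j (taylor U X g) := by
  have hb : bodies (fun i => j (X i)) = bodies X := by
    funext i; exact hj _
  have hs : souls (fun i => j (X i)) = fun i => j (souls X i) := by
    funext i; simp [souls, hj]
  rw [taylor_eq (by rwa [hb]) (show N' < N + N' + 1 by omega),
    taylor_eq hx (show N < N + N' + 1 by omega), map_sum, hb, hs]
  exact Finset.sum_congr rfl fun k _ => by rw [jet_map, map_smul]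

end Taylor

/-! ### Values of superfunctions at supermatrices -/

-- the instances are found once here, as their synthesis on the tensor product is slow
section Instances
variable {I J : Type} [Fintype I] {U : TopologicalSpace.Opens (I → ℝ)}

set_option synthInstance.maxHeartbeats 400000 in
instance : Ring (SFun U J) := inferInstance

set_option synthInstance.maxHeartbeats 400000 in
instance : AddCommGroup (SFun U J) := inferInstance

set_option synthInstance.maxHeartbeats 400000 in
instance : Module ℝ (SFun U J) := inferInstance

end Instances

section OddEval
variable {J : Type} {N : ℕ}

theorem linearCombination_odd {Ξ : J → Gr N} (hΞ : ∀ j, Ξ j ∈ Par N 1) (v : J →₀ ℝ) :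
    Finsupp.linearCombination ℝ Ξ v ∈ Par N 1 := by
  rw [Finsupp.linearCombination_apply]
  exact Submodule.sum_mem _ fun j _ => Submodule.smul_mem _ _ (hΞ j)

/-- The algebra homomorphism `Λ[ξ_j] → Gr N`, `ξ_j ↦ Ξ_j`. -/
def oddHom {Ξ : J → Gr N} (hΞ : ∀ j, Ξ j ∈ Par N 1) :
    ExteriorAlgebra ℝ (J →₀ ℝ) →ₐ[ℝ] Gr N :=
  ExteriorAlgebra.lift ℝ ⟨Finsupp.linearCombination ℝ Ξ,
    fun v => odd_mul_self (linearCombination_odd hΞ v)⟩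

theorem oddEval_eq {Ξ : J → Gr N} (hΞ : ∀ j, Ξ j ∈ Par N 1) (a : ExteriorAlgebra ℝ (J →₀ ℝ)) :
    oddEval Ξ a = oddHom hΞ a := by
  rw [oddEval, dif_pos fun v => odd_mul_self (linearCombination_odd hΞ v)]
  rfl

theorem oddHom_ι {Ξ : J → Gr N} (hΞ : ∀ j, Ξ j ∈ Par N 1) (v : J →₀ ℝ) :
    oddHom hΞ (ExteriorAlgebra.ι ℝ v) = Finsupp.linearCombination ℝ Ξ v :=
  ExteriorAlgebra.lift_ι_apply _ _ _ _

end OddEval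

section Value
variable {R0 R1 C0 C1 : Type} [Fintype R0] [Fintype R1] [Fintype C0] [Fintype C1] {N : ℕ}
  {U : TopologicalSpace.Opens (Ev R0 R1 C0 C1 → ℝ)}
  {M : Matrix (R0 ⊕ R1) (C0 ⊕ C1) (Gr N)}

theorem value_add (f g : SFun U (Od R0 R1 C0 C1)) : value (f + g) M = value f M + value g M :=
  map_add _ _ _

theorem value_sub (f g : SFun U (Od R0 R1 C0 C1)) : value (f - g) M = value f M - value g M :=
  map_sub _ _ _

theorem value_smul (c : ℝ) (f : SFun U (Od R0 R1 C0 C1)) : value (c • f) M = c • value f M :=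
  map_smul _ _ _

theorem value_zero : value (0 : SFun U (Od R0 R1 C0 C1)) M = 0 := map_zero _

theorem value_sum {ι : Type*} (s : Finset ι) (f : ι → SFun U (Od R0 R1 C0 C1)) :
    value (∑ i ∈ s, f i) M = ∑ i ∈ s, value (f i) M := map_sum _ _ _

theorem value_tmul (g : Smooth U) (a : ExteriorAlgebra ℝ (Od R0 R1 C0 C1 →₀ ℝ)) :
    value (g ⊗ₜ[ℝ] a : SFun U (Od R0 R1 C0 C1)) M =
      taylor U (evPart M) g * oddEval (odPart M) a := rfl

theorem IsSuper.ev (hM : IsSuper M) (i : Ev R0 R1 C0 C1) : evPart M i ∈ Par N 0 := by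
  rcases i with ⟨a, k⟩ | ⟨a, k⟩
  · exact hM (.inl a) (.inl k)
  · have := hM (.inr a) (.inr k)
    have e : Par N 0 = Par N (par (.inr a : R0 ⊕ R1) + par (.inr k : C0 ⊕ C1)) :=
      Par_congr (by simp [par])
    rw [e]; exact this

theorem IsSuper.od (hM : IsSuper M) (i : Od R0 R1 C0 C1) : odPart M i ∈ Par N 1 := by
  rcases i with ⟨a, k⟩ | ⟨a, k⟩
  · exact hM (.inl a) (.inr k)
  · exact hM (.inr a) (.inl k)

theorem IsSuper.of_parts (h0 : ∀ i, evPart M i ∈ Par N 0) (h1 : ∀ i, odPart M i ∈ Par N 1) :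
    IsSuper M := by
  rintro (a | a) (k | k)
  · exact h0 (.inl (a, k))
  · exact h1 (.inl (a, k))
  · exact h1 (.inr (a, k))
  · have e : Par N 0 = Par N (par (.inr a : R0 ⊕ R1) + par (.inr k : C0 ⊕ C1)) :=
      Par_congr (by simp [par])
    have := h0 (.inr (a, k))
    rw [e] at this; exact this

theorem value_mul (hM : IsPoint U M) (f g : SFun U (Od R0 R1 C0 C1)) :
    value (f * g) M = value f M * value g M := by
  induction f using TensorProduct.induction_on with
  | zero => rw [zero_mul, value_zero, zero_mul]
  | add f₁ f₂ h₁ h₂ => rw [add_mul, value_add, h₁, h₂, value_add, add_mul]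
  | tmul g₁ a₁ =>
    induction g using TensorProduct.induction_on with
    | zero => rw [mul_zero, value_zero, mul_zero]
    | add f₁ f₂ h₁ h₂ => rw [mul_add, value_add, h₁, h₂, value_add, mul_add]
    | tmul g₂ a₂ =>
      rw [Algebra.TensorProduct.tmul_mul_tmul, value_tmul, value_tmul, value_tmul,
        taylor_mul hM.1.ev hM.2, oddEval_eq hM.1.od, oddEval_eq hM.1.od, oddEval_eq hM.1.od,
        map_mul, mul_assoc, mul_assoc]
      congr 1
      rw [← mul_assoc, ← mul_assoc, even_comm (taylor_even hM.1.ev hM.2 g₂)]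

theorem value_coord (hM : IsPoint U M) (a : R0 ⊕ R1) (k : C0 ⊕ C1) :
    value (coord U a k) M = M a k := by
  rcases a with a | a <;> rcases k with k | k
  · rw [coord, value_tmul, taylor_coord hM.2, oddEval_eq hM.1.od, map_one, mul_one]; rfl
  · rw [coord, value_tmul, taylor_one hM.2, oddEval_eq hM.1.od, oddHom_ι, one_mul]
    simp [odPart]
  · rw [coord, value_tmul, taylor_one hM.2, oddEval_eq hM.1.od, oddHom_ι, one_mul]
    simp [odPart]
  · rw [coord, value_tmul, taylor_coord hM.2, oddEval_eq hM.1.od, map_one, mul_one]; rfl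

/-- Superfunctions are natural with respect to homomorphisms of Grassmann algebras. -/
theorem value_map {N' : ℕ} (j : Gr N →ₐ[ℝ] Gr N') (hj : ∀ x, body (j x) = body x)
    (hp : ∀ i, ∀ x ∈ Par N i, j x ∈ Par N' i) (hM : IsPoint U M)
    (f : SFun U (Od R0 R1 C0 C1)) : value f (M.map j) = j (value f M) := by
  have e0 : evPart (M.map j) = fun i => j (evPart M i) := by
    funext i; rcases i with i | i <;> rfl
  have e1 : odPart (M.map j) = fun i => j (odPart M i) := by
    funext i; rcases i with i | i <;> rfl
  induction f using TensorProduct.induction_on with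
  | zero => rw [value_zero, value_zero, map_zero]
  | add f₁ f₂ h₁ h₂ => rw [value_add, value_add, h₁, h₂, map_add]
  | tmul g a =>
    rw [value_tmul, value_tmul, map_mul, e0, taylor_map j hj hM.2, e1,
      oddEval_eq (fun i => hp _ _ (hM.1.od i)), oddEval_eq hM.1.od]
    congr 1
    have : oddHom (fun i => hp _ _ (hM.1.od i)) = j.comp (oddHom hM.1.od) := by
      ext i
      simp [oddHom_ι]
    rw [this]; rfl

end Value

/-! ### Substitutions -/

section Pull
variable {R0 R1 C0 C1 R0' R1' C0' C1' : Type} [Fintype R0] [Fintype R1] [Fintype C0] [Fintype C1]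
  [Fintype R0'] [Fintype R1'] [Fintype C0'] [Fintype C1'] {N : ℕ}
  (φ : Subst R0 R1 C0 C1 R0' R1' C0' C1')

/-- An even entry of a substitution: a coordinate or a constant. -/
def Subst.evIdx : Ev R0 R1 C0 C1 → Ev R0' R1' C0' C1' ⊕ ℝ
  | .inl (a, k) => Sum.map .inl id (φ.ee a k)
  | .inr (a, k) => Sum.map .inr id (φ.oo a k)

/-- The result of a substitution at a supermatrix over a Grassmann algebra. -/
def Subst.app (M : Matrix (R0' ⊕ R1') (C0' ⊕ C1') (Gr N)) :
    Matrix (R0 ⊕ R1) (C0 ⊕ C1) (Gr N)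
  | .inl a, .inl k => Sum.elim (fun c => M (.inl c.1) (.inl c.2)) (algebraMap ℝ _) (φ.ee a k)
  | .inr a, .inr k => Sum.elim (fun c => M (.inr c.1) (.inr c.2)) (algebraMap ℝ _) (φ.oo a k)
  | .inl a, .inr k => (φ.eo a k).elim 0 (fun c => M (.inl c.1) (.inr c.2))
  | .inr a, .inl k => (φ.oe a k).elim 0 (fun c => M (.inr c.1) (.inl c.2))

theorem Subst.even_apply (x : Ev R0' R1' C0' C1' → ℝ) (i : Ev R0 R1 C0 C1) :
    φ.even x i = Sum.elim x id (φ.evIdx i) := by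
  rcases i with ⟨a, k⟩ | ⟨a, k⟩
  · rcases h : φ.ee a k with c | c <;> simp [Subst.even, Subst.evIdx, h]
  · rcases h : φ.oo a k with c | c <;> simp [Subst.even, Subst.evIdx, h]

theorem Subst.evPart_app (M : Matrix (R0' ⊕ R1') (C0' ⊕ C1') (Gr N)) (i : Ev R0 R1 C0 C1) :
    evPart (φ.app M) i = Sum.elim (evPart M) (algebraMap ℝ _) (φ.evIdx i) := by
  rcases i with ⟨a, k⟩ | ⟨a, k⟩
  · rcases h : φ.ee a k with c | c <;> simp [Subst.app, Subst.evIdx, h, evPart]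
  · rcases h : φ.oo a k with c | c <;> simp [Subst.app, Subst.evIdx, h, evPart]

theorem Subst.bodies_app (M : Matrix (R0' ⊕ R1') (C0' ⊕ C1') (Gr N)) :
    bodies (evPart (φ.app M)) = φ.even (bodies (evPart M)) := by
  funext i
  rw [bodies, φ.even_apply, φ.evPart_app]
  rcases φ.evIdx i with c | c <;> simp

theorem Subst.isSuper_app {M : Matrix (R0' ⊕ R1') (C0' ⊕ C1') (Gr N)} (hM : IsSuper M) :
    IsSuper (φ.app M) := by
  refine IsSuper.of_parts (fun i => ?_) (fun i => ?_)
  · rw [φ.evPart_app]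
    rcases φ.evIdx i with c | c
    · exact hM.ev c
    · exact Par.algebraMap_mem c
  · rcases i with ⟨a, k⟩ | ⟨a, k⟩
    · rcases h : φ.eo a k with _ | c
      · simp [Subst.app, h, odPart]
      · simpa [Subst.app, h, odPart] using hM.od (.inl c)
    · rcases h : φ.oe a k with _ | c
      · simp [Subst.app, h, odPart]
      · simpa [Subst.app, h, odPart] using hM.od (.inr c)

variable {U : TopologicalSpace.Opens (Ev R0 R1 C0 C1 → ℝ)}
  {U' : TopologicalSpace.Opens (Ev R0' R1' C0' C1' → ℝ)} (hU : ∀ x ∈ U', φ.even x ∈ U)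

theorem Subst.isPoint_app (hU : ∀ x ∈ U', φ.even x ∈ U) {M : Matrix (R0' ⊕ R1') (C0' ⊕ C1') (Gr N)} (hM : IsPoint U' M) :
    IsPoint U (φ.app M) :=
  ⟨φ.isSuper_app hM.1, by
    have := hU _ hM.2
    rwa [← φ.bodies_app] at this⟩

theorem Subst.extendZero_comp (g : Smooth U) {x : Ev R0' R1' C0' C1' → ℝ} (hx : x ∈ U') :
    extendZero U' (Smooth.comp φ.even φ.contDiff_even hU g).1 x =
      extendZero U g.1 (φ.even x) := by
  rw [extendZero_of_mem _ _ hx, extendZero_of_mem _ _ (hU x hx)]; rfl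

open Classical in
theorem Subst.hasFDerivAt_even (x : Ev R0' R1' C0' C1' → ℝ) :
    HasFDerivAt φ.even (ContinuousLinearMap.pi fun i =>
      Sum.elim (fun c => (ContinuousLinearMap.proj c : (Ev R0' R1' C0' C1' → ℝ) →L[ℝ] ℝ))
        (fun _ => 0) (φ.evIdx i)) x := by
  rw [hasFDerivAt_pi]
  intro i
  have h : (fun x => φ.even x i) = fun x => Sum.elim x id (φ.evIdx i) := by
    funext x; exact φ.even_apply x i
  rw [h]
  rcases φ.evIdx i with c | c
  · exact hasFDerivAt_apply c x
  · exact hasFDerivAt_const c x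

open Classical in
theorem Subst.pderiv_comp (j : Ev R0' R1' C0' C1') (g : Smooth U) :
    Smooth.pderiv U' j (Smooth.comp φ.even φ.contDiff_even hU g) =
      ∑ i, if φ.evIdx i = .inl j then
        Smooth.comp φ.even φ.contDiff_even hU (Smooth.pderiv U i g) else 0 := by
  refine Smooth.ext_extendZero fun x hx => ?_
  have h1 : extendZero U' (Smooth.comp φ.even φ.contDiff_even hU g).1 =ᶠ[nhds x]
      extendZero U g.1 ∘ φ.even := by
    filter_upwards [U'.isOpen.mem_nhds hx] with y hy
    exact φ.extendZero_comp hU g hy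
  have h2 := ((Smooth.differentiableAt g (hU x hx)).hasFDerivAt.comp x
    (φ.hasFDerivAt_even x)).fderiv
  rw [Smooth.extendZero_pderiv j _ hx, h1.fderiv_eq, h2]
  have h3 : ∀ v : Ev R0 R1 C0 C1 → ℝ, fderiv ℝ (extendZero U g.1) (φ.even x) v =
      ∑ i, v i * extendZero U (Smooth.pderiv U i g).1 (φ.even x) := by
    intro v
    conv_lhs => rw [← Finset.univ_sum_single v]
    rw [map_sum]
    refine Finset.sum_congr rfl fun i _ => ?_
    rw [Smooth.extendZero_pderiv i g (hU x hx)]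
    have : Pi.single i (v i) = v i • (Pi.single i 1 : Ev R0 R1 C0 C1 → ℝ) := by
      rw [← Pi.single_smul]; simp
    rw [this, map_smul, smul_eq_mul]
    congr!
  have h4 : extendZero U' (∑ i, if φ.evIdx i = .inl j then
        Smooth.comp φ.even φ.contDiff_even hU (Smooth.pderiv U i g) else 0).1 x =
      ∑ i, extendZero U' (if φ.evIdx i = .inl j then
        Smooth.comp φ.even φ.contDiff_even hU (Smooth.pderiv U i g) else 0).1 x :=
    map_sum (evalZero U' x) _ _
  rw [h4, ContinuousLinearMap.comp_apply, h3]
  refine Finset.sum_congr rfl fun i _ => ?_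
  rw [ContinuousLinearMap.coe_pi']
  beta_reduce
  rcases h : φ.evIdx i with c | c
  · by_cases hc : c = j
    · subst hc
      simp [φ.extendZero_comp hU _ hx]
    · have : extendZero U' ((0 : Smooth U')).1 x = 0 := map_zero (evalZero U' x)
      simp only [Sum.inl.injEq, hc, if_false, this, Sum.elim_inl, ContinuousLinearMap.proj_apply]
      simp [hc]
  · have : extendZero U' (0 : U' → ℝ) x = 0 := map_zero (evalZero U' x)
    simp [this]

theorem Subst.jet_comp {x : Ev R0' R1' C0' C1' → ℝ} (hx : x ∈ U') (n : Ev R0' R1' C0' C1' → Gr N)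
    (k : ℕ) (g : Smooth U) :
    jet U' x n k (Smooth.comp φ.even φ.contDiff_even hU g) =
      jet U (φ.even x) (fun i => Sum.elim n (fun _ => 0) (φ.evIdx i)) k g := by
  classical
  induction k generalizing g with
  | zero => rw [jet_zero, jet_zero, φ.extendZero_comp hU g hx]
  | succ k ih =>
    rw [jet_succ, jet_succ]
    simp only [φ.pderiv_comp hU, map_sum, Finset.sum_mul]
    rw [Finset.sum_comm]
    refine Finset.sum_congr rfl fun i _ => ?_
    rcases h : φ.evIdx i with c | c
    · rw [Finset.sum_eq_single c]
      · simp [ih]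
      · intro j _ hj
        simp [Ne.symm hj]
      · simp
    · simp

theorem Subst.taylor_comp {X : Ev R0' R1' C0' C1' → Gr N} (hx : bodies X ∈ U') (g : Smooth U) :
    taylor U' X (Smooth.comp φ.even φ.contDiff_even hU g) =
      taylor U (fun i => Sum.elim X (algebraMap ℝ _) (φ.evIdx i)) g := by
  have hb : bodies (fun i => Sum.elim X (algebraMap ℝ _) (φ.evIdx i)) = φ.even (bodies X) := by
    funext i
    rw [bodies, φ.even_apply]
    rcases φ.evIdx i with c | c <;> simp
  have hs : souls (fun i => Sum.elim X (algebraMap ℝ _) (φ.evIdx i)) =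
      fun i => Sum.elim (souls X) (fun _ => 0) (φ.evIdx i) := by
    funext i
    rcases h : φ.evIdx i with c | c <;> simp [souls, h]
  rw [taylor_eq hx (Nat.lt_succ_self N), taylor_eq (by rw [hb]; exact hU _ hx)
    (Nat.lt_succ_self N), hb, hs]
  exact Finset.sum_congr rfl fun k _ => by rw [φ.jet_comp hU hx]

theorem Subst.value_pull {M : Matrix (R0' ⊕ R1') (C0' ⊕ C1') (Gr N)} (hM : IsPoint U' M)
    (f : SFun U (Od R0 R1 C0 C1)) : value (φ.pull hU f) M = value f (φ.app M) := by
  induction f using TensorProduct.induction_on with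
  | zero => rw [map_zero, value_zero, value_zero]
  | add f₁ f₂ h₁ h₂ => rw [map_add, value_add, value_add, h₁, h₂]
  | tmul g a =>
    rw [Subst.pull, Algebra.TensorProduct.map_tmul, value_tmul, value_tmul,
      φ.taylor_comp hU hM.2, oddEval_eq hM.1.od, oddEval_eq (φ.isSuper_app hM.1).od]
    congr 1
    · congr 1
      congr 1
      funext i
      exact (φ.evPart_app M i).symm
    · have : oddHom (φ.isSuper_app hM.1).od =
          (oddHom hM.1.od).comp (ExteriorAlgebra.map (Finsupp.linearCombination ℝ φ.odd)) := by
        ext i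
        simp only [LinearMap.coe_comp, Function.comp_apply, Finsupp.lsingle_apply,
          AlgHom.toLinearMap_apply, AlgHom.comp_apply, ExteriorAlgebra.map_apply_ι, oddHom_ι,
          Finsupp.linearCombination_single, one_smul]
        rcases i with ⟨a, k⟩ | ⟨a, k⟩
        · rcases h : φ.eo a k with _ | c <;> simp [Subst.app, h, odPart, Subst.odd]
        · rcases h : φ.oe a k with _ | c <;> simp [Subst.app, h, odPart, Subst.odd]
      rw [this]; rfl

end Pull

/-! ### Derivatives of values -/

section HD
variable {N : ℕ}

/-- `G : ℝ → Gr N` has derivative `G'` at `t`; the condition is tested by all linear functionals,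
as no topology is fixed on the finite-dimensional space `Gr N`. -/
def HD (G : ℝ → Gr N) (G' : Gr N) (t : ℝ) : Prop :=
  ∀ ℓ : Gr N →ₗ[ℝ] ℝ, HasDerivAt (fun s => ℓ (G s)) (ℓ G') t

theorem HD.const (c : Gr N) (t : ℝ) : HD (fun _ => c) 0 t := fun ℓ => by
  simpa using hasDerivAt_const t (ℓ c)

theorem HD.add {G H : ℝ → Gr N} {G' H' : Gr N} {t : ℝ} (hG : HD G G' t) (hH : HD H H' t) :
    HD (fun s => G s + H s) (G' + H') t := fun ℓ => by
  simpa using (hG ℓ).fun_add (hH ℓ)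

theorem HD.sum {ι : Type*} {s : Finset ι} {G : ι → ℝ → Gr N} {G' : ι → Gr N} {t : ℝ}
    (h : ∀ i ∈ s, HD (G i) (G' i) t) : HD (fun x => ∑ i ∈ s, G i x) (∑ i ∈ s, G' i) t :=
  fun ℓ => by
    simpa using HasDerivAt.fun_sum fun i hi => h i hi ℓ

theorem HD.map {N' : ℕ} (φ : Gr N →ₗ[ℝ] Gr N') {G : ℝ → Gr N} {G' : Gr N} {t : ℝ} (h : HD G G' t) :
    HD (fun s => φ (G s)) (φ G') t := fun ℓ => h (ℓ ∘ₗ φ)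

theorem HD.line (c E : Gr N) (t : ℝ) : HD (fun s => c + s • E) E t := fun ℓ => by
  have := ((hasDerivAt_id t).mul_const (ℓ E)).const_add (ℓ c)
  simpa using this

theorem HD.mul {G H : ℝ → Gr N} {G' H' : Gr N} {t : ℝ} (hG : HD G G' t) (hH : HD H H' t) :
    HD (fun s => G s * H s) (G' * H t + G t * H') t := fun ℓ => by
  set b := Module.finBasis ℝ (Gr N)
  have key : ∀ x y : Gr N, ℓ (x * y) = ∑ i, b.coord i x * ℓ (b i * y) := by
    intro x y
    conv_lhs => rw [← b.sum_repr x, Finset.sum_mul, map_sum]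
    refine Finset.sum_congr rfl fun i _ => ?_
    rw [smul_mul_assoc, map_smul]; rfl
  have h := HasDerivAt.fun_sum (u := Finset.univ) fun i _ =>
    (hG (b.coord i)).fun_mul (hH (ℓ ∘ₗ LinearMap.mulLeft ℝ (b i)))
  simp only [LinearMap.comp_apply, LinearMap.mulLeft_apply, Finset.sum_add_distrib] at h
  have e : (fun s => ℓ (G s * H s)) = fun s => ∑ i, b.coord i (G s) * ℓ (b i * H s) :=
    funext fun s => key _ _
  rw [e, map_add, key G' (H t), key (G t) H']
  exact h

theorem HD.congr {G H : ℝ → Gr N} {G' : Gr N} {t : ℝ} (hG : HD G G' t)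
    (h : H =ᶠ[nhds t] G) : HD H G' t := fun ℓ =>
  (hG ℓ).congr_of_eventuallyEq (h.fun_comp ℓ)

theorem eq_of_forall_functional {x y : Gr N} (h : ∀ ℓ : Gr N →ₗ[ℝ] ℝ, ℓ x = ℓ y) : x = y :=
  (Module.finBasis ℝ (Gr N)).ext_elem fun i => h ((Module.finBasis ℝ (Gr N)).coord i)

/-- A function with constant derivative is affine. -/
theorem HD.affine {G : ℝ → Gr N} {K : Gr N} (h : ∀ t, HD G K t) : G 1 = G 0 + K := by
  refine eq_of_forall_functional fun ℓ => ?_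
  have h2 : ∀ t, HasDerivAt (fun s => ℓ (G s) - s * ℓ K) 0 t := fun t => by
    simpa using (h t ℓ).fun_sub ((hasDerivAt_id t).mul_const (ℓ K))
  have := is_const_of_deriv_eq_zero (fun t => (h2 t).differentiableAt) (fun t => (h2 t).deriv) 1 0
  simp only [one_mul, zero_mul, sub_zero] at this
  rw [map_add, ← this]; ring

end HD

section JetDeriv
variable {I : Type} [Fintype I] {N : ℕ} {U : TopologicalSpace.Opens (I → ℝ)}

theorem jet_HD (x e : I → ℝ) (n ν : I → Gr N) (hν : ∀ i, ν i ∈ Par N 0) {t : ℝ}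
    (ht : x + t • e ∈ U) (k : ℕ) (g : Smooth U) :
    HD (fun s => jet U (x + s • e) (n + s • ν) k g)
      (∑ i, e i • jet U (x + t • e) (n + t • ν) k (Smooth.pderiv U i g) +
        (k : ℝ) • ∑ i, jet U (x + t • e) (n + t • ν) (k - 1) (Smooth.pderiv U i g) * ν i) t := by
  classical
  induction k generalizing g with
  | zero =>
    intro ℓ
    have h1 : HasDerivAt (fun s : ℝ => x + s • e) e t := by
      simpa using ((hasDerivAt_id t).smul_const e).const_add x
    have h2 := (Smooth.differentiableAt g ht).hasFDerivAt.comp_hasDerivAt t h1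
    have h3 : fderiv ℝ (extendZero U g.1) (x + t • e) e =
        ∑ i, e i * extendZero U (Smooth.pderiv U i g).1 (x + t • e) := by
      have h5 : fderiv ℝ (extendZero U g.1) (x + t • e) e =
          fderiv ℝ (extendZero U g.1) (x + t • e) (∑ i, Pi.single i (e i)) := by
        rw [Finset.univ_sum_single]
      rw [h5, map_sum]
      refine Finset.sum_congr rfl fun i _ => ?_
      rw [Smooth.extendZero_pderiv i g ht]
      have : Pi.single i (e i) = e i • (Pi.single i 1 : I → ℝ) := by
        rw [← Pi.single_smul]; simp
      rw [this, map_smul, smul_eq_mul]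
    have h4 := h2.mul_const (ℓ 1)
    rw [h3] at h4
    simp only [jet_zero, Nat.cast_zero, zero_smul, add_zero, map_sum, map_smul,
      Algebra.algebraMap_eq_smul_one, smul_eq_mul]
    refine h4.congr_deriv ?_
    rw [Finset.sum_mul]
    exact Finset.sum_congr rfl fun i _ => by ring
  | succ k ih =>
    have h := HD.sum (s := Finset.univ) fun i _ => (ih (Smooth.pderiv U i g)).mul
      (HD.line (n i) (ν i) t)
    simp only [jet_succ]
    convert h using 1
    · rfl
    simp only [Finset.sum_add_distrib, add_mul]
    have e1 : ∑ i, e i • ∑ j, jet U (x + t • e) (n + t • ν) k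
        (Smooth.pderiv U j (Smooth.pderiv U i g)) * (n + t • ν) j =
        ∑ j, (∑ i, e i • jet U (x + t • e) (n + t • ν) k
          (Smooth.pderiv U i (Smooth.pderiv U j g))) * (n j + t • ν j) := by
      simp only [Finset.smul_sum, Finset.sum_mul]
      rw [Finset.sum_comm]
      refine Finset.sum_congr rfl fun j _ => Finset.sum_congr rfl fun i _ => ?_
      rw [Smooth.pderiv_comm, smul_mul_assoc]; rfl
    have e2 : (k : ℝ) • ∑ i, jet U (x + t • e) (n + t • ν) k (Smooth.pderiv U i g) * ν i =
        ∑ j, ((k : ℝ) • ∑ i, jet U (x + t • e) (n + t • ν) (k - 1)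
          (Smooth.pderiv U i (Smooth.pderiv U j g)) * ν i) * (n j + t • ν j) := by
      rcases k with _ | k
      · simp
      · simp only [Nat.add_sub_cancel, jet_succ, smul_mul_assoc, Finset.sum_mul]
        rw [← Finset.smul_sum, Finset.sum_comm]
        congr 1
        refine Finset.sum_congr rfl fun j _ => Finset.sum_congr rfl fun i _ => ?_
        rw [Smooth.pderiv_comm, mul_assoc, mul_assoc, even_comm (hν i)]; rfl
    rw [e1, Nat.add_sub_cancel, Nat.cast_succ, add_smul, one_smul, ← e2, add_assoc]

theorem taylor_HD {X E : I → Gr N} (hE : ∀ i, E i ∈ Par N 0) {t : ℝ}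
    (ht : bodies (X + t • E) ∈ U) (g : Smooth U) :
    HD (fun s => taylor U (X + s • E) g)
      (∑ i, E i * taylor U (X + t • E) (Smooth.pderiv U i g)) t := by
  have hb : ∀ s : ℝ, bodies (X + s • E) = bodies X + s • bodies E := fun s => by
    funext i; simp [bodies]
  have hs : ∀ s : ℝ, souls (X + s • E) = souls X + s • souls E := fun s => by
    funext i
    simp only [souls, Pi.add_apply, Pi.smul_apply, map_add, map_smul, smul_sub]
    rw [Algebra.algebraMap_eq_smul_one, Algebra.algebraMap_eq_smul_one,
      Algebra.algebraMap_eq_smul_one, smul_smul]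
    simp only [smul_eq_mul]
    abel
  have ht' : bodies X + t • bodies E ∈ U := by rwa [← hb]
  have hev : ∀ᶠ s in nhds t, bodies X + s • bodies E ∈ U := by
    have hc : Continuous fun s : ℝ => bodies X + s • bodies E := by fun_prop
    exact hc.continuousAt.eventually (U.isOpen.mem_nhds ht')
  have h := HD.sum (s := Finset.range (N + 2)) fun k _ => (jet_HD (bodies X) (bodies E) (souls X)
    (souls E) (souls_even hE) ht' k g).map (((k.factorial : ℝ)⁻¹) • LinearMap.id)
  have h2 := h.congr (H := fun s => taylor U (X + s • E) g) <| by
    filter_upwards [hev] with s hs'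
    rw [taylor_eq (by rwa [hb]) (show N < N + 2 by omega), hb, hs]
    rfl
  convert h2 using 1
  simp only [LinearMap.smul_apply, LinearMap.id_apply, smul_add, Finset.sum_add_distrib]
  have e1 : ∑ k ∈ Finset.range (N + 2), ((k.factorial : ℝ)⁻¹) • ∑ i, bodies E i •
      jet U (bodies X + t • bodies E) (souls X + t • souls E) k (Smooth.pderiv U i g) =
      ∑ i, bodies E i • taylor U (X + t • E) (Smooth.pderiv U i g) := by
    simp only [taylor_eq ht (show N < N + 2 by omega), Finset.smul_sum]
    rw [Finset.sum_comm]
    refine Finset.sum_congr rfl fun i _ => Finset.sum_congr rfl fun k _ => ?_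
    rw [smul_comm, hb, hs]
  have e2 : ∑ k ∈ Finset.range (N + 2), ((k.factorial : ℝ)⁻¹) • (k : ℝ) • ∑ i,
      jet U (bodies X + t • bodies E) (souls X + t • souls E) (k - 1) (Smooth.pderiv U i g) *
        souls E i =
      ∑ i, taylor U (X + t • E) (Smooth.pderiv U i g) * souls E i := by
    rw [Finset.sum_range_succ']
    simp only [taylor_eq ht (show N < N + 1 by omega), Finset.smul_sum, Finset.sum_mul,
      Nat.cast_zero, zero_smul, smul_zero, Finset.sum_const_zero, add_zero, Nat.add_sub_cancel]
    rw [Finset.sum_comm]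
    refine Finset.sum_congr rfl fun i _ => Finset.sum_congr rfl fun k _ => ?_
    rw [smul_smul, hb, hs, smul_mul_assoc]
    congr 1
    rw [Nat.factorial_succ]
    have := Nat.factorial_ne_zero k
    push_cast
    field_simp
  rw [e1, e2, ← Finset.sum_add_distrib]
  refine Finset.sum_congr rfl fun i _ => ?_
  rw [← even_comm (souls_even hE i), Algebra.smul_def (bodies E i), ← add_mul]
  simp [souls, bodies]

end JetDeriv

section OddDeriv
variable {J : Type} {N : ℕ}

theorem oddDeriv_ι_mul (j : J) (v : J →₀ ℝ) (b : ExteriorAlgebra ℝ (J →₀ ℝ)) :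
    oddDeriv j (ExteriorAlgebra.ι ℝ v * b) =
      v j • b - ExteriorAlgebra.ι ℝ v * oddDeriv j b :=
  CliffordAlgebra.contractLeft_ι_mul _ _ _

theorem oddDeriv_algebraMap (j : J) (r : ℝ) :
    oddDeriv j (algebraMap ℝ (ExteriorAlgebra ℝ (J →₀ ℝ)) r) = 0 :=
  CliffordAlgebra.contractLeft_algebraMap _ _ _

theorem oddDeriv_comm (i j : J) (a : ExteriorAlgebra ℝ (J →₀ ℝ)) :
    oddDeriv i (oddDeriv j a) = -oddDeriv j (oddDeriv i a) :=
  CliffordAlgebra.contractLeft_comm _ _ _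

theorem ExteriorAlgebra.left_induction {M : Type*} [AddCommGroup M] [Module ℝ M]
    {P : ExteriorAlgebra ℝ M → Prop} (algebraMap : ∀ r, P (algebraMap ℝ _ r))
    (add : ∀ x y, P x → P y → P (x + y))
    (ι_mul : ∀ x m, P x → P (ExteriorAlgebra.ι ℝ m * x)) (x) : P x :=
  CliffordAlgebra.left_induction _ algebraMap add ι_mul x

theorem linearCombination_eq_sum [Fintype J] (Ξ : J → Gr N) (v : J →₀ ℝ) :
    Finsupp.linearCombination ℝ Ξ v = ∑ j, v j • Ξ j := by
  rw [Finsupp.linearCombination_apply, Finsupp.sum_fintype _ _ (by simp)]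

theorem oddEval_HD [Fintype J] {Ξ H : J → Gr N} (hΞ : ∀ j, Ξ j ∈ Par N 1)
    (hH : ∀ j, H j ∈ Par N 1) (t : ℝ) (a : ExteriorAlgebra ℝ (J →₀ ℝ)) :
    HD (fun s => oddEval (Ξ + s • H) a) (∑ j, H j * oddEval (Ξ + t • H) (oddDeriv j a)) t := by
  have hs : ∀ (s : ℝ) (j : J), (Ξ + s • H) j ∈ Par N 1 := fun s j =>
    Submodule.add_mem _ (hΞ j) (Submodule.smul_mem _ s (hH j))
  simp only [fun (s : ℝ) a => oddEval_eq (hs s) a]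
  have hlc : ∀ (s : ℝ) (v : J →₀ ℝ), Finsupp.linearCombination ℝ (Ξ + s • H) v =
      Finsupp.linearCombination ℝ Ξ v + s • Finsupp.linearCombination ℝ H v := by
    intro s v
    simp only [linearCombination_eq_sum, Finset.smul_sum, ← Finset.sum_add_distrib]
    refine Finset.sum_congr rfl fun i _ => ?_
    simp only [Pi.add_apply, Pi.smul_apply, smul_add]
    rw [smul_comm]
  induction a using ExteriorAlgebra.left_induction with
  | algebraMap r =>
    simp only [oddDeriv_algebraMap, map_zero, mul_zero, Finset.sum_const_zero, AlgHom.commutes]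
    exact HD.const _ _
  | add a b ha hb =>
    simp only [map_add, mul_add, Finset.sum_add_distrib]
    exact ha.add hb
  | ι_mul b v hb =>
    have h := (HD.line (Finsupp.linearCombination ℝ Ξ v)
      (Finsupp.linearCombination ℝ H v) t).mul hb
    simp only [map_mul, oddHom_ι, hlc]
    convert h using 1
    rw [← hlc, linearCombination_eq_sum H, Finset.sum_mul, Finset.mul_sum, ← Finset.sum_add_distrib]
    refine Finset.sum_congr rfl fun j _ => ?_
    rw [oddDeriv_ι_mul, map_sub, map_smul, map_mul, oddHom_ι, mul_sub, mul_smul_comm,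
      smul_mul_assoc, sub_eq_add_neg, ← mul_assoc, ← mul_assoc,
      super_comm (hH j) (linearCombination_odd (hs t) v)]
    simp [sg]

end OddDeriv

section ValueDeriv
variable {R0 R1 C0 C1 : Type} [Fintype R0] [Fintype R1] [Fintype C0] [Fintype C1] {N : ℕ}
  {U : TopologicalSpace.Opens (Ev R0 R1 C0 C1 → ℝ)}

/-- The differential of a superfunction `f` at `M`, evaluated at the matrix `E`. -/
def dval (f : SFun U (Od R0 R1 C0 C1)) (M E : Matrix (R0 ⊕ R1) (C0 ⊕ C1) (Gr N)) : Gr N :=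
  ∑ a, ∑ k, E a k * value (pd U a k f) M

theorem evPart_line (M E : Matrix (R0 ⊕ R1) (C0 ⊕ C1) (Gr N)) (s : ℝ) :
    evPart (M + s • E) = evPart M + s • evPart E := by
  funext i; rcases i with i | i <;> rfl

theorem odPart_line (M E : Matrix (R0 ⊕ R1) (C0 ⊕ C1) (Gr N)) (s : ℝ) :
    odPart (M + s • E) = odPart M + s • odPart E := by
  funext i; rcases i with i | i <;> rfl

theorem dval_add_fun (f g : SFun U (Od R0 R1 C0 C1)) (M E : Matrix (R0 ⊕ R1) (C0 ⊕ C1) (Gr N)) :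
    dval (f + g) M E = dval f M E + dval g M E := by
  simp only [dval, map_add, value_add, mul_add, Finset.sum_add_distrib]

theorem dval_tmul (g : Smooth U) (a : ExteriorAlgebra ℝ (Od R0 R1 C0 C1 →₀ ℝ))
    (M E : Matrix (R0 ⊕ R1) (C0 ⊕ C1) (Gr N)) :
    dval (g ⊗ₜ[ℝ] a : SFun U (Od R0 R1 C0 C1)) M E =
      (∑ i, evPart E i * (taylor U (evPart M) (Smooth.pderiv U i g) * oddEval (odPart M) a)) +
      ∑ j, odPart E j * (taylor U (evPart M) g * oddEval (odPart M) (oddDeriv j a)) := by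
  simp only [dval, Fintype.sum_sum_type, Fintype.sum_prod_type, pd, TensorProduct.map_tmul,
    value_tmul, evPart, odPart, LinearMap.id_apply, Finset.sum_add_distrib]
  abel

theorem value_HD {M E : Matrix (R0 ⊕ R1) (C0 ⊕ C1) (Gr N)} (hM : IsSuper M) (hE : IsSuper E)
    {t : ℝ} (ht : bodies (evPart (M + t • E)) ∈ U) (f : SFun U (Od R0 R1 C0 C1)) :
    HD (fun s => value f (M + s • E)) (dval f (M + t • E) E) t := by
  induction f using TensorProduct.induction_on with
  | zero =>
    simp only [value_zero, dval, map_zero, mul_zero, Finset.sum_const_zero]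
    exact HD.const _ _
  | add f₁ f₂ h₁ h₂ =>
    simp only [value_add, dval_add_fun]
    exact h₁.add h₂
  | tmul g a =>
    have hX : ∀ i, (evPart M + t • evPart E) i ∈ Par N 0 := fun i =>
      Submodule.add_mem _ (hM.ev i) (Submodule.smul_mem _ t (hE.ev i))
    rw [evPart_line] at ht
    have h := (taylor_HD hE.ev ht g).mul (oddEval_HD hM.od hE.od t a)
    simp only [value_tmul, dval_tmul, evPart_line, odPart_line]
    convert h using 1
    congr 1
    · rw [Finset.sum_mul]
      exact Finset.sum_congr rfl fun i _ => by rw [mul_assoc]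
    · rw [Finset.mul_sum]
      refine Finset.sum_congr rfl fun j _ => ?_
      rw [← mul_assoc, ← mul_assoc, even_comm (taylor_even hX ht g)]

/-- If the differential in the direction `E` is constant along the line `M + t E`, then the
superfunction is affine along this line. -/
theorem value_flow {M E : Matrix (R0 ⊕ R1) (C0 ⊕ C1) (Gr N)} {f : SFun U (Od R0 R1 C0 C1)}
    {K : Gr N} (hE : IsSuper E) (h : ∀ t : ℝ, IsPoint U (M + t • E))
    (hd : ∀ t : ℝ, dval f (M + t • E) E = K) : value f (M + E) = value f M + K := by
  have hM : IsSuper M := by simpa using (h 0).1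
  have := HD.affine fun t => by
    have := value_HD hM hE (h t).2 f
    rwa [hd t] at this
  simpa using this

/-- A superfunction is affine in the direction of a matrix whose entries have zero products. -/
theorem value_add_of_mul_eq_zero {M δ : Matrix (R0 ⊕ R1) (C0 ⊕ C1) (Gr N)}
    (hM : IsPoint U M) (hδ : IsSuper δ) (h0 : ∀ a k b l, δ a k * δ b l = 0)
    (f : SFun U (Od R0 R1 C0 C1)) : value f (M + δ) = value f M + dval f M δ := by
  have hb : ∀ a k, body (δ a k) = 0 := fun a k => by
    have := congrArg body (h0 a k a k)
    rw [map_mul, map_zero] at this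
    exact mul_self_eq_zero.1 this
  have hbod : ∀ t : ℝ, bodies (evPart (M + t • δ)) = bodies (evPart M) := fun t => by
    rw [evPart_line]
    funext i
    rcases i with ⟨a, k⟩ | ⟨a, k⟩ <;> simp [bodies, evPart, hb]
  have hpt : ∀ t : ℝ, IsPoint U (M + t • δ) := fun t =>
    ⟨fun a k => Submodule.add_mem _ (hM.1 a k) (Submodule.smul_mem _ t (hδ a k)), by
      have := hM.2
      change bodies (evPart M) ∈ U at this
      rw [← hbod t] at this; exact this⟩
  refine value_flow hδ hpt fun t => ?_
  refine Finset.sum_congr rfl fun a _ => Finset.sum_congr rfl fun k _ => ?_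
  have h1 : ∀ s : ℝ, HD (fun s => δ a k * value (pd U a k f) (M + (s * t) • δ)) 0 s := fun s => by
    have h2 := (value_HD hM.1 hδ (t := s * t) (hpt (s * t)).2 (pd U a k f)).map
      (LinearMap.mulLeft ℝ (δ a k))
    have h3 : LinearMap.mulLeft ℝ (δ a k) (dval (pd U a k f) (M + (s * t) • δ) δ) = 0 := by
      simp only [LinearMap.mulLeft_apply, dval, Finset.mul_sum, ← mul_assoc, h0, zero_mul,
        Finset.sum_const_zero]
    rw [h3] at h2
    intro ℓ
    have h5 : HasDerivAt (fun s : ℝ => s * t) t s := by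
      simpa using (hasDerivAt_id s).mul_const t
    refine (HasDerivAt.comp s (h2 ℓ) h5).congr_deriv ?_
    rw [map_zero, zero_mul]
  have := HD.affine h1
  simpa using this

end ValueDeriv

/-! ### Superfunctions are determined by their values -/

section Faithful
variable {R0 R1 C0 C1 : Type} [Fintype R0] [Fintype R1] [Fintype C0] [Fintype C1]
  {U : TopologicalSpace.Opens (Ev R0 R1 C0 C1 → ℝ)}

/-- Restriction of a superfunction to a point of the underlying domain. -/
def atPoint (U : TopologicalSpace.Opens (Ev R0 R1 C0 C1 → ℝ)) (x : Ev R0 R1 C0 C1 → ℝ) :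
    SFun U (Od R0 R1 C0 C1) →ₗ[ℝ] ExteriorAlgebra ℝ (Od R0 R1 C0 C1 →₀ ℝ) :=
  TensorProduct.lift ((LinearMap.lsmul ℝ _).comp (evalZero U x))

set_option synthInstance.maxHeartbeats 400000 in
theorem eq_zero_of_atPoint {f : SFun U (Od R0 R1 C0 C1)} (h : ∀ x ∈ U, atPoint U x f = 0) :
    f = 0 := by
  classical
  let b := Module.Free.chooseBasis ℝ (ExteriorAlgebra ℝ (Od R0 R1 C0 C1 →₀ ℝ))
  let e := TensorProduct.equivFinsuppOfBasisRight (M := Smooth U) b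
  have key : ∀ (x : Ev R0 R1 C0 C1 → ℝ) (f : SFun U (Od R0 R1 C0 C1)) i,
      b.repr (atPoint U x f) i = evalZero U x (e f i) := by
    intro x f i
    induction f using TensorProduct.induction_on with
    | zero => simp
    | add f₁ f₂ h₁ h₂ => simp only [map_add, Finsupp.add_apply, h₁, h₂]
    | tmul g a =>
      simp only [e, atPoint, TensorProduct.lift.tmul, LinearMap.comp_apply,
        LinearMap.lsmul_apply, map_smul, Finsupp.smul_apply,
        TensorProduct.equivFinsuppOfBasisRight_apply_tmul_apply, smul_eq_mul]
      rw [mul_comm]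
  refine e.injective ((Finsupp.ext fun i => ?_).trans (LinearEquiv.map_zero e).symm)
  refine Smooth.ext_extendZero fun x hx => ?_
  have := key x f i
  rw [h x hx, map_zero] at this
  exact this.symm.trans (map_zero (evalZero U x)).symm

/-- A superfunction whose values at all points over Grassmann algebras vanish is zero. It
suffices to insert real numbers for the even coordinates and independent generators for the odd
ones. -/
theorem eq_zero_of_value {f : SFun U (Od R0 R1 C0 C1)}
    (h : ∀ (N : ℕ) (M : Matrix (R0 ⊕ R1) (C0 ⊕ C1) (Gr N)), IsPoint U M → value f M = 0) :
    f = 0 := by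
  classical
  refine eq_zero_of_atPoint fun x hx => ?_
  let N := Fintype.card (Od R0 R1 C0 C1)
  let eN : Od R0 R1 C0 C1 ≃ Fin N := Fintype.equivFin _
  let L : (Od R0 R1 C0 C1 →₀ ℝ) ≃ₗ[ℝ] (Fin N → ℝ) :=
    (Finsupp.domLCongr eN).trans (Finsupp.linearEquivFunOnFinite ℝ ℝ (Fin N))
  let X : Ev R0 R1 C0 C1 → Gr N := fun i => algebraMap ℝ _ (x i)
  let Ξ : Od R0 R1 C0 C1 → Gr N := fun j => ExteriorAlgebra.ι ℝ (L (Finsupp.single j 1))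
  let M : Matrix (R0 ⊕ R1) (C0 ⊕ C1) (Gr N) := fun a k =>
    match a, k with
    | .inl a, .inl k => X (.inl (a, k))
    | .inr a, .inr k => X (.inr (a, k))
    | .inl a, .inr k => Ξ (.inl (a, k))
    | .inr a, .inl k => Ξ (.inr (a, k))
  have hev : evPart M = X := by funext i; rcases i with i | i <;> rfl
  have hod : odPart M = Ξ := by funext i; rcases i with i | i <;> rfl
  have hM : IsPoint U M := by
    refine ⟨IsSuper.of_parts (fun i => ?_) (fun j => ?_), ?_⟩
    · rw [hev]; exact Par.algebraMap_mem _
    · rw [hod]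
      have := CliffordAlgebra.ι_mem_evenOdd_one (0 : QuadraticForm ℝ (Fin N → ℝ))
        (L (Finsupp.single j 1))
      simpa [Par] using this
    · have : (fun i => body (evPart M i)) = x := by funext i; rw [hev]; exact body_algebraMap _
      rw [this]; exact hx
  have key : ∀ f : SFun U (Od R0 R1 C0 C1),
      value f M = ExteriorAlgebra.map L.toLinearMap (atPoint U x f) := by
    intro f
    induction f using TensorProduct.induction_on with
    | zero => rw [value_zero, map_zero, map_zero]
    | add f₁ f₂ h₁ h₂ => rw [value_add, map_add, map_add, h₁, h₂]
    | tmul g a =>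
      rw [value_tmul, hev, taylor_real hx, oddEval_eq hM.1.od]
      have e2 : oddHom hM.1.od = ExteriorAlgebra.map L.toLinearMap := by
        ext j
        simp [oddHom_ι, hod, Ξ]
      rw [e2]
      simp only [atPoint, TensorProduct.lift.tmul, LinearMap.comp_apply, LinearMap.lsmul_apply,
        Algebra.smul_def]
      rw [map_mul, AlgHom.commutes]
      rfl
  have hinj : Function.Injective (ExteriorAlgebra.map L.toLinearMap) :=
    ExteriorAlgebra.map_injective ⟨L.symm.toLinearMap, by ext; simp⟩
  refine hinj ?_
  rw [← key, h N M hM, map_zero]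

theorem eq_of_value {f g : SFun U (Od R0 R1 C0 C1)}
    (h : ∀ (N : ℕ) (M : Matrix (R0 ⊕ R1) (C0 ⊕ C1) (Gr N)), IsPoint U M → value f M = value g M) :
    f = g := by
  rw [← sub_eq_zero]
  refine eq_zero_of_value fun N M hM => ?_
  rw [value_sub, h N M hM, sub_self]

end Faithful

/-! ### Adjoining infinitesimal parameters -/

section Eps
variable (N : ℕ)

/-- The inclusion of the space of generators of `Gr N` into that of `Gr (N + 2)`. -/
def extGen : (Fin N → ℝ) →ₗ[ℝ] (Fin (N + 2) → ℝ) :=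
  LinearMap.pi fun i => if h : (i : ℕ) < N then LinearMap.proj ⟨i, h⟩ else 0

/-- The inclusion of `Gr N` into `Gr (N + 2)`. -/
def ext : Gr N →ₐ[ℝ] Gr (N + 2) := ExteriorAlgebra.map (extGen N)

theorem body_ι {N : ℕ} (v : Fin N → ℝ) : body (ExteriorAlgebra.ι ℝ v) = 0 := by
  simp [ExteriorAlgebra.algebraMapInv]

theorem body_ext (x : Gr N) : body (ext N x) = body x := by
  have : (body (N := N + 2)).comp (ext N) = body := by
    refine ExteriorAlgebra.hom_ext (LinearMap.ext fun v => ?_)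
    have h : ext N (ExteriorAlgebra.ι ℝ v) = ExteriorAlgebra.ι ℝ (extGen N v) :=
      ExteriorAlgebra.map_apply_ι _ _
    simp only [AlgHom.comp_toLinearMap, LinearMap.comp_apply, AlgHom.toLinearMap_apply]
    rw [h, body_ι, body_ι]
  exact DFunLike.congr_fun this x

theorem involute_ext (x : Gr N) :
    CliffordAlgebra.involute (ext N x) = ext N (CliffordAlgebra.involute x) := by
  induction x using ExteriorAlgebra.induction with
  | algebraMap r => rw [AlgHom.commutes, AlgHom.commutes, AlgHom.commutes, AlgHom.commutes]
  | ι v =>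
    have h : ExteriorAlgebra.map (extGen N) (CliffordAlgebra.ι 0 v) =
      CliffordAlgebra.ι 0 (extGen N v) := ExteriorAlgebra.map_apply_ι _ _
    have h2 : CliffordAlgebra.involute (ExteriorAlgebra.ι ℝ v) = -ExteriorAlgebra.ι ℝ v :=
      CliffordAlgebra.involute_ι _
    rw [h2, map_neg]
    refine (congrArg CliffordAlgebra.involute h).trans ?_
    rw [CliffordAlgebra.involute_ι]
    exact congrArg Neg.neg h.symm
  | mul a b ha hb => simp only [map_mul, ha, hb]
  | add a b ha hb => simp only [map_add, ha, hb]

theorem ext_mem {i : ℕ} {x : Gr N} (hx : x ∈ Par N i) : ext N x ∈ Par (N + 2) i := by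
  rw [mem_Par_iff, involute_ext, involute_of_mem hx, map_smul]

/-- The first of the two generators of `Gr (N + 2)` not in `Gr N`. -/
def theta1 : Gr (N + 2) := ExteriorAlgebra.ι ℝ (Pi.single ⟨N, by omega⟩ 1)

/-- The second of the two generators of `Gr (N + 2)` not in `Gr N`. -/
def theta2 : Gr (N + 2) := ExteriorAlgebra.ι ℝ (Pi.single ⟨N + 1, by omega⟩ 1)

/-- An element of parity `i` and square zero of `Gr (N + 2)`, independent of `Gr N`. -/
def eps (i : ℕ) : Gr (N + 2) := if i % 2 = 0 then theta1 N * theta2 N else theta1 N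

theorem theta1_mem : theta1 N ∈ Par (N + 2) 1 := by
  have := CliffordAlgebra.ι_mem_evenOdd_one (0 : QuadraticForm ℝ (Fin (N + 2) → ℝ))
    (Pi.single ⟨N, by omega⟩ 1)
  unfold theta1
  rw [Par, Nat.cast_one]
  exact this

theorem theta2_mem : theta2 N ∈ Par (N + 2) 1 := by
  have := CliffordAlgebra.ι_mem_evenOdd_one (0 : QuadraticForm ℝ (Fin (N + 2) → ℝ))
    (Pi.single ⟨N + 1, by omega⟩ 1)
  unfold theta2
  rw [Par, Nat.cast_one]
  exact this

theorem eps_mem (i : ℕ) : eps N i ∈ Par (N + 2) i := by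
  unfold eps
  split_ifs with h
  · exact Par.mul_of (i := 1) (j := 1) (by omega) (theta1_mem N) (theta2_mem N)
  · rw [Par_congr (show i % 2 = 1 % 2 by omega)]
    exact theta1_mem N

theorem eps_mul_mul_eps (i : ℕ) (x : Gr (N + 2)) : eps N i * x * eps N i = 0 := by
  have h1 : ∀ x, theta1 N * x * theta1 N = 0 := by
    intro x
    rw [mul_assoc, odd_mul (theta1_mem N), ← mul_assoc, odd_mul_self (theta1_mem N), zero_mul]
  unfold eps
  split_ifs with h
  · rw [← mul_assoc, mul_assoc (theta1 N), h1, zero_mul]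
  · exact h1 x

theorem contract_ext (d : Module.Dual ℝ (Fin (N + 2) → ℝ)) (hd : d ∘ₗ extGen N = 0) (x : Gr N) :
    CliffordAlgebra.contractLeft (Q := (0 : QuadraticForm ℝ (Fin (N + 2) → ℝ))) d (ext N x) = 0 := by
  induction x using ExteriorAlgebra.left_induction with
  | algebraMap r =>
    rw [AlgHom.commutes]
    exact CliffordAlgebra.contractLeft_algebraMap _ _ _
  | add a b ha hb => rw [map_add, map_add, ha, hb, add_zero]
  | ι_mul b v hb =>
    have h1 : ext N (ExteriorAlgebra.ι ℝ v * b) =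
        CliffordAlgebra.ι (0 : QuadraticForm ℝ (Fin (N + 2) → ℝ)) (extGen N v) * ext N b := by
      rw [map_mul]; congr 1; exact ExteriorAlgebra.map_apply_ι _ _
    rw [h1, CliffordAlgebra.contractLeft_ι_mul, hb, mul_zero, sub_zero]
    have : d (extGen N v) = 0 := LinearMap.congr_fun hd v
    rw [this, zero_smul]

theorem eps_cancel (i : ℕ) {x : Gr N} (h : eps N i * ext N x = 0) : x = 0 := by
  have hd : ∀ k (hk : k < N + 2), N ≤ k → ((LinearMap.proj (⟨k, hk⟩ : Fin (N + 2)) :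
      (Fin (N + 2) → ℝ) →ₗ[ℝ] ℝ)) ∘ₗ extGen N = 0 := by
    intro k hk hN
    ext v
    simp [extGen, not_lt.2 hN]
  have hinj : Function.Injective (ext N) := by
    refine ExteriorAlgebra.map_injective ⟨LinearMap.pi fun i => LinearMap.proj ⟨i, by omega⟩, ?_⟩
    ext v i
    simp [extGen]
  have h1 : ∀ y : Gr (N + 2), CliffordAlgebra.contractLeft
      (Q := (0 : QuadraticForm ℝ (Fin (N + 2) → ℝ)))
      (LinearMap.proj (⟨N, by omega⟩ : Fin (N + 2))) y = 0 → theta1 N * y = 0 → y = 0 := by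
    intro y hy h
    have h2 := congrArg (CliffordAlgebra.contractLeft
      (Q := (0 : QuadraticForm ℝ (Fin (N + 2) → ℝ)))
      (LinearMap.proj (⟨N, by omega⟩ : Fin (N + 2)))) h
    have h3 := CliffordAlgebra.contractLeft_ι_mul (Q := (0 : QuadraticForm ℝ (Fin (N + 2) → ℝ)))
      (d := LinearMap.proj (⟨N, by omega⟩ : Fin (N + 2)))
      (Pi.single ⟨N, by omega⟩ 1) y
    rw [hy, mul_zero, sub_zero] at h3
    simp only [LinearMap.proj_apply, Pi.single_eq_same, one_smul] at h3
    rw [map_zero] at h2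
    exact h3.symm.trans h2
  have h2 : ∀ y : Gr (N + 2), CliffordAlgebra.contractLeft
      (Q := (0 : QuadraticForm ℝ (Fin (N + 2) → ℝ)))
      (LinearMap.proj (⟨N + 1, by omega⟩ : Fin (N + 2))) y = 0 → theta2 N * y = 0 → y = 0 := by
    intro y hy h
    have h2 := congrArg (CliffordAlgebra.contractLeft
      (Q := (0 : QuadraticForm ℝ (Fin (N + 2) → ℝ)))
      (LinearMap.proj (⟨N + 1, by omega⟩ : Fin (N + 2)))) h
    have h3 := CliffordAlgebra.contractLeft_ι_mul (Q := (0 : QuadraticForm ℝ (Fin (N + 2) → ℝ)))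
      (d := LinearMap.proj (⟨N + 1, by omega⟩ : Fin (N + 2)))
      (Pi.single ⟨N + 1, by omega⟩ 1) y
    rw [hy, mul_zero, sub_zero] at h3
    simp only [LinearMap.proj_apply, Pi.single_eq_same, one_smul] at h3
    rw [map_zero] at h2
    exact h3.symm.trans h2
  refine hinj ?_
  rw [map_zero]
  unfold eps at h
  split_ifs at h with hi
  · refine h2 _ (contract_ext N _ (hd _ _ (by omega)) x) (h1 _ ?_ (by rwa [mul_assoc] at h))
    have h3 := CliffordAlgebra.contractLeft_ι_mul (Q := (0 : QuadraticForm ℝ (Fin (N + 2) → ℝ)))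
      (d := LinearMap.proj (⟨N, by omega⟩ : Fin (N + 2)))
      (Pi.single ⟨N + 1, by omega⟩ 1) (ext N x)
    rw [contract_ext N _ (hd _ _ le_rfl) x, mul_zero, sub_zero] at h3
    refine h3.trans ?_
    simp
  · exact h1 _ (contract_ext N _ (hd _ _ le_rfl) x) h

end Eps

/-! ### The algebra of partial derivatives -/

section PD
variable {R0 R1 C0 C1 : Type} [Fintype R0] [Fintype R1] [Fintype C0] [Fintype C1]
  {U : TopologicalSpace.Opens (Ev R0 R1 C0 C1 → ℝ)}

open Classical in
theorem pd_coord_mul (a b : R0 ⊕ R1) (k l : C0 ⊕ C1) (f : SFun U (Od R0 R1 C0 C1)) :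
    pd U a k (coord U b l * f) = (if a = b ∧ k = l then f else 0) +
      sg ((par a + par k) * (par b + par l)) • (coord U b l * pd U a k f) := by
  induction f using TensorProduct.induction_on with
  | zero => simp
  | add f₁ f₂ h₁ h₂ =>
    rw [mul_add (coord U b l), map_add, h₁, h₂, map_add, mul_add (coord U b l), smul_add]
    split_ifs
    · abel
    · abel
  | tmul g θ =>
    have hev : ∀ i j : Ev R0 R1 C0 C1, Smooth.pderiv U i (Smooth.coord U j * g) ⊗ₜ[ℝ] θ =
        (if i = j then g ⊗ₜ[ℝ] θ else 0) + (Smooth.coord U j * Smooth.pderiv U i g) ⊗ₜ[ℝ] θ := by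
      intro i j
      rw [Smooth.pderiv_mul, Smooth.pderiv_coord, TensorProduct.add_tmul]
      split_ifs <;> simp_all
    have hod : ∀ i j : Od R0 R1 C0 C1,
        g ⊗ₜ[ℝ] oddDeriv i (ExteriorAlgebra.ι ℝ (Finsupp.single j 1) * θ) =
        (if i = j then g ⊗ₜ[ℝ] θ else 0) -
          g ⊗ₜ[ℝ] (ExteriorAlgebra.ι ℝ (Finsupp.single j 1) * oddDeriv i θ) := by
      intro i j
      rw [oddDeriv_ι_mul, TensorProduct.tmul_sub]
      split_ifs <;> simp_all
    rcases a with a | a <;> rcases b with b | b <;> rcases k with k | k <;> rcases l with l | l <;>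
    simp only [coord, pd, par, Algebra.TensorProduct.tmul_mul_tmul, TensorProduct.map_tmul,
      one_mul, LinearMap.id_apply, hev, hod] <;>
    simp [sg, sub_eq_add_neg] <;> norm_num

theorem pd_comm (a b : R0 ⊕ R1) (k l : C0 ⊕ C1) (f : SFun U (Od R0 R1 C0 C1)) :
    pd U a k (pd U b l f) =
      sg ((par a + par k) * (par b + par l)) • pd U b l (pd U a k f) := by
  induction f using TensorProduct.induction_on with
  | zero => simp
  | add f₁ f₂ h₁ h₂ => simp only [map_add, h₁, h₂, smul_add]
  | tmul g θ =>
    rcases a with a | a <;> rcases b with b | b <;> rcases k with k | k <;> rcases l with l | l <;>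
    simp only [pd, par, TensorProduct.map_tmul, LinearMap.id_apply, Sum.elim_inl, Sum.elim_inr,
      sg, zero_add, zero_mul, mul_zero, pow_zero, one_smul, add_zero, mul_one, pow_one,
      neg_smul] <;>
    first
    | (rw [oddDeriv_comm, TensorProduct.tmul_neg])
    | (rw [Smooth.pderiv_comm]; norm_num)
    | rw [Smooth.pderiv_comm]
    | norm_num

theorem coord_comm (a b : R0 ⊕ R1) (k l : C0 ⊕ C1) :
    coord U a k * coord U b l =
      sg ((par a + par k) * (par b + par l)) • (coord U b l * coord U a k) := by
  refine eq_of_value fun N M hM => ?_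
  rw [value_smul, value_mul hM, value_mul hM, value_coord hM, value_coord hM]
  exact super_comm (hM.1 a k) (hM.1 b l)

end PD

section PDPull
variable {R0 R1 C0 C1 R0' R1' C0' C1' : Type} [Fintype R0] [Fintype R1] [Fintype C0] [Fintype C1]
  [Fintype R0'] [Fintype R1'] [Fintype C0'] [Fintype C1']
  (φ : Subst R0 R1 C0 C1 R0' R1' C0' C1')
  {U : TopologicalSpace.Opens (Ev R0 R1 C0 C1 → ℝ)}
  {U' : TopologicalSpace.Opens (Ev R0' R1' C0' C1' → ℝ)} (hU : ∀ x ∈ U', φ.even x ∈ U)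

theorem Subst.oddDeriv_map (j : Od R0' R1' C0' C1') (θ : ExteriorAlgebra ℝ (Od R0 R1 C0 C1 →₀ ℝ)) :
    oddDeriv j (ExteriorAlgebra.map (Finsupp.linearCombination ℝ φ.odd) θ) =
      ∑ i, φ.odd i j • ExteriorAlgebra.map (Finsupp.linearCombination ℝ φ.odd) (oddDeriv i θ) := by
  induction θ using ExteriorAlgebra.left_induction with
  | algebraMap r => simp [oddDeriv_algebraMap]
  | add a b ha hb => simp only [map_add, ha, hb, smul_add, Finset.sum_add_distrib]
  | ι_mul b v hb =>
    rw [map_mul, ExteriorAlgebra.map_apply_ι, oddDeriv_ι_mul, hb]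
    simp only [oddDeriv_ι_mul, map_sub, map_smul, smul_sub, Finset.sum_sub_distrib, map_mul,
      ExteriorAlgebra.map_apply_ι, Finset.mul_sum, mul_smul_comm]
    congr 1
    simp only [smul_smul, ← Finset.sum_smul]
    congr 1
    rw [Finsupp.linearCombination_apply, Finsupp.sum_fintype _ _ (by simp), Finsupp.finsetSum_apply]
    exact Finset.sum_congr rfl fun i _ => by
      rw [Finsupp.smul_apply, smul_eq_mul, mul_comm]

/-- The chain rule for a substitution in which the entry `(a', k')` occurs once, in row `a` and
column `k`. -/
theorem Subst.pd_pull {a' : R0' ⊕ R1'} {k' : C0' ⊕ C1'} {a : R0 ⊕ R1} {k : C0 ⊕ C1}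
    (h : match a', k', a, k with
      | .inl a', .inl k', .inl a, .inl k =>
          ∀ i, φ.evIdx i = .inl (.inl (a', k')) ↔ i = .inl (a, k)
      | .inr a', .inr k', .inr a, .inr k =>
          ∀ i, φ.evIdx i = .inl (.inr (a', k')) ↔ i = .inr (a, k)
      | .inl a', .inr k', .inl a, .inr k =>
          (∀ i, i ≠ .inl (a, k) → φ.odd i (.inl (a', k')) = 0) ∧
            φ.odd (.inl (a, k)) (.inl (a', k')) = 1
      | .inr a', .inl k', .inr a, .inl k =>
          (∀ i, i ≠ .inr (a, k) → φ.odd i (.inr (a', k')) = 0) ∧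
            φ.odd (.inr (a, k)) (.inr (a', k')) = 1
      | _, _, _, _ => False) (f : SFun U (Od R0 R1 C0 C1)) :
    pd U' a' k' (φ.pull hU f) = φ.pull hU (pd U a k f) := by
  classical
  induction f using TensorProduct.induction_on with
  | zero => simp
  | add f₁ f₂ h₁ h₂ => simp only [map_add, h₁, h₂]
  | tmul g θ =>
    have hev : ∀ j i, (∀ i', φ.evIdx i' = .inl j ↔ i' = i) →
        Smooth.pderiv U' j (Smooth.comp φ.even φ.contDiff_even hU g) =
          Smooth.comp φ.even φ.contDiff_even hU (Smooth.pderiv U i g) := by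
      intro j i hji
      rw [φ.pderiv_comp hU]
      simp [hji]
    have hod : ∀ j i, (∀ i', i' ≠ i → φ.odd i' j = 0) ∧ φ.odd i j = 1 →
        oddDeriv j (ExteriorAlgebra.map (Finsupp.linearCombination ℝ φ.odd) θ) =
          ExteriorAlgebra.map (Finsupp.linearCombination ℝ φ.odd) (oddDeriv i θ) := by
      intro j i hji
      rw [φ.oddDeriv_map, Finset.sum_eq_single i]
      · rw [hji.2, one_smul]
      · intro i' _ hi'
        rw [hji.1 i' hi', zero_smul]
      · simp
    rcases a' with a' | a' <;> rcases k' with k' | k' <;> rcases a with a | a <;>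
      rcases k with k | k <;> simp only at h <;>
    simp only [Subst.pull, pd, Algebra.TensorProduct.map_tmul, TensorProduct.map_tmul,
      LinearMap.id_apply]
    · rw [hev _ _ h]
    · rw [hod _ _ h]
    · rw [hod _ _ h]
    · rw [hev _ _ h]

/-- The derivative with respect to an entry that does not occur in a substitution is zero. -/
theorem Subst.pd_pull_eq_zero {a' : R0' ⊕ R1'} {k' : C0' ⊕ C1'}
    (h : match a', k' with
      | .inl a', .inl k' => ∀ i, φ.evIdx i ≠ .inl (.inl (a', k'))
      | .inr a', .inr k' => ∀ i, φ.evIdx i ≠ .inl (.inr (a', k'))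
      | .inl a', .inr k' => ∀ i, φ.odd i (.inl (a', k')) = 0
      | .inr a', .inl k' => ∀ i, φ.odd i (.inr (a', k')) = 0) (f : SFun U (Od R0 R1 C0 C1)) :
    pd U' a' k' (φ.pull hU f) = 0 := by
  classical
  induction f using TensorProduct.induction_on with
  | zero => simp
  | add f₁ f₂ h₁ h₂ => simp only [map_add, h₁, h₂, add_zero]
  | tmul g θ =>
    rcases a' with a' | a' <;> rcases k' with k' | k' <;> simp only at h <;>
    simp only [Subst.pull, pd, Algebra.TensorProduct.map_tmul, TensorProduct.map_tmul,
      LinearMap.id_apply]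
    · rw [φ.pderiv_comp hU]; simp [h]
    · rw [φ.oddDeriv_map]; simp [h]
    · rw [φ.oddDeriv_map]; simp [h]
    · rw [φ.pderiv_comp hU]; simp [h]

end PDPull

/-! ### Operators that preserve the second order system -/

/-- A Kronecker delta. -/
def delta {ι : Type} (i j : ι) : ℝ := open Classical in if i = j then 1 else 0

theorem delta_self {ι : Type} (i : ι) : delta i i = 1 := by simp [delta]

theorem delta_of_ne {ι : Type} {i j : ι} (h : i ≠ j) : delta i j = 0 := by simp [delta, h]

theorem delta_comm {ι : Type} (i j : ι) : delta i j = delta j i := by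
  by_cases h : i = j
  · rw [h]
  · rw [delta_of_ne h, delta_of_ne (Ne.symm h)]

theorem eq_zero_of_eq_neg_self {V : Type} [AddCommGroup V] [Module ℝ V] {x : V} (h : x = -x) :
    x = 0 := by
  have h2 : (2 : ℝ) • x = 0 := by rw [two_smul]; nth_rw 2 [h]; exact add_neg_cancel x
  exact (smul_eq_zero.1 h2).resolve_left two_ne_zero

theorem sum_delta_smul {ι V : Type} [Fintype ι] [AddCommGroup V] [Module ℝ V] (j : ι) (f : ι → V) :
    ∑ i, delta j i • f i = f j := by
  classical
  simp [delta]

theorem sg_add (m n : ℕ) : sg (m + n) = sg m * sg n := pow_add _ _ _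

theorem sg_of_zmod {m n : ℕ} (h : (m : ZMod 2) = n) : sg m = sg n :=
  sg_congr ((ZMod.natCast_eq_natCast_iff' m n 2).1 h)

section Operators
variable {R0 R1 C0 C1 : Type} [Fintype R0] [Fintype R1] [Fintype C0] [Fintype C1]
  {U : TopologicalSpace.Opens (Ev R0 R1 C0 C1 → ℝ)}

theorem pd_coord_mul' (a b : R0 ⊕ R1) (k l : C0 ⊕ C1) (f : SFun U (Od R0 R1 C0 C1)) :
    pd U a k (coord U b l * f) = (delta a b * delta k l) • f +
      sg ((par a + par k) * (par b + par l)) • (coord U b l * pd U a k f) := by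
  classical
  rw [pd_coord_mul, delta, delta]
  by_cases h1 : a = b <;> by_cases h2 : k = l <;> simp [h1, h2]

/-- The operator `x_i^K ∂/∂x_b^K`, which replaces row `b` by row `i`. -/
def rowD (U : TopologicalSpace.Opens (Ev R0 R1 C0 C1 → ℝ)) (i b : R0 ⊕ R1) :
    SFun U (Od R0 R1 C0 C1) →ₗ[ℝ] SFun U (Od R0 R1 C0 C1) :=
  ∑ K, (LinearMap.mulLeft ℝ (coord U i K)).comp (pd U b K)

theorem rowD_apply (i b : R0 ⊕ R1) (f : SFun U (Od R0 R1 C0 C1)) :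
    rowD U i b f = ∑ K, coord U i K * pd U b K f := by
  simp [rowD]

/-- The operator `(-1)^{bj + bl + jl} x_b^j ∂/∂x_b^l` (summation over `b`), which replaces column
`l` by column `j`. -/
def colD (U : TopologicalSpace.Opens (Ev R0 R1 C0 C1 → ℝ)) (j l : C0 ⊕ C1) :
    SFun U (Od R0 R1 C0 C1) →ₗ[ℝ] SFun U (Od R0 R1 C0 C1) :=
  ∑ b, sg (par b * par j + par b * par l + par j * par l) •
    (LinearMap.mulLeft ℝ (coord U b j)).comp (pd U b l)

theorem colD_apply (j l : C0 ⊕ C1) (f : SFun U (Od R0 R1 C0 C1)) :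
    colD U j l f = ∑ b, sg (par b * par j + par b * par l + par j * par l) •
      (coord U b j * pd U b l f) := by
  simp [colD]

/-- The operator `x_i^j - ∑ ± x_i^K x_b^j ∂/∂x_b^K`. For an additional row `i` or an additional
column `j`, it is the operator `e_α` or `e(u)` for a coordinate covector or vector. -/
def crossD (U : TopologicalSpace.Opens (Ev R0 R1 C0 C1 → ℝ)) (i : R0 ⊕ R1) (j : C0 ⊕ C1) :
    SFun U (Od R0 R1 C0 C1) →ₗ[ℝ] SFun U (Od R0 R1 C0 C1) :=
  LinearMap.mulLeft ℝ (coord U i j) -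
    ∑ K, (LinearMap.mulLeft ℝ (coord U i K)).comp (colD U j K)

theorem crossD_apply (i : R0 ⊕ R1) (j : C0 ⊕ C1) (f : SFun U (Od R0 R1 C0 C1)) :
    crossD U i j f = coord U i j * f - ∑ K, coord U i K * colD U j K f := by
  simp [crossD]

theorem pd_rowD (a i b : R0 ⊕ R1) (k : C0 ⊕ C1) (f : SFun U (Od R0 R1 C0 C1)) :
    pd U a k (rowD U i b f) = delta a i • pd U b k f +
      sg ((par a + par k) * (par i + par b)) • rowD U i b (pd U a k f) := by
  rw [rowD_apply, rowD_apply, map_sum, Finset.smul_sum]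
  have : ∀ K, pd U a k (coord U i K * pd U b K f) = delta k K • (delta a i • pd U b K f) +
      sg ((par a + par k) * (par i + par b)) • (coord U i K * pd U b K (pd U a k f)) := by
    intro K
    rw [pd_coord_mul', pd_comm a b k K, mul_smul_comm, smul_smul, ← sg_add, smul_smul,
      mul_comm (delta k K)]
    congr 2
    refine sg_of_zmod ?_
    push_cast
    generalize (par a : ZMod 2) = a, (par b : ZMod 2) = b, (par i : ZMod 2) = i,
      (par k : ZMod 2) = k, (par K : ZMod 2) = K
    decide +revert
  simp only [this, Finset.sum_add_distrib, sum_delta_smul]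

theorem pd_colD (a : R0 ⊕ R1) (k j l : C0 ⊕ C1) (f : SFun U (Od R0 R1 C0 C1)) :
    pd U a k (colD U j l f) =
      (delta k j * sg (par a * par j + par a * par l + par j * par l)) • pd U a l f +
      sg ((par a + par k) * (par j + par l)) • colD U j l (pd U a k f) := by
  rw [colD_apply, colD_apply, map_sum, Finset.smul_sum]
  have : ∀ b, pd U a k (sg (par b * par j + par b * par l + par j * par l) •
      (coord U b j * pd U b l f)) = delta a b •
        ((delta k j * sg (par b * par j + par b * par l + par j * par l)) • pd U b l f) +
      sg ((par a + par k) * (par j + par l)) • sg (par b * par j + par b * par l + par j * par l) •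
        (coord U b j * pd U b l (pd U a k f)) := by
    intro b
    rw [map_smul, pd_coord_mul', pd_comm a b k l, mul_smul_comm, smul_smul, ← sg_add, smul_add,
      smul_smul, smul_smul, smul_smul, smul_smul, ← sg_add, ← sg_add]
    congr 2
    · ring
    refine sg_of_zmod ?_
    push_cast
    generalize (par a : ZMod 2) = a, (par b : ZMod 2) = b, (par j : ZMod 2) = j,
      (par k : ZMod 2) = k, (par l : ZMod 2) = l
    decide +revert
  simp only [this, Finset.sum_add_distrib, sum_delta_smul]

theorem pd_crossD (b i : R0 ⊕ R1) (l j : C0 ⊕ C1) (f : SFun U (Od R0 R1 C0 C1)) :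
    pd U b l (crossD U i j f) =
      sg ((par b + par l) * (par i + par j)) • crossD U i j (pd U b l f) +
      (delta b i * delta l j) • f - delta b i • colD U j l f -
      (delta l j * sg (par b * par i + par i * par j + par b * par j)) • rowD U i b f := by
  rw [crossD_apply, crossD_apply, map_sub, map_sum, pd_coord_mul', rowD_apply, Finset.smul_sum,
    smul_sub, Finset.smul_sum]
  have : ∀ K, pd U b l (coord U i K * colD U j K f) = delta l K • (delta b i • colD U j K f) +
      ((delta l j * sg (par b * par i + par i * par j + par b * par j)) •
        (coord U i K * pd U b K f) +
      sg ((par b + par l) * (par i + par j)) • (coord U i K * colD U j K (pd U b l f))) := by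
    intro K
    rw [pd_coord_mul', pd_colD, mul_add (coord U i K), mul_smul_comm, mul_smul_comm, smul_add, smul_smul,
      smul_smul, smul_smul, ← sg_add]
    congr 2
    · rw [mul_comm]
    · by_cases h : l = j
      · subst h
        congr 1
        rw [mul_left_comm, ← sg_add]
        congr 1
        refine sg_of_zmod ?_
        push_cast
        generalize (par b : ZMod 2) = b, (par i : ZMod 2) = i, (par K : ZMod 2) = K,
          (par l : ZMod 2) = l
        decide +revert
      · simp [delta_of_ne h]
    · congr 1
      refine sg_of_zmod ?_
      push_cast
      generalize (par b : ZMod 2) = b, (par i : ZMod 2) = i, (par j : ZMod 2) = j,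
        (par K : ZMod 2) = K, (par l : ZMod 2) = l
      decide +revert
  simp only [this, Finset.sum_add_distrib, sum_delta_smul]
  abel

theorem system_iff {f : SFun U (Od R0 R1 C0 C1)} : SecondOrderSystem f ↔
    ∀ a b k l, pd U a k (pd U b l f) =
      -(sg (par a * par b + (par a + par b) * par l) • pd U b k (pd U a l f)) := by
  simp only [SecondOrderSystem, sg, eq_neg_iff_add_eq_zero]

/-- The system in terms of the exchange of two columns. -/
theorem SecondOrderSystem.col {f : SFun U (Od R0 R1 C0 C1)} (hf : SecondOrderSystem f)
    (c b : R0 ⊕ R1) (k l : C0 ⊕ C1) : pd U c k (pd U b l f) =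
      -(sg (par c * par k + par c * par l + par k * par l) • pd U c l (pd U b k f)) := by
  rw [system_iff.1 hf, pd_comm b c, smul_smul, ← sg_add]
  congr 2
  refine sg_of_zmod ?_
  push_cast
  generalize (par b : ZMod 2) = b, (par c : ZMod 2) = i, (par k : ZMod 2) = j,
    (par l : ZMod 2) = l
  decide +revert

theorem SecondOrderSystem.add {f g : SFun U (Od R0 R1 C0 C1)} (hf : SecondOrderSystem f)
    (hg : SecondOrderSystem g) : SecondOrderSystem (f + g) := by
  rw [system_iff] at *
  intro a b k l
  rw [map_add, map_add, hf, hg, map_add, map_add, smul_add, neg_add]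

theorem SecondOrderSystem.smul {f : SFun U (Od R0 R1 C0 C1)} (hf : SecondOrderSystem f) (c : ℝ) :
    SecondOrderSystem (c • f) := by
  rw [system_iff] at *
  intro a b k l
  rw [map_smul, map_smul, hf, map_smul, map_smul, smul_neg, smul_comm]

theorem SecondOrderSystem.zero : SecondOrderSystem (0 : SFun U (Od R0 R1 C0 C1)) := by
  intro a b k l
  simp

theorem SecondOrderSystem.sum {ι : Type} (s : Finset ι) {f : ι → SFun U (Od R0 R1 C0 C1)}
    (hf : ∀ i ∈ s, SecondOrderSystem (f i)) : SecondOrderSystem (∑ i ∈ s, f i) :=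
  Finset.sum_induction f SecondOrderSystem (fun _ _ h h' => h.add h') .zero hf

theorem SecondOrderSystem.rowD {f : SFun U (Od R0 R1 C0 C1)} (hf : SecondOrderSystem f)
    (i A : R0 ⊕ R1) : SecondOrderSystem (rowD U i A f) := by
  rw [system_iff] at *
  intro a b k l
  have h1 := congrArg (SuperForms.rowD U i A) (hf a b k l)
  have h2 := hf A b k l
  have h3 := hf a A k l
  simp only [map_neg, map_smul] at h1
  simp only [pd_rowD, map_add, map_smul, h1, h2, h3]
  match_scalars
  · rcases eq_or_ne b i with rfl | h
    · simp only [delta_self, one_mul, mul_one, ← sg_add, neg_inj]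
      refine sg_of_zmod ?_
      push_cast
      generalize (par a : ZMod 2) = a, (par b : ZMod 2) = b, (par A : ZMod 2) = A,
        (par l : ZMod 2) = l
      decide +revert
    · simp [delta_of_ne h]
  · rcases eq_or_ne a i with rfl | h
    · simp only [delta_self, one_mul, mul_one, ← sg_add, neg_inj, mul_neg]
      refine sg_of_zmod ?_
      push_cast
      generalize (par a : ZMod 2) = a, (par b : ZMod 2) = b, (par A : ZMod 2) = A,
        (par l : ZMod 2) = l
      decide +revert
    · simp [delta_of_ne h]
  · simp only [mul_one, ← sg_add, neg_inj, mul_neg]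
    refine sg_of_zmod ?_
    push_cast
    generalize (par a : ZMod 2) = a, (par b : ZMod 2) = b, (par A : ZMod 2) = A,
      (par l : ZMod 2) = l, (par k : ZMod 2) = k, (par i : ZMod 2) = i
    decide +revert

theorem colD_system {f : SFun U (Od R0 R1 C0 C1)} (hf : SecondOrderSystem f) (b : R0 ⊕ R1)
    (j k l : C0 ⊕ C1) : colD U j k (pd U b l f) =
      -(sg (par j * par k + par l * par k + par j * par l) • colD U j l (pd U b k f)) := by
  rw [colD_apply, colD_apply, Finset.smul_sum, ← Finset.sum_neg_distrib]
  refine Finset.sum_congr rfl fun c _ => ?_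
  rw [hf.col c b k l, mul_neg, mul_smul_comm, smul_neg, smul_smul, smul_smul, ← sg_add, ← sg_add]
  congr 2
  refine sg_of_zmod ?_
  push_cast
  generalize (par c : ZMod 2) = c, (par j : ZMod 2) = j, (par k : ZMod 2) = k,
    (par l : ZMod 2) = l
  decide +revert

theorem rowD_system {f : SFun U (Od R0 R1 C0 C1)} (hf : SecondOrderSystem f) (i a b : R0 ⊕ R1)
    (l : C0 ⊕ C1) : SuperForms.rowD U i a (pd U b l f) =
      -(sg (par a * par b + (par a + par b) * par l) • SuperForms.rowD U i b (pd U a l f)) := by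
  rw [rowD_apply, rowD_apply, Finset.smul_sum, ← Finset.sum_neg_distrib]
  refine Finset.sum_congr rfl fun c _ => ?_
  rw [system_iff.1 hf a b c l, mul_neg, mul_smul_comm]

theorem SecondOrderSystem.crossD {f : SFun U (Od R0 R1 C0 C1)} (hf : SecondOrderSystem f)
    (i : R0 ⊕ R1) (j : C0 ⊕ C1) : SecondOrderSystem (crossD U i j f) := by
  rw [system_iff]
  intro a b k l
  have h1 := congrArg (SuperForms.crossD U i j) (system_iff.1 hf a b k l)
  simp only [map_neg, map_smul] at h1
  simp only [pd_crossD, map_add, map_sub, map_smul, h1, pd_colD, pd_rowD, rowD_system hf i a b l,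
    rowD_system hf i b a k, colD_system hf b j k l, colD_system hf a j k l]
  match_scalars
  · simp only [delta_self, one_mul, mul_one, ← sg_add, neg_inj, mul_neg, neg_neg]
    refine sg_of_zmod ?_
    push_cast
    generalize (par a : ZMod 2) = a, (par b : ZMod 2) = b, (par k : ZMod 2) = k, (par l : ZMod 2) = l, (par i : ZMod 2) = i, (par j : ZMod 2) = j
    decide +revert
  · rcases eq_or_ne a i with rfl | h
    swap
    · simp [delta_of_ne h]
    rcases eq_or_ne k j with rfl | h
    swap
    · simp [delta_of_ne h]
    simp only [delta_self, one_mul, mul_one, ← sg_add, neg_inj, mul_neg, neg_neg]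
    refine sg_of_zmod ?_
    push_cast
    generalize (par a : ZMod 2) = a, (par b : ZMod 2) = b, (par k : ZMod 2) = k, (par l : ZMod 2) = l
    decide +revert
  · rcases eq_or_ne a i with rfl | h
    swap
    · simp [delta_of_ne h]
    simp only [delta_self, one_mul, mul_one, ← sg_add, neg_inj, mul_neg, neg_neg]
    refine sg_of_zmod ?_
    push_cast
    generalize (par a : ZMod 2) = a, (par b : ZMod 2) = b, (par k : ZMod 2) = k, (par l : ZMod 2) = l, (par j : ZMod 2) = j
    decide +revert
  · rcases eq_or_ne k j with rfl | h
    swap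
    · simp [delta_of_ne h]
    simp only [delta_self, one_mul, mul_one, ← sg_add, neg_inj, mul_neg, neg_neg]
    refine sg_of_zmod ?_
    push_cast
    generalize (par a : ZMod 2) = a, (par b : ZMod 2) = b, (par k : ZMod 2) = k, (par l : ZMod 2) = l, (par i : ZMod 2) = i
    decide +revert
  · rcases eq_or_ne b i with rfl | h
    swap
    · simp [delta_of_ne h]
    rcases eq_or_ne l j with rfl | h
    swap
    · simp [delta_of_ne h]
    simp only [delta_self, one_mul, mul_one, ← sg_add, neg_inj, mul_neg, neg_neg]
    refine sg_zero.symm.trans (sg_of_zmod ?_)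
    push_cast
    generalize (par a : ZMod 2) = a, (par b : ZMod 2) = b, (par k : ZMod 2) = k, (par l : ZMod 2) = l
    decide +revert
  · rcases eq_or_ne b i with rfl | h
    swap
    · simp [delta_of_ne h]
    rcases eq_or_ne k j with rfl | h
    swap
    · simp [delta_of_ne h]
    simp only [delta_self, one_mul, mul_one, ← sg_add, neg_inj, mul_neg, neg_neg]
    refine sg_of_zmod ?_
    push_cast
    generalize (par a : ZMod 2) = a, (par b : ZMod 2) = b, (par k : ZMod 2) = k, (par l : ZMod 2) = l
    decide +revert
  · rcases eq_or_ne b i with rfl | h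
    swap
    · simp [delta_of_ne h]
    simp only [delta_self, one_mul, mul_one, ← sg_add, neg_inj, mul_neg, neg_neg]
    refine sg_of_zmod ?_
    push_cast
    generalize (par a : ZMod 2) = a, (par b : ZMod 2) = b, (par k : ZMod 2) = k, (par l : ZMod 2) = l, (par j : ZMod 2) = j
    decide +revert
  · rcases eq_or_ne l j with rfl | h
    swap
    · simp [delta_of_ne h]
    rcases eq_or_ne a i with rfl | h
    swap
    · simp [delta_of_ne h]
    simp only [delta_self, one_mul, mul_one, ← sg_add, neg_inj, mul_neg, neg_neg]
    refine sg_of_zmod ?_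
    push_cast
    generalize (par a : ZMod 2) = a, (par b : ZMod 2) = b, (par k : ZMod 2) = k, (par l : ZMod 2) = l
    decide +revert
  · rcases eq_or_ne l j with rfl | h
    swap
    · simp [delta_of_ne h]
    simp only [delta_self, one_mul, mul_one, ← sg_add, neg_inj, mul_neg, neg_neg]
    refine sg_of_zmod ?_
    push_cast
    generalize (par a : ZMod 2) = a, (par b : ZMod 2) = b, (par k : ZMod 2) = k, (par l : ZMod 2) = l, (par i : ZMod 2) = i
    decide +revert

end Operators

/-! ### Solutions of the system that are linear in a row or a column -/

section Linear
variable {R0 R1 C0 C1 : Type} [Fintype R0] [Fintype R1] [Fintype C0] [Fintype C1]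
  {U : TopologicalSpace.Opens (Ev R0 R1 C0 C1 → ℝ)} {f : SFun U (Od R0 R1 C0 C1)}

/-- If `f` does not depend on row `y`, then `x_y^K ∂f/∂x_A^K` is linear in row `y`. -/
theorem rowD_rowD_self {y : R0 ⊕ R1} (hf : ∀ K, pd U y K f = 0) (A : R0 ⊕ R1) :
    rowD U y y (rowD U y A f) = rowD U y A f := by
  rw [rowD_apply y y, rowD_apply y A]
  refine Finset.sum_congr rfl fun l _ => ?_
  rw [← rowD_apply, pd_rowD, hf, map_zero, smul_zero, add_zero, delta_self, one_smul]

/-- If `f` does not depend on row `y`, then `crossD U y j f` is linear in row `y`. -/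
theorem rowD_crossD_self {y : R0 ⊕ R1} (hf : ∀ K, pd U y K f = 0) (j : C0 ⊕ C1) :
    rowD U y y (crossD U y j f) = crossD U y j f := by
  have h0 : rowD U y y f = 0 := by simp [rowD_apply, hf]
  rw [rowD_apply y y]
  have : ∀ l, coord U y l * pd U y l (crossD U y j f) =
      delta j l • (coord U y l * f) - coord U y l * colD U j l f := by
    intro l
    rw [pd_crossD, hf, h0, map_zero, smul_zero, smul_zero, zero_add, sub_zero, delta_self,
      one_mul, one_smul, mul_sub, mul_smul_comm]
    rw [delta_comm]
  rw [Finset.sum_congr rfl fun l _ => this l, Finset.sum_sub_distrib, sum_delta_smul, crossD_apply]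

/-- If `f` does not depend on the even column `z`, then `crossD U i z f` is linear in
column `z`. -/
theorem colD_crossD_self {z : C0 ⊕ C1} (hz : par z = 0) (hf : ∀ b, pd U b z f = 0) (i : R0 ⊕ R1) :
    colD U z z (crossD U i z f) = crossD U i z f := by
  have h0 : colD U z z f = 0 := by simp [colD_apply, hf]
  rw [colD_apply z z]
  have : ∀ b, sg (par b * par z + par b * par z + par z * par z) •
      (coord U b z * pd U b z (crossD U i z f)) =
      delta i b • (coord U b z * f) -
        sg (par b * par i) • (coord U b z * rowD U i b f) := by
    intro b
    rw [pd_crossD, hf, h0, map_zero, smul_zero, smul_zero, zero_add, sub_zero, delta_self,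
      mul_one, one_mul, mul_sub, mul_smul_comm, mul_smul_comm, hz]
    simp only [mul_zero, add_zero, sg_zero, one_smul]
    rw [delta_comm]
  rw [Finset.sum_congr rfl fun l _ => this l, Finset.sum_sub_distrib, sum_delta_smul, crossD_apply]
  congr 1
  simp only [rowD_apply, colD_apply, Finset.mul_sum, Finset.smul_sum]
  rw [Finset.sum_comm]
  refine Finset.sum_congr rfl fun K _ => Finset.sum_congr rfl fun b _ => ?_
  rw [← mul_assoc, coord_comm b i z K, smul_mul_assoc, smul_smul, ← sg_add, mul_smul_comm,
    ← mul_assoc, hz]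
  congr 1
  refine sg_of_zmod ?_
  push_cast
  generalize (par b : ZMod 2) = b, (par i : ZMod 2) = i, (par K : ZMod 2) = K
  decide +revert

/-- A solution of the system that is linear in an even row `y` does not change to first order
when multiples of `y` are added to another row. -/
theorem rowD_eq_zero (hf : SecondOrderSystem f) {y : R0 ⊕ R1} (hy : par y = 0)
    (hlin : rowD U y y f = f) {a : R0 ⊕ R1} (ha : a ≠ y) : rowD U y a f = 0 := by
  have h1 : ∀ K, pd U a K f = rowD U y y (pd U a K f) := by
    intro K
    conv_lhs => rw [← hlin]
    rw [pd_rowD, delta_of_ne ha, zero_smul, zero_add, hy, add_zero, mul_zero, sg_zero, one_smul]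
  let T : C0 ⊕ C1 → C0 ⊕ C1 → SFun U (Od R0 R1 C0 C1) := fun K L =>
    coord U y K * (coord U y L * pd U y L (pd U a K f))
  -- by the system `T` is antisymmetric
  have hT : ∀ K L, T K L = -T L K := by
    intro K L
    simp only [T]
    rw [system_iff.1 hf y a L K, pd_comm a y, ← mul_assoc, ← mul_assoc, coord_comm y y K L, smul_smul,
      mul_neg, mul_smul_comm, smul_mul_assoc, smul_smul, ← sg_add, ← sg_add, hy]
    rw [show sg _ = (1 : ℝ) from ?_, one_smul]
    refine (sg_of_zmod ?_).trans sg_zero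
    push_cast
    generalize (par a : ZMod 2) = b, (par L : ZMod 2) = i, (par K : ZMod 2) = K
    decide +revert
  have h2 : rowD U y a f = ∑ K, ∑ L, T K L := by
    rw [rowD_apply]
    refine Finset.sum_congr rfl fun K _ => ?_
    conv_lhs => rw [h1, rowD_apply, Finset.mul_sum]
  have h3 : rowD U y a f = -rowD U y a f := by
    conv_lhs => rw [h2, Finset.sum_comm]
    rw [h2, ← Finset.sum_neg_distrib]
    refine Finset.sum_congr rfl fun K _ => ?_
    rw [← Finset.sum_neg_distrib]
    exact Finset.sum_congr rfl fun L _ => hT L K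
  exact eq_zero_of_eq_neg_self h3

/-- A solution of the system that is linear in an even column `z` does not change to first order
when multiples of `z` are added to another column. -/
theorem colD_eq_zero (hf : SecondOrderSystem f) {z : C0 ⊕ C1} (hz : par z = 0)
    (hlin : colD U z z f = f) {K : C0 ⊕ C1} (hK : K ≠ z) : colD U z K f = 0 := by
  have h1 : ∀ b, pd U b K f = colD U z z (pd U b K f) := by
    intro b
    conv_lhs => rw [← hlin]
    rw [pd_colD, delta_of_ne hK, zero_mul, zero_smul, zero_add, hz, add_zero, mul_zero, sg_zero,
      one_smul]
  let T : R0 ⊕ R1 → R0 ⊕ R1 → SFun U (Od R0 R1 C0 C1) := fun b c =>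
    sg (par b * par K) • (coord U b z * (coord U c z * pd U c z (pd U b K f)))
  -- by the system `T` is antisymmetric
  have hT : ∀ b c, T b c = -T c b := by
    intro b c
    simp only [T]
    rw [hf.col c b z K, pd_comm c b, ← mul_assoc, ← mul_assoc, coord_comm b c z z, smul_smul,
      mul_neg, mul_smul_comm, smul_mul_assoc, smul_smul, ← sg_add, ← sg_add, hz, smul_neg,
      smul_smul, ← sg_add]
    congr 2
    refine sg_of_zmod ?_
    push_cast
    generalize (par b : ZMod 2) = b, (par c : ZMod 2) = i, (par K : ZMod 2) = K
    decide +revert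
  have h2 : colD U z K f = ∑ b, ∑ c, T b c := by
    rw [colD_apply]
    refine Finset.sum_congr rfl fun b _ => ?_
    conv_lhs => rw [h1, colD_apply, Finset.mul_sum]
    rw [Finset.smul_sum]
    refine Finset.sum_congr rfl fun c _ => ?_
    simp only [T, hz, mul_zero, zero_mul, add_zero, zero_add, sg_zero, one_smul]
  have h3 : colD U z K f = -colD U z K f := by
    conv_lhs => rw [h2, Finset.sum_comm]
    rw [h2, ← Finset.sum_neg_distrib]
    refine Finset.sum_congr rfl fun K _ => ?_
    rw [← Finset.sum_neg_distrib]
    exact Finset.sum_congr rfl fun L _ => hT L K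
  exact eq_zero_of_eq_neg_self h3

/-- The condition that a domain is given by conditions on the odd-odd block. -/
def OddDom (U : TopologicalSpace.Opens (Ev R0 R1 C0 C1 → ℝ)) : Prop :=
  ∀ x x' : Ev R0 R1 C0 C1 → ℝ, (∀ i, x (.inr i) = x' (.inr i)) → x ∈ U → x' ∈ U

theorem OddDom.isPoint (hU : OddDom U) {N : ℕ} {M M' : Matrix (R0 ⊕ R1) (C0 ⊕ C1) (Gr N)}
    (hM : IsPoint U M) (hM' : IsSuper M')
    (h : ∀ a k, body (M (.inr a) (.inr k)) = body (M' (.inr a) (.inr k))) : IsPoint U M' :=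
  ⟨hM', hU _ _ (fun i => h i.1 i.2) hM.2⟩

theorem value_rowD {N : ℕ} {M : Matrix (R0 ⊕ R1) (C0 ⊕ C1) (Gr N)} (hM : IsPoint U M)
    (i b : R0 ⊕ R1) : value (rowD U i b f) M = ∑ K, M i K * value (pd U b K f) M := by
  rw [rowD_apply, value_sum]
  exact Finset.sum_congr rfl fun K _ => by rw [value_mul hM, value_coord hM]

theorem value_colD {N : ℕ} {M : Matrix (R0 ⊕ R1) (C0 ⊕ C1) (Gr N)} (hM : IsPoint U M)
    (j l : C0 ⊕ C1) : value (colD U j l f) M =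
      ∑ b, sg (par b * par j + par b * par l + par j * par l) •
        (M b j * value (pd U b l f) M) := by
  rw [colD_apply, value_sum]
  exact Finset.sum_congr rfl fun K _ => by rw [value_smul, value_mul hM, value_coord hM]

theorem value_crossD {N : ℕ} {M : Matrix (R0 ⊕ R1) (C0 ⊕ C1) (Gr N)} (hM : IsPoint U M)
    (i : R0 ⊕ R1) (j : C0 ⊕ C1) : value (crossD U i j f) M =
      M i j * value f M - ∑ K, M i K * value (colD U j K f) M := by
  rw [crossD_apply, value_sub, value_mul hM, value_coord hM, value_sum]
  congr 1
  exact Finset.sum_congr rfl fun K _ => by rw [value_mul hM, value_coord hM]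

theorem IsSuper.add {N : ℕ} {M M' : Matrix (R0 ⊕ R1) (C0 ⊕ C1) (Gr N)} (h : IsSuper M)
    (h' : IsSuper M') : IsSuper (M + M') := fun a k => add_mem (h a k) (h' a k)

theorem IsSuper.sub {N : ℕ} {M M' : Matrix (R0 ⊕ R1) (C0 ⊕ C1) (Gr N)} (h : IsSuper M)
    (h' : IsSuper M') : IsSuper (M - M') := fun a k => sub_mem (h a k) (h' a k)

theorem IsSuper.smul {N : ℕ} {M : Matrix (R0 ⊕ R1) (C0 ⊕ C1) (Gr N)} (h : IsSuper M) (t : ℝ) :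
    IsSuper (t • M) := fun a k => Submodule.smul_mem _ t (h a k)

/-- A solution of the system that is linear in an even row is invariant under the addition of
multiples of this row to the other rows. -/
theorem value_add_row (hU : OddDom U) (hf : SecondOrderSystem f) {y : R0}
    (hlin : rowD U (.inl y) (.inl y) f = f) {N : ℕ} {M : Matrix (R0 ⊕ R1) (C0 ⊕ C1) (Gr N)}
    (hM : IsPoint U M) {d : R0 ⊕ R1 → Gr N} (hd : ∀ a, d a ∈ Par N (par a))
    (hdy : d (.inl y) = 0) :
    value f (M + Matrix.of fun a k => d a * M (.inl y) k) = value f M := by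
  set E : Matrix (R0 ⊕ R1) (C0 ⊕ C1) (Gr N) :=
    Matrix.of fun a k => d a * M (.inl y) k with hE
  have hE' : ∀ a k, E a k = d a * M (.inl y) k := fun a k => rfl
  clear_value E
  have hEs : IsSuper E := fun a k => by
    have h2 := hM.1 (.inl y) k
    simp only [par, Sum.elim_inl, zero_add] at h2
    rw [hE']
    exact Par.mul (hd a) h2
  have hEp : ∀ t : ℝ, IsPoint U (M + t • E) := fun t => by
    refine hU.isPoint hM (hM.1.add (hEs.smul t)) fun a k => ?_
    have h3 : d (.inr a) ∈ Par N 1 := hd (.inr a)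
    simp only [Matrix.add_apply, Matrix.smul_apply, hE', map_add, map_smul, map_mul,
      body_odd h3, zero_mul, smul_zero, add_zero]
  -- the line `M + t E` does not change row `y`, so the differential vanishes along all of it
  suffices hd0 : ∀ t : ℝ, dval f (M + t • E) E = 0 by
    have h := value_flow hEs hEp hd0
    rwa [add_zero] at h
  intro t
  have hy : ∀ k, M (.inl y) k = (M + t • E) (.inl y) k := fun k => by simp [hE', hdy]
  rw [dval]
  refine Finset.sum_eq_zero fun a _ => ?_
  by_cases ha : a = .inl y
  · simp [hE', ha, hdy]
  · have h0 := value_rowD (f := f) (hEp t) (.inl y) a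
    rw [rowD_eq_zero hf rfl hlin ha, value_zero] at h0
    have h1 : ∀ k, E a k * value (pd U a k f) (M + t • E) =
        d a * ((M + t • E) (.inl y) k * value (pd U a k f) (M + t • E)) := fun k => by
      rw [← hy, hE', mul_assoc]
    simp only [h1, ← Finset.mul_sum]
    rw [← h0, mul_zero]

/-- A solution of the system that is linear in an even column is invariant under the addition of
multiples of this column to the other columns. -/
theorem value_add_col (hU : OddDom U) (hf : SecondOrderSystem f) {z : C0}
    (hlin : colD U (.inl z) (.inl z) f = f) {N : ℕ} {M : Matrix (R0 ⊕ R1) (C0 ⊕ C1) (Gr N)}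
    (hM : IsPoint U M) {d : C0 ⊕ C1 → Gr N} (hd : ∀ k, d k ∈ Par N (par k))
    (hdz : d (.inl z) = 0) :
    value f (M + Matrix.of fun a k => M a (.inl z) * d k) = value f M := by
  set E : Matrix (R0 ⊕ R1) (C0 ⊕ C1) (Gr N) :=
    Matrix.of fun a k => M a (.inl z) * d k with hE
  have hE' : ∀ a k, E a k = M a (.inl z) * d k := fun a k => rfl
  clear_value E
  have hMz : ∀ a, M a (.inl z) ∈ Par N (par a) := fun a => by
    have h2 := hM.1 a (.inl z)
    simp only [par, Sum.elim_inl, add_zero] at h2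
    exact h2
  have hEs : IsSuper E := fun a k => by
    rw [hE']
    exact Par.mul (hMz a) (hd k)
  have hEp : ∀ t : ℝ, IsPoint U (M + t • E) := fun t => by
    refine hU.isPoint hM (hM.1.add (hEs.smul t)) fun a k => ?_
    have h3 : d (.inr k) ∈ Par N 1 := hd (.inr k)
    simp only [Matrix.add_apply, Matrix.smul_apply, hE', map_add, map_smul, map_mul,
      body_odd h3, mul_zero, smul_zero, add_zero]
  suffices hd0 : ∀ t : ℝ, dval f (M + t • E) E = 0 by
    have h := value_flow hEs hEp hd0
    rwa [add_zero] at h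
  intro t
  have hz : ∀ a, M a (.inl z) = (M + t • E) a (.inl z) := fun k => by simp [hE', hdz]
  rw [dval, Finset.sum_comm]
  refine Finset.sum_eq_zero fun k _ => ?_
  by_cases hk : k = .inl z
  · simp [hE', hk, hdz]
  · have h0 := value_colD (f := f) (hEp t) (.inl z) k
    rw [colD_eq_zero hf rfl hlin hk, value_zero] at h0
    have h1 : ∀ a, E a k * value (pd U a k f) (M + t • E) = d k * (sg (par a * par k) •
        ((M + t • E) a (.inl z) * value (pd U a k f) (M + t • E))) := by
      intro a
      rw [← hz, hE', super_comm (hMz a) (hd k), smul_mul_assoc, mul_assoc, mul_smul_comm]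
    simp only [h1, ← Finset.mul_sum]
    have h2 : ∀ a : R0 ⊕ R1, par a * par (Sum.inl z : C0 ⊕ C1) + par a * par k +
        par (Sum.inl z : C0 ⊕ C1) * par k = par a * par k := fun a => by simp [par]
    simp only [h2] at h0
    rw [← h0, mul_zero]

end Linear

/-! ### Determinants of matrices with even entries -/

/-- The even subalgebra of a Grassmann algebra. -/
def EvRing (N : ℕ) : Subalgebra ℝ (Gr N) :=
  (Par N 0).toSubalgebra Par.one_mem fun _ _ hx hy => Par.mul_of (i := 0) (j := 0) rfl hx hy

instance (N : ℕ) : CommRing (EvRing N) :=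
  { (inferInstance : Ring (EvRing N)) with
    mul_comm := fun x y => Subtype.ext (even_comm x.2 y.1) }

open Classical in
/-- An even element, considered as an element of the even subalgebra (`0` if it is not even). -/
def evl {N : ℕ} (x : Gr N) : EvRing N := if h : x ∈ Par N 0 then ⟨x, h⟩ else 0

theorem coe_evl {N : ℕ} {x : Gr N} (h : x ∈ Par N 0) : (evl x : Gr N) = x := by
  rw [evl, dif_pos h]

/-- A matrix with even entries. -/
def EvenMat {N : ℕ} {ι κ : Type} (M : Matrix ι κ (Gr N)) : Prop := ∀ i j, M i j ∈ Par N 0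

/-- A matrix with odd entries. -/
def OddMat {N : ℕ} {ι κ : Type} (M : Matrix ι κ (Gr N)) : Prop := ∀ i j, M i j ∈ Par N 1

section EvenMat
variable {N : ℕ} {ι κ lam : Type} [Fintype κ]

theorem EvenMat.mul {M : Matrix ι κ (Gr N)} {M' : Matrix κ lam (Gr N)} (h : EvenMat M)
    (h' : EvenMat M') : EvenMat (M * M') := fun i j =>
  Submodule.sum_mem _ fun k _ => Par.mul_of (i := 0) (j := 0) rfl (h i k) (h' k j)

theorem EvenMat.mul_odd {M : Matrix ι κ (Gr N)} {M' : Matrix κ lam (Gr N)} (h : EvenMat M)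
    (h' : OddMat M') : OddMat (M * M') := fun i j =>
  Submodule.sum_mem _ fun k _ => Par.mul_of (i := 0) (j := 1) rfl (h i k) (h' k j)

theorem OddMat.mul_even {M : Matrix ι κ (Gr N)} {M' : Matrix κ lam (Gr N)} (h : OddMat M)
    (h' : EvenMat M') : OddMat (M * M') := fun i j =>
  Submodule.sum_mem _ fun k _ => Par.mul_of (i := 1) (j := 0) rfl (h i k) (h' k j)

theorem OddMat.mul {M : Matrix ι κ (Gr N)} {M' : Matrix κ lam (Gr N)} (h : OddMat M)
    (h' : OddMat M') : EvenMat (M * M') := fun i j =>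
  Submodule.sum_mem _ fun k _ => Par.mul_of (i := 1) (j := 1) rfl (h i k) (h' k j)

theorem EvenMat.add {M M' : Matrix ι κ (Gr N)} (h : EvenMat M) (h' : EvenMat M') :
    EvenMat (M + M') := fun i j => add_mem (h i j) (h' i j)

theorem EvenMat.sub {M M' : Matrix ι κ (Gr N)} (h : EvenMat M) (h' : EvenMat M') :
    EvenMat (M - M') := fun i j => sub_mem (h i j) (h' i j)

theorem OddMat.add {M M' : Matrix ι κ (Gr N)} (h : OddMat M) (h' : OddMat M') :
    OddMat (M + M') := fun i j => add_mem (h i j) (h' i j)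

theorem OddMat.zero : OddMat (0 : Matrix ι κ (Gr N)) := fun _ _ => zero_mem _

theorem EvenMat.one [DecidableEq κ] : EvenMat (1 : Matrix κ κ (Gr N)) := fun i j => by
  rw [Matrix.one_apply]; split_ifs
  · exact Par.one_mem
  · exact zero_mem _

theorem EvenMat.map_evl {M : Matrix ι κ (Gr N)} (h : EvenMat M) :
    (M.map evl).map (Subtype.val : EvRing N → Gr N) = M := by
  ext i j
  exact coe_evl (h i j)

theorem map_evl_mul {M : Matrix ι κ (Gr N)} {M' : Matrix κ lam (Gr N)} (h : EvenMat M)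
    (h' : EvenMat M') : (M * M').map evl = M.map evl * M'.map evl := by
  ext i j
  rw [Matrix.map_apply, coe_evl (h.mul h' i j), Matrix.mul_apply, Matrix.mul_apply]
  refine Eq.trans ?_ (map_sum (EvRing N).val _ _).symm
  refine Finset.sum_congr rfl fun k _ => ?_
  rw [map_mul]
  exact congrArg₂ (· * ·) (coe_evl (h i k)).symm (coe_evl (h' k j)).symm

end EvenMat

section Det
variable {N : ℕ} {ι κ : Type} [Fintype ι] [DecidableEq ι] [Fintype κ] [DecidableEq κ]

/-- The determinant of a matrix with even entries. -/
def edet (M : Matrix ι ι (Gr N)) : Gr N := ((M.map evl).det : EvRing N)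

theorem edet_mem (M : Matrix ι ι (Gr N)) : edet M ∈ Par N 0 := (M.map evl).det.2

theorem evl_one : evl (1 : Gr N) = 1 := Subtype.ext (coe_evl Par.one_mem)

theorem evl_zero : evl (0 : Gr N) = 0 := Subtype.ext (coe_evl (zero_mem _))

theorem edet_one : edet (1 : Matrix ι ι (Gr N)) = 1 := by
  rw [edet, Matrix.map_one _ evl_zero evl_one, Matrix.det_one]
  rfl

theorem edet_mul {M M' : Matrix ι ι (Gr N)} (h : EvenMat M) (h' : EvenMat M') :
    edet (M * M') = edet M * edet M' := by
  rw [edet, map_evl_mul h h', Matrix.det_mul]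
  rfl

theorem edet_map {N' : ℕ} (j : Gr N →ₐ[ℝ] Gr N') (hj : ∀ x ∈ Par N 0, j x ∈ Par N' 0)
    {M : Matrix ι ι (Gr N)} (h : EvenMat M) : edet (M.map j) = j (edet M) := by
  rw [edet, edet, Matrix.det_apply, Matrix.det_apply]
  have h1 : ∀ i k, ((evl (j (M i k)) : EvRing N') : Gr N') = j (evl (M i k) : EvRing N) :=
    fun i k => by rw [coe_evl (h i k), coe_evl (hj _ (h i k))]
  let jr : EvRing N →+* EvRing N' := j.toRingHom.restrict (EvRing N).toSubring (EvRing N').toSubring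
    (fun x hx => hj x hx)
  have h2 : (M.map j).map evl = (M.map evl).map jr := by
    ext i k
    exact h1 i k
  rw [← Matrix.det_apply, ← Matrix.det_apply, h2, ← RingHom.mapMatrix_apply, ← RingHom.map_det]
  rfl

theorem ldet_eq_edet {d : ℕ} {M : Matrix (Fin d) (Fin d) (Gr N)} (h : EvenMat M) :
    ldet M = edet M := by
  rw [ldet, edet, Matrix.det_apply]
  refine Eq.trans ?_ (map_sum (EvRing N).val _ _).symm
  refine Finset.sum_congr rfl fun σ _ => ?_
  have h1 : (List.ofFn fun i => M (σ i) i).prod =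
      (EvRing N).val (∏ i, (M.map evl) (σ i) i) := by
    rw [← List.prod_ofFn, map_list_prod, List.map_ofFn]
    congr 2
    funext i
    exact (coe_evl (h (σ i) i)).symm
  rw [h1, Units.smul_def, map_zsmul]

theorem edet_reindex (e : κ ≃ ι) (M : Matrix ι ι (Gr N)) : edet (M.submatrix e e) = edet M := by
  rw [edet, edet]
  congr 1
  exact Matrix.det_submatrix_equiv_self e (M.map evl)

theorem edet_fromBlocks_zero₁₂ {A : Matrix ι ι (Gr N)} {C : Matrix κ ι (Gr N)}
    {D : Matrix κ κ (Gr N)} :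
    edet (Matrix.fromBlocks A 0 C D) = edet A * edet D := by
  have : (Matrix.fromBlocks A 0 C D).map evl =
      Matrix.fromBlocks (A.map evl) 0 (C.map evl) (D.map evl) := by
    rw [Matrix.fromBlocks_map]
    congr 1
    ext i j
    simp [evl_zero]
  rw [edet, this, Matrix.det_fromBlocks_zero₁₂]
  rfl

/-- The body of a matrix. -/
abbrev bodyMat {ι κ : Type} (M : Matrix ι κ (Gr N)) : Matrix ι κ ℝ := M.map body

theorem bodyMat_mul {ι κ lam : Type} [Fintype κ] (M : Matrix ι κ (Gr N)) (M' : Matrix κ lam (Gr N)) :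
    bodyMat (M * M') = bodyMat M * bodyMat M' := Matrix.map_mul (f := (body : Gr N →ₐ[ℝ] ℝ).toRingHom)

theorem isNilpotent_of_bodyMat {M : Matrix ι ι (Gr N)} (h : bodyMat M = 0) : IsNilpotent M := by
  have h1 : ∀ k i j, (M ^ k) i j ∈ augPow N k := by
    intro k
    induction k with
    | zero => intro i j; rw [augPow_zero]; trivial
    | succ k ih =>
      intro i j
      rw [pow_succ, Matrix.mul_apply]
      refine Submodule.sum_mem _ fun l _ => mul_mem_augPow (ih i l) ?_
      exact mem_augPow_one_iff.2 (congrFun (congrFun h l) j)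
  refine ⟨N + 1, ?_⟩
  ext i j
  have := h1 (N + 1) i j
  rw [augPow_eq_bot (Nat.lt_succ_self N)] at this
  exact (Submodule.mem_bot ℝ).1 this

theorem isUnit_iff_bodyMat {M : Matrix ι ι (Gr N)} : IsUnit M ↔ IsUnit (bodyMat M) := by
  constructor
  · intro h
    exact h.map (body : Gr N →ₐ[ℝ] ℝ).mapMatrix
  · intro h
    obtain ⟨u, hu⟩ := h
    let c : Matrix ι ι ℝ →+* Matrix ι ι (Gr N) := (algebraMap ℝ (Gr N)).mapMatrix
    have hc : IsUnit (c (bodyMat M)) := by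
      rw [← hu]; exact u.isUnit.map c
    have hb : ∀ X : Matrix ι ι ℝ, bodyMat (c X) = X := fun X => by
      ext i j; exact body_algebraMap _
    let X := c (↑u⁻¹ : Matrix ι ι ℝ) * (M - c (bodyMat M))
    have hX : bodyMat X = 0 := by
      have h0 : bodyMat (M - c (bodyMat M)) = 0 := by
        have : bodyMat (M - c (bodyMat M)) = bodyMat M - bodyMat (c (bodyMat M)) := by
          ext i j; simp
        rw [this, hb, sub_self]
      rw [bodyMat_mul, h0, mul_zero]
    have h1 : M = c (bodyMat M) * (1 + X) := by
      have : c (bodyMat M) * c (↑u⁻¹ : Matrix ι ι ℝ) = 1 := by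
        rw [← map_mul, ← hu, Units.mul_inv, map_one]
      rw [mul_add, mul_one, ← mul_assoc, this, one_mul, add_sub_cancel]
    rw [h1]
    exact hc.mul (isNilpotent_of_bodyMat hX).isUnit_one_add

theorem bodyMat_det {M : Matrix ι ι (Gr N)} (h : EvenMat M) :
    body (edet M) = (bodyMat M).det := by
  have h1 : bodyMat M = (M.map evl).map ((body : Gr N →ₐ[ℝ] ℝ).toRingHom.comp
      (EvRing N).val.toRingHom) := by
    conv_lhs => rw [← h.map_evl]
    rfl
  rw [h1, ← RingHom.mapMatrix_apply, ← RingHom.map_det]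
  rfl

theorem isUnit_edet_iff {M : Matrix ι ι (Gr N)} (h : EvenMat M) : IsUnit (edet M) ↔ IsUnit M := by
  rw [isUnit_iff_body, bodyMat_det h, isUnit_iff_bodyMat, Matrix.isUnit_iff_isUnit_det,
    isUnit_iff_ne_zero]

/-- If all products of two entries of `E` vanish, then `det (1 + E) = 1 + tr E`. -/
theorem det_one_add_of_mul_eq_zero {R : Type} [CommRing R] {E : Matrix ι ι R}
    (h : ∀ i j k l, E i j * E k l = 0) : (1 + E).det = 1 + E.trace := by
  rw [Matrix.det_apply, Finset.sum_eq_single 1]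
  · have h1 : ∀ s : Finset ι, ∏ i ∈ s, (1 + E i i) = 1 + ∑ i ∈ s, E i i := by
      intro s
      induction s using Finset.induction_on with
      | empty => simp
      | insert a s ha ih =>
        rw [Finset.prod_insert ha, Finset.sum_insert ha, ih]
        have h2 : E a a * ∑ i ∈ s, E i i = 0 := by
          rw [Finset.mul_sum]; exact Finset.sum_eq_zero fun i _ => h _ _ _ _
        linear_combination h2
    simpa [Matrix.trace] using h1 Finset.univ
  · intro σ _ hσ
    -- a permutation other than the identity moves at least two points
    obtain ⟨a, ha⟩ : ∃ a, σ a ≠ a := by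
      by_contra! hc
      exact hσ (Equiv.ext hc)
    have hb : σ (σ a) ≠ σ a := fun h => ha (σ.injective h)
    rw [← Finset.mul_prod_erase _ _ (Finset.mem_univ a),
      ← Finset.mul_prod_erase _ _ (Finset.mem_erase.2 ⟨ha, Finset.mem_univ (σ a)⟩),
      Matrix.add_apply, Matrix.add_apply, Matrix.one_apply_ne ha, Matrix.one_apply_ne hb,
      zero_add, zero_add, ← mul_assoc, h, zero_mul, smul_zero]
  · simp

theorem edet_one_add {E : Matrix ι ι (Gr N)} (hE : EvenMat E)
    (h : ∀ i j k l, E i j * E k l = 0) : edet (1 + E) = 1 + E.trace := by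
  have h1 : (1 + E).map evl = 1 + E.map evl := by
    ext i j
    rw [Matrix.map_apply, coe_evl ((EvenMat.one.add hE) i j)]
    simp only [Matrix.add_apply, Matrix.one_apply, Subalgebra.coe_add, Matrix.map_apply,
      coe_evl (hE i j)]
    split_ifs <;> rfl
  rw [edet, h1, det_one_add_of_mul_eq_zero]
  · rw [Matrix.trace, Matrix.trace]
    refine (map_add (EvRing N).val _ _).trans ?_
    rw [map_one, map_sum]
    congr 1
    exact Finset.sum_congr rfl fun i _ => coe_evl (hE i i)
  · intro i j k l
    refine Subtype.ext ?_
    refine Eq.trans ?_ (h i j k l)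
    exact congrArg₂ (· * ·) (coe_evl (hE i j)) (coe_evl (hE k l))

theorem EvenMat.inverse {M : Matrix ι ι (Gr N)} (h : EvenMat M) (hu : IsUnit M) :
    EvenMat (Ring.inverse M) := by
  have h1 : IsUnit (M.map evl) := by
    rw [Matrix.isUnit_iff_isUnit_det]
    have h2 := (isUnit_edet_iff h).2 hu
    have h3 : Ring.inverse (edet M) ∈ Par N 0 := by
      have hm := edet_mem M
      rw [mem_Par_iff, sg_zero, one_smul]
      have h4 : CliffordAlgebra.involute (Ring.inverse (edet M)) * edet M = 1 := by
        have h5 := involute_of_mem hm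
        rw [sg_zero, one_smul] at h5
        calc _ = CliffordAlgebra.involute (Ring.inverse (edet M)) *
              CliffordAlgebra.involute (edet M) := by rw [h5]
          _ = 1 := by rw [← map_mul, Ring.inverse_mul_cancel _ h2, map_one]
      have h6 := congrArg (· * Ring.inverse (edet M)) h4
      simp only [mul_assoc, Ring.mul_inverse_cancel _ h2, mul_one, one_mul] at h6
      exact h6
    refine IsUnit.of_mul_eq_one (⟨_, h3⟩ : EvRing N) (Subtype.ext ?_)
    exact Ring.mul_inverse_cancel _ h2
  obtain ⟨u, hu'⟩ := h1
  have h2 : M * (↑u⁻¹ : Matrix ι ι (EvRing N)).map Subtype.val = 1 := by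
    have h3 : M.map evl * (↑u⁻¹ : Matrix ι ι (EvRing N)) = 1 := by rw [← hu', Units.mul_inv]
    have h4 := congrArg (fun X => (EvRing N).val.mapMatrix X) h3
    simp only [map_mul, map_one] at h4
    refine Eq.trans ?_ h4
    congr 1
    exact h.map_evl.symm
  have h3 : Ring.inverse M = (↑u⁻¹ : Matrix ι ι (EvRing N)).map Subtype.val := by
    have := congrArg (Ring.inverse M * ·) h2
    simp only [← mul_assoc, Ring.inverse_mul_cancel _ hu, one_mul, mul_one] at this
    exact this.symm
  rw [h3]
  intro i j
  exact ((↑u⁻¹ : Matrix ι ι (EvRing N)) i j).2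

end Det

/-! ### Invertible supermatrices and the Berezinian -/

theorem inverse_eq_of_mul_eq_one {R : Type} [Ring R] {x y : R} (hx : IsUnit x) (h : x * y = 1) :
    Ring.inverse x = y := by
  have := congrArg (Ring.inverse x * ·) h
  simp only [← mul_assoc, Ring.inverse_mul_cancel _ hx, one_mul, mul_one] at this
  exact this.symm

section Super
variable {N : ℕ} {R0 R1 C0 C1 D0 D1 : Type}

theorem IsSuper.entry {M : Matrix (R0 ⊕ R1) (C0 ⊕ C1) (Gr N)} (h : IsSuper M) (a : R0 ⊕ R1)
    (k : C0 ⊕ C1) {i : ℕ} (hi : (par a + par k) % 2 = i % 2) : M a k ∈ Par N i := by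
  rw [← Par_congr hi]
  exact h a k

theorem IsSuper.b11 {M : Matrix (R0 ⊕ R1) (C0 ⊕ C1) (Gr N)} (h : IsSuper M) :
    EvenMat M.toBlocks₁₁ := fun i j => h (.inl i) (.inl j)

theorem IsSuper.b12 {M : Matrix (R0 ⊕ R1) (C0 ⊕ C1) (Gr N)} (h : IsSuper M) :
    OddMat M.toBlocks₁₂ := fun i j => h (.inl i) (.inr j)

theorem IsSuper.b21 {M : Matrix (R0 ⊕ R1) (C0 ⊕ C1) (Gr N)} (h : IsSuper M) :
    OddMat M.toBlocks₂₁ := fun i j => h (.inr i) (.inl j)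

theorem IsSuper.b22 {M : Matrix (R0 ⊕ R1) (C0 ⊕ C1) (Gr N)} (h : IsSuper M) :
    EvenMat M.toBlocks₂₂ := fun i j => by
  have h1 : M (.inr i) (.inr j) ∈ Par N (par (Sum.inr i : R0 ⊕ R1) + par (Sum.inr j : C0 ⊕ C1)) :=
    h (.inr i) (.inr j)
  rwa [Par_congr (show (par (Sum.inr i : R0 ⊕ R1) + par (Sum.inr j : C0 ⊕ C1)) % 2 = 0 % 2 by
    simp [par])] at h1

theorem IsSuper.fromBlocks {A : Matrix R0 C0 (Gr N)} {B : Matrix R0 C1 (Gr N)}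
    {C : Matrix R1 C0 (Gr N)} {D : Matrix R1 C1 (Gr N)} (hA : EvenMat A) (hB : OddMat B)
    (hC : OddMat C) (hD : EvenMat D) : IsSuper (Matrix.fromBlocks A B C D) := by
  rintro (i | i) (j | j)
  · exact hA i j
  · exact hB i j
  · exact hC i j
  · have := hD i j
    rwa [Par_congr (show 0 % 2 = (par (Sum.inr i : R0 ⊕ R1) + par (Sum.inr j : C0 ⊕ C1)) % 2 by
      simp [par])] at this

theorem IsSuper.mul [Fintype C0] [Fintype C1] {M : Matrix (R0 ⊕ R1) (C0 ⊕ C1) (Gr N)}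
    {M' : Matrix (C0 ⊕ C1) (D0 ⊕ D1) (Gr N)} (h : IsSuper M) (h' : IsSuper M') :
    IsSuper (M * M') := fun a k => by
  rw [Matrix.mul_apply]
  refine Submodule.sum_mem _ fun c _ => ?_
  refine Par.mul_of (i := par a + par c) (j := par c + par k) ?_ (h a c) (h' c k)
  omega

theorem IsSuper.one [DecidableEq R0] [DecidableEq R1] :
    IsSuper (1 : Matrix (R0 ⊕ R1) (R0 ⊕ R1) (Gr N)) := fun a k => by
  rw [Matrix.one_apply]
  split_ifs with h
  · subst h
    have := Par.one_mem (N := N)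
    rwa [Par_congr (show 0 % 2 = (par a + par a) % 2 by omega)] at this
  · exact zero_mem _

theorem IsSuper.neg {M : Matrix (R0 ⊕ R1) (C0 ⊕ C1) (Gr N)} (h : IsSuper M) : IsSuper (-M) :=
  fun a k => neg_mem (h a k)

theorem IsSuper.zero : IsSuper (0 : Matrix (R0 ⊕ R1) (C0 ⊕ C1) (Gr N)) :=
  fun _ _ => zero_mem _

theorem isSuper_map {N' : ℕ} (j : Gr N →ₐ[ℝ] Gr N') (hj : ∀ i, ∀ x ∈ Par N i, j x ∈ Par N' i)
    {M : Matrix (R0 ⊕ R1) (C0 ⊕ C1) (Gr N)} (h : IsSuper M) : IsSuper (M.map j) :=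
  fun a k => hj _ _ (h a k)

theorem bodyMat_of_odd {ι κ : Type} {M : Matrix ι κ (Gr N)} (h : OddMat M) : bodyMat M = 0 := by
  ext i j
  exact body_odd (h i j)

theorem IsSuper.bodyMat_eq {M : Matrix (R0 ⊕ R1) (C0 ⊕ C1) (Gr N)} (h : IsSuper M) :
    bodyMat M = Matrix.fromBlocks (bodyMat M.toBlocks₁₁) 0 0 (bodyMat M.toBlocks₂₂) := by
  conv_lhs => rw [← Matrix.fromBlocks_toBlocks M]
  rw [bodyMat, Matrix.fromBlocks_map]
  congr 1
  · exact bodyMat_of_odd h.b12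
  · exact bodyMat_of_odd h.b21

variable [Fintype R0] [Fintype R1] [DecidableEq R0] [DecidableEq R1]

theorem IsSuper.isUnit_iff {M : Matrix (R0 ⊕ R1) (R0 ⊕ R1) (Gr N)} (h : IsSuper M) :
    IsUnit M ↔ IsUnit M.toBlocks₁₁ ∧ IsUnit M.toBlocks₂₂ := by
  rw [isUnit_iff_bodyMat, isUnit_iff_bodyMat, isUnit_iff_bodyMat, h.bodyMat_eq,
    Matrix.isUnit_iff_isUnit_det, Matrix.det_fromBlocks_zero₂₁, IsUnit.mul_iff,
    Matrix.isUnit_iff_isUnit_det, Matrix.isUnit_iff_isUnit_det]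

/-- The inverse of an even supermatrix is an even supermatrix. -/
theorem IsSuper.inverse {M : Matrix (R0 ⊕ R1) (R0 ⊕ R1) (Gr N)} (h : IsSuper M) (hu : IsUnit M) :
    IsSuper (Ring.inverse M) := by
  set K := Ring.inverse M with hK
  have h1 : K * M = 1 := Ring.inverse_mul_cancel _ hu
  let K' : Matrix (R0 ⊕ R1) (R0 ⊕ R1) (Gr N) :=
    Matrix.of fun a b => sg (par a + par b) • CliffordAlgebra.involute (K a b)
  have h2 : K' * M = 1 := by
    ext a c
    have h3 := congrArg CliffordAlgebra.involute (congrFun (congrFun h1 a) c)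
    rw [Matrix.mul_apply, map_sum] at h3
    have h4 : (K' * M) a c = sg (par a + par c) •
        ∑ b, CliffordAlgebra.involute (K a b * M b c) := by
      rw [Matrix.mul_apply, Finset.smul_sum]
      refine Finset.sum_congr rfl fun b _ => ?_
      rw [map_mul, involute_of_mem (h b c), mul_smul_comm, smul_smul, ← sg_add]
      refine (smul_mul_assoc (sg (par a + par b)) (CliffordAlgebra.involute (K a b)) (M b c)).trans ?_
      congr 1
      exact sg_congr (by omega)
    rw [h4, h3, Matrix.one_apply]
    split_ifs with hac
    · subst hac
      rw [map_one, sg_congr (n := 0) (by omega), sg_zero, one_smul]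
    · rw [map_zero, smul_zero]
  have h5 : K' = K := by
    have := congrArg (· * K) h2
    simp only [mul_assoc, hK, Ring.mul_inverse_cancel _ hu, mul_one, one_mul] at this
    exact this
  intro a b
  change K a b ∈ Par N (par a + par b)
  rw [mem_Par_iff]
  have h6 : sg (par a + par b) • CliffordAlgebra.involute (K a b) = K a b :=
    congrFun (congrFun h5 a) b
  have h7 := congrArg (sg (par a + par b) • ·) h6
  simpa only [smul_smul, sg_mul_self, one_smul] using h7

end Super

section Ber
variable {N a b : ℕ}

theorem IsGL.mul {g h : Matrix (Fin a ⊕ Fin b) (Fin a ⊕ Fin b) (Gr N)} (hg : IsGL g) (hh : IsGL h) :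
    IsGL (g * h) := ⟨hg.1.mul hh.1, hg.2.mul hh.2⟩

theorem IsGL.one : IsGL (1 : Matrix (Fin a ⊕ Fin b) (Fin a ⊕ Fin b) (Gr N)) :=
  ⟨IsSuper.one, isUnit_one⟩

theorem IsGL.map {N' : ℕ} (j : Gr N →ₐ[ℝ] Gr N') (hj : ∀ i, ∀ x ∈ Par N i, j x ∈ Par N' i)
    {g : Matrix (Fin a ⊕ Fin b) (Fin a ⊕ Fin b) (Gr N)} (hg : IsGL g) : IsGL (g.map j) :=
  ⟨isSuper_map j hj hg.1, hg.2.map j.mapMatrix⟩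

/-- The Schur complement `A - B D⁻¹ C` of a supermatrix `(A B; C D)`. -/
def schur (M : Matrix (Fin a ⊕ Fin b) (Fin a ⊕ Fin b) (Gr N)) : Matrix (Fin a) (Fin a) (Gr N) :=
  M.toBlocks₁₁ - M.toBlocks₁₂ * Ring.inverse M.toBlocks₂₂ * M.toBlocks₂₁

theorem IsGL.isUnit₂₂ {g : Matrix (Fin a ⊕ Fin b) (Fin a ⊕ Fin b) (Gr N)} (hg : IsGL g) :
    IsUnit g.toBlocks₂₂ := (hg.1.isUnit_iff.1 hg.2).2

theorem IsGL.isUnit₁₁ {g : Matrix (Fin a ⊕ Fin b) (Fin a ⊕ Fin b) (Gr N)} (hg : IsGL g) :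
    IsUnit g.toBlocks₁₁ := (hg.1.isUnit_iff.1 hg.2).1

theorem IsGL.schur_even {g : Matrix (Fin a ⊕ Fin b) (Fin a ⊕ Fin b) (Gr N)} (hg : IsGL g) :
    EvenMat (schur g) :=
  hg.1.b11.sub ((hg.1.b12.mul_even (hg.1.b22.inverse hg.isUnit₂₂)).mul hg.1.b21)

theorem IsGL.schur_isUnit {g : Matrix (Fin a ⊕ Fin b) (Fin a ⊕ Fin b) (Gr N)} (hg : IsGL g) :
    IsUnit (schur g) := by
  rw [isUnit_iff_bodyMat]
  have h1 : bodyMat (schur g) = bodyMat g.toBlocks₁₁ := by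
    have h2 : bodyMat (schur g) = bodyMat g.toBlocks₁₁ -
        bodyMat (g.toBlocks₁₂ * Ring.inverse g.toBlocks₂₂ * g.toBlocks₂₁) := by
      ext i j; exact map_sub body _ _
    rw [h2, bodyMat_mul, bodyMat_of_odd hg.1.b21, Matrix.mul_zero, sub_zero]
  rw [h1, ← isUnit_iff_bodyMat]
  exact hg.isUnit₁₁

theorem IsGL.ber_eq {g : Matrix (Fin a ⊕ Fin b) (Fin a ⊕ Fin b) (Gr N)} (hg : IsGL g) :
    Ber g = edet (schur g) * Ring.inverse (edet g.toBlocks₂₂) := by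
  rw [Ber, ldet_eq_edet hg.1.b22]
  congr 1
  exact ldet_eq_edet hg.schur_even

theorem inverse_mem_even {x : Gr N} (hx : x ∈ Par N 0) : Ring.inverse x ∈ Par N 0 := by
  by_cases hu : IsUnit x
  · rw [mem_Par_iff, sg_zero, one_smul]
    have h5 := involute_of_mem hx
    rw [sg_zero, one_smul] at h5
    have h4 : CliffordAlgebra.involute (Ring.inverse x) * x = 1 := by
      calc _ = CliffordAlgebra.involute (Ring.inverse x) * CliffordAlgebra.involute x := by rw [h5]
        _ = 1 := by rw [← map_mul, Ring.inverse_mul_cancel _ hu, map_one]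
    have h6 := congrArg (· * Ring.inverse x) h4
    simp only [mul_assoc, Ring.mul_inverse_cancel _ hu, mul_one, one_mul] at h6
    exact h6
  · rw [Ring.inverse_non_unit _ hu]; exact zero_mem _

theorem IsGL.ber_mem {g : Matrix (Fin a ⊕ Fin b) (Fin a ⊕ Fin b) (Gr N)} (hg : IsGL g) :
    Ber g ∈ Par N 0 := by
  rw [hg.ber_eq]
  exact Par.mul_of (i := 0) (j := 0) rfl (edet_mem _) (inverse_mem_even (edet_mem _))

theorem IsGL.fromBlocks {A : Matrix (Fin a) (Fin a) (Gr N)} {B : Matrix (Fin a) (Fin b) (Gr N)}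
    {C : Matrix (Fin b) (Fin a) (Gr N)} {D : Matrix (Fin b) (Fin b) (Gr N)} (hA : EvenMat A)
    (hB : OddMat B) (hC : OddMat C) (hD : EvenMat D) (hAu : IsUnit A) (hDu : IsUnit D) :
    IsGL (Matrix.fromBlocks A B C D) := by
  have h := IsSuper.fromBlocks hA hB hC hD
  exact ⟨h, h.isUnit_iff.2 ⟨by rwa [Matrix.toBlocks_fromBlocks₁₁],
    by rwa [Matrix.toBlocks_fromBlocks₂₂]⟩⟩

theorem ber_fromBlocks {A : Matrix (Fin a) (Fin a) (Gr N)} {B : Matrix (Fin a) (Fin b) (Gr N)}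
    {C : Matrix (Fin b) (Fin a) (Gr N)} {D : Matrix (Fin b) (Fin b) (Gr N)} (hA : EvenMat A)
    (hB : OddMat B) (hC : OddMat C) (hD : EvenMat D) (hAu : IsUnit A) (hDu : IsUnit D) :
    Ber (Matrix.fromBlocks A B C D) =
      edet (A - B * Ring.inverse D * C) * Ring.inverse (edet D) := by
  rw [(IsGL.fromBlocks hA hB hC hD hAu hDu).ber_eq, schur]
  simp only [Matrix.toBlocks_fromBlocks₁₁, Matrix.toBlocks_fromBlocks₁₂,
    Matrix.toBlocks_fromBlocks₂₁, Matrix.toBlocks_fromBlocks₂₂]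

theorem ber_diag {A : Matrix (Fin a) (Fin a) (Gr N)} {D : Matrix (Fin b) (Fin b) (Gr N)}
    (hA : EvenMat A) (hD : EvenMat D) (hAu : IsUnit A) (hDu : IsUnit D) :
    Ber (Matrix.fromBlocks A 0 0 D) = edet A * Ring.inverse (edet D) := by
  rw [ber_fromBlocks hA OddMat.zero OddMat.zero hD hAu hDu]
  simp

theorem ber_one : Ber (1 : Matrix (Fin a ⊕ Fin b) (Fin a ⊕ Fin b) (Gr N)) = 1 := by
  rw [← Matrix.fromBlocks_one, ber_diag EvenMat.one EvenMat.one isUnit_one isUnit_one, edet_one,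
    edet_one, Ring.inverse_one, mul_one]

theorem isGL_upper {B : Matrix (Fin a) (Fin b) (Gr N)} (hB : OddMat B) :
    IsGL (Matrix.fromBlocks 1 B 0 1) :=
  IsGL.fromBlocks EvenMat.one hB OddMat.zero EvenMat.one isUnit_one isUnit_one

theorem isGL_lower {C : Matrix (Fin b) (Fin a) (Gr N)} (hC : OddMat C) :
    IsGL (Matrix.fromBlocks 1 0 C 1) :=
  IsGL.fromBlocks EvenMat.one OddMat.zero hC EvenMat.one isUnit_one isUnit_one

theorem isGL_diag {A : Matrix (Fin a) (Fin a) (Gr N)} {D : Matrix (Fin b) (Fin b) (Gr N)}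
    (hA : EvenMat A) (hD : EvenMat D) (hAu : IsUnit A) (hDu : IsUnit D) :
    IsGL (Matrix.fromBlocks A 0 0 D) :=
  IsGL.fromBlocks hA OddMat.zero OddMat.zero hD hAu hDu

theorem IsGL.factor {g : Matrix (Fin a ⊕ Fin b) (Fin a ⊕ Fin b) (Gr N)} (hg : IsGL g) :
    ∃ (B : Matrix (Fin a) (Fin b) (Gr N)) (A : Matrix (Fin a) (Fin a) (Gr N))
      (D : Matrix (Fin b) (Fin b) (Gr N)) (C : Matrix (Fin b) (Fin a) (Gr N)),
      OddMat B ∧ EvenMat A ∧ EvenMat D ∧ OddMat C ∧ IsUnit A ∧ IsUnit D ∧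
      g = Matrix.fromBlocks 1 B 0 1 * Matrix.fromBlocks A 0 0 D * Matrix.fromBlocks 1 0 C 1 := by
  refine ⟨g.toBlocks₁₂ * Ring.inverse g.toBlocks₂₂, schur g, g.toBlocks₂₂,
    Ring.inverse g.toBlocks₂₂ * g.toBlocks₂₁, hg.1.b12.mul_even (hg.1.b22.inverse hg.isUnit₂₂),
    hg.schur_even, hg.1.b22, (hg.1.b22.inverse hg.isUnit₂₂).mul_odd hg.1.b21, hg.schur_isUnit,
    hg.isUnit₂₂, ?_⟩
  conv_lhs => rw [← Matrix.fromBlocks_toBlocks g]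
  have h1 := Ring.inverse_mul_cancel _ hg.isUnit₂₂
  have h2 := Ring.mul_inverse_cancel _ hg.isUnit₂₂
  simp only [Matrix.fromBlocks_multiply, Matrix.one_mul, Matrix.mul_one, Matrix.zero_mul,
    Matrix.mul_zero, add_zero, zero_add, schur, Matrix.mul_assoc, h1]
  rw [← Matrix.mul_assoc g.toBlocks₂₂, h2, Matrix.one_mul, sub_add_cancel]

theorem ber_upper_mul {B : Matrix (Fin a) (Fin b) (Gr N)} (hB : OddMat B)
    {g : Matrix (Fin a ⊕ Fin b) (Fin a ⊕ Fin b) (Gr N)} (hg : IsGL g) :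
    Ber (Matrix.fromBlocks 1 B 0 1 * g) = Ber g := by
  have h := (isGL_upper hB).mul hg
  rw [h.ber_eq, hg.ber_eq, schur, schur]
  have e : Matrix.fromBlocks 1 B 0 1 * g = Matrix.fromBlocks
      (g.toBlocks₁₁ + B * g.toBlocks₂₁) (g.toBlocks₁₂ + B * g.toBlocks₂₂)
      g.toBlocks₂₁ g.toBlocks₂₂ := by
    conv_lhs => rw [← Matrix.fromBlocks_toBlocks g]
    simp [Matrix.fromBlocks_multiply]
  simp only [e, Matrix.toBlocks_fromBlocks₁₁, Matrix.toBlocks_fromBlocks₁₂,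
    Matrix.toBlocks_fromBlocks₂₁, Matrix.toBlocks_fromBlocks₂₂]
  congr 2
  rw [Matrix.add_mul, Matrix.mul_assoc B, Ring.mul_inverse_cancel _ hg.isUnit₂₂, Matrix.mul_one,
    Matrix.add_mul, add_sub_add_right_eq_sub]

theorem ber_mul_lower {C : Matrix (Fin b) (Fin a) (Gr N)} (hC : OddMat C)
    {g : Matrix (Fin a ⊕ Fin b) (Fin a ⊕ Fin b) (Gr N)} (hg : IsGL g) :
    Ber (g * Matrix.fromBlocks 1 0 C 1) = Ber g := by
  have h := hg.mul (isGL_lower hC)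
  rw [h.ber_eq, hg.ber_eq, schur, schur]
  have e : g * Matrix.fromBlocks 1 0 C 1 = Matrix.fromBlocks
      (g.toBlocks₁₁ + g.toBlocks₁₂ * C) g.toBlocks₁₂
      (g.toBlocks₂₁ + g.toBlocks₂₂ * C) g.toBlocks₂₂ := by
    conv_lhs => rw [← Matrix.fromBlocks_toBlocks g]
    simp [Matrix.fromBlocks_multiply]
  simp only [e, Matrix.toBlocks_fromBlocks₁₁, Matrix.toBlocks_fromBlocks₁₂,
    Matrix.toBlocks_fromBlocks₂₁, Matrix.toBlocks_fromBlocks₂₂]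
  congr 2
  rw [Matrix.mul_add, Matrix.mul_assoc _ _ (_ * C), ← Matrix.mul_assoc _ _ C,
    Ring.inverse_mul_cancel _ hg.isUnit₂₂, Matrix.one_mul, add_sub_add_right_eq_sub]

theorem inverse_mul_of_even {x y : Gr N} (hx : x ∈ Par N 0) :
    Ring.inverse (x * y) = Ring.inverse x * Ring.inverse y := by
  rw [Ring.mul_inverse_rev' (even_comm hx y), even_comm (inverse_mem_even hx)]

theorem ber_diag_mul {A : Matrix (Fin a) (Fin a) (Gr N)} {D : Matrix (Fin b) (Fin b) (Gr N)}
    (hA : EvenMat A) (hD : EvenMat D) (hAu : IsUnit A) (hDu : IsUnit D)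
    {g : Matrix (Fin a ⊕ Fin b) (Fin a ⊕ Fin b) (Gr N)} (hg : IsGL g) :
    Ber (Matrix.fromBlocks A 0 0 D * g) = edet A * Ring.inverse (edet D) * Ber g := by
  have h := (isGL_diag hA hD hAu hDu).mul hg
  have e : Matrix.fromBlocks A 0 0 D * g = Matrix.fromBlocks
      (A * g.toBlocks₁₁) (A * g.toBlocks₁₂) (D * g.toBlocks₂₁) (D * g.toBlocks₂₂) := by
    conv_lhs => rw [← Matrix.fromBlocks_toBlocks g]
    simp [Matrix.fromBlocks_multiply]
  have e2 : schur (Matrix.fromBlocks A 0 0 D * g) = A * schur g := by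
    simp only [schur, e, Matrix.toBlocks_fromBlocks₁₁, Matrix.toBlocks_fromBlocks₁₂,
      Matrix.toBlocks_fromBlocks₂₁, Matrix.toBlocks_fromBlocks₂₂]
    rw [Ring.inverse_mul (.inl hDu), Matrix.mul_sub]
    simp only [Matrix.mul_assoc]
    rw [← Matrix.mul_assoc (Ring.inverse D) D, Ring.inverse_mul_cancel _ hDu, Matrix.one_mul]
  rw [h.ber_eq, hg.ber_eq, e2, edet_mul hA hg.schur_even, e, Matrix.toBlocks_fromBlocks₂₂,
    edet_mul hD hg.1.b22, inverse_mul_of_even (edet_mem _)]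
  rw [mul_assoc, mul_assoc]
  congr 1
  rw [← mul_assoc, ← mul_assoc, even_comm (edet_mem (schur g)) (Ring.inverse (edet D))]

theorem ber_mul_diag {A : Matrix (Fin a) (Fin a) (Gr N)} {D : Matrix (Fin b) (Fin b) (Gr N)}
    (hA : EvenMat A) (hD : EvenMat D) (hAu : IsUnit A) (hDu : IsUnit D)
    {g : Matrix (Fin a ⊕ Fin b) (Fin a ⊕ Fin b) (Gr N)} (hg : IsGL g) :
    Ber (g * Matrix.fromBlocks A 0 0 D) = Ber g * (edet A * Ring.inverse (edet D)) := by
  have h := hg.mul (isGL_diag hA hD hAu hDu)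
  have e : g * Matrix.fromBlocks A 0 0 D = Matrix.fromBlocks
      (g.toBlocks₁₁ * A) (g.toBlocks₁₂ * D) (g.toBlocks₂₁ * A) (g.toBlocks₂₂ * D) := by
    conv_lhs => rw [← Matrix.fromBlocks_toBlocks g]
    simp [Matrix.fromBlocks_multiply]
  have e2 : schur (g * Matrix.fromBlocks A 0 0 D) = schur g * A := by
    simp only [schur, e, Matrix.toBlocks_fromBlocks₁₁, Matrix.toBlocks_fromBlocks₁₂,
      Matrix.toBlocks_fromBlocks₂₁, Matrix.toBlocks_fromBlocks₂₂]
    rw [Ring.inverse_mul (.inl hg.isUnit₂₂), Matrix.sub_mul]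
    simp only [Matrix.mul_assoc]
    rw [← Matrix.mul_assoc D, Ring.mul_inverse_cancel _ hDu, Matrix.one_mul]
  rw [h.ber_eq, hg.ber_eq, e2, edet_mul hg.schur_even hA, e, Matrix.toBlocks_fromBlocks₂₂,
    edet_mul hg.1.b22 hD, inverse_mul_of_even (edet_mem _)]
  rw [mul_assoc, mul_assoc]
  congr 1
  rw [← mul_assoc, ← mul_assoc, even_comm (edet_mem A) (Ring.inverse (edet g.toBlocks₂₂))]

/-- The case of one odd entry: `Ber` of the product of a lower and an upper unitriangular
supermatrix is `det(1 - BC) / det(1 + CB)`, and both determinants are equal to `1 - β c`. -/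
theorem ber_lower_mul_single {C : Matrix (Fin b) (Fin a) (Gr N)} (hC : OddMat C) (i : Fin a)
    (j : Fin b) {β : Gr N} (hβ : β ∈ Par N 1) :
    Ber (Matrix.fromBlocks 1 0 C 1 * Matrix.fromBlocks 1 (Matrix.single i j β) 0 1) = 1 := by
  set B := Matrix.single i j β with hB
  have hBo : OddMat B := fun i' j' => by
    rw [hB, Matrix.single_apply]; split_ifs
    · exact hβ
    · exact zero_mem _
  have hββ : ∀ x ∈ Par N 1, β * x * β = 0 := fun x hx => by
    have := super_comm hx hβ
    rw [mul_assoc, this, mul_smul_comm, ← mul_assoc, odd_mul_self hβ, zero_mul, smul_zero]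
  have hBCB : B * C * B = 0 := by
    rw [hB, Matrix.single_mul_mul_single, hββ _ (hC j i), Matrix.single_zero]
  have e : Matrix.fromBlocks 1 0 C 1 * Matrix.fromBlocks 1 B 0 1 =
      Matrix.fromBlocks 1 B C (1 + C * B) := by
    simp [Matrix.fromBlocks_multiply, add_comm]
  have hDi : (1 + C * B) * (1 - C * B) = 1 := by
    rw [add_mul, one_mul, mul_sub, mul_one, Matrix.mul_assoc C B, ← Matrix.mul_assoc B C B, hBCB,
      Matrix.mul_zero]
    abel
  have hDi' : (1 - C * B) * (1 + C * B) = 1 := by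
    rw [sub_mul, one_mul, mul_add, mul_one, Matrix.mul_assoc C B, ← Matrix.mul_assoc B C B, hBCB,
      Matrix.mul_zero]
    abel
  have hDu : IsUnit (1 + C * B) := ⟨⟨_, _, hDi, hDi'⟩, rfl⟩
  have hS : (1 : Matrix (Fin a) (Fin a) (Gr N)) - B * Ring.inverse (1 + C * B) * C =
      1 + -(B * C) := by
    rw [inverse_eq_of_mul_eq_one hDu hDi, Matrix.mul_sub, Matrix.mul_one, ← Matrix.mul_assoc, hBCB,
      sub_zero, sub_eq_add_neg]
  have hz : ∀ i' k i'' k', (B * C) i' k * (B * C) i'' k' = 0 := by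
    intro i' k i'' k'
    rw [hB]
    by_cases h1 : i' = i
    · by_cases h2 : i'' = i
      · subst h1 h2
        rw [Matrix.single_mul_apply_same, Matrix.single_mul_apply_same, ← mul_assoc,
          hββ _ (hC j k), zero_mul]
      · rw [Matrix.single_mul_apply_of_ne _ _ _ _ _ h2, mul_zero]
    · rw [Matrix.single_mul_apply_of_ne _ _ _ _ _ h1, zero_mul]
  have hz' : ∀ i' k i'' k', (C * B) i' k * (C * B) i'' k' = 0 := by
    intro i' k i'' k'
    rw [hB]
    by_cases h1 : k = j
    · by_cases h2 : k' = j
      · subst h1 h2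
        rw [Matrix.mul_single_apply_same, Matrix.mul_single_apply_same, mul_assoc, ← mul_assoc β,
          hββ _ (hC i'' i), mul_zero]
      · rw [Matrix.mul_single_apply_of_ne _ _ _ _ _ h2, mul_zero]
    · rw [Matrix.mul_single_apply_of_ne _ _ _ _ _ h1, zero_mul]
  have ht1 : (B * C).trace = β * C j i := by
    rw [Matrix.trace, Finset.sum_eq_single i]
    · rw [hB, Matrix.diag_apply, Matrix.single_mul_apply_same]
    · intro i' _ h
      rw [hB, Matrix.diag_apply, Matrix.single_mul_apply_of_ne _ _ _ _ _ h]
    · simp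
  have ht2 : (C * B).trace = -(β * C j i) := by
    rw [Matrix.trace, Finset.sum_eq_single j]
    · rw [hB, Matrix.diag_apply, Matrix.mul_single_apply_same, super_comm (hC j i) hβ, mul_one,
        sg_one, neg_smul, one_smul]
    · intro i' _ h
      rw [hB, Matrix.diag_apply, Matrix.mul_single_apply_of_ne _ _ _ _ _ h]
    · simp
  have hE1 : EvenMat (-(B * C)) := fun i' k => neg_mem ((hBo.mul hC) i' k)
  have hD : EvenMat (1 + C * B) := EvenMat.one.add (hC.mul hBo)
  rw [e, ber_fromBlocks EvenMat.one hBo hC hD isUnit_one hDu, hS,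
    edet_one_add hE1 (by intro i j k l; simp only [Matrix.neg_apply, neg_mul_neg]; exact hz _ _ _ _),
    edet_one_add (hC.mul hBo) hz', Matrix.trace_neg, ht1, ht2]
  refine Ring.mul_inverse_cancel _ ?_
  rw [isUnit_iff_body, map_add, map_neg, map_mul, map_one, body_odd hβ]
  simp

/-- An upper unitriangular factor on the right does not change the Berezinian. It is a product of
factors with a single odd entry, and by the factorization of `g` the claim for these reduces to
`ber_lower_mul_single`. -/
theorem ber_mul_upper {B : Matrix (Fin a) (Fin b) (Gr N)} (hB : OddMat B) :
    ∀ g : Matrix (Fin a ⊕ Fin b) (Fin a ⊕ Fin b) (Gr N), IsGL g →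
      Ber (g * Matrix.fromBlocks 1 B 0 1) = Ber g := by
  have h1 : ∀ i j (β : Gr N), β ∈ Par N 1 → ∀ g, IsGL g →
      Ber (g * Matrix.fromBlocks 1 (Matrix.single i j β : Matrix (Fin a) (Fin b) _) 0 1) =
        Ber g := by
    intro i j β hβ g hg
    obtain ⟨B', A, D, C, hB', hA, hD, hC, hAu, hDu, rfl⟩ := hg.factor
    have hS : OddMat (Matrix.single i j β : Matrix (Fin a) (Fin b) (Gr N)) := fun i' j' => by
      rw [Matrix.single_apply]; split_ifs
      · exact hβ
      · exact zero_mem _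
    have g1 := isGL_upper hB'
    have g2 := isGL_diag hA hD hAu hDu
    have g3 := isGL_lower hC
    have g4 := isGL_upper hS
    simp only [Matrix.mul_assoc]
    rw [ber_upper_mul hB' (g2.mul (g3.mul g4)), ber_upper_mul hB' (g2.mul g3),
      ber_diag_mul hA hD hAu hDu (g3.mul g4), ber_diag_mul hA hD hAu hDu g3,
      ber_lower_mul_single hC i j hβ]
    have := ber_mul_lower hC (IsGL.one (N := N) (a := a) (b := b))
    rw [one_mul, ber_one] at this
    rw [this]
  let P : Matrix (Fin a) (Fin b) (Gr N) → Prop := fun B => OddMat B ∧ ∀ g, IsGL g →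
    Ber (g * Matrix.fromBlocks 1 B 0 1) = Ber g
  have hadd : ∀ B B', P B → P B' → P (B + B') := by
    rintro B B' ⟨h, h2⟩ ⟨h', h2'⟩
    refine ⟨h.add h', fun g hg => ?_⟩
    have e : (Matrix.fromBlocks 1 (B + B') 0 1 : Matrix (Fin a ⊕ Fin b) (Fin a ⊕ Fin b) (Gr N)) =
        Matrix.fromBlocks 1 B 0 1 * Matrix.fromBlocks 1 B' 0 1 := by
      simp [Matrix.fromBlocks_multiply, add_comm]
    rw [e, ← Matrix.mul_assoc, h2' _ (hg.mul (isGL_upper h)), h2 _ hg]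
  have hz : P 0 := ⟨OddMat.zero, fun g _ => by rw [Matrix.fromBlocks_one, mul_one]⟩
  have hP : P B := by
    rw [Matrix.matrix_eq_sum_single B]
    refine Finset.sum_induction _ P hadd hz fun i _ =>
      Finset.sum_induction _ P hadd hz fun j _ => ⟨fun i' j' => ?_, h1 i j _ (hB i j)⟩
    rw [Matrix.single_apply]; split_ifs
    · exact hB i j
    · exact zero_mem _
  exact hP.2

/-- The Berezinian is multiplicative. -/
theorem ber_mul {g h : Matrix (Fin a ⊕ Fin b) (Fin a ⊕ Fin b) (Gr N)} (hg : IsGL g)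
    (hh : IsGL h) : Ber (g * h) = Ber g * Ber h := by
  obtain ⟨B, A, D, C, hB, hA, hD, hC, hAu, hDu, rfl⟩ := hh.factor
  have g1 := isGL_upper hB
  have g2 := isGL_diag hA hD hAu hDu
  rw [← Matrix.mul_assoc, ← Matrix.mul_assoc, ber_mul_lower hC ((hg.mul g1).mul g2),
    ber_mul_diag hA hD hAu hDu (hg.mul g1), ber_mul_upper hB _ hg, ber_mul_lower hC (g1.mul g2),
    ber_upper_mul hB g2, ber_diag hA hD hAu hDu]

theorem ber_map {N' : ℕ} (j : Gr N →ₐ[ℝ] Gr N') (hj : ∀ i, ∀ x ∈ Par N i, j x ∈ Par N' i)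
    {g : Matrix (Fin a ⊕ Fin b) (Fin a ⊕ Fin b) (Gr N)} (hg : IsGL g) :
    Ber (g.map j) = j (Ber g) := by
  obtain ⟨B, A, D, C, hB, hA, hD, hC, hAu, hDu, rfl⟩ := hg.factor
  have hm : ∀ {ι κ : Type} {M : Matrix ι κ (Gr N)}, EvenMat M → EvenMat (M.map j) :=
    fun h i k => hj 0 _ (h i k)
  have hm1 : ∀ {ι κ : Type} {M : Matrix ι κ (Gr N)}, OddMat M → OddMat (M.map j) :=
    fun h i k => hj 1 _ (h i k)
  have hu : ∀ {ι : Type} [Fintype ι] [DecidableEq ι] {M : Matrix ι ι (Gr N)}, IsUnit M →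
      IsUnit (M.map j) := fun h => h.map j.mapMatrix
  have e : ∀ (A : Matrix (Fin a) (Fin a) (Gr N)) (B : Matrix (Fin a) (Fin b) (Gr N))
      (C : Matrix (Fin b) (Fin a) (Gr N)) (D : Matrix (Fin b) (Fin b) (Gr N)),
      j.mapMatrix (Matrix.fromBlocks A B C D) = Matrix.fromBlocks (A.map j) (B.map j) (C.map j)
        (D.map j) := fun A B C D => Matrix.fromBlocks_map _ _ _ _ _
  have g1 := isGL_upper hB
  have g2 := isGL_diag hA hD hAu hDu
  have g1' := isGL_upper (hm1 hB)
  have g2' := isGL_diag (hm hA) (hm hD) (hu hAu) (hu hDu)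
  rw [← AlgHom.mapMatrix_apply, map_mul, map_mul, e, e, e,
    Matrix.map_one _ (map_zero j) (map_one j), Matrix.map_one _ (map_zero j) (map_one j),
    Matrix.map_zero _ (map_zero j), Matrix.map_zero _ (map_zero j),
    ber_mul_lower (hm1 hC) (g1'.mul g2'), ber_upper_mul (hm1 hB) g2',
    ber_diag (hm hA) (hm hD) (hu hAu) (hu hDu), ber_mul_lower hC (g1.mul g2), ber_upper_mul hB g2,
    ber_diag hA hD hAu hDu, map_mul, edet_map j (hj 0) hA, edet_map j (hj 0) hD]
  congr 1
  refine inverse_eq_of_mul_eq_one (((isUnit_edet_iff hD).2 hDu).map j) ?_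
  rw [← map_mul, Ring.mul_inverse_cancel _ ((isUnit_edet_iff hD).2 hDu), map_one]

/-- If all products of two entries of `E` vanish, then `Ber (1 + E) = 1 + str E`. -/
theorem ber_one_add {E : Matrix (Fin a ⊕ Fin b) (Fin a ⊕ Fin b) (Gr N)} (hE : IsSuper E)
    (h : ∀ i j k l, E i j * E k l = 0) :
    IsGL (1 + E) ∧ Ber (1 + E) = 1 + ∑ i, sg (par i) • E i i := by
  have hb : bodyMat E = 0 := by
    ext i k
    have := congrArg body (h i k i k)
    rw [map_mul, map_zero] at this
    exact mul_self_eq_zero.1 this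
  have hbu : ∀ {ι : Type} [Fintype ι] [DecidableEq ι] {X : Matrix ι ι (Gr N)}, bodyMat X = 0 →
      IsUnit (1 + X) := fun hX => (isNilpotent_of_bodyMat hX).isUnit_one_add
  have hgl : IsGL (1 + E) := ⟨IsSuper.one.add hE, hbu hb⟩
  refine ⟨hgl, ?_⟩
  have e : 1 + E = Matrix.fromBlocks (1 + E.toBlocks₁₁) E.toBlocks₁₂ E.toBlocks₂₁
      (1 + E.toBlocks₂₂) := by
    conv_lhs => rw [← Matrix.fromBlocks_toBlocks E, ← Matrix.fromBlocks_one,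
      Matrix.fromBlocks_add, zero_add, zero_add]
  have hu1 : IsUnit (1 + E.toBlocks₁₁) := hbu (by ext i k; exact congrFun (congrFun hb _) _)
  have hu2 : IsUnit (1 + E.toBlocks₂₂) := hbu (by ext i k; exact congrFun (congrFun hb _) _)
  have hz : ∀ {ι κ lam : Type} [Fintype κ] (X : Matrix ι κ (Gr N)) (Y : Matrix κ lam (Gr N)),
      (∀ i j k l, X i j * Y k l = 0) → X * Y = 0 := fun X Y hXY => by
    ext i l
    rw [Matrix.mul_apply]
    exact Finset.sum_eq_zero fun k _ => hXY _ _ _ _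
  have h22 : E.toBlocks₂₂ * E.toBlocks₂₂ = 0 := hz _ _ fun i j k l => h _ _ _ _
  have hinv : Ring.inverse (1 + E.toBlocks₂₂) = 1 - E.toBlocks₂₂ := by
    refine inverse_eq_of_mul_eq_one hu2 ?_
    rw [add_mul, one_mul, mul_sub, mul_one, h22]
    abel
  have h1221 : E.toBlocks₁₂ * (1 - E.toBlocks₂₂) * E.toBlocks₂₁ = 0 := by
    have h12 : E.toBlocks₁₂ * E.toBlocks₂₂ = 0 := hz _ _ fun i j k l => h _ _ _ _
    have h121 : E.toBlocks₁₂ * E.toBlocks₂₁ = 0 := hz _ _ fun i j k l => h _ _ _ _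
    rw [Matrix.mul_sub, Matrix.mul_one, h12, sub_zero, h121]
  rw [e, ber_fromBlocks (EvenMat.one.add hE.b11) hE.b12 hE.b21 (EvenMat.one.add hE.b22) hu1 hu2,
    hinv, h1221, sub_zero, edet_one_add hE.b11 fun i j k l => h _ _ _ _,
    edet_one_add hE.b22 fun i j k l => h _ _ _ _]
  have ht : E.toBlocks₁₁.trace * E.toBlocks₂₂.trace = 0 := by
    rw [Matrix.trace, Matrix.trace, Finset.sum_mul_sum]
    exact Finset.sum_eq_zero fun i _ => Finset.sum_eq_zero fun j _ => h _ _ _ _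
  have ht2 : E.toBlocks₂₂.trace * E.toBlocks₂₂.trace = 0 := by
    rw [Matrix.trace, Finset.sum_mul_sum]
    exact Finset.sum_eq_zero fun i _ => Finset.sum_eq_zero fun j _ => h _ _ _ _
  have hi : Ring.inverse (1 + E.toBlocks₂₂.trace) = 1 - E.toBlocks₂₂.trace := by
    refine inverse_eq_of_mul_eq_one ?_ ?_
    · rw [isUnit_iff_body, map_add, map_one, mul_self_eq_zero.1 ((map_mul body _ _).symm.trans
        ((congrArg body ht2).trans (map_zero _)))]
      simp
    · rw [add_mul, one_mul, mul_sub, mul_one, ht2]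
      abel
  rw [hi, add_mul, one_mul, mul_sub, mul_one, ht, Fintype.sum_sum_type, Matrix.trace, Matrix.trace]
  simp only [par, Sum.elim_inl, Sum.elim_inr, sg_zero, sg_one, one_smul, neg_smul,
    Finset.sum_neg_distrib, Matrix.diag_apply, Matrix.toBlocks₁₁, Matrix.toBlocks₂₂,
    Matrix.of_apply]
  abel

end Ber

/-! ### Block triangular supermatrices -/

section Blocks
variable {N : ℕ}

theorem isUnit_lower_blocks {ι κ lam : Type} [Fintype ι] [Fintype κ] [Fintype lam] [DecidableEq ι]
    [DecidableEq κ] [DecidableEq lam] (e : ι ⊕ κ ≃ lam) {M : Matrix lam lam (Gr N)}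
    (h0 : ∀ i j, M (e (.inl i)) (e (.inr j)) = 0) :
    IsUnit M ↔ IsUnit (M.submatrix (fun i => e (.inl i)) (fun i => e (.inl i))) ∧
      IsUnit (M.submatrix (fun i => e (.inr i)) (fun i => e (.inr i))) := by
  have h1 : (bodyMat M).submatrix e e =
      Matrix.fromBlocks (bodyMat (M.submatrix (fun i => e (.inl i)) (fun i => e (.inl i)))) 0
        ((bodyMat M).submatrix (fun i => e (.inr i)) (fun i => e (.inl i)))
        (bodyMat (M.submatrix (fun i => e (.inr i)) (fun i => e (.inr i)))) := by
    ext (i | i) (j | j)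
    · rfl
    · simp [h0]
    · rfl
    · rfl
  rw [isUnit_iff_bodyMat, isUnit_iff_bodyMat, isUnit_iff_bodyMat, Matrix.isUnit_iff_isUnit_det,
    ← Matrix.det_submatrix_equiv_self e, h1, Matrix.det_fromBlocks_zero₁₂, IsUnit.mul_iff,
    Matrix.isUnit_iff_isUnit_det, Matrix.isUnit_iff_isUnit_det]

theorem par_map {α β α' β' : Type} (f : α → α') (g : β → β') (a : α ⊕ β) :
    par (Sum.map f g a) = par a := by
  rcases a with a | a <;> rfl

theorem IsSuper.submatrix {R0 R1 C0 C1 R0' R1' C0' C1' : Type}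
    {M : Matrix (R0 ⊕ R1) (C0 ⊕ C1) (Gr N)} (hM : IsSuper M) (f : R0' → R0) (f' : R1' → R1)
    (g : C0' → C0) (g' : C1' → C1) : IsSuper (M.submatrix (Sum.map f f') (Sum.map g g')) := by
  intro a k
  have h := hM (Sum.map f f' a) (Sum.map g g' k)
  rw [par_map, par_map] at h
  exact h

variable {p q k l p' q' : ℕ} (e0 : Fin p ⊕ Fin k ≃ Fin p') (e1 : Fin q ⊕ Fin l ≃ Fin q')

/-- The first indices of a division. -/
abbrev fstIdx : Fin p ⊕ Fin q → Fin p' ⊕ Fin q' :=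
  Sum.map (fun i => e0 (.inl i)) (fun i => e1 (.inl i))

/-- The second indices of a division. -/
abbrev sndIdx : Fin k ⊕ Fin l → Fin p' ⊕ Fin q' :=
  Sum.map (fun i => e0 (.inr i)) (fun i => e1 (.inr i))

theorem isGL_lower_blocks {h : Matrix (Fin p' ⊕ Fin q') (Fin p' ⊕ Fin q') (Gr N)} (hh : IsSuper h)
    (h0 : ∀ i j, h (fstIdx e0 e1 i) (sndIdx e0 e1 j) = 0) :
    IsGL h ↔ IsGL (h.submatrix (fstIdx e0 e1) (fstIdx e0 e1)) ∧
      IsGL (h.submatrix (sndIdx e0 e1) (sndIdx e0 e1)) := by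
  have s1 := hh.submatrix (fun i => e0 (.inl i)) (fun i => e1 (.inl i)) (fun i => e0 (.inl i))
    (fun i => e1 (.inl i))
  have s2 := hh.submatrix (fun i => e0 (.inr i)) (fun i => e1 (.inr i)) (fun i => e0 (.inr i))
    (fun i => e1 (.inr i))
  have u1 := isUnit_lower_blocks e0 (M := h.toBlocks₁₁) fun i j => h0 (.inl i) (.inl j)
  have u2 := isUnit_lower_blocks e1 (M := h.toBlocks₂₂) fun i j => h0 (.inr i) (.inr j)
  constructor
  · intro hg
    have v1 := u1.1 hg.isUnit₁₁
    have v2 := u2.1 hg.isUnit₂₂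
    exact ⟨⟨s1, s1.isUnit_iff.2 ⟨v1.1, v2.1⟩⟩, ⟨s2, s2.isUnit_iff.2 ⟨v1.2, v2.2⟩⟩⟩
  · rintro ⟨g1, g2⟩
    exact ⟨hh, hh.isUnit_iff.2 ⟨u1.2 ⟨g1.isUnit₁₁, g2.isUnit₁₁⟩, u2.2 ⟨g1.isUnit₂₂, g2.isUnit₂₂⟩⟩⟩

theorem ber_lower_blocks {h : Matrix (Fin p' ⊕ Fin q') (Fin p' ⊕ Fin q') (Gr N)} (hh : IsGL h)
    (h0 : ∀ i j, h (fstIdx e0 e1 i) (sndIdx e0 e1 j) = 0) :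
    Ber h = Ber (h.submatrix (fstIdx e0 e1) (fstIdx e0 e1)) *
      Ber (h.submatrix (sndIdx e0 e1) (sndIdx e0 e1)) := by
  obtain ⟨g1, g2⟩ := (isGL_lower_blocks e0 e1 hh.1 h0).1 hh
  set h1 := h.submatrix (fstIdx e0 e1) (fstIdx e0 e1) with hh1
  set h2 := h.submatrix (sndIdx e0 e1) (sndIdx e0 e1) with hh2
  -- `X = D⁻¹ C` is block triangular as well
  set X := Ring.inverse h.toBlocks₂₂ * h.toBlocks₂₁ with hX
  have hDX : h.toBlocks₂₂ * X = h.toBlocks₂₁ := by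
    rw [hX, ← Matrix.mul_assoc, Ring.mul_inverse_cancel _ hh.isUnit₂₂, Matrix.one_mul]
  have hsum : ∀ f : Fin q' → Gr N,
      ∑ c, f c = ∑ c, f (e1 (.inl c)) + ∑ c, f (e1 (.inr c)) := fun f => by
    rw [← e1.sum_comp, Fintype.sum_sum_type]
  have hX12 : X.submatrix (fun i => e1 (.inl i)) (fun j => e0 (.inr j)) = 0 := by
    have : h1.toBlocks₂₂ * X.submatrix (fun i => e1 (.inl i)) (fun j => e0 (.inr j)) = 0 := by
      ext i j
      have h3 := congrFun (congrFun hDX (e1 (.inl i))) (e0 (.inr j))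
      rw [Matrix.mul_apply, hsum] at h3
      have h4 : h.toBlocks₂₁ (e1 (.inl i)) (e0 (.inr j)) = 0 := h0 (.inr i) (.inl j)
      have h5 : ∀ c, h.toBlocks₂₂ (e1 (.inl i)) (e1 (.inr c)) = 0 := fun c => h0 (.inr i) (.inr c)
      simp only [h4, h5, zero_mul, Finset.sum_const_zero, add_zero] at h3
      exact h3
    have h6 := congrArg (Ring.inverse h1.toBlocks₂₂ * ·) this
    simpa only [← Matrix.mul_assoc, Ring.inverse_mul_cancel _ g1.isUnit₂₂, Matrix.one_mul,
      Matrix.mul_zero] using h6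
  have hX11 : X.submatrix (fun i => e1 (.inl i)) (fun j => e0 (.inl j)) =
      Ring.inverse h1.toBlocks₂₂ * h1.toBlocks₂₁ := by
    have : h1.toBlocks₂₂ * X.submatrix (fun i => e1 (.inl i)) (fun j => e0 (.inl j)) =
        h1.toBlocks₂₁ := by
      ext i j
      have h3 := congrFun (congrFun hDX (e1 (.inl i))) (e0 (.inl j))
      rw [Matrix.mul_apply, hsum] at h3
      have h5 : ∀ c, h.toBlocks₂₂ (e1 (.inl i)) (e1 (.inr c)) = 0 := fun c => h0 (.inr i) (.inr c)
      simp only [h5, zero_mul, Finset.sum_const_zero, add_zero] at h3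
      exact h3
    rw [← this, ← Matrix.mul_assoc, Ring.inverse_mul_cancel _ g1.isUnit₂₂, Matrix.one_mul]
  have hX22 : X.submatrix (fun i => e1 (.inr i)) (fun j => e0 (.inr j)) =
      Ring.inverse h2.toBlocks₂₂ * h2.toBlocks₂₁ := by
    have : h2.toBlocks₂₂ * X.submatrix (fun i => e1 (.inr i)) (fun j => e0 (.inr j)) =
        h2.toBlocks₂₁ := by
      ext i j
      have h3 := congrFun (congrFun hDX (e1 (.inr i))) (e0 (.inr j))
      rw [Matrix.mul_apply, hsum] at h3
      have h5 : ∀ c, X (e1 (.inl c)) (e0 (.inr j)) = 0 := fun c => congrFun (congrFun hX12 c) j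
      simp only [h5, mul_zero, Finset.sum_const_zero, zero_add] at h3
      exact h3
    rw [← this, ← Matrix.mul_assoc, Ring.inverse_mul_cancel _ g2.isUnit₂₂, Matrix.one_mul]
  have hS : schur h = h.toBlocks₁₁ - h.toBlocks₁₂ * X := by rw [schur, Matrix.mul_assoc]
  have hB12 : ∀ i c, h.toBlocks₁₂ (e0 (.inl i)) (e1 (.inr c)) = 0 := fun i c => h0 (.inl i) (.inr c)
  have e : (schur h).submatrix e0 e0 = Matrix.fromBlocks (schur h1) 0
      ((schur h).submatrix (fun i => e0 (.inr i)) (fun i => e0 (.inl i))) (schur h2) := by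
    ext (i | i) (j | j)
    · rw [Matrix.submatrix_apply, hS, Matrix.sub_apply, Matrix.mul_apply, hsum]
      simp only [hB12, zero_mul, Finset.sum_const_zero, add_zero]
      rw [Matrix.fromBlocks_apply₁₁, schur, Matrix.mul_assoc, ← hX11]
      rfl
    · rw [Matrix.submatrix_apply, hS, Matrix.sub_apply, Matrix.mul_apply, hsum]
      have h5 : ∀ c, X (e1 (.inl c)) (e0 (.inr j)) = 0 := fun c => congrFun (congrFun hX12 c) j
      have h6 : h.toBlocks₁₁ (e0 (.inl i)) (e0 (.inr j)) = 0 := h0 (.inl i) (.inl j)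
      simp [hB12, h5, h6]
    · rfl
    · rw [Matrix.submatrix_apply, hS, Matrix.sub_apply, Matrix.mul_apply, hsum]
      have h5 : ∀ c, X (e1 (.inl c)) (e0 (.inr j)) = 0 := fun c => congrFun (congrFun hX12 c) j
      simp only [h5, mul_zero, Finset.sum_const_zero, zero_add]
      rw [Matrix.fromBlocks_apply₂₂, schur, Matrix.mul_assoc, ← hX22]
      rfl
  have eD : (h.toBlocks₂₂).submatrix e1 e1 = Matrix.fromBlocks h1.toBlocks₂₂ 0
      (h.toBlocks₂₂.submatrix (fun i => e1 (.inr i)) (fun i => e1 (.inl i))) h2.toBlocks₂₂ := by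
    ext (i | i) (j | j)
    · rfl
    · exact h0 (.inr i) (.inr j)
    · rfl
    · rfl
  rw [hh.ber_eq, g1.ber_eq, g2.ber_eq, ← edet_reindex e0, e, edet_fromBlocks_zero₁₂,
    ← edet_reindex e1, eD, edet_fromBlocks_zero₁₂, inverse_mul_of_even (edet_mem _)]
  rw [mul_assoc, mul_assoc]
  congr 1
  rw [← mul_assoc, ← mul_assoc, even_comm (edet_mem (schur h2))]

theorem isGL_upper_blocks {h : Matrix (Fin p' ⊕ Fin q') (Fin p' ⊕ Fin q') (Gr N)} (hh : IsSuper h)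
    (h0 : ∀ i j, h (sndIdx e0 e1 i) (fstIdx e0 e1 j) = 0) :
    IsGL h ↔ IsGL (h.submatrix (fstIdx e0 e1) (fstIdx e0 e1)) ∧
      IsGL (h.submatrix (sndIdx e0 e1) (sndIdx e0 e1)) := by
  have := isGL_lower_blocks ((Equiv.sumComm _ _).trans e0) ((Equiv.sumComm _ _).trans e1) hh h0
  exact this.trans and_comm

theorem ber_upper_blocks {h : Matrix (Fin p' ⊕ Fin q') (Fin p' ⊕ Fin q') (Gr N)} (hh : IsGL h)
    (h0 : ∀ i j, h (sndIdx e0 e1 i) (fstIdx e0 e1 j) = 0) :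
    Ber h = Ber (h.submatrix (fstIdx e0 e1) (fstIdx e0 e1)) *
      Ber (h.submatrix (sndIdx e0 e1) (sndIdx e0 e1)) := by
  have h1 := ber_lower_blocks ((Equiv.sumComm _ _).trans e0) ((Equiv.sumComm _ _).trans e1) hh h0
  exact h1.trans (even_comm ((isGL_upper_blocks e0 e1 hh.1 h0).1 hh).2.ber_mem _)

end Blocks

section LastIdx
variable {N r s : ℕ}

/-- The division of `r + 1` indices into the first `r` and the last one. -/
def lastEquiv (r : ℕ) : Fin r ⊕ Fin 1 ≃ Fin (r + 1) := finSumFinEquiv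

theorem lastEquiv_inr (i : Fin 1) : lastEquiv r (.inr i) = Fin.last r := by
  ext; simp [lastEquiv]

/-- The last even index. -/
abbrev newIdx (r s : ℕ) : Fin (r + 1) ⊕ Fin s := .inl (Fin.last r)

/-- The indices other than the last even one. -/
abbrev oldIdx (r s : ℕ) : Fin r ⊕ Fin s → Fin (r + 1) ⊕ Fin s := Sum.map Fin.castSucc id

theorem ber_entry (h : Matrix (Fin 1 ⊕ Fin 0) (Fin 1 ⊕ Fin 0) (Gr N)) :
    Ber h = h (.inl 0) (.inl 0) := by
  simp [Ber, ldet, Matrix.toBlocks₁₁, Matrix.mul_apply]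

theorem oldIdx_ne_newIdx (i : Fin r ⊕ Fin s) : oldIdx r s i ≠ newIdx r s := by
  rcases i with i | i
  · simp [Fin.castSucc_ne_last]
  · simp

theorem eq_newIdx_or (i : Fin (r + 1) ⊕ Fin s) : i = newIdx r s ∨ ∃ j, i = oldIdx r s j := by
  rcases i with i | i
  · induction i using Fin.lastCases with
    | last => exact .inl rfl
    | cast i => exact .inr ⟨.inl i, rfl⟩
  · exact .inr ⟨.inr i, rfl⟩

theorem sum_oldIdx {V : Type} [AddCommMonoid V] (f : Fin (r + 1) ⊕ Fin s → V) :
    ∑ i, f i = ∑ i, f (oldIdx r s i) + f (newIdx r s) := by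
  rw [Fintype.sum_sum_type, Fintype.sum_sum_type, Fin.sum_univ_castSucc]
  simp only [Sum.map_inl, Sum.map_inr, id]
  abel

theorem isGL_last_aux {g : Matrix (Fin (r + 1) ⊕ Fin s) (Fin (r + 1) ⊕ Fin s) (Gr N)}
    (hg : IsSuper g) : IsGL (g.submatrix (sndIdx (lastEquiv r) (Equiv.sumEmpty (Fin s) (Fin 0)))
      (sndIdx (lastEquiv r) (Equiv.sumEmpty (Fin s) (Fin 0)))) ↔
      IsUnit (g (newIdx r s) (newIdx r s)) := by
  have h1 := hg.submatrix (fun i => lastEquiv r (.inr i))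
    (fun i => Equiv.sumEmpty (Fin s) (Fin 0) (.inr i)) (fun i => lastEquiv r (.inr i))
    (fun i => Equiv.sumEmpty (Fin s) (Fin 0) (.inr i))
  set h := g.submatrix (sndIdx (lastEquiv r) (Equiv.sumEmpty (Fin s) (Fin 0)))
      (sndIdx (lastEquiv r) (Equiv.sumEmpty (Fin s) (Fin 0))) with hh
  have e : h.toBlocks₁₁ 0 0 = g (newIdx r s) (newIdx r s) := by
    simp [hh, Matrix.toBlocks₁₁, lastEquiv_inr]
  rw [← e, isUnit_iff_body]
  have h2 : IsUnit h.toBlocks₂₂ := by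
    have : h.toBlocks₂₂ = 1 := Subsingleton.elim _ _
    rw [this]; exact isUnit_one
  have h3 : IsUnit h.toBlocks₁₁ ↔ body (h.toBlocks₁₁ 0 0) ≠ 0 := by
    rw [isUnit_iff_bodyMat, Matrix.isUnit_iff_isUnit_det, Matrix.det_fin_one, isUnit_iff_ne_zero]
    rfl
  rw [← h3]
  exact ⟨fun hx => hx.isUnit₁₁, fun hx => ⟨h1, h1.isUnit_iff.2 ⟨hx, h2⟩⟩⟩

variable {g : Matrix (Fin (r + 1) ⊕ Fin s) (Fin (r + 1) ⊕ Fin s) (Gr N)}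

theorem isGL_lower_last (hg : IsSuper g) (h0 : ∀ i, g (oldIdx r s i) (newIdx r s) = 0) :
    IsGL g ↔ IsGL (g.submatrix (oldIdx r s) (oldIdx r s)) ∧ IsUnit (g (newIdx r s) (newIdx r s)) := by
  rw [← isGL_last_aux hg]
  refine isGL_lower_blocks (lastEquiv r) (Equiv.sumEmpty (Fin s) (Fin 0)) hg fun i j => ?_
  rcases j with j | j
  · change g (oldIdx r s i) (.inl (lastEquiv r (.inr j))) = 0
    rw [lastEquiv_inr]
    exact h0 i
  · exact j.elim0

theorem ber_lower_last (hg : IsGL g) (h0 : ∀ i, g (oldIdx r s i) (newIdx r s) = 0) :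
    Ber g = Ber (g.submatrix (oldIdx r s) (oldIdx r s)) * g (newIdx r s) (newIdx r s) := by
  rw [ber_lower_blocks (lastEquiv r) (Equiv.sumEmpty (Fin s) (Fin 0)) hg fun i j => ?_, ber_entry]
  · congr 1
  rcases j with j | j
  · change g (oldIdx r s i) (.inl (lastEquiv r (.inr j))) = 0
    rw [lastEquiv_inr]
    exact h0 i
  · exact j.elim0

theorem isGL_upper_last (hg : IsSuper g) (h0 : ∀ i, g (newIdx r s) (oldIdx r s i) = 0) :
    IsGL g ↔ IsGL (g.submatrix (oldIdx r s) (oldIdx r s)) ∧ IsUnit (g (newIdx r s) (newIdx r s)) := by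
  rw [← isGL_last_aux hg]
  refine isGL_upper_blocks (lastEquiv r) (Equiv.sumEmpty (Fin s) (Fin 0)) hg fun i j => ?_
  rcases i with i | i
  · change g (.inl (lastEquiv r (.inr i))) (oldIdx r s j) = 0
    rw [lastEquiv_inr]
    exact h0 j
  · exact i.elim0

theorem ber_upper_last (hg : IsGL g) (h0 : ∀ i, g (newIdx r s) (oldIdx r s i) = 0) :
    Ber g = Ber (g.submatrix (oldIdx r s) (oldIdx r s)) * g (newIdx r s) (newIdx r s) := by
  rw [ber_upper_blocks (lastEquiv r) (Equiv.sumEmpty (Fin s) (Fin 0)) hg fun i j => ?_, ber_entry]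
  · congr 1
  rcases i with i | i
  · change g (.inl (lastEquiv r (.inr i))) (oldIdx r s j) = 0
    rw [lastEquiv_inr]
    exact h0 j
  · exact i.elim0

/-- The transformation that adds multiples of the last even row to the other rows. -/
def addRowMat (d : Fin (r + 1) ⊕ Fin s → Gr N) :
    Matrix (Fin (r + 1) ⊕ Fin s) (Fin (r + 1) ⊕ Fin s) (Gr N) :=
  1 + Matrix.vecMulVec d (Pi.single (newIdx r s) 1)

/-- The transformation that adds multiples of the last even column to the other columns. -/
def addColMat (d : Fin (r + 1) ⊕ Fin s → Gr N) :
    Matrix (Fin (r + 1) ⊕ Fin s) (Fin (r + 1) ⊕ Fin s) (Gr N) :=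
  1 + Matrix.vecMulVec (Pi.single (newIdx r s) 1) d

theorem single_mem (i : Fin (r + 1) ⊕ Fin s) (j : Fin (r + 1) ⊕ Fin s) (hi : par i = 0) {x : Gr N}
    (hx : x ∈ Par N 0) : (Pi.single i x : Fin (r + 1) ⊕ Fin s → Gr N) j ∈ Par N (par j) := by
  by_cases h : j = i
  · subst h; rw [Pi.single_eq_same, hi]; exact hx
  · rw [Pi.single_eq_of_ne h]; exact zero_mem _

theorem isSuper_vecMulVec {R0 R1 C0 C1 : Type} {d : R0 ⊕ R1 → Gr N} {c : C0 ⊕ C1 → Gr N}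
    (hd : ∀ a, d a ∈ Par N (par a)) (hc : ∀ a, c a ∈ Par N (par a)) :
    IsSuper (Matrix.vecMulVec d c) := fun a k => Par.mul (hd a) (hc k)

theorem isGL_addRowMat {d : Fin (r + 1) ⊕ Fin s → Gr N} (hd : ∀ a, d a ∈ Par N (par a))
    (hy : d (newIdx r s) = 0) : IsGL (addRowMat d) ∧ Ber (addRowMat d) = 1 := by
  have h1 : IsSuper (addRowMat d) :=
    IsSuper.one.add (isSuper_vecMulVec hd fun k => single_mem _ k rfl Par.one_mem)
  have h0 : ∀ i, addRowMat d (newIdx r s) (oldIdx r s i) = 0 := fun i => by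
    simp [addRowMat, Matrix.vecMulVec_apply, hy, Matrix.one_apply_ne (oldIdx_ne_newIdx i).symm]
  have h2 : (addRowMat d).submatrix (oldIdx r s) (oldIdx r s) = 1 := by
    ext i j
    rw [Matrix.submatrix_apply, addRowMat, Matrix.add_apply, Matrix.vecMulVec_apply,
      Pi.single_eq_of_ne (oldIdx_ne_newIdx j), mul_zero, add_zero, Matrix.one_apply,
      Matrix.one_apply]
    have : Function.Injective (oldIdx r s) :=
      Sum.map_injective.2 ⟨Fin.castSucc_injective _, Function.injective_id⟩
    simp [this.eq_iff]
  have h3 : addRowMat d (newIdx r s) (newIdx r s) = 1 := by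
    simp [addRowMat, Matrix.vecMulVec_apply, hy]
  have h4 : IsGL (addRowMat d) := (isGL_upper_last h1 h0).2 (by
    rw [h2, h3]; exact ⟨IsGL.one, isUnit_one⟩)
  refine ⟨h4, ?_⟩
  rw [ber_upper_last h4 h0, h2, h3, ber_one, mul_one]

theorem isGL_addColMat {d : Fin (r + 1) ⊕ Fin s → Gr N} (hd : ∀ a, d a ∈ Par N (par a))
    (hy : d (newIdx r s) = 0) : IsGL (addColMat d) ∧ Ber (addColMat d) = 1 := by
  have h1 : IsSuper (addColMat d) :=
    IsSuper.one.add (isSuper_vecMulVec (fun k => single_mem _ k rfl Par.one_mem) hd)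
  have h0 : ∀ i, addColMat d (oldIdx r s i) (newIdx r s) = 0 := fun i => by
    simp [addColMat, Matrix.vecMulVec_apply, hy, Matrix.one_apply_ne (oldIdx_ne_newIdx i)]
  have h2 : (addColMat d).submatrix (oldIdx r s) (oldIdx r s) = 1 := by
    ext i j
    rw [Matrix.submatrix_apply, addColMat, Matrix.add_apply, Matrix.vecMulVec_apply,
      Pi.single_eq_of_ne (oldIdx_ne_newIdx i), zero_mul, add_zero, Matrix.one_apply,
      Matrix.one_apply]
    have : Function.Injective (oldIdx r s) :=
      Sum.map_injective.2 ⟨Fin.castSucc_injective _, Function.injective_id⟩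
    simp [this.eq_iff]
  have h3 : addColMat d (newIdx r s) (newIdx r s) = 1 := by
    simp [addColMat, Matrix.vecMulVec_apply, hy]
  have h4 : IsGL (addColMat d) := (isGL_lower_last h1 h0).2 (by
    rw [h2, h3]; exact ⟨IsGL.one, isUnit_one⟩)
  refine ⟨h4, ?_⟩
  rw [ber_lower_last h4 h0, h2, h3, ber_one, mul_one]

theorem addRowMat_mul {ι : Type} (d : Fin (r + 1) ⊕ Fin s → Gr N)
    (M : Matrix (Fin (r + 1) ⊕ Fin s) ι (Gr N)) :
    addRowMat d * M = M + Matrix.of fun a k => d a * M (newIdx r s) k := by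
  rw [addRowMat, Matrix.add_mul, Matrix.one_mul]
  congr 1
  ext a k
  simp [Matrix.mul_apply, Matrix.vecMulVec_apply, Pi.single_apply, mul_assoc]

theorem mul_addRowMat {ι : Type} (d : Fin (r + 1) ⊕ Fin s → Gr N)
    (M : Matrix ι (Fin (r + 1) ⊕ Fin s) (Gr N)) :
    M * addRowMat d = M + Matrix.vecMulVec (M.mulVec d) (Pi.single (newIdx r s) 1) := by
  rw [addRowMat, Matrix.mul_add, Matrix.mul_one, Matrix.mul_vecMulVec]

theorem mul_addColMat {ι : Type} (d : Fin (r + 1) ⊕ Fin s → Gr N)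
    (M : Matrix ι (Fin (r + 1) ⊕ Fin s) (Gr N)) :
    M * addColMat d = M + Matrix.of fun a k => M a (newIdx r s) * d k := by
  rw [addColMat, Matrix.mul_add, Matrix.mul_one]
  congr 1
  ext a k
  simp [Matrix.mul_apply, Matrix.vecMulVec_apply, Pi.single_apply, ← mul_assoc]

theorem addColMat_mul {ι : Type} (d : Fin (r + 1) ⊕ Fin s → Gr N)
    (M : Matrix (Fin (r + 1) ⊕ Fin s) ι (Gr N)) :
    addColMat d * M = M + Matrix.vecMulVec (Pi.single (newIdx r s) 1) (Matrix.vecMul d M) := by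
  rw [addColMat, Matrix.add_mul, Matrix.one_mul, Matrix.vecMulVec_mul]

/-- An even row of an invertible supermatrix has an invertible entry in an even column. -/
theorem IsGL.exists_isUnit_row {a b : ℕ} {g : Matrix (Fin a ⊕ Fin b) (Fin a ⊕ Fin b) (Gr N)}
    (hg : IsGL g) (i : Fin a) : ∃ j, IsUnit (g (.inl i) (.inl j)) := by
  by_contra! h
  have h1 := hg.isUnit₁₁
  rw [isUnit_iff_bodyMat, Matrix.isUnit_iff_isUnit_det, isUnit_iff_ne_zero] at h1
  refine h1 (Matrix.det_eq_zero_of_row_eq_zero i fun j => ?_)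
  have := h j
  rw [isUnit_iff_body, not_not] at this
  exact this

theorem IsGL.exists_isUnit_col {a b : ℕ} {g : Matrix (Fin a ⊕ Fin b) (Fin a ⊕ Fin b) (Gr N)}
    (hg : IsGL g) (j : Fin a) : ∃ i, IsUnit (g (.inl i) (.inl j)) := by
  by_contra! h
  have h1 := hg.isUnit₁₁
  rw [isUnit_iff_bodyMat, Matrix.isUnit_iff_isUnit_det, isUnit_iff_ne_zero] at h1
  refine h1 (Matrix.det_eq_zero_of_column_eq_zero j fun i => ?_)
  have := h i
  rw [isUnit_iff_body, not_not] at this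
  exact this

/-- The transformations `(P, W) ↦ (P + a W, g W)` are generated by the addition of multiples of the
last even row of `W` and the transformations that use this row only to rescale it. -/
theorem row_induction {n m : ℕ}
    {Q : Matrix (Fin n ⊕ Fin m) (Fin (r + 1) ⊕ Fin s) (Gr N) →
      Matrix (Fin (r + 1) ⊕ Fin s) (Fin (r + 1) ⊕ Fin s) (Gr N) → Prop}
    (hmul : ∀ a g a' g', IsSuper a → IsGL g → IsSuper a' → IsGL g' → Q a g → Q a' g' →
      Q (a + a' * g) (g' * g))
    (hU : ∀ (c : Fin n ⊕ Fin m → Gr N) (d : Fin (r + 1) ⊕ Fin s → Gr N),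
      (∀ a, c a ∈ Par N (par a)) → (∀ a, d a ∈ Par N (par a)) → d (newIdx r s) = 0 →
        Q (Matrix.vecMulVec c (Pi.single (newIdx r s) 1)) (addRowMat d))
    (hL : ∀ a g, IsSuper a → IsGL g → (∀ A, a A (newIdx r s) = 0) →
      (∀ F, g (oldIdx r s F) (newIdx r s) = 0) → Q a g)
    (a : Matrix (Fin n ⊕ Fin m) (Fin (r + 1) ⊕ Fin s) (Gr N))
    (g : Matrix (Fin (r + 1) ⊕ Fin s) (Fin (r + 1) ⊕ Fin s) (Gr N)) (ha : IsSuper a)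
    (hg : IsGL g) : Q a g := by
  -- with an invertible last even diagonal entry, the last even column is cleared by elimination
  have key : ∀ a g, IsSuper a → IsGL g → IsUnit (g (newIdx r s) (newIdx r s)) → Q a g := by
    intro a g ha hg hu
    set e := g (newIdx r s) (newIdx r s) with he
    have hee : e ∈ Par N 0 := hg.1.entry (newIdx r s) (newIdx r s) rfl
    have hie := inverse_mem_even hee
    let d : Fin (r + 1) ⊕ Fin s → Gr N := fun F =>
      if F = newIdx r s then 0 else g F (newIdx r s) * Ring.inverse e
    let c : Fin n ⊕ Fin m → Gr N := fun A => a A (newIdx r s) * Ring.inverse e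
    have hd : ∀ F, d F ∈ Par N (par F) := fun F => by
      simp only [d]
      split_ifs
      · exact zero_mem _
      · exact Par.mul_of (i := par F) (j := 0) rfl (hg.1.entry F (newIdx r s) rfl) hie
    have hc : ∀ F, c F ∈ Par N (par F) := fun F =>
      Par.mul_of (i := par F) (j := 0) rfl (ha.entry F (newIdx r s) rfl) hie
    have hdy : d (newIdx r s) = 0 := if_pos rfl
    have hnd : ∀ F, (-d) F ∈ Par N (par F) := fun F => neg_mem (hd F)
    have hndy : (-d) (newIdx r s) = 0 := by rw [Pi.neg_apply, hdy, neg_zero]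
    have hUgl := (isGL_addRowMat hd hdy).1
    have hUgl' := (isGL_addRowMat hnd hndy).1
    have hUU : addRowMat d * addRowMat (-d) = 1 := by
      rw [addRowMat_mul, addRowMat]
      ext a k
      simp [Matrix.vecMulVec_apply, hdy, Matrix.one_apply, Pi.single_apply, eq_comm]
    let g₁ := addRowMat (-d) * g
    let a₁ := a - Matrix.of fun A k => c A * g (newIdx r s) k
    have hg₁ : IsGL g₁ := hUgl'.mul hg
    have hcs : IsSuper (Matrix.of fun A k => c A * g (newIdx r s) k) := fun A k => by
      have := hg.1.entry (newIdx r s) k (i := par k) (by simp [par])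
      exact Par.mul (hc A) this
    have ha₁ : IsSuper a₁ := ha.sub hcs
    have hgy : ∀ k, g₁ (newIdx r s) k = g (newIdx r s) k := fun k => by
      simp only [g₁]
      rw [addRowMat_mul]
      simp [hdy]
    have h1 := hL a₁ g₁ ha₁ hg₁ (fun A => by
        simp only [a₁, c, Matrix.sub_apply, Matrix.of_apply]
        rw [mul_assoc, ← he, Ring.inverse_mul_cancel _ hu, mul_one, sub_self])
      (fun F => by
        simp only [g₁]
        rw [addRowMat_mul]
        simp only [Matrix.add_apply, Matrix.of_apply, d, Pi.neg_apply,
          if_neg (oldIdx_ne_newIdx F)]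
        rw [neg_mul, mul_assoc, ← he, Ring.inverse_mul_cancel _ hu, mul_one, add_neg_cancel])
    have h2 := hmul _ _ _ _ ha₁ hg₁ (isSuper_vecMulVec hc fun k => single_mem _ k rfl Par.one_mem)
      hUgl h1 (hU c d hc hd hdy)
    have e1 : addRowMat d * g₁ = g := by
      simp only [g₁]
      rw [← Matrix.mul_assoc, hUU, Matrix.one_mul]
    have e2 : a₁ + Matrix.vecMulVec c (Pi.single (newIdx r s) 1) * g₁ = a := by
      have : Matrix.vecMulVec c (Pi.single (newIdx r s) 1) * g₁ =
          Matrix.of fun A k => c A * g (newIdx r s) k := by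
        ext A k
        simp [Matrix.mul_apply, Matrix.vecMulVec_apply, Pi.single_apply, mul_assoc, hgy]
      rw [this, sub_add_cancel]
    rwa [e1, e2] at h2
  by_cases hu : IsUnit (g (newIdx r s) (newIdx r s))
  · exact key a g ha hg hu
  -- otherwise an even column with an invertible entry is first added to the last one
  obtain ⟨j, hj⟩ := hg.exists_isUnit_row (Fin.last r)
  have hjl : (.inl j : Fin (r + 1) ⊕ Fin s) ≠ newIdx r s := by
    rintro h
    rw [h] at hj
    exact hu hj
  let d : Fin (r + 1) ⊕ Fin s → Gr N := Pi.single (.inl j) 1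
  have hd : ∀ F, d F ∈ Par N (par F) := fun F => single_mem _ F rfl Par.one_mem
  have hdy : d (newIdx r s) = 0 := Pi.single_eq_of_ne hjl.symm _
  have hnd : ∀ F, (-d) F ∈ Par N (par F) := fun F => neg_mem (hd F)
  have hndy : (-d) (newIdx r s) = 0 := by rw [Pi.neg_apply, hdy, neg_zero]
  have hU1 := (isGL_addRowMat hd hdy).1
  have hU2 := (isGL_addRowMat hnd hndy).1
  have hUU : addRowMat d * addRowMat (-d) = 1 := by
    rw [addRowMat_mul, addRowMat]
    ext a k
    simp [Matrix.vecMulVec_apply, hdy, Matrix.one_apply, Pi.single_apply, eq_comm]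
  have h1 := key (a * addRowMat d) (g * addRowMat d) (ha.mul hU1.1) (hg.mul hU1) (by
    have : (g * addRowMat d) (newIdx r s) (newIdx r s) =
        g (newIdx r s) (newIdx r s) + g (newIdx r s) (.inl j) := by
      rw [mul_addRowMat]
      simp [Matrix.vecMulVec_apply, d]
    rw [this, isUnit_iff_body, map_add, not_not.1 (fun h => hu (isUnit_iff_body.2 h)), zero_add]
    exact isUnit_iff_body.1 hj)
  have h2 := hU 0 (-d) (fun _ => zero_mem _) hnd hndy
  have h3 := hmul (Matrix.vecMulVec 0 (Pi.single (newIdx r s) 1)) _ _ _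
    (isSuper_vecMulVec (fun _ => zero_mem _) fun k => single_mem _ k rfl Par.one_mem) hU2 (ha.mul hU1.1) (hg.mul hU1) h2 h1
  rwa [Matrix.zero_vecMulVec, zero_add, Matrix.mul_assoc, Matrix.mul_assoc, hUU, Matrix.mul_one,
    Matrix.mul_one] at h3

/-- The group `GL(p+1|q)` is generated by the matrices that add multiples of the last even column
and the matrices that use this column only to rescale it. -/
theorem col_induction {Q : Matrix (Fin (r + 1) ⊕ Fin s) (Fin (r + 1) ⊕ Fin s) (Gr N) → Prop}
    (hmul : ∀ g g', IsGL g → IsGL g' → Q g → Q g' → Q (g * g'))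
    (hU : ∀ d : Fin (r + 1) ⊕ Fin s → Gr N,
      (∀ a, d a ∈ Par N (par a)) → d (newIdx r s) = 0 → Q (addColMat d))
    (hL : ∀ g, IsGL g → (∀ F, g (newIdx r s) (oldIdx r s F) = 0) → Q g)
    (g : Matrix (Fin (r + 1) ⊕ Fin s) (Fin (r + 1) ⊕ Fin s) (Gr N)) (hg : IsGL g) : Q g := by
  have hUU : ∀ d : Fin (r + 1) ⊕ Fin s → Gr N, d (newIdx r s) = 0 →
      addColMat (-d) * addColMat d = 1 := by
    intro d hdy
    rw [mul_addColMat, addColMat]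
    ext a k
    simp [Matrix.vecMulVec_apply, hdy, Matrix.one_apply, Pi.single_apply]
  -- with an invertible last even diagonal entry, the last even row is cleared by elimination
  have key : ∀ g, IsGL g → IsUnit (g (newIdx r s) (newIdx r s)) → Q g := by
    intro g hg hu
    set e := g (newIdx r s) (newIdx r s) with he
    have hee : e ∈ Par N 0 := hg.1.entry (newIdx r s) (newIdx r s) rfl
    have hie := inverse_mem_even hee
    let d : Fin (r + 1) ⊕ Fin s → Gr N := fun F =>
      if F = newIdx r s then 0 else Ring.inverse e * g (newIdx r s) F
    have hd : ∀ F, d F ∈ Par N (par F) := fun F => by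
      simp only [d]
      split_ifs
      · exact zero_mem _
      · exact Par.mul_of (i := 0) (j := par F) (by simp) hie (hg.1.entry (newIdx r s) F (by simp [par]))
    have hdy : d (newIdx r s) = 0 := if_pos rfl
    have hnd : ∀ F, (-d) F ∈ Par N (par F) := fun F => neg_mem (hd F)
    have hndy : (-d) (newIdx r s) = 0 := by rw [Pi.neg_apply, hdy, neg_zero]
    have hUgl := (isGL_addColMat hd hdy).1
    have hUgl' := (isGL_addColMat hnd hndy).1
    let g₁ := g * addColMat (-d)
    have hg₁ : IsGL g₁ := hg.mul hUgl'
    have h1 := hL g₁ hg₁ (fun F => by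
        simp only [g₁]
        rw [mul_addColMat]
        simp only [Matrix.add_apply, Matrix.of_apply, d, Pi.neg_apply,
          if_neg (oldIdx_ne_newIdx F)]
        rw [mul_neg, ← mul_assoc, ← he, Ring.mul_inverse_cancel _ hu, one_mul, add_neg_cancel])
    have h2 := hmul _ _ hg₁ hUgl h1 (hU d hd hdy)
    have e1 : g₁ * addColMat d = g := by
      simp only [g₁]
      rw [Matrix.mul_assoc, hUU d hdy, Matrix.mul_one]
    rwa [e1] at h2
  by_cases hu : IsUnit (g (newIdx r s) (newIdx r s))
  · exact key g hg hu
  -- otherwise an even row with an invertible entry is first added to the last one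
  obtain ⟨j, hj⟩ := hg.exists_isUnit_col (Fin.last r)
  have hjl : (.inl j : Fin (r + 1) ⊕ Fin s) ≠ newIdx r s := by
    rintro h
    rw [h] at hj
    exact hu hj
  let d : Fin (r + 1) ⊕ Fin s → Gr N := Pi.single (.inl j) 1
  have hd : ∀ F, d F ∈ Par N (par F) := fun F => single_mem _ F rfl Par.one_mem
  have hdy : d (newIdx r s) = 0 := Pi.single_eq_of_ne hjl.symm _
  have hnd : ∀ F, (-d) F ∈ Par N (par F) := fun F => neg_mem (hd F)
  have hndy : (-d) (newIdx r s) = 0 := by rw [Pi.neg_apply, hdy, neg_zero]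
  have hU1 := (isGL_addColMat hd hdy).1
  have hU2 := (isGL_addColMat hnd hndy).1
  have h1 := key (addColMat d * g) (hU1.mul hg) (by
    have : (addColMat d * g) (newIdx r s) (newIdx r s) =
        g (newIdx r s) (newIdx r s) + g (.inl j) (newIdx r s) := by
      rw [addColMat_mul]
      simp [Matrix.vecMulVec_apply, d]
    rw [this, isUnit_iff_body, map_add, not_not.1 (fun h => hu (isUnit_iff_body.2 h)), zero_add]
    exact isUnit_iff_body.1 hj)
  have h3 := hmul _ _ hU2 (hU1.mul hg) (hU _ hnd hndy) h1
  rwa [← Matrix.mul_assoc, hUU d hdy, Matrix.one_mul] at h3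

end LastIdx

/-! ### Functions of a part of the rows and columns -/

section Restrict
variable {R0 R1 C0 C1 R0' R1' C0' C1' : Type} [Fintype R0] [Fintype R1] [Fintype C0] [Fintype C1]
  [Fintype R0'] [Fintype R1'] [Fintype C0'] [Fintype C1']
  (ρ₀ : R0 → R0') (ρ₁ : R1 → R1') (κ₀ : C0 → C0') (κ₁ : C1 → C1')

/-- The substitution of a generic supermatrix by the submatrix with the given rows and columns. -/
abbrev subSubst : Subst R0 R1 C0 C1 R0' R1' C0' C1' where
  ee a k := .inl (ρ₀ a, κ₀ k)
  oo a k := .inl (ρ₁ a, κ₁ k)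
  eo a k := some (ρ₀ a, κ₁ k)
  oe a k := some (ρ₁ a, κ₀ k)

variable {U : TopologicalSpace.Opens (Ev R0 R1 C0 C1 → ℝ)}
  {U' : TopologicalSpace.Opens (Ev R0' R1' C0' C1' → ℝ)}
  (hU : ∀ x ∈ U', (subSubst ρ₀ ρ₁ κ₀ κ₁).even x ∈ U)

theorem value_sub_pull {N : ℕ} {M : Matrix (R0' ⊕ R1') (C0' ⊕ C1') (Gr N)} (hM : IsPoint U' M)
    (f : SFun U (Od R0 R1 C0 C1)) : value ((subSubst ρ₀ ρ₁ κ₀ κ₁).pull hU f) M =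
      value f (M.submatrix (Sum.map ρ₀ ρ₁) (Sum.map κ₀ κ₁)) := by
  rw [Subst.value_pull _ hU hM]
  congr 1
  ext (a | a) (k | k) <;> rfl

variable {ρ₀ ρ₁ κ₀ κ₁}

theorem pd_sub_pull (h₀ : Function.Injective ρ₀) (h₁ : Function.Injective ρ₁)
    (h₂ : Function.Injective κ₀) (h₃ : Function.Injective κ₁) (a : R0 ⊕ R1) (k : C0 ⊕ C1)
    (f : SFun U (Od R0 R1 C0 C1)) :
    pd U' (Sum.map ρ₀ ρ₁ a) (Sum.map κ₀ κ₁ k) ((subSubst ρ₀ ρ₁ κ₀ κ₁).pull hU f) =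
      (subSubst ρ₀ ρ₁ κ₀ κ₁).pull hU (pd U a k f) := by
  refine Subst.pd_pull _ hU ?_ f
  rcases a with a | a <;> rcases k with k | k
  · rintro (⟨a', k'⟩ | ⟨a', k'⟩) <;> simp [Subst.evIdx, h₀.eq_iff, h₂.eq_iff]
  · refine ⟨?_, by simp [Subst.odd]⟩
    rintro (⟨a', k'⟩ | ⟨a', k'⟩) hi
    · simp only [ne_eq, Sum.inl.injEq, Prod.mk.injEq] at hi
      refine Finsupp.single_eq_of_ne fun h => hi ?_
      simpa [h₀.eq_iff, h₃.eq_iff, eq_comm] using h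
    · simp [Subst.odd]
  · refine ⟨?_, by simp [Subst.odd]⟩
    rintro (⟨a', k'⟩ | ⟨a', k'⟩) hi
    · simp [Subst.odd]
    · simp only [ne_eq, Sum.inr.injEq, Prod.mk.injEq] at hi
      refine Finsupp.single_eq_of_ne fun h => hi ?_
      simpa [h₁.eq_iff, h₂.eq_iff, eq_comm] using h
  · rintro (⟨a', k'⟩ | ⟨a', k'⟩) <;> simp [Subst.evIdx, h₁.eq_iff, h₃.eq_iff]

theorem pd_sub_pull_of_row {a' : R0' ⊕ R1'} (h : ∀ a, Sum.map ρ₀ ρ₁ a ≠ a') (k' : C0' ⊕ C1')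
    (f : SFun U (Od R0 R1 C0 C1)) : pd U' a' k' ((subSubst ρ₀ ρ₁ κ₀ κ₁).pull hU f) = 0 := by
  refine Subst.pd_pull_eq_zero _ hU ?_ f
  rcases a' with a' | a' <;> rcases k' with k' | k' <;> rintro (⟨a, k⟩ | ⟨a, k⟩) <;>
    first
    | (have := h (.inl a)
       simp only [Sum.map_inl, ne_eq, Sum.inl.injEq, reduceCtorEq, not_false_eq_true] at this
       simp [Subst.evIdx, Subst.odd, this])
    | (have := h (.inr a)
       simp only [Sum.map_inr, ne_eq, Sum.inr.injEq, reduceCtorEq, not_false_eq_true] at this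
       simp [Subst.evIdx, Subst.odd, this])

theorem pd_sub_pull_of_col {k' : C0' ⊕ C1'} (h : ∀ k, Sum.map κ₀ κ₁ k ≠ k') (a' : R0' ⊕ R1')
    (f : SFun U (Od R0 R1 C0 C1)) : pd U' a' k' ((subSubst ρ₀ ρ₁ κ₀ κ₁).pull hU f) = 0 := by
  refine Subst.pd_pull_eq_zero _ hU ?_ f
  rcases a' with a' | a' <;> rcases k' with k' | k' <;> rintro (⟨a, k⟩ | ⟨a, k⟩) <;>
    first
    | (have := h (.inl k)
       simp only [Sum.map_inl, ne_eq, Sum.inl.injEq, reduceCtorEq, not_false_eq_true] at this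
       simp [Subst.evIdx, Subst.odd, this])
    | (have := h (.inr k)
       simp only [Sum.map_inr, ne_eq, Sum.inr.injEq, reduceCtorEq, not_false_eq_true] at this
       simp [Subst.evIdx, Subst.odd, this])

theorem SecondOrderSystem.sub_pull (h₀ : Function.Injective ρ₀) (h₁ : Function.Injective ρ₁)
    (h₂ : Function.Injective κ₀) (h₃ : Function.Injective κ₁) {f : SFun U (Od R0 R1 C0 C1)}
    (hf : SecondOrderSystem f) : SecondOrderSystem ((subSubst ρ₀ ρ₁ κ₀ κ₁).pull hU f) := by
  intro a' b' k' l'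
  by_cases ha : ∃ a, Sum.map ρ₀ ρ₁ a = a'
  swap
  · rw [not_exists] at ha
    rw [pd_comm a' b', pd_sub_pull_of_row hU ha k', pd_sub_pull_of_row hU ha l']
    simp
  by_cases hb : ∃ b, Sum.map ρ₀ ρ₁ b = b'
  swap
  · rw [not_exists] at hb
    rw [pd_comm b' a', pd_sub_pull_of_row hU hb k', pd_sub_pull_of_row hU hb l']
    simp
  by_cases hk : ∃ k, Sum.map κ₀ κ₁ k = k'
  swap
  · rw [not_exists] at hk
    rw [pd_comm a' b' k' l', pd_comm b' a' k' l', pd_sub_pull_of_col hU hk a', pd_sub_pull_of_col hU hk b']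
    simp
  by_cases hl : ∃ l, Sum.map κ₀ κ₁ l = l'
  swap
  · rw [not_exists] at hl
    rw [pd_sub_pull_of_col hU hl a', pd_sub_pull_of_col hU hl b']
    simp
  obtain ⟨a, rfl⟩ := ha
  obtain ⟨b, rfl⟩ := hb
  obtain ⟨k, rfl⟩ := hk
  obtain ⟨l, rfl⟩ := hl
  simp only [pd_sub_pull hU h₀ h₁ h₂ h₃, par_map]
  rw [← map_smul, ← map_add, hf, map_zero]

end Restrict

/-! ### Arguments of mixed and straight forms -/

section Args
variable {n m p q r s N : ℕ}

@[simp] theorem par_pRow (A : Fin n ⊕ Fin m) : par (pRow (r := r) (s := s) A) = par A :=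
  par_map _ _ A

@[simp] theorem par_wRow (F : Fin r ⊕ Fin s) : par (wRow (n := n) (m := m) F) = par F :=
  par_map _ _ F

theorem mrow_cases (a : MRow n m r s) : (∃ A, a = pRow A) ∨ ∃ F, a = wRow F := by
  rcases a with (a | a) | (a | a)
  · exact .inl ⟨.inl a, rfl⟩
  · exact .inr ⟨.inl a, rfl⟩
  · exact .inl ⟨.inr a, rfl⟩
  · exact .inr ⟨.inr a, rfl⟩

theorem sum_mrow {V : Type} [AddCommMonoid V] (f : MRow n m r s → V) :
    ∑ a, f a = ∑ A, f (pRow A) + ∑ F, f (wRow F) := by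
  simp only [Fintype.sum_sum_type, pRow, wRow, Sum.map_inl, Sum.map_inr]
  abel

section Stack
variable {κ A : Type} (P : Matrix (Fin n ⊕ Fin m) κ A) (W : Matrix (Fin r ⊕ Fin s) κ A)

@[simp] theorem stack_pRow (a : Fin n ⊕ Fin m) : stack P W (pRow a) = P a := by
  rcases a with a | a <;> rfl

@[simp] theorem stack_wRow (a : Fin r ⊕ Fin s) : stack P W (wRow a) = W a := by
  rcases a with a | a <;> rfl

theorem mrow_ext {M M' : Matrix (MRow n m r s) κ A} (h₁ : ∀ a, M (pRow a) = M' (pRow a))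
    (h₂ : ∀ a, M (wRow a) = M' (wRow a)) : M = M' := by
  funext a
  rcases mrow_cases a with ⟨a, rfl⟩ | ⟨a, rfl⟩
  · exact h₁ a
  · exact h₂ a

theorem stack_eta (M : Matrix (MRow n m r s) κ A) :
    stack (M.submatrix pRow id) (M.submatrix wRow id) = M :=
  mrow_ext (fun a => by rw [stack_pRow]; rfl) (fun a => by rw [stack_wRow]; rfl)

theorem stack_mul {lam : Type} [Fintype κ] [NonUnitalNonAssocSemiring A] (h : Matrix κ lam A) :
    stack P W * h = stack (P * h) (W * h) :=
  mrow_ext (fun a => by ext k; simp [Matrix.mul_apply]) (fun a => by ext k; simp [Matrix.mul_apply])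

theorem stack_map {B : Type} (j : A → B) : (stack P W).map j = stack (P.map j) (W.map j) :=
  mrow_ext (fun a => by ext k; simp) (fun a => by ext k; simp)

theorem stack_submatrix {lam : Type} (j : lam → κ) :
    (stack P W).submatrix id j = stack (P.submatrix id j) (W.submatrix id j) :=
  mrow_ext (fun a => by ext k; simp) (fun a => by ext k; simp)

theorem stack_add [Add A] (P' : Matrix (Fin n ⊕ Fin m) κ A) (W' : Matrix (Fin r ⊕ Fin s) κ A) :
    stack P W + stack P' W' = stack (P + P') (W + W') :=
  mrow_ext (fun a => by ext k; simp) (fun a => by ext k; simp)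

end Stack

theorem isSuper_stack_iff {C0 C1 : Type} {P : Matrix (Fin n ⊕ Fin m) (C0 ⊕ C1) (Gr N)}
    {W : Matrix (Fin r ⊕ Fin s) (C0 ⊕ C1) (Gr N)} :
    IsSuper (stack P W) ↔ IsSuper P ∧ IsSuper W := by
  constructor
  · intro h
    refine ⟨fun a k => ?_, fun a k => ?_⟩
    · have := h (pRow a) k
      rwa [stack_pRow, par_pRow] at this
    · have := h (wRow a) k
      rwa [stack_wRow, par_wRow] at this
  · rintro ⟨h1, h2⟩ a k
    rcases mrow_cases a with ⟨a, rfl⟩ | ⟨a, rfl⟩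
    · have := h1 a k
      rwa [stack_pRow, par_pRow]
    · have := h2 a k
      rwa [stack_wRow, par_wRow]

theorem bodyMat_mul_toBlocks₂₂ {R0 R1 C0 C1 D0 D1 : Type} [Fintype C0] [Fintype C1]
    {M : Matrix (R0 ⊕ R1) (C0 ⊕ C1) (Gr N)} {M' : Matrix (C0 ⊕ C1) (D0 ⊕ D1) (Gr N)}
    (hM : IsSuper M) : bodyMat (M * M').toBlocks₂₂ =
      bodyMat M.toBlocks₂₂ * bodyMat M'.toBlocks₂₂ := by
  ext i j
  have h1 : ∀ c, body (M (.inr i) (.inl c)) = 0 := fun c =>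
    body_odd (hM.entry (.inr i) (.inl c) rfl)
  simp [Matrix.mul_apply, Matrix.toBlocks₂₂, h1]

/-- Points of the domain of mixed forms: the columns of the odd-odd block of `(p, w)` and the rows
of the odd-odd block of `w` are linearly independent. -/
theorem isPoint_mixed_iff {P : Matrix (Fin n ⊕ Fin m) (Fin p ⊕ Fin q) (Gr N)}
    {W : Matrix (Fin r ⊕ Fin s) (Fin p ⊕ Fin q) (Gr N)} :
    IsPoint (mixedDom n m p q r s) (stack P W) ↔ (IsSuper P ∧ IsSuper W) ∧
      (∀ v, (bodyMat P.toBlocks₂₂).mulVec v = 0 → (bodyMat W.toBlocks₂₂).mulVec v = 0 → v = 0) ∧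
        ∀ v, Matrix.vecMul v (bodyMat W.toBlocks₂₂) = 0 → v = 0 := by
  refine and_congr isSuper_stack_iff ?_
  refine and_congr ?_ ?_
  · rw [Fintype.linearIndependent_iff]
    have e : ∀ v : Fin q → ℝ, (∑ K, v K • fun a : Fin m ⊕ Fin s =>
        body (evPart (stack P W) (.inr (a, K)))) = 0 ↔
        (bodyMat P.toBlocks₂₂).mulVec v = 0 ∧ (bodyMat W.toBlocks₂₂).mulVec v = 0 := by
      intro v
      rw [funext_iff, funext_iff, funext_iff, Sum.forall]
      refine and_congr (forall_congr' fun a => ?_) (forall_congr' fun a => ?_) <;>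
      · simp only [Finset.sum_apply, Pi.smul_apply, smul_eq_mul, Matrix.mulVec, dotProduct,
          Pi.zero_apply, mul_comm (v _)]
        rfl
    constructor
    · exact fun h v h1 h2 => funext (h v ((e v).2 ⟨h1, h2⟩))
    · intro h v hv i
      have := (e v).1 hv
      rw [h v this.1 this.2]
      rfl
  · rw [Fintype.linearIndependent_iff]
    have e : ∀ v : Fin s → ℝ, (∑ F, v F • fun K : Fin q =>
        body (evPart (stack P W) (.inr (.inr F, K)))) = 0 ↔
        Matrix.vecMul v (bodyMat W.toBlocks₂₂) = 0 := by
      intro v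
      rw [funext_iff, funext_iff]
      refine forall_congr' fun a => ?_
      simp only [Finset.sum_apply, Pi.smul_apply, smul_eq_mul, Matrix.vecMul, dotProduct,
          Pi.zero_apply]
      rfl
    constructor
    · exact fun h v h1 => funext (h v ((e v).2 h1))
    · intro h v hv i
      rw [h v ((e v).1 hv)]
      rfl

theorem isPoint_straight_iff {v : Matrix (Fin r ⊕ Fin s) (Fin n ⊕ Fin m) (Gr N)} :
    IsPoint (straightDom n m r s) v ↔ IsSuper v ∧
      ∀ c, Matrix.vecMul c (bodyMat v.toBlocks₂₂) = 0 → c = 0 := by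
  refine and_congr Iff.rfl ?_
  change LinearIndependent ℝ _ ↔ _
  rw [Fintype.linearIndependent_iff]
  have e : ∀ c : Fin s → ℝ, (∑ F, c F • fun K : Fin m => body (evPart v (.inr (F, K)))) = 0 ↔
      Matrix.vecMul c (bodyMat v.toBlocks₂₂) = 0 := by
    intro c
    rw [funext_iff, funext_iff]
    refine forall_congr' fun a => ?_
    simp only [Finset.sum_apply, Pi.smul_apply, smul_eq_mul, Matrix.vecMul, dotProduct,
        Pi.zero_apply]
    rfl
  constructor
  · exact fun h v h1 => funext (h v ((e v).2 h1))
  · intro h v hv i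
    rw [h v ((e v).1 hv)]
    rfl

theorem oddDom_mixed : OddDom (mixedDom n m p q r s) := by
  intro x x' h hx
  change LinearIndependent ℝ _ ∧ LinearIndependent ℝ _ at hx ⊢
  simpa only [h] using hx

theorem oddDom_straight : OddDom (straightDom n m r s) := by
  intro x x' h hx
  change LinearIndependent ℝ _ at hx ⊢
  simpa only [h] using hx

theorem vecMul_eq_zero_of_isUnit {ι : Type} [Fintype ι] [DecidableEq ι] {B : Matrix ι ι ℝ}
    (hB : IsUnit B) {v : ι → ℝ} (h : Matrix.vecMul v B = 0) : v = 0 := by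
  have := congrArg (Matrix.vecMul · (Ring.inverse B)) h
  simpa [Matrix.vecMul_vecMul, Ring.mul_inverse_cancel _ hB] using this

theorem mulVec_eq_zero_of_isUnit {ι : Type} [Fintype ι] [DecidableEq ι] {B : Matrix ι ι ℝ}
    (hB : IsUnit B) {v : ι → ℝ} (h : Matrix.mulVec B v = 0) : v = 0 := by
  have := congrArg (Matrix.mulVec (Ring.inverse B)) h
  simpa [Matrix.mulVec_mulVec, Ring.inverse_mul_cancel _ hB] using this

theorem IsGL.isUnit_body₂₂ {a b : ℕ} {g : Matrix (Fin a ⊕ Fin b) (Fin a ⊕ Fin b) (Gr N)}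
    (hg : IsGL g) : IsUnit (bodyMat g.toBlocks₂₂) := isUnit_iff_bodyMat.1 hg.isUnit₂₂

theorem isPoint_mul_right {M : Matrix (MRow n m r s) (Fin p ⊕ Fin q) (Gr N)}
    {h : Matrix (Fin p ⊕ Fin q) (Fin p ⊕ Fin q) (Gr N)} (hM : IsPoint (mixedDom n m p q r s) M)
    (hh : IsGL h) : IsPoint (mixedDom n m p q r s) (M * h) := by
  rw [← stack_eta M] at hM ⊢
  rw [stack_mul]
  rw [isPoint_mixed_iff] at hM ⊢
  obtain ⟨⟨hP, hW⟩, h1, h2⟩ := hM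
  refine ⟨⟨hP.mul hh.1, hW.mul hh.1⟩, fun v hv hv' => ?_, fun v hv => ?_⟩
  · rw [bodyMat_mul_toBlocks₂₂ hP, ← Matrix.mulVec_mulVec] at hv
    rw [bodyMat_mul_toBlocks₂₂ hW, ← Matrix.mulVec_mulVec] at hv'
    exact mulVec_eq_zero_of_isUnit hh.isUnit_body₂₂ (h1 _ hv hv')
  · rw [bodyMat_mul_toBlocks₂₂ hW, ← Matrix.vecMul_vecMul] at hv
    exact h2 _ (vecMul_eq_zero_of_isUnit hh.isUnit_body₂₂ hv)

theorem isPoint_left {P : Matrix (Fin n ⊕ Fin m) (Fin p ⊕ Fin q) (Gr N)}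
    {W : Matrix (Fin r ⊕ Fin s) (Fin p ⊕ Fin q) (Gr N)}
    {a : Matrix (Fin n ⊕ Fin m) (Fin r ⊕ Fin s) (Gr N)}
    {g : Matrix (Fin r ⊕ Fin s) (Fin r ⊕ Fin s) (Gr N)}
    (hM : IsPoint (mixedDom n m p q r s) (stack P W)) (ha : IsSuper a) (hg : IsGL g) :
    IsPoint (mixedDom n m p q r s) (stack (P + a * W) (g * W)) := by
  rw [isPoint_mixed_iff] at hM ⊢
  obtain ⟨⟨hP, hW⟩, h1, h2⟩ := hM
  refine ⟨⟨hP.add (ha.mul hW), hg.1.mul hW⟩, fun v hv hv' => ?_, fun v hv => ?_⟩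
  · rw [bodyMat_mul_toBlocks₂₂ hg.1, ← Matrix.mulVec_mulVec] at hv'
    have hw := mulVec_eq_zero_of_isUnit hg.isUnit_body₂₂ hv'
    refine h1 _ ?_ hw
    have e : bodyMat (P + a * W).toBlocks₂₂ = bodyMat P.toBlocks₂₂ +
        bodyMat a.toBlocks₂₂ * bodyMat W.toBlocks₂₂ := by
      rw [← bodyMat_mul_toBlocks₂₂ ha]
      ext i j
      exact map_add body _ _
    rwa [e, Matrix.add_mulVec, ← Matrix.mulVec_mulVec, hw, Matrix.mulVec_zero, add_zero] at hv
  · rw [bodyMat_mul_toBlocks₂₂ hg.1, ← Matrix.vecMul_vecMul] at hv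
    exact vecMul_eq_zero_of_isUnit hg.isUnit_body₂₂ (h2 _ hv)

theorem isPoint_straight_mul {v : Matrix (Fin r ⊕ Fin s) (Fin n ⊕ Fin m) (Gr N)}
    {g : Matrix (Fin r ⊕ Fin s) (Fin r ⊕ Fin s) (Gr N)} (hv : IsPoint (straightDom n m r s) v)
    (hg : IsGL g) : IsPoint (straightDom n m r s) (g * v) := by
  rw [isPoint_straight_iff] at hv ⊢
  refine ⟨hg.1.mul hv.1, fun c hc => ?_⟩
  rw [bodyMat_mul_toBlocks₂₂ hg.1, ← Matrix.vecMul_vecMul] at hc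
  exact vecMul_eq_zero_of_isUnit hg.isUnit_body₂₂ (hv.2 _ hc)

theorem isPoint_straight_mul_right {v : Matrix (Fin r ⊕ Fin s) (Fin n ⊕ Fin m) (Gr N)}
    {h : Matrix (Fin n ⊕ Fin m) (Fin n ⊕ Fin m) (Gr N)} (hv : IsPoint (straightDom n m r s) v)
    (hh : IsGL h) : IsPoint (straightDom n m r s) (v * h) := by
  rw [isPoint_straight_iff] at hv ⊢
  refine ⟨hv.1.mul hh.1, fun c hc => ?_⟩
  rw [bodyMat_mul_toBlocks₂₂ hv.1, ← Matrix.vecMul_vecMul] at hc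
  exact hv.2 _ (vecMul_eq_zero_of_isUnit hh.isUnit_body₂₂ hc)

end Args

/-! ### Additional rows and columns -/

section AddRow
variable {n m p q r s N : ℕ}

/-- The rows of `(p, w)`, without the last even row of `w`. -/
abbrev oldRow (n m r s : ℕ) : MRow n m r s → MRow n m (r + 1) s :=
  Sum.map (Sum.map id Fin.castSucc) id

theorem oldRow_pRow (A : Fin n ⊕ Fin m) : oldRow n m r s (pRow A) = pRow A := by
  rcases A with A | A <;> rfl

theorem oldRow_ne (a : MRow n m r s) : oldRow n m r s a ≠ wRow (newIdx r s) := by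
  rcases a with (a | a) | (a | a) <;> simp [wRow, Fin.castSucc_ne_last]

theorem oldRow_castSucc_injective :
    Function.Injective (Sum.map id Fin.castSucc : Fin n ⊕ Fin r → Fin n ⊕ Fin (r + 1)) :=
  Sum.map_injective.2 ⟨Function.injective_id, Fin.castSucc_injective _⟩

theorem value_addRow {P : Matrix (Fin n ⊕ Fin m) (Fin p ⊕ Fin q) (Gr N)}
    {W : Matrix (Fin (r + 1) ⊕ Fin s) (Fin p ⊕ Fin q) (Gr N)}
    (hM : IsPoint (mixedDom n m p q (r + 1) s) (stack P W)) (L : MixedFun n m p q r s) :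
    value (addRow L) (stack P W) = value L (stack P (W.submatrix (oldIdx r s) id)) := by
  refine (value_sub_pull (Sum.map id Fin.castSucc) id id id (fun _ hx => hx) hM L).trans ?_
  rw [Sum.map_id_id]
  congr 1
  exact mrow_ext (fun a => by rcases a with a | a <;> rfl) (fun a => by rcases a with a | a <;> rfl)

theorem isPoint_oldRow {P : Matrix (Fin n ⊕ Fin m) (Fin p ⊕ Fin q) (Gr N)}
    {W : Matrix (Fin (r + 1) ⊕ Fin s) (Fin p ⊕ Fin q) (Gr N)} :
    IsPoint (mixedDom n m p q (r + 1) s) (stack P W) ↔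
      IsSuper W ∧ IsPoint (mixedDom n m p q r s) (stack P (W.submatrix (oldIdx r s) id)) := by
  rw [isPoint_mixed_iff, isPoint_mixed_iff]
  have h : IsSuper W → IsSuper (W.submatrix (oldIdx r s) id) := fun h => by
    have := h.submatrix Fin.castSucc id id id
    rwa [Sum.map_id_id] at this
  have e : (W.submatrix (oldIdx r s) id).toBlocks₂₂ = W.toBlocks₂₂ := rfl
  rw [e]
  tauto

theorem pd_addRow (a : MRow n m r s) (K : Fin p ⊕ Fin q) (L : MixedFun n m p q r s) :
    pd (mixedDom n m p q (r + 1) s) (oldRow n m r s a) K (addRow L) =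
      addRow (pd (mixedDom n m p q r s) a K L) := by
  have h := pd_sub_pull (ρ₀ := Sum.map id Fin.castSucc) (ρ₁ := id) (κ₀ := id) (κ₁ := id)
    (U := mixedDom n m p q r s) (U' := mixedDom n m p q (r + 1) s) (fun _ hx => hx)
    oldRow_castSucc_injective Function.injective_id Function.injective_id Function.injective_id
    a K L
  rw [Sum.map_id_id, id] at h
  exact h

theorem pd_addRow_new (K : Fin p ⊕ Fin q) (L : MixedFun n m p q r s) :
    pd (mixedDom n m p q (r + 1) s) (wRow (newIdx r s)) K (addRow L) = 0 :=
  pd_sub_pull_of_row (ρ₀ := Sum.map id Fin.castSucc) (ρ₁ := id) (κ₀ := id) (κ₁ := id)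
    (U := mixedDom n m p q r s) (U' := mixedDom n m p q (r + 1) s) (fun _ hx => hx)
    oldRow_ne K L

theorem SecondOrderSystem.addRow {L : MixedFun n m p q r s} (hL : SecondOrderSystem L) :
    SecondOrderSystem (addRow L) :=
  hL.sub_pull (ρ₀ := Sum.map id Fin.castSucc) (ρ₁ := id) (κ₀ := id) (κ₁ := id)
    (U := mixedDom n m p q r s) (U' := mixedDom n m p q (r + 1) s) (fun _ hx => hx)
    oldRow_castSucc_injective Function.injective_id Function.injective_id Function.injective_id

theorem value_addCol {M : Matrix (MRow n m r s) (Fin (p + 1) ⊕ Fin q) (Gr N)}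
    (hM : IsPoint (mixedDom n m (p + 1) q r s) M) (L : MixedFun n m p q r s) :
    value (addCol L) M = value L (M.submatrix id (oldIdx p q)) := by
  refine (value_sub_pull id id Fin.castSucc id (fun _ hx => hx) hM L).trans ?_
  rw [Sum.map_id_id]

theorem isPoint_oldCol {M : Matrix (MRow n m r s) (Fin (p + 1) ⊕ Fin q) (Gr N)} :
    IsPoint (mixedDom n m (p + 1) q r s) M ↔
      IsSuper M ∧ IsPoint (mixedDom n m p q r s) (M.submatrix id (oldIdx p q)) := by
  constructor
  · intro h
    refine ⟨h.1, ?_, h.2⟩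
    have := h.1.submatrix id id Fin.castSucc id
    rwa [Sum.map_id_id] at this
  · rintro ⟨h, h'⟩
    exact ⟨h, h'.2⟩

theorem pd_addCol (a : MRow n m r s) (K : Fin p ⊕ Fin q) (L : MixedFun n m p q r s) :
    pd (mixedDom n m (p + 1) q r s) a (oldIdx p q K) (addCol L) =
      addCol (pd (mixedDom n m p q r s) a K L) := by
  have h := pd_sub_pull (ρ₀ := id) (ρ₁ := id) (κ₀ := Fin.castSucc) (κ₁ := id)
    (U := mixedDom n m p q r s) (U' := mixedDom n m (p + 1) q r s) (fun _ hx => hx)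
    Function.injective_id Function.injective_id (Fin.castSucc_injective _) Function.injective_id
    a K L
  rw [Sum.map_id_id, id] at h
  exact h

theorem pd_addCol_new (a : MRow n m r s) (L : MixedFun n m p q r s) :
    pd (mixedDom n m (p + 1) q r s) a (newIdx p q) (addCol L) = 0 :=
  pd_sub_pull_of_col (ρ₀ := id) (ρ₁ := id) (κ₀ := Fin.castSucc) (κ₁ := id)
    (U := mixedDom n m p q r s) (U' := mixedDom n m (p + 1) q r s) (fun _ hx => hx)
    oldIdx_ne_newIdx a L

theorem SecondOrderSystem.addCol {L : MixedFun n m p q r s} (hL : SecondOrderSystem L) :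
    SecondOrderSystem (addCol L) :=
  hL.sub_pull (ρ₀ := id) (ρ₁ := id) (κ₀ := Fin.castSucc) (κ₁ := id)
    (U := mixedDom n m p q r s) (U' := mixedDom n m (p + 1) q r s) (fun _ hx => hx)
    Function.injective_id Function.injective_id (Fin.castSucc_injective _) Function.injective_id

theorem value_addVec {v : Matrix (Fin (r + 1) ⊕ Fin s) (Fin n ⊕ Fin m) (Gr N)}
    (hv : IsPoint (straightDom n m (r + 1) s) v) (L : StraightFun n m r s) :
    value (addVec L) v = value L (v.submatrix (oldIdx r s) id) := by
  refine (value_sub_pull Fin.castSucc id id id (fun _ hx => hx) hv L).trans ?_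
  rw [Sum.map_id_id]

theorem isPoint_oldVec {v : Matrix (Fin (r + 1) ⊕ Fin s) (Fin n ⊕ Fin m) (Gr N)} :
    IsPoint (straightDom n m (r + 1) s) v ↔
      IsSuper v ∧ IsPoint (straightDom n m r s) (v.submatrix (oldIdx r s) id) := by
  constructor
  · intro h
    refine ⟨h.1, ?_, h.2⟩
    have := h.1.submatrix Fin.castSucc id id id
    rwa [Sum.map_id_id] at this
  · rintro ⟨h, h'⟩
    exact ⟨h, h'.2⟩

theorem pd_addVec (F : Fin r ⊕ Fin s) (A : Fin n ⊕ Fin m) (L : StraightFun n m r s) :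
    pd (straightDom n m (r + 1) s) (oldIdx r s F) A (addVec L) =
      addVec (pd (straightDom n m r s) F A L) := by
  have h := pd_sub_pull (ρ₀ := Fin.castSucc) (ρ₁ := id) (κ₀ := id) (κ₁ := id)
    (U := straightDom n m r s) (U' := straightDom n m (r + 1) s) (fun _ hx => hx)
    (Fin.castSucc_injective _) Function.injective_id Function.injective_id Function.injective_id
    F A L
  rw [Sum.map_id_id, id] at h
  exact h

theorem pd_addVec_new (A : Fin n ⊕ Fin m) (L : StraightFun n m r s) :
    pd (straightDom n m (r + 1) s) (newIdx r s) A (addVec L) = 0 :=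
  pd_sub_pull_of_row (ρ₀ := Fin.castSucc) (ρ₁ := id) (κ₀ := id) (κ₁ := id)
    (U := straightDom n m r s) (U' := straightDom n m (r + 1) s) (fun _ hx => hx)
    oldIdx_ne_newIdx A L

theorem SecondOrderSystem.addVec {L : StraightFun n m r s} (hL : SecondOrderSystem L) :
    SecondOrderSystem (addVec L) :=
  hL.sub_pull (ρ₀ := Fin.castSucc) (ρ₁ := id) (κ₀ := id) (κ₁ := id)
    (U := straightDom n m r s) (U' := straightDom n m (r + 1) s) (fun _ hx => hx)
    (Fin.castSucc_injective _) Function.injective_id Function.injective_id Function.injective_id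

/-! ### The operators in terms of the elementary operators -/

theorem eCov_eq (α : Fin n ⊕ Fin m → ℝ) (L : MixedFun n m p q r s) :
    eCov α L = sg r • ∑ A, (α A * sg (par A)) •
      rowD (mixedDom n m p q (r + 1) s) (wRow (newIdx r s)) (pRow A) (addRow L) := by
  rw [eCov]
  congr 1
  refine Finset.sum_congr rfl fun A _ => ?_
  rw [rowD_apply, Finset.smul_sum]
  refine Finset.sum_congr rfl fun K _ => ?_
  have h := pd_addRow (pRow A) K L
  rw [oldRow_pRow] at h
  rw [h]

theorem sum_mul_pd_addCol (A : Fin n ⊕ Fin m) (e : ℕ) (b : MRow n m r s)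
    (y : MixedFun n m (p + 1) q r s) (L : MixedFun n m p q r s) :
    ∑ K, sg (e * par K) • (coord (mixedDom n m (p + 1) q r s) (pRow A) K * y *
        pd (mixedDom n m (p + 1) q r s) b K (addCol L)) =
      ∑ K, sg (e * par K) • (coord (mixedDom n m (p + 1) q r s) (pRow A) (oldIdx p q K) * y *
        addCol (pd (mixedDom n m p q r s) b K L)) := by
  have h0 := pd_addCol_new b L
  have h1 := fun K => pd_addCol b K L
  generalize addCol L = f at *
  have h2 : sg (e * par (newIdx p q)) •
      (coord (mixedDom n m (p + 1) q r s) (pRow A) (newIdx p q) * y *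
        pd (mixedDom n m (p + 1) q r s) b (newIdx p q) f) = 0 := by
    refine (congrArg (fun z => sg (e * par (newIdx p q)) •
      (coord (mixedDom n m (p + 1) q r s) (pRow A) (newIdx p q) * y * z)) h0).trans ?_
    simp only [mul_zero, smul_zero]
  refine (sum_oldIdx _).trans ((congrArg (_ + ·) h2).trans ((add_zero _).trans ?_))
  refine Finset.sum_congr rfl fun K _ => ?_
  refine congrArg₂ (· • ·) (congrArg (fun z => sg (e * z)) (par_map _ _ _)) ?_
  exact congrArg (fun z => coord (mixedDom n m (p + 1) q r s) (pRow A) (oldIdx p q K) * y * z) (h1 K)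

theorem eVec_eq (u : Fin n ⊕ Fin m → ℝ) (L : MixedFun n m p q r s) :
    eVec u L = sg r • ∑ A, u A •
      crossD (mixedDom n m (p + 1) q r s) (pRow A) (newIdx p q) (addCol L) := by
  rw [eVec]
  congr 1
  refine Finset.sum_congr rfl fun A _ => ?_
  congr 1
  rw [crossD_apply, sub_sub]
  congr 1
  have h : ∀ K, coord (mixedDom n m (p + 1) q r s) (pRow A) K *
      colD (mixedDom n m (p + 1) q r s) (newIdx p q) K (addCol L) =
      ∑ B, sg (par B * par K) • (coord (mixedDom n m (p + 1) q r s) (pRow A) K *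
        coord (mixedDom n m (p + 1) q r s) (pRow B) (newIdx p q) *
        pd (mixedDom n m (p + 1) q r s) (pRow B) K (addCol L)) +
      ∑ F, sg (par F * par K) • (coord (mixedDom n m (p + 1) q r s) (pRow A) K *
        coord (mixedDom n m (p + 1) q r s) (wRow F) (newIdx p q) *
        pd (mixedDom n m (p + 1) q r s) (wRow F) K (addCol L)) := by
    intro K
    rw [colD_apply, Finset.mul_sum, sum_mrow]
    congr 1 <;>
    · refine Finset.sum_congr rfl fun B _ => ?_
      rw [mul_smul_comm, mul_assoc]
      simp only [par_pRow, par_wRow, show par (newIdx p q) = 0 from rfl, mul_zero, zero_mul,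
        add_zero, zero_add]
  simp only [h]
  rw [Finset.sum_add_distrib]
  refine congrArg₂ (· + ·) ?_ ?_
  · refine Eq.trans (Finset.sum_congr rfl fun B _ => ?_) Finset.sum_comm
    exact (sum_mul_pd_addCol A (par B) (pRow B) _ L).symm
  · refine Eq.trans (Finset.sum_congr rfl fun F _ => ?_) Finset.sum_comm
    exact (sum_mul_pd_addCol A (par F) (wRow F) _ L).symm

theorem crossD_eq_rowD {R0 R1 C0 C1 : Type} [Fintype R0] [Fintype R1] [Fintype C0] [Fintype C1]
    {U : TopologicalSpace.Opens (Ev R0 R1 C0 C1 → ℝ)} (f : SFun U (Od R0 R1 C0 C1)) (i : R0 ⊕ R1)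
    (j : C0 ⊕ C1) : crossD U i j f = coord U i j * f -
      ∑ b, sg (par i * par b + par i * par j + par b * par j) • (coord U b j * rowD U i b f) := by
  rw [crossD_apply]
  congr 1
  simp only [rowD_apply, colD_apply, Finset.mul_sum, Finset.smul_sum]
  rw [Finset.sum_comm]
  refine Finset.sum_congr rfl fun b _ => Finset.sum_congr rfl fun K _ => ?_
  rw [mul_smul_comm, ← mul_assoc, ← mul_assoc, coord_comm i b K j, smul_mul_assoc, smul_smul,
    ← sg_add]
  congr 1
  refine sg_of_zmod ?_
  push_cast
  generalize (par b : ZMod 2) = b, (par i : ZMod 2) = i, (par K : ZMod 2) = K,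
    (par j : ZMod 2) = j
  decide +revert

theorem eStraight_eq (α : Fin n ⊕ Fin m → ℝ) (L : StraightFun n m r s) :
    eStraight α L = sg r • ∑ A, α A •
      crossD (straightDom n m (r + 1) s) (newIdx r s) A (addVec L) := by
  rw [eStraight]
  congr 1
  simp only [crossD_eq_rowD, smul_sub, Finset.sum_sub_distrib]
  congr 1
  rw [Finset.sum_comm]
  refine Finset.sum_congr rfl fun A _ => ?_
  rw [sum_oldIdx, rowD_apply]
  simp only [pd_addVec_new, mul_zero, Finset.sum_const_zero, smul_zero, add_zero]
  rw [Finset.smul_sum]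
  refine Finset.sum_congr rfl fun F _ => ?_
  rw [rowD_apply, Finset.mul_sum, Finset.smul_sum, Finset.smul_sum]
  refine Finset.sum_congr rfl fun B _ => ?_
  rw [pd_addVec, smul_smul, mul_assoc, mul_comm (α A)]
  congr 2
  refine sg_congr ?_
  rw [oldIdx, par_map]
  simp [newIdx, par, mul_comm]

theorem eCov_system (α : Fin n ⊕ Fin m → ℝ) {L : MixedFun n m p q r s}
    (hL : SecondOrderSystem L) : SecondOrderSystem (eCov α L) := by
  rw [eCov_eq]
  exact .smul (.sum _ fun A _ => .smul (hL.addRow.rowD _ _) _) _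

theorem eVec_system (u : Fin n ⊕ Fin m → ℝ) {L : MixedFun n m p q r s}
    (hL : SecondOrderSystem L) : SecondOrderSystem (eVec u L) := by
  rw [eVec_eq]
  exact .smul (.sum _ fun A _ => .smul (hL.addCol.crossD _ _) _) _

theorem eStraight_system (α : Fin n ⊕ Fin m → ℝ) {L : StraightFun n m r s}
    (hL : SecondOrderSystem L) : SecondOrderSystem (eStraight α L) := by
  rw [eStraight_eq]
  exact .smul (.sum _ fun A _ => .smul (hL.addVec.crossD _ _) _) _

end AddRow

/-! ### The elementary operators as infinitesimal transformations -/

/-- An infinitesimal of a given parity in a Grassmann algebra: a homogeneous element `η` with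
`η x η = 0` for all `x`, so that everything is affine in `η`. -/
structure IsInf (N i : ℕ) (η : Gr N) : Prop where
  mem : η ∈ Par N i
  mul_mul : ∀ x, η * x * η = 0

theorem isInf_eps (N i : ℕ) : IsInf (N + 2) i (eps N i) := ⟨eps_mem N i, eps_mul_mul_eps N i⟩

theorem IsInf.mul_even {N i : ℕ} {η e : Gr N} (hη : IsInf N i η) (he : e ∈ Par N 0) :
    IsInf N i (η * e) :=
  ⟨Par.mul_of (i := i) (j := 0) rfl hη.mem he, fun x => by
    rw [mul_assoc η e x, ← mul_assoc _ η e, hη.mul_mul, zero_mul]⟩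

/-- An identity may be verified after multiplication by an infinitesimal. -/
theorem eq_of_eps_mul {N : ℕ} (i : ℕ) {x y : Gr N} (h : eps N i * ext N x = eps N i * ext N y) :
    x = y := by
  rw [← sub_eq_zero]
  refine eps_cancel N i ?_
  rw [map_sub, mul_sub, h, sub_self]

/-- The matrix with entries `w_a η v_k`. -/
def infMat {ι κ : Type} {N : ℕ} (w : ι → Gr N) (η : Gr N) (v : κ → Gr N) : Matrix ι κ (Gr N) :=
  Matrix.of fun a k => w a * η * v k

section InfMat
variable {ι κ lam : Type} {N i : ℕ} {η : Gr N}

theorem infMat_apply (w : ι → Gr N) (η : Gr N) (v : κ → Gr N) (a : ι) (k : κ) :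
    infMat w η v a k = w a * η * v k := rfl

theorem mul_infMat [Fintype κ] (M : Matrix ι κ (Gr N)) (w : κ → Gr N) (v : lam → Gr N) :
    M * infMat w η v = infMat (M.mulVec w) η v := by
  ext a k
  simp only [Matrix.mul_apply, infMat_apply, Matrix.mulVec, dotProduct, Finset.sum_mul, mul_assoc]

theorem infMat_mul [Fintype κ] (w : ι → Gr N) (v : κ → Gr N) (M : Matrix κ lam (Gr N)) :
    infMat w η v * M = infMat w η (Matrix.vecMul v M) := by
  ext a k
  simp only [Matrix.mul_apply, infMat_apply, Matrix.vecMul, dotProduct, Finset.mul_sum, mul_assoc]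

theorem infMat_add (w : ι → Gr N) (v v' : κ → Gr N) :
    infMat w η (v + v') = infMat w η v + infMat w η v' := by
  ext a k
  simp only [Matrix.add_apply, infMat_apply, Pi.add_apply, mul_add]

theorem add_infMat (w w' : ι → Gr N) (v : κ → Gr N) :
    infMat (w + w') η v = infMat w η v + infMat w' η v := by
  ext a k
  simp only [Matrix.add_apply, infMat_apply, Pi.add_apply, add_mul]

theorem infMat_entries (hη : IsInf N i η) {ι' κ' : Type} (w : ι → Gr N) (v : κ → Gr N)
    (w' : ι' → Gr N) (v' : κ' → Gr N) (a : ι) (k : κ) (b : ι') (l : κ') :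
    infMat w η v a k * infMat w' η v' b l = 0 := by
  simp only [infMat_apply]
  rw [mul_assoc (w a), mul_assoc (w a), mul_assoc (w' b), ← mul_assoc _ (w' b), mul_assoc η,
    ← mul_assoc _ η, hη.mul_mul, zero_mul, mul_zero]

theorem infMat_mul_infMat [Fintype κ] (hη : IsInf N i η) (w : ι → Gr N) (v : κ → Gr N)
    (w' : κ → Gr N) (v' : lam → Gr N) : infMat w η v * infMat w' η v' = 0 := by
  ext a k
  rw [Matrix.mul_apply]
  exact Finset.sum_eq_zero fun c _ => infMat_entries hη w v w' v' a c c k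

theorem body_infMat (hη : IsInf N i η) (w : ι → Gr N) (v : κ → Gr N) (a : ι) (k : κ) :
    body (infMat w η v a k) = 0 := by
  have := congrArg body (infMat_entries hη w v w v a k a k)
  rw [map_mul, map_zero] at this
  exact mul_self_eq_zero.1 this

theorem isSuper_infMat {R0 R1 C0 C1 : Type} {w : R0 ⊕ R1 → Gr N} {v : C0 ⊕ C1 → Gr N} {e f : ℕ}
    (hη : IsInf N i η) (hi : (e + f) % 2 = i % 2) (hw : ∀ a, w a ∈ Par N (par a + e))
    (hv : ∀ k, v k ∈ Par N (f + par k)) : IsSuper (infMat w η v) := fun a k => by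
  have h1 := Par.mul_of (k := par a + f) (i := par a + e) (j := i) (by omega) (hw a) hη.mem
  exact Par.mul_of (i := par a + f) (j := f + par k) (by omega) h1 (hv k)

/-- The Berezinian `1 + str (w η v)` of an infinitesimal transformation. -/
theorem ber_one_add_infMat {a b e f : ℕ} {w v : Fin a ⊕ Fin b → Gr N} (hη : IsInf N i η)
    (hi : (e + f) % 2 = i % 2) (hw : ∀ a, w a ∈ Par N (par a + e))
    (hv : ∀ k, v k ∈ Par N (f + par k)) : IsGL (1 + infMat w η v) ∧
      Ber (1 + infMat w η v) = 1 + sg e • (η * dotProduct v w) := by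
  obtain ⟨h1, h2⟩ := ber_one_add (isSuper_infMat hη hi hw hv) (infMat_entries hη w v w v)
  refine ⟨h1, h2.trans ?_⟩
  rw [dotProduct, Finset.mul_sum, Finset.smul_sum]
  congr 1
  refine Finset.sum_congr rfl fun F _ => ?_
  rw [infMat_apply, mul_assoc, super_comm (hw F) (Par.mul hη.mem (hv F)), smul_smul, ← sg_add,
    mul_assoc]
  congr 1
  refine sg_of_zmod ?_
  have : (i : ZMod 2) = e + f := by
    rw [← Nat.cast_add]
    exact ((ZMod.natCast_eq_natCast_iff' _ _ 2).2 hi).symm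
  push_cast
  rw [this]
  generalize (par F : ZMod 2) = F, (e : ZMod 2) = e, (f : ZMod 2) = f
  decide +revert

/-- The first order change of a function `X`, with new value `Y = X + η κ`, that is also multiplied
by the factor `1 + η τ` (the Berezinian of an infinitesimal transformation). -/
theorem mul_one_add_sub (hη : IsInf N i η) {X Y κ τ : Gr N} (h : Y - X = η * κ)
    (ht : η * τ ∈ Par N 0) : Y * (1 + η * τ) - X = η * κ + η * τ * X := by
  have h1 : Y = X + η * κ := by rw [← h]; abel
  have h2 : η * κ * (η * τ) = 0 := by
    rw [← mul_assoc, hη.mul_mul, zero_mul]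
  rw [h1, mul_add, mul_one, add_mul, h2, even_comm ht X]
  abel

end InfMat

section Values
variable {R0 R1 C0 C1 : Type} [Fintype R0] [Fintype R1] [Fintype C0] [Fintype C1]
  {U : TopologicalSpace.Opens (Ev R0 R1 C0 C1 → ℝ)} {f : SFun U (Od R0 R1 C0 C1)} {N : ℕ}
  {M : Matrix (R0 ⊕ R1) (C0 ⊕ C1) (Gr N)} {η : Gr N}

theorem isPoint_add_infMat {i : ℕ} (hU : OddDom U) (hM : IsPoint U M) (hη : IsInf N i η)
    {w : R0 ⊕ R1 → Gr N} {v : C0 ⊕ C1 → Gr N} (h : IsSuper (infMat w η v)) :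
    IsPoint U (M + infMat w η v) :=
  hU.isPoint hM (hM.1.add h) fun a k => by
    rw [Matrix.add_apply, map_add, body_infMat hη, add_zero]

theorem par_single [DecidableEq R0] [DecidableEq R1] (b a : R0 ⊕ R1) :
    (Pi.single b 1 : R0 ⊕ R1 → Gr N) a ∈ Par N (par a + par b) := by
  by_cases h : a = b
  · subst h
    rw [Pi.single_eq_same, Par_congr (show _ = 0 % 2 by omega)]
    exact Par.one_mem
  · rw [Pi.single_eq_of_ne h]
    exact zero_mem _

theorem isSuper_infMat_single [DecidableEq R0] [DecidableEq R1] {i b : R0 ⊕ R1} (hM : IsSuper M)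
    (hη : IsInf N (par i + par b) η) : IsSuper (infMat (Pi.single b 1) η (M i)) :=
  isSuper_infMat hη (by rw [add_comm]) (par_single b) (hM i)

theorem isSuper_infMat_cross {i : R0 ⊕ R1} {j : C0 ⊕ C1} (hM : IsSuper M)
    (hη : IsInf N (par i + par j) η) : IsSuper (infMat (fun b => M b j) η (M i)) :=
  isSuper_infMat hη (by rw [add_comm]) (fun b => hM b j) (hM i)

/-- `rowD U i b` is the derivative in the direction of the addition of row `i` to row `b`. -/
theorem value_rowD_inf [DecidableEq R0] [DecidableEq R1] (hM : IsPoint U M) (i b : R0 ⊕ R1)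
    (hη : IsInf N (par i + par b) η) : η * value (rowD U i b f) M =
      value f (M + infMat (Pi.single b 1) η (M i)) - value f M := by
  rw [value_add_of_mul_eq_zero hM (isSuper_infMat_single hM.1 hη) (infMat_entries hη _ _ _ _),
    add_sub_cancel_left, dval, Finset.sum_eq_single b, value_rowD hM, Finset.mul_sum]
  · refine Finset.sum_congr rfl fun K _ => ?_
    rw [infMat_apply, Pi.single_eq_same, one_mul, mul_assoc]
  · intro a _ ha
    refine Finset.sum_eq_zero fun K _ => ?_
    rw [infMat_apply, Pi.single_eq_of_ne ha, zero_mul, zero_mul, zero_mul]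
  · simp

/-- The operator `crossD U i j` in terms of the infinitesimal transformation
`x_b^k ↦ x_b^k + x_b^j η x_i^k`. -/
theorem value_crossD_inf (hM : IsPoint U M) (i : R0 ⊕ R1) (j : C0 ⊕ C1)
    (hη : IsInf N (par i + par j) η) : η * value (crossD U i j f) M =
      η * M i j * value f M -
        sg (par j) • (value f (M + infMat (fun b => M b j) η (M i)) - value f M) := by
  rw [value_add_of_mul_eq_zero hM (isSuper_infMat_cross hM.1 hη) (infMat_entries hη _ _ _ _),
    add_sub_cancel_left, dval, value_crossD hM, mul_sub, mul_assoc]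
  congr 1
  rw [Finset.sum_comm, Finset.mul_sum, Finset.smul_sum]
  refine Finset.sum_congr rfl fun K _ => ?_
  rw [value_colD hM, Finset.mul_sum, Finset.mul_sum, Finset.smul_sum]
  refine Finset.sum_congr rfl fun b _ => ?_
  rw [infMat_apply, mul_assoc (M b j), super_comm (hM.1 b j) (Par.mul hη.mem (hM.1 i K)),
    mul_smul_comm, mul_smul_comm, smul_mul_assoc, smul_smul, ← sg_add]
  simp only [mul_assoc]
  congr 1
  refine sg_of_zmod ?_
  push_cast
  generalize (par b : ZMod 2) = b, (par i : ZMod 2) = i, (par K : ZMod 2) = K,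
    (par j : ZMod 2) = j
  decide +revert

end Values

/-! ### The Berezinian conditions -/

section Triangular
variable {r s N : ℕ} {ι : Type}

/-- The old rows of a product, for a matrix that does not add the last even row to the others. -/
theorem old_mul {g : Matrix (Fin (r + 1) ⊕ Fin s) (Fin (r + 1) ⊕ Fin s) (Gr N)}
    (h0 : ∀ F, g (oldIdx r s F) (newIdx r s) = 0) (M : Matrix (Fin (r + 1) ⊕ Fin s) ι (Gr N)) :
    (g * M).submatrix (oldIdx r s) id =
      g.submatrix (oldIdx r s) (oldIdx r s) * M.submatrix (oldIdx r s) id := by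
  ext a k
  rw [Matrix.submatrix_apply, Matrix.mul_apply, sum_oldIdx, h0, zero_mul, add_zero]
  rfl

theorem mul_of_new_col {κ : Type} {a : Matrix κ (Fin (r + 1) ⊕ Fin s) (Gr N)}
    (h0 : ∀ F, a F (newIdx r s) = 0) (M : Matrix (Fin (r + 1) ⊕ Fin s) ι (Gr N)) :
    a * M = a.submatrix id (oldIdx r s) * M.submatrix (oldIdx r s) id := by
  ext b k
  rw [Matrix.mul_apply, sum_oldIdx, h0, zero_mul, add_zero]
  rfl

theorem new_mul (g : Matrix (Fin (r + 1) ⊕ Fin s) (Fin (r + 1) ⊕ Fin s) (Gr N))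
    (M : Matrix (Fin (r + 1) ⊕ Fin s) ι (Gr N)) :
    (g * M) (newIdx r s) = Matrix.vecMul (fun F => g (newIdx r s) (oldIdx r s F))
      (M.submatrix (oldIdx r s) id) +
        fun k => g (newIdx r s) (newIdx r s) * M (newIdx r s) k := by
  ext k
  rw [Matrix.mul_apply, sum_oldIdx]
  rfl

theorem mul_old {h : Matrix (Fin (r + 1) ⊕ Fin s) (Fin (r + 1) ⊕ Fin s) (Gr N)}
    (h0 : ∀ F, h (newIdx r s) (oldIdx r s F) = 0) (M : Matrix ι (Fin (r + 1) ⊕ Fin s) (Gr N)) :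
    (M * h).submatrix id (oldIdx r s) =
      M.submatrix id (oldIdx r s) * h.submatrix (oldIdx r s) (oldIdx r s) := by
  ext a k
  rw [Matrix.submatrix_apply, Matrix.mul_apply, sum_oldIdx, h0, mul_zero, add_zero]
  rfl

theorem mul_new (h : Matrix (Fin (r + 1) ⊕ Fin s) (Fin (r + 1) ⊕ Fin s) (Gr N))
    (M : Matrix ι (Fin (r + 1) ⊕ Fin s) (Gr N)) :
    (fun a => (M * h) a (newIdx r s)) = Matrix.mulVec (M.submatrix id (oldIdx r s))
      (fun K => h (oldIdx r s K) (newIdx r s)) +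
        fun a => M a (newIdx r s) * h (newIdx r s) (newIdx r s) := by
  ext k
  rw [Matrix.mul_apply, sum_oldIdx]
  rfl

theorem infMat_mul_right {ι κ : Type} (w : ι → Gr N) (η e : Gr N) (v : κ → Gr N) :
    infMat w η (fun k => e * v k) = infMat w (η * e) v := by
  ext a k
  simp only [infMat_apply, mul_assoc]

theorem infMat_mul_left {ι κ : Type} (w : ι → Gr N) (η : Gr N) {e : Gr N} (he : e ∈ Par N 0)
    (v : κ → Gr N) : infMat (fun a => w a * e) η v = infMat w (η * e) v := by
  ext a k
  simp only [infMat_apply, mul_assoc, even_comm he]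

end Triangular

section Transfer
variable {R0 R1 C0 C1 : Type} [Fintype R0] [Fintype R1] [Fintype C0] [Fintype C1]
  {U : TopologicalSpace.Opens (Ev R0 R1 C0 C1 → ℝ)} {N : ℕ}
  {M : Matrix (R0 ⊕ R1) (C0 ⊕ C1) (Gr N)}

theorem isPoint_ext (hM : IsPoint U M) : IsPoint U (M.map (ext N)) := by
  refine ⟨isSuper_map (ext N) (fun i x hx => ext_mem N hx) hM.1, ?_⟩
  have e : (fun i => body (evPart (M.map (ext N)) i)) = fun i => body (evPart M i) := by
    funext i
    rcases i with ⟨a, k⟩ | ⟨a, k⟩ <;> exact body_ext N _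
  rw [e]
  exact hM.2

theorem value_ext (hM : IsPoint U M) (f : SFun U (Od R0 R1 C0 C1)) :
    value f (M.map (ext N)) = ext N (value f M) :=
  value_map (ext N) (body_ext N) (fun _ _ hx => ext_mem N hx) hM f

theorem isGL_ext {a b : ℕ} {g : Matrix (Fin a ⊕ Fin b) (Fin a ⊕ Fin b) (Gr N)} (hg : IsGL g) :
    IsGL (g.map (ext N)) := hg.map _ fun _ _ hx => ext_mem N hx

/-- A transformation law may be verified after multiplication by an infinitesimal. -/
theorem value_eq_mul_of_inf {a b : ℕ} (i : ℕ) {T : SFun U (Od R0 R1 C0 C1)}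
    {M' : Matrix (R0 ⊕ R1) (C0 ⊕ C1) (Gr N)} (hM : IsPoint U M) (hM' : IsPoint U M')
    {g : Matrix (Fin a ⊕ Fin b) (Fin a ⊕ Fin b) (Gr N)} (hg : IsGL g)
    (h : eps N i * value T (M'.map (ext N)) =
      eps N i * (value T (M.map (ext N)) * Ber (g.map (ext N)))) :
    value T M' = value T M * Ber g := by
  refine eq_of_eps_mul i ?_
  rw [map_mul, ← value_ext hM, ← value_ext hM', ← ber_map (ext N) (fun _ _ hx => ext_mem N hx) hg]
  exact h

end Transfer

section Ber
variable {n m p q r s N : ℕ}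

theorem IsSuper.old_cols {R0 R1 : Type} {M : Matrix (R0 ⊕ R1) (Fin (r + 1) ⊕ Fin s) (Gr N)}
    (hM : IsSuper M) : IsSuper (M.submatrix id (oldIdx r s)) := by
  have := hM.submatrix id id Fin.castSucc id
  rwa [Sum.map_id_id] at this

theorem infMat_single_pRow {κ : Type} (A : Fin n ⊕ Fin m) (η : Gr N) (v : κ → Gr N) :
    infMat (Pi.single (pRow (r := r) (s := s) A) 1) η v = stack (infMat (Pi.single A 1) η v) 0 := by
  refine mrow_ext (fun B => ?_) (fun F => ?_)
  · ext k
    rw [stack_pRow, infMat_apply, infMat_apply]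
    have : Function.Injective (pRow : Fin n ⊕ Fin m → MRow n m r s) :=
      Sum.map_injective.2 ⟨Sum.inl_injective, Sum.inl_injective⟩
    by_cases h : B = A
    · subst h; simp
    · rw [Pi.single_eq_of_ne h, Pi.single_eq_of_ne fun h' => h (this h')]
  · ext k
    rw [stack_wRow, infMat_apply, Pi.single_eq_of_ne, zero_mul, zero_mul]
    · rfl
    · rcases A with A | A <;> rcases F with F | F <;> simp [pRow, wRow]

/-- The summands of the operator `e(α)`. -/
theorem value_rowD_addRow {L : MixedFun n m p q r s} {A : Fin n ⊕ Fin m}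
    {P : Matrix (Fin n ⊕ Fin m) (Fin p ⊕ Fin q) (Gr N)}
    {W : Matrix (Fin (r + 1) ⊕ Fin s) (Fin p ⊕ Fin q) (Gr N)} {η : Gr N}
    (hM : IsPoint (mixedDom n m p q (r + 1) s) (stack P W)) (hη : IsInf N (par A) η) :
    η * value (rowD (mixedDom n m p q (r + 1) s) (wRow (newIdx r s)) (pRow A) (addRow L))
        (stack P W) =
      value L (stack (P + infMat (Pi.single A 1) η (W (newIdx r s)))
        (W.submatrix (oldIdx r s) id)) - value L (stack P (W.submatrix (oldIdx r s) id)) := by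
  have hη' : IsInf N (par (wRow (n := n) (m := m) (newIdx r s)) +
      par (pRow (r := r + 1) (s := s) A)) η := by
    rw [par_wRow, par_pRow]
    change IsInf N (0 + par A) η
    rwa [zero_add]
  rw [value_rowD_inf hM _ _ hη', value_addRow hM]
  have h := isPoint_add_infMat oddDom_mixed hM hη' (isSuper_infMat_single hM.1 hη')
  rw [stack_wRow, infMat_single_pRow, stack_add, add_zero] at h ⊢
  rw [value_addRow h]

variable {L : MixedFun n m p q r s}

/-- The transformation `M ↦ M h` commutes with the addition of a row to another one, so that the
values whose difference gives the derivative are both multiplied by `Ber h`. -/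
theorem rowD_ber_right (hL : IsMixed L) (A : Fin n ⊕ Fin m)
    {M : Matrix (MRow n m (r + 1) s) (Fin p ⊕ Fin q) (Gr N)}
    {h : Matrix (Fin p ⊕ Fin q) (Fin p ⊕ Fin q) (Gr N)}
    (hM : IsPoint (mixedDom n m p q (r + 1) s) M) (hh : IsGL h) :
    value (rowD (mixedDom n m p q (r + 1) s) (wRow (newIdx r s)) (pRow A) (addRow L)) (M * h) =
      value (rowD (mixedDom n m p q (r + 1) s) (wRow (newIdx r s)) (pRow A) (addRow L)) M *
        Ber h := by
  refine value_eq_mul_of_inf (par A) hM (isPoint_mul_right hM hh) hh ?_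
  have hη := isInf_eps N (par A)
  replace hM := isPoint_ext hM
  replace hh := isGL_ext hh
  rw [Matrix.map_mul]
  generalize M.map (ext N) = M at *
  generalize h.map (ext N) = h at *
  generalize eps N (par A) = η at *
  rw [← stack_eta M] at hM ⊢
  generalize M.submatrix pRow id = P at *
  generalize M.submatrix wRow id = W at *
  have hM' := isPoint_mul_right hM hh
  rw [stack_mul] at hM' ⊢
  rw [← mul_assoc, value_rowD_addRow hM hη, value_rowD_addRow hM' hη, sub_mul]
  have e1 : (W * h).submatrix (oldIdx r s) id = W.submatrix (oldIdx r s) id * h := rfl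
  have e2 : (W * h) (newIdx r s) = Matrix.vecMul (W (newIdx r s)) h := rfl
  have hp := (isPoint_oldRow.1 hM).2
  have hp' : IsPoint (mixedDom n m p q r s)
      (stack (P + infMat (Pi.single A 1) η (W (newIdx r s))) (W.submatrix (oldIdx r s) id)) := by
    refine oddDom_mixed.isPoint hp ?_ ?_
    · rw [isSuper_stack_iff]
      have hs := isSuper_stack_iff.1 hp.1
      have hw := (isSuper_stack_iff.1 hM.1).2
      refine ⟨hs.1.add (isSuper_infMat (e := par A) (f := 0) hη rfl (par_single A) ?_), hs.2⟩
      exact fun k => hw.entry (newIdx r s) k rfl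
    · rintro (a | a) k
      · change _ = body (P (.inr a) (.inr k) + infMat (Pi.single A 1) η (W (newIdx r s)) _ _)
        rw [map_add, body_infMat hη, add_zero]
        rfl
      · rfl
  rw [e1, e2, ← infMat_mul, ← Matrix.add_mul, ← stack_mul, ← stack_mul, hL.ber_right _ _ _ hp hh,
    hL.ber_right _ _ _ hp' hh]

/-- By `row_induction` it is enough to consider two kinds of transformations. The addition of
multiples of the last even row to the others changes nothing, as the operator gives a solution of
the system that is linear in this row. For a transformation that only rescales this row by `e` and
adds combinations `c` of the other rows to it, the infinitesimal transformation `P_A ↦ P_A + η W_y`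
turns into `P_A ↦ P_A + η e W_y` followed by the addition of `η c` times the other rows, which is
absorbed by the invariance of `L`. -/
theorem rowD_ber_left (hL : IsMixed L) (A : Fin n ⊕ Fin m)
    {P : Matrix (Fin n ⊕ Fin m) (Fin p ⊕ Fin q) (Gr N)}
    {W : Matrix (Fin (r + 1) ⊕ Fin s) (Fin p ⊕ Fin q) (Gr N)}
    {a : Matrix (Fin n ⊕ Fin m) (Fin (r + 1) ⊕ Fin s) (Gr N)}
    {g : Matrix (Fin (r + 1) ⊕ Fin s) (Fin (r + 1) ⊕ Fin s) (Gr N)}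
    (hM : IsPoint (mixedDom n m p q (r + 1) s) (stack P W)) (ha : IsSuper a) (hg : IsGL g) :
    value (rowD (mixedDom n m p q (r + 1) s) (wRow (newIdx r s)) (pRow A) (addRow L))
        (stack (P + a * W) (g * W)) =
      value (rowD (mixedDom n m p q (r + 1) s) (wRow (newIdx r s)) (pRow A) (addRow L))
        (stack P W) * Ber g := by
  set T := rowD (mixedDom n m p q (r + 1) s) (wRow (newIdx r s)) (pRow A) (addRow L) with hT
  have hTs : SecondOrderSystem T := hL.system.addRow.rowD _ _
  have hTl : rowD (mixedDom n m p q (r + 1) s) (wRow (newIdx r s)) (wRow (newIdx r s)) T = T :=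
    rowD_rowD_self (fun K => pd_addRow_new K L) (pRow A)
  suffices H : ∀ P W, IsPoint (mixedDom n m p q (r + 1) s) (stack P W) →
      value T (stack (P + a * W) (g * W)) = value T (stack P W) * Ber g from H P W hM
  clear hM P W
  refine row_induction (Q := fun a g => ∀ P W, IsPoint (mixedDom n m p q (r + 1) s) (stack P W) →
      value T (stack (P + a * W) (g * W)) = value T (stack P W) * Ber g) ?_ ?_ ?_ a g ha hg
  · intro a g a' g' ha hg ha' hg' h h' P W hM
    have := h' _ _ (isPoint_left hM ha hg)
    rw [h _ _ hM] at this
    rw [Matrix.add_mul, Matrix.mul_assoc, Matrix.mul_assoc, ← add_assoc, this, mul_assoc,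
      ← ber_mul hg hg', ber_mul hg hg', ber_mul hg' hg, even_comm hg.ber_mem]
  -- multiples of the last even row are added to the other rows
  · intro c d hc hd hdy P W hM
    rw [(isGL_addRowMat hd hdy).2, mul_one]
    have h := value_add_row oddDom_mixed hTs (y := Sum.inr (Fin.last r)) hTl hM
      (d := fun x => stack (Matrix.of fun B (_ : Unit) => c B) (Matrix.of fun F _ => d F) x ())
      (fun x => ?_) hdy
    · rw [← h]
      congr 1
      refine mrow_ext (fun B => ?_) (fun F => ?_)
      · ext k
        rw [stack_pRow, Matrix.add_apply, Matrix.add_apply, Matrix.of_apply, stack_pRow, stack_pRow]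
        congr 1
        simp [Matrix.mul_apply, Matrix.vecMulVec_apply, Pi.single_apply, mul_assoc]
        rfl
      · ext k
        rw [stack_wRow, addRowMat_mul, Matrix.add_apply, Matrix.add_apply, Matrix.of_apply,
          Matrix.of_apply, stack_wRow, stack_wRow]
        rfl
    · rcases mrow_cases x with ⟨B, rfl⟩ | ⟨F, rfl⟩
      · rw [stack_pRow, par_pRow]
        exact hc B
      · rw [stack_wRow, par_wRow]
        exact hd F
  -- the last even row is not added to the other rows
  · intro a g ha hg ha0 hg0 P W hM
    refine value_eq_mul_of_inf (par A) hM (isPoint_left hM ha hg) hg ?_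
    have hη := isInf_eps N (par A)
    replace ha : IsSuper (a.map (ext N)) := isSuper_map _ (fun i x hx => ext_mem N hx) ha
    replace hM := isPoint_ext hM
    replace hg := isGL_ext hg
    replace ha0 : ∀ B, a.map (ext N) B (newIdx r s) = 0 := fun B => by
      rw [Matrix.map_apply, ha0, map_zero]
    replace hg0 : ∀ F, g.map (ext N) (oldIdx r s F) (newIdx r s) = 0 := fun F => by
      rw [Matrix.map_apply, hg0, map_zero]
    have e0 : (stack (P + a * W) (g * W)).map (ext N) = stack (P.map (ext N) +
        a.map (ext N) * W.map (ext N)) (g.map (ext N) * W.map (ext N)) := by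
      rw [stack_map, Matrix.map_mul, Matrix.map_add _ (map_add (ext N)), Matrix.map_mul]
    rw [e0]
    rw [stack_map] at hM ⊢
    generalize P.map (ext N) = P at *
    generalize W.map (ext N) = W at *
    generalize a.map (ext N) = a at *
    generalize g.map (ext N) = g at *
    generalize eps N (par A) = η at *
    have hM' := isPoint_left hM ha hg
    rw [value_rowD_addRow hM' hη, old_mul hg0, mul_of_new_col ha0, new_mul]
    obtain ⟨hgo, hge⟩ := (isGL_lower_last hg.1 hg0).1 hg
    rw [ber_lower_last hg hg0]
    have hee : g (newIdx r s) (newIdx r s) ∈ Par (N + 2) 0 := hg.1.entry _ _ rfl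
    set e := g (newIdx r s) (newIdx r s)
    have hη' := hη.mul_even hee
    have hw := (isSuper_stack_iff.1 hM.1).2
    set c := fun F => g (newIdx r s) (oldIdx r s F) with hc
    have hcs : IsSuper (infMat (Pi.single A 1) η c) := by
      refine isSuper_infMat (e := par A) (f := 0) hη rfl (par_single A) fun F => ?_
      exact hg.1.entry (newIdx r s) (oldIdx r s F) (by rw [oldIdx, par_map]; rfl)
    have has : IsSuper (a.submatrix id (oldIdx r s)) := ha.old_cols
    have hp := (isPoint_oldRow.1 hM).2
    have hp' : IsPoint (mixedDom n m p q r s) (stack (P + infMat (Pi.single A 1)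
        (η * e) (W (newIdx r s))) (W.submatrix (oldIdx r s) id)) := by
      refine oddDom_mixed.isPoint hp ?_ ?_
      · rw [isSuper_stack_iff]
        have hs := isSuper_stack_iff.1 hp.1
        refine ⟨hs.1.add (isSuper_infMat (e := par A) (f := 0) hη' rfl (par_single A) ?_), hs.2⟩
        exact fun k => hw.entry (newIdx r s) k rfl
      · rintro (a | a) k
        · change _ = body (P (.inr a) (.inr k) +
            infMat (Pi.single A 1) (η * e) (W (newIdx r s)) _ _)
          rw [map_add, body_infMat hη', add_zero]
          rfl
        · rfl
    have e1 : P + a.submatrix id (oldIdx r s) * W.submatrix (oldIdx r s) id +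
        infMat (Pi.single A 1) η (Matrix.vecMul c (W.submatrix (oldIdx r s) id) +
          fun k => e * W (newIdx r s) k) =
        P + infMat (Pi.single A 1) (η * e) (W (newIdx r s)) +
          (a.submatrix id (oldIdx r s) + infMat (Pi.single A 1) η c) *
            W.submatrix (oldIdx r s) id := by
      rw [infMat_add, infMat_mul_right, Matrix.add_mul, infMat_mul]
      abel
    rw [e1, hL.ber_left _ _ _ _ _ hp' (has.add hcs) hgo, hL.ber_left _ _ _ _ _ hp has hgo,
      ← sub_mul, ← value_rowD_addRow hM hη', mul_assoc, mul_assoc, even_comm hee, mul_assoc]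

end Ber

section BerCol
variable {n m p q r s N : ℕ} {L : MixedFun n m p q r s}

/-- The summands of the operator `e(u)`. -/
theorem value_crossD_addCol {A : Fin n ⊕ Fin m}
    {M : Matrix (MRow n m r s) (Fin (p + 1) ⊕ Fin q) (Gr N)} {η : Gr N}
    (hM : IsPoint (mixedDom n m (p + 1) q r s) M) (hη : IsInf N (par A) η) :
    η * value (crossD (mixedDom n m (p + 1) q r s) (pRow A) (newIdx p q) (addCol L)) M =
      η * M (pRow A) (newIdx p q) * value L (M.submatrix id (oldIdx p q)) -
        (value L (M.submatrix id (oldIdx p q) + infMat (fun b => M b (newIdx p q)) η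
          (M.submatrix id (oldIdx p q) (pRow A))) - value L (M.submatrix id (oldIdx p q))) := by
  have hη' : IsInf N (par (pRow (r := r) (s := s) A) + par (newIdx p q)) η := by
    rw [par_pRow]
    exact hη
  rw [value_crossD_inf hM _ _ hη', value_addCol hM, value_addCol (isPoint_add_infMat oddDom_mixed hM
    hη' (isSuper_infMat_cross hM.1 hη'))]
  rw [show par (newIdx p q) = 0 from rfl, sg_zero, one_smul]
  rfl

/-- By `col_induction` it is enough to consider two kinds of transformations. The addition of
multiples of the last even column to the others changes nothing, as the operator gives a solution of
the system that is linear in this column. For a transformation that only rescales this column and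
adds a combination `l` of the others to it, the infinitesimal change of the argument of `L` contains
the factor `1 + l η p_A`, whose Berezinian cancels the change of the term `p_A^{p+1} L`. -/
theorem crossD_ber_right (hL : IsMixed L) (A : Fin n ⊕ Fin m)
    {M : Matrix (MRow n m r s) (Fin (p + 1) ⊕ Fin q) (Gr N)}
    {h : Matrix (Fin (p + 1) ⊕ Fin q) (Fin (p + 1) ⊕ Fin q) (Gr N)}
    (hM : IsPoint (mixedDom n m (p + 1) q r s) M) (hh : IsGL h) :
    value (crossD (mixedDom n m (p + 1) q r s) (pRow A) (newIdx p q) (addCol L)) (M * h) =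
      value (crossD (mixedDom n m (p + 1) q r s) (pRow A) (newIdx p q) (addCol L)) M * Ber h := by
  set T := crossD (mixedDom n m (p + 1) q r s) (pRow A) (newIdx p q) (addCol L) with hT
  have hTs : SecondOrderSystem T := hL.system.addCol.crossD _ _
  have hTl : colD (mixedDom n m (p + 1) q r s) (newIdx p q) (newIdx p q) T = T :=
    colD_crossD_self rfl (fun b => pd_addCol_new b L) (pRow A)
  suffices H : ∀ M, IsPoint (mixedDom n m (p + 1) q r s) M →
      value T (M * h) = value T M * Ber h from H M hM
  clear hM M
  refine col_induction (Q := fun h => ∀ M, IsPoint (mixedDom n m (p + 1) q r s) M →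
      value T (M * h) = value T M * Ber h) ?_ ?_ ?_ h hh
  · intro g g' hg hg' h h' M hM
    rw [← Matrix.mul_assoc, h' _ (isPoint_mul_right hM hg), h _ hM, ber_mul hg hg', mul_assoc]
  -- multiples of the last even column are added to the other columns
  · intro d hd hdy M hM
    rw [(isGL_addColMat hd hdy).2, mul_one, mul_addColMat]
    exact value_add_col oddDom_mixed hTs hTl hM hd hdy
  -- the last even column is not added to the other columns
  · intro h hh hh0 M hM
    refine value_eq_mul_of_inf (par A) hM (isPoint_mul_right hM hh) hh ?_
    have hη := isInf_eps N (par A)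
    replace hM := isPoint_ext hM
    replace hh := isGL_ext hh
    replace hh0 : ∀ F, h.map (ext N) (newIdx p q) (oldIdx p q F) = 0 := fun F => by
      rw [Matrix.map_apply, hh0, map_zero]
    rw [Matrix.map_mul]
    generalize M.map (ext N) = M at *
    generalize h.map (ext N) = h at *
    generalize eps N (par A) = η at *
    obtain ⟨hho, hhe⟩ := (isGL_upper_last hh.1 hh0).1 hh
    rw [value_crossD_addCol (isPoint_mul_right hM hh) hη, mul_old hh0, mul_new,
      ber_upper_last hh hh0]
    have hee : h (newIdx p q) (newIdx p q) ∈ Par (N + 2) 0 := hh.1.entry _ _ rfl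
    set e := h (newIdx p q) (newIdx p q) with he
    have hη' := hη.mul_even hee
    have hdiff := value_crossD_addCol (L := L) hM hη'
    rw [← hT] at hdiff
    have hp := (isPoint_oldCol.1 hM).2
    have hnew : (M * h) (pRow A) (newIdx p q) =
        dotProduct (M.submatrix id (oldIdx p q) (pRow A))
          (fun K => h (oldIdx p q K) (newIdx p q)) + M (pRow A) (newIdx p q) * e :=
      congrFun (mul_new h M) (pRow A)
    rw [hnew]
    have hw : ∀ a, M a (newIdx p q) ∈ Par (N + 2) (par a + 0) := fun a =>
      hM.1.entry a (newIdx p q) rfl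
    have hv : ∀ k, M.submatrix id (oldIdx p q) (pRow A) k ∈ Par (N + 2) (par A + par k) := by
      intro k
      refine hM.1.entry _ _ ?_
      rw [id, par_pRow, oldIdx, par_map]
    have hl : ∀ k, (fun K => h (oldIdx p q K) (newIdx p q)) k ∈ Par (N + 2) (par k + 0) := by
      intro k
      refine hh.1.entry _ _ ?_
      rw [oldIdx, par_map]
      rfl
    generalize M.submatrix id (oldIdx p q) = Mo at *
    generalize h.submatrix (oldIdx p q) (oldIdx p q) = ho at *
    generalize (fun K => h (oldIdx p q K) (newIdx p q)) = l at *
    obtain ⟨hE, hB⟩ := ber_one_add_infMat hη (by rw [zero_add]) hl hv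
    rw [sg_zero, one_smul] at hB
    have hev : η * (Mo (pRow A) ⬝ᵥ l) ∈ Par (N + 2) 0 := by
      have := sub_mem hE.ber_mem (Par.one_mem (N := N + 2))
      rwa [hB, add_sub_cancel_left] at this
    have hp' := isPoint_add_infMat oddDom_mixed hp hη' (isSuper_infMat hη' (by rw [zero_add]) hw hv)
    have e1 : Mo * ho + infMat (Mo.mulVec l + fun a => M a (newIdx p q) * e) η
        ((Mo * ho) (pRow A)) = (Mo + infMat (fun a => M a (newIdx p q)) (η * e) (Mo (pRow A))) *
          ((1 + infMat l η (Mo (pRow A))) * ho) := by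
      have e2 : (Mo * ho) (pRow A) = Matrix.vecMul (Mo (pRow A)) ho := rfl
      rw [e2, ← infMat_mul, add_infMat, ← mul_infMat, infMat_mul_left _ _ hee]
      rw [← infMat_mul_left _ _ hee]
      simp only [Matrix.mul_add, Matrix.add_mul, Matrix.mul_one, Matrix.one_mul,
        infMat_mul_infMat hη, ← Matrix.mul_assoc, Matrix.zero_mul]
      abel
    rw [e1, hL.ber_right _ _ _ hp' (hE.mul hho), hL.ber_right _ _ _ hp hho, ber_mul hE hho, hB,
      ← mul_assoc]
    set X := value L Mo
    set Y := value L (Mo + infMat (fun a => M a (newIdx p q)) (η * e) (Mo (pRow A)))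
    set τ := Mo (pRow A) ⬝ᵥ l
    set B := Ber ho
    set z := M (pRow A) (newIdx p q)
    have h1 : Y - X = η * (e * (z * X - value T M)) := by
      rw [← mul_assoc, mul_sub, hdiff]
      noncomm_ring
    have h2 := mul_one_add_sub hη h1 hev
    have h3 : Y * (1 + η * τ) * B - X * B = (η * (e * (z * X - value T M)) + η * τ * X) * B := by
      rw [← h2, sub_mul]
    rw [← mul_assoc Y, h3, ← even_comm hee z, ← even_comm hee B, ← mul_assoc _ e B,
      ← even_comm hee (value T M)]
    noncomm_ring

theorem infMat_stack {κ : Type} (w : MRow n m r s → Gr N) (η : Gr N) (v : κ → Gr N) :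
    infMat w η v = stack (infMat (fun B => w (pRow B)) η v) (infMat (fun F => w (wRow F)) η v) :=
  mrow_ext (fun a => by rw [stack_pRow]; rfl) (fun a => by rw [stack_wRow]; rfl)

/-- The infinitesimal transformation at the point `(P + a W, g W)` is the one at `(P, W)` followed by
the transformation with `g (1 + w^{p+1} η a_A)` in place of `g` and another `a`; the Berezinian of
the additional factor cancels the change of the term `p_A^{p+1} L`. -/
theorem crossD_ber_left (hL : IsMixed L) (A : Fin n ⊕ Fin m)
    {P : Matrix (Fin n ⊕ Fin m) (Fin (p + 1) ⊕ Fin q) (Gr N)}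
    {W : Matrix (Fin r ⊕ Fin s) (Fin (p + 1) ⊕ Fin q) (Gr N)}
    {a : Matrix (Fin n ⊕ Fin m) (Fin r ⊕ Fin s) (Gr N)}
    {g : Matrix (Fin r ⊕ Fin s) (Fin r ⊕ Fin s) (Gr N)}
    (hM : IsPoint (mixedDom n m (p + 1) q r s) (stack P W)) (ha : IsSuper a) (hg : IsGL g) :
    value (crossD (mixedDom n m (p + 1) q r s) (pRow A) (newIdx p q) (addCol L))
        (stack (P + a * W) (g * W)) =
      value (crossD (mixedDom n m (p + 1) q r s) (pRow A) (newIdx p q) (addCol L)) (stack P W) *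
        Ber g := by
  refine value_eq_mul_of_inf (par A) hM (isPoint_left hM ha hg) hg ?_
  have hη := isInf_eps N (par A)
  replace ha : IsSuper (a.map (ext N)) := isSuper_map _ (fun i x hx => ext_mem N hx) ha
  replace hM := isPoint_ext hM
  replace hg := isGL_ext hg
  have e0 : (stack (P + a * W) (g * W)).map (ext N) = stack (P.map (ext N) +
      a.map (ext N) * W.map (ext N)) (g.map (ext N) * W.map (ext N)) := by
    rw [stack_map, Matrix.map_mul, Matrix.map_add _ (map_add (ext N)), Matrix.map_mul]
  rw [e0]
  rw [stack_map] at hM ⊢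
  generalize P.map (ext N) = P at *
  generalize W.map (ext N) = W at *
  generalize a.map (ext N) = a at *
  generalize g.map (ext N) = g at *
  generalize eps N (par A) = η at *
  have hM' := isPoint_left hM ha hg
  have hdiff := value_crossD_addCol (L := L) hM hη
  rw [value_crossD_addCol hM' hη]
  have hp := (isPoint_oldCol.1 hM).2
  have hw : ∀ a, stack P W a (newIdx p q) ∈ Par (N + 2) (par a + 0) := fun a =>
    hM.1.entry a (newIdx p q) rfl
  have hw' : ∀ a, W a (newIdx p q) ∈ Par (N + 2) (par a + 0) := fun a =>
    (isSuper_stack_iff.1 hM.1).2.entry a (newIdx p q) rfl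
  have hw'' : ∀ a, P a (newIdx p q) ∈ Par (N + 2) (par a + 0) := fun a =>
    (isSuper_stack_iff.1 hM.1).1.entry a (newIdx p q) rfl
  have hv : ∀ k, (stack P W).submatrix id (oldIdx p q) (pRow A) k ∈
      Par (N + 2) (par A + par k) := by
    intro k
    refine hM.1.entry _ _ ?_
    rw [id, par_pRow, oldIdx, par_map]
  have hp' := isPoint_add_infMat oddDom_mixed hp hη (isSuper_infMat hη (by rw [zero_add]) hw hv)
  have e1 : (stack (P + a * W) (g * W)).submatrix id (oldIdx p q) =
      stack (P.submatrix id (oldIdx p q) + a * W.submatrix id (oldIdx p q))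
        (g * W.submatrix id (oldIdx p q)) := by
    rw [stack_submatrix]
    rfl
  rw [e1, stack_pRow, stack_pRow]
  have e2 : infMat (fun b => stack (P + a * W) (g * W) b (newIdx p q)) η
      ((P.submatrix id (oldIdx p q) + a * W.submatrix id (oldIdx p q)) A) =
      stack (infMat ((fun B => P B (newIdx p q)) + a.mulVec (fun F => W F (newIdx p q))) η
          (P.submatrix id (oldIdx p q) A + Matrix.vecMul (a A) (W.submatrix id (oldIdx p q))))
        (infMat (g.mulVec (fun F => W F (newIdx p q))) η (P.submatrix id (oldIdx p q) A +
          Matrix.vecMul (a A) (W.submatrix id (oldIdx p q)))) := by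
    rw [infMat_stack]
    simp only [stack_pRow, stack_wRow]
    rfl
  rw [e2]
  rw [infMat_stack] at hp' hdiff
  have e3 : (P + a * W) A (newIdx p q) = P A (newIdx p q) +
      a A ⬝ᵥ (fun F => W F (newIdx p q)) := rfl
  rw [e3]
  rw [stack_submatrix] at hp hp' hdiff hv
  simp only [stack_pRow, stack_wRow, stack_add] at hp' hdiff hv
  generalize P.submatrix id (oldIdx p q) = Po at *
  generalize W.submatrix id (oldIdx p q) = Wo at *
  obtain ⟨hE, hB⟩ := ber_one_add_infMat hη (by rw [zero_add]) hw' (ha A)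
  have hPa := isSuper_infMat hη (by rw [zero_add]) hw'' (ha A)
  rw [sg_zero, one_smul] at hB
  generalize P A (newIdx p q) = z at *
  generalize (fun F => W F (newIdx p q)) = zw at *
  generalize (fun F => P F (newIdx p q)) = zp at *
  have hev : η * (a A ⬝ᵥ zw) ∈ Par (N + 2) 0 := by
    have := sub_mem hE.ber_mem (Par.one_mem (N := N + 2))
    rwa [hB, add_sub_cancel_left] at this
  have e4 : stack (Po + a * Wo) (g * Wo) + stack (infMat (zp + a.mulVec zw) η
        (Po A + Matrix.vecMul (a A) Wo)) (infMat (g.mulVec zw) η (Po A + Matrix.vecMul (a A) Wo)) =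
      stack (Po + infMat zp η (Po A) + (infMat zp η (a A) + a * (1 + infMat zw η (a A))) *
          (Wo + infMat zw η (Po A)))
        (g * (1 + infMat zw η (a A)) * (Wo + infMat zw η (Po A))) := by
    rw [stack_add]
    congr 1
    · rw [add_infMat, infMat_add, infMat_add, ← infMat_mul, ← mul_infMat, ← mul_infMat,
        ← infMat_mul]
      simp only [Matrix.mul_add, Matrix.add_mul, Matrix.mul_one, infMat_mul_infMat hη,
        Matrix.mul_assoc, Matrix.mul_zero]
      abel
    · rw [infMat_add, ← infMat_mul, ← mul_infMat, ← mul_infMat]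
      simp only [Matrix.mul_add, Matrix.add_mul, Matrix.mul_one, infMat_mul_infMat hη,
        Matrix.mul_assoc, Matrix.mul_zero]
      abel
  rw [e4, hL.ber_left _ _ _ _ _ hp' (hPa.add (ha.mul hE.1)) (hg.mul hE),
    hL.ber_left _ _ _ _ _ hp ha hg, ber_mul hg hE, hB, even_comm hg.ber_mem]
  set T := crossD (mixedDom n m (p + 1) q r s) (pRow A) (newIdx p q) (addCol L)
  set X := value L (stack Po Wo)
  set Y := value L (stack (Po + infMat zp η (Po A)) (Wo + infMat zw η (Po A)))
  set τ := a A ⬝ᵥ zw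
  have h1 : Y - X = η * (z * X - value T (stack P W)) := by
    rw [mul_sub, hdiff]
    noncomm_ring
  have h2 := mul_one_add_sub hη h1 hev
  have h3 : Y * (1 + η * τ) * Ber g - X * Ber g =
      (η * (z * X - value T (stack P W)) + η * τ * X) * Ber g := by
    rw [← h2, sub_mul]
  rw [← mul_assoc Y, h3]
  noncomm_ring

end BerCol

section BerStraight
variable {n m r s N : ℕ} {L : StraightFun n m r s}

/-- The summands of the operator `e_α`. -/
theorem value_crossD_addVec {A : Fin n ⊕ Fin m}
    {v : Matrix (Fin (r + 1) ⊕ Fin s) (Fin n ⊕ Fin m) (Gr N)} {η : Gr N}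
    (hv : IsPoint (straightDom n m (r + 1) s) v) (hη : IsInf N (par A) η) :
    η * value (crossD (straightDom n m (r + 1) s) (newIdx r s) A (addVec L)) v =
      η * v (newIdx r s) A * value L (v.submatrix (oldIdx r s) id) -
        sg (par A) • (value L (v.submatrix (oldIdx r s) id +
          infMat (fun F => v.submatrix (oldIdx r s) id F A) η (v (newIdx r s))) -
            value L (v.submatrix (oldIdx r s) id)) := by
  have hη' : IsInf N (par (newIdx r s) + par A) η := by
    change IsInf N (0 + par A) η
    rwa [zero_add]
  rw [value_crossD_inf hv _ _ hη', value_addVec hv, value_addVec (isPoint_add_infMat oddDom_straight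
    hv hη' (isSuper_infMat_cross hv.1 hη'))]
  rfl

/-- By `row_induction` it is enough to consider two kinds of transformations. The addition of
multiples of the last even row to the others changes nothing, as the operator gives a solution of
the system that is linear in this row. For a transformation that only rescales this row and adds a
combination `c` of the others to it, the infinitesimal change of the argument of `L` contains the
factor `1 + v^A η c`, whose Berezinian cancels the change of the term `v_{r+1}^A L`. -/
theorem crossD_ber_straight (hL : IsStraight L) (A : Fin n ⊕ Fin m)
    {v : Matrix (Fin (r + 1) ⊕ Fin s) (Fin n ⊕ Fin m) (Gr N)}
    {g : Matrix (Fin (r + 1) ⊕ Fin s) (Fin (r + 1) ⊕ Fin s) (Gr N)}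
    (hv : IsPoint (straightDom n m (r + 1) s) v) (hg : IsGL g) :
    value (crossD (straightDom n m (r + 1) s) (newIdx r s) A (addVec L)) (g * v) =
      value (crossD (straightDom n m (r + 1) s) (newIdx r s) A (addVec L)) v * Ber g := by
  set T := crossD (straightDom n m (r + 1) s) (newIdx r s) A (addVec L) with hT
  have hTs : SecondOrderSystem T := hL.system.addVec.crossD _ _
  have hTl : rowD (straightDom n m (r + 1) s) (newIdx r s) (newIdx r s) T = T :=
    rowD_crossD_self (fun K => pd_addVec_new K L) A
  suffices H : ∀ v, IsPoint (straightDom n m (r + 1) s) v →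
      value T (g * v) = value T v * Ber g from H v hv
  clear hv v
  refine row_induction (n := 0) (m := 0) (Q := fun _ g => ∀ v,
      IsPoint (straightDom n m (r + 1) s) v → value T (g * v) = value T v * Ber g) ?_ ?_ ?_
      0 g IsSuper.zero hg
  · intro a g a' g' ha hg ha' hg' h h' v hv
    rw [Matrix.mul_assoc, h' _ (isPoint_straight_mul hv hg), h _ hv, mul_assoc, ber_mul hg' hg,
      even_comm hg.ber_mem]
  -- multiples of the last even row are added to the other rows
  · intro c d hc hd hdy v hv
    rw [(isGL_addRowMat hd hdy).2, mul_one, addRowMat_mul]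
    exact value_add_row oddDom_straight hTs hTl hv hd hdy
  -- the last even row is not added to the other rows
  · intro a g ha hg ha0 hg0 v hv
    refine value_eq_mul_of_inf (par A) hv (isPoint_straight_mul hv hg) hg ?_
    have hη := isInf_eps N (par A)
    replace hv := isPoint_ext hv
    replace hg := isGL_ext hg
    replace hg0 : ∀ F, g.map (ext N) (oldIdx r s F) (newIdx r s) = 0 := fun F => by
      rw [Matrix.map_apply, hg0, map_zero]
    rw [Matrix.map_mul]
    generalize v.map (ext N) = v at *
    generalize g.map (ext N) = g at *
    generalize eps N (par A) = η at *
    obtain ⟨hgo, hge⟩ := (isGL_lower_last hg.1 hg0).1 hg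
    rw [value_crossD_addVec (isPoint_straight_mul hv hg) hη, old_mul hg0, new_mul,
      ber_lower_last hg hg0]
    have hee : g (newIdx r s) (newIdx r s) ∈ Par (N + 2) 0 := hg.1.entry _ _ rfl
    set e := g (newIdx r s) (newIdx r s) with he
    have hη' := hη.mul_even hee
    have hdiff := value_crossD_addVec (L := L) hv hη'
    rw [← hT] at hdiff
    have hp := (isPoint_oldVec.1 hv).2
    have hw : ∀ F, v.submatrix (oldIdx r s) id F A ∈ Par (N + 2) (par F + par A) := by
      intro k
      refine hv.1.entry _ _ ?_
      rw [oldIdx, par_map]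
      rfl
    have hy : ∀ k, v (newIdx r s) k ∈ Par (N + 2) (0 + par k) := fun a =>
      hv.1.entry (newIdx r s) a rfl
    have hc : ∀ k, (fun F => g (newIdx r s) (oldIdx r s F)) k ∈ Par (N + 2) (0 + par k) := by
      intro k
      refine hg.1.entry _ _ ?_
      rw [oldIdx, par_map]
      rfl
    generalize v.submatrix (oldIdx r s) id = vo at *
    generalize g.submatrix (oldIdx r s) (oldIdx r s) = go at *
    generalize (fun F => g (newIdx r s) (oldIdx r s F)) = c at *
    obtain ⟨hE, hB⟩ := ber_one_add_infMat hη (by rw [add_zero]) hw hc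
    have hp' := isPoint_add_infMat oddDom_straight hp hη'
      (isSuper_infMat hη' (by rw [add_zero]) hw hy)
    have hev : η * sg (par A) • (c ⬝ᵥ fun F => vo F A) ∈ Par (N + 2) 0 := by
      have := sub_mem hE.ber_mem (Par.one_mem (N := N + 2))
      rwa [hB, add_sub_cancel_left, ← mul_smul_comm] at this
    rw [← mul_smul_comm] at hB
    have e1 : go * vo + infMat (fun F => (go * vo) F A) η
        (Matrix.vecMul c vo + fun k => e * v (newIdx r s) k) =
        go * (1 + infMat (fun F => vo F A) η c) *
          (vo + infMat (fun F => vo F A) (η * e) (v (newIdx r s))) := by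
      have e2 : (fun F => (go * vo) F A) = go.mulVec fun F => vo F A := rfl
      rw [e2, ← mul_infMat, infMat_add, ← infMat_mul, ← infMat_mul_right]
      simp only [Matrix.mul_add, Matrix.add_mul, Matrix.mul_one, infMat_mul_infMat hη,
        Matrix.mul_assoc, Matrix.mul_zero]
      abel
    rw [e1, hL.ber _ _ _ hp' (hgo.mul hE), hL.ber _ _ _ hp hgo, ber_mul hgo hE, hB,
      even_comm hgo.ber_mem, ← mul_assoc]
    have e3 : (Matrix.vecMul c vo + fun k => e * v (newIdx r s) k) A =
        c ⬝ᵥ (fun F => vo F A) + e * v (newIdx r s) A := rfl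
    rw [e3]
    set X := value L vo
    set Y := value L (vo + infMat (fun F => vo F A) (η * e) (v (newIdx r s)))
    set τ := c ⬝ᵥ fun F => vo F A
    set B := Ber go
    set z := v (newIdx r s) A
    have h1 : Y - X = η * (sg (par A) • (e * (z * X - value T v))) := by
      have h5 : sg (par A) • (Y - X) = η * (e * (z * X - value T v)) := by
        rw [← mul_assoc, mul_sub, hdiff]
        noncomm_ring
      rw [mul_smul_comm, ← h5, smul_smul, sg_mul_self, one_smul]
    have h2 := mul_one_add_sub hη h1 hev
    have h3 : sg (par A) • (Y * (1 + η * sg (par A) • τ) * B - X * B) =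
        (η * (e * (z * X - value T v)) + η * τ * X) * B := by
      rw [← sub_mul, h2, ← smul_mul_assoc, smul_add, mul_smul_comm, mul_smul_comm, smul_mul_assoc,
        smul_smul, smul_smul, sg_mul_self, one_smul, one_smul]
    rw [← mul_assoc Y, h3, ← even_comm hee B, ← mul_assoc _ e B, ← even_comm hee (value T v)]
    noncomm_ring

end BerStraight

section Forms
variable {n m p q r s : ℕ}

theorem sum_smul_value {R0 R1 C0 C1 ι : Type} [Fintype R0] [Fintype R1] [Fintype C0] [Fintype C1]
    [Fintype ι] {U : TopologicalSpace.Opens (Ev R0 R1 C0 C1 → ℝ)} (c : ℝ) (b : ι → ℝ)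
    (f : ι → SFun U (Od R0 R1 C0 C1)) {N : ℕ} {M M' : Matrix (R0 ⊕ R1) (C0 ⊕ C1) (Gr N)} {x : Gr N}
    (h : ∀ i, value (f i) M' = value (f i) M * x) :
    value (c • ∑ i, b i • f i) M' = value (c • ∑ i, b i • f i) M * x := by
  simp only [value_smul, value_sum, h, smul_mul_assoc, Finset.sum_mul]

theorem isMixed_eCov (α : Fin n ⊕ Fin m → ℝ) {L : MixedFun n m p q r s} (hL : IsMixed L) :
    IsMixed (eCov α L) where
  ber_right N M h hM hh := by
    rw [eCov_eq]
    exact sum_smul_value _ _ _ fun A => rowD_ber_right hL A hM hh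
  ber_left N P W a g hM ha hg := by
    rw [eCov_eq]
    exact sum_smul_value _ _ _ fun A => rowD_ber_left hL A hM ha hg
  system := eCov_system α hL.system

theorem isMixed_eVec (u : Fin n ⊕ Fin m → ℝ) {L : MixedFun n m p q r s} (hL : IsMixed L) :
    IsMixed (eVec u L) where
  ber_right N M h hM hh := by
    rw [eVec_eq]
    exact sum_smul_value _ _ _ fun A => crossD_ber_right hL A hM hh
  ber_left N P W a g hM ha hg := by
    rw [eVec_eq]
    exact sum_smul_value _ _ _ fun A => crossD_ber_left hL A hM ha hg
  system := eVec_system u hL.system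

theorem isStraight_eStraight (α : Fin n ⊕ Fin m → ℝ) {L : StraightFun n m r s}
    (hL : IsStraight L) : IsStraight (eStraight α L) where
  ber N v g hv hg := by
    rw [eStraight_eq]
    exact sum_smul_value _ _ _ fun A => crossD_ber_straight hL A hv hg
  system := eStraight_system α hL.system

end Forms

/-! ### The isomorphism between straight forms and mixed forms of codegree `n|m` -/

section Tau
variable {n m r s N : ℕ}

/-- The odd columns of `(1; v)` are always linearly independent. -/
theorem isPoint_stack_one {v : Matrix (Fin r ⊕ Fin s) (Fin n ⊕ Fin m) (Gr N)} :
    IsPoint (mixedDom n m n m r s) (stack 1 v) ↔ IsPoint (straightDom n m r s) v := by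
  rw [isPoint_mixed_iff, isPoint_straight_iff]
  have e : bodyMat (1 : Matrix (Fin n ⊕ Fin m) (Fin n ⊕ Fin m) (Gr N)).toBlocks₂₂ = 1 := by
    ext i j
    by_cases h : i = j <;> simp [Matrix.toBlocks₂₂, Matrix.one_apply, h]
  rw [e]
  refine ⟨fun h => ⟨h.1.2, h.2.2⟩, fun h => ⟨⟨IsSuper.one, h.1⟩, fun w hw _ => ?_, h.2⟩⟩
  rwa [Matrix.one_mulVec] at hw

theorem value_tauInv {v : Matrix (Fin r ⊕ Fin s) (Fin n ⊕ Fin m) (Gr N)}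
    (hv : IsPoint (straightDom n m r s) v) (L : MixedFun n m n m r s) :
    value (tauInv L) v = value L (stack 1 v) := by
  refine (Subst.value_pull _ tauSubst_mem hv L).trans ?_
  congr 1
  ext a k
  rcases a with (a | a) | (a | a) <;> rcases k with k | k
  all_goals first
    | rfl
    | simp [Subst.app, tauSubst, stack, Matrix.one_apply]

theorem pd_tauInv (F : Fin r ⊕ Fin s) (A : Fin n ⊕ Fin m) (L : MixedFun n m n m r s) :
    pd (straightDom n m r s) F A (tauInv L) =
      tauInv (pd (mixedDom n m n m r s) (wRow F) A L) := by
  refine Subst.pd_pull _ tauSubst_mem ?_ L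
  rcases F with F | F <;> rcases A with A | A
  · rintro (⟨a | a, k⟩ | ⟨a | a, k⟩) <;> simp [Subst.evIdx, tauSubst]
  · refine ⟨?_, by simp [Subst.odd, tauSubst]⟩
    rintro (⟨a | a, k⟩ | ⟨a | a, k⟩) hi
    · simp [Subst.odd, tauSubst]
    · refine Finsupp.single_eq_of_ne fun h => hi ?_
      simpa [eq_comm] using h
    · simp [Subst.odd, tauSubst]
    · simp [Subst.odd, tauSubst]
  · refine ⟨?_, by simp [Subst.odd, tauSubst]⟩
    rintro (⟨a | a, k⟩ | ⟨a | a, k⟩) hi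
    · simp [Subst.odd, tauSubst]
    · simp [Subst.odd, tauSubst]
    · simp [Subst.odd, tauSubst]
    · refine Finsupp.single_eq_of_ne fun h => hi ?_
      simpa [eq_comm] using h
  · rintro (⟨a | a, k⟩ | ⟨a | a, k⟩) <;> simp [Subst.evIdx, tauSubst]

theorem IsTau.eq_tauInv {L : StraightFun n m r s} {L' : MixedFun n m n m r s} (h : IsTau L L') :
    L = tauInv L' := by
  refine eq_of_value fun N v hv => ?_
  have := h N 1 v (isPoint_stack_one.2 hv) isUnit_one
  rw [value_tauInv hv, this, Ring.inverse_one, Matrix.mul_one, ber_one, mul_one]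

/-- `(p; w) = (1; w p⁻¹) p`, so that the law for `h = p` recovers `L` from `τ⁻¹ L`. -/
theorem isTau_tauInv {L' : MixedFun n m n m r s}
    (hL' : ∀ (N : ℕ) (M : Matrix (MRow n m r s) (Fin n ⊕ Fin m) (Gr N))
      (h : Matrix (Fin n ⊕ Fin m) (Fin n ⊕ Fin m) (Gr N)),
      IsPoint (mixedDom n m n m r s) M → IsGL h → value L' (M * h) = value L' M * Ber h) :
    IsTau (tauInv L') L' := by
  intro N P W hM hP
  have hs := isSuper_stack_iff.1 hM.1
  have hPg : IsGL P := ⟨hs.1, hP⟩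
  have hPi : IsGL (Ring.inverse P) := ⟨hs.1.inverse hP, hP.ringInverse⟩
  have hW : IsPoint (straightDom n m r s) W :=
    isPoint_straight_iff.2 ⟨hs.2, (isPoint_mixed_iff.1 hM).2.2⟩
  have hv := isPoint_straight_mul_right hW hPi
  rw [value_tauInv hv, ← hL' _ _ _ (isPoint_stack_one.2 hv) hPg, stack_mul, Matrix.one_mul,
    Matrix.mul_assoc, Ring.inverse_mul_cancel _ hP, Matrix.mul_one]

theorem IsInf.neg {i : ℕ} {η : Gr N} (hη : IsInf N i η) : IsInf N i (-η) :=
  ⟨neg_mem hη.mem, fun x => by rw [neg_mul, neg_mul, mul_neg, neg_neg, hη.mul_mul]⟩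

/-- At `p = 1` the addition of `η v_{r+1}` to row `A` of `p` is compensated by the transformation
`h = 1 + η v_{r+1}` of all columns: its Berezinian gives the term `v_{r+1}^A L`, and its inverse acts
on `v` as the infinitesimal transformation of `e_α`. -/
theorem tauInv_eCov (α : Fin n ⊕ Fin m → ℝ) {L : MixedFun n m n m r s} (hL : IsMixed L) :
    tauInv (eCov α L) = eStraight α (tauInv L) := by
  refine eq_of_value fun N v hv => ?_
  rw [value_tauInv hv, eCov_eq, eStraight_eq]
  simp only [value_smul, value_sum]
  congr 1
  refine Finset.sum_congr rfl fun A _ => ?_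
  rw [mul_smul]
  congr 1
  refine eq_of_eps_mul (par A) ?_
  rw [map_smul, ← value_ext (isPoint_stack_one.2 hv), ← value_ext hv, stack_map,
    Matrix.map_one _ (map_zero _) (map_one _)]
  have hη := isInf_eps N (par A)
  replace hv := isPoint_ext hv
  generalize v.map (ext N) = v at *
  generalize eps N (par A) = η at *
  have hp := (isPoint_oldVec.1 hv).2
  have hM := isPoint_stack_one.2 hv
  have hdiff := value_crossD_addVec (L := tauInv L) hv hη.neg
  rw [mul_smul_comm, value_rowD_addRow hM hη]
  have hy : ∀ k, v (newIdx r s) k ∈ Par (N + 2) (0 + par k) := fun a =>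
    hv.1.entry (newIdx r s) a rfl
  have hw : ∀ F, v.submatrix (oldIdx r s) id F A ∈ Par (N + 2) (par F + par A) := by
    intro k
    refine hv.1.entry _ _ ?_
    rw [oldIdx, par_map]
    rfl
  generalize v.submatrix (oldIdx r s) id = vo at *
  generalize v (newIdx r s) = y at *
  have hp' := isPoint_add_infMat oddDom_straight hp hη.neg
    (isSuper_infMat hη.neg (by rw [add_zero]) hw hy)
  obtain ⟨hE, hB⟩ := ber_one_add_infMat hη (by rw [add_zero]) (par_single A) hy
  have hyA : y ⬝ᵥ Pi.single A 1 = y A := by simp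
  have hev : η * sg (par A) • y A ∈ Par (N + 2) 0 := by
    have := sub_mem hE.ber_mem (Par.one_mem (N := N + 2))
    rwa [hB, add_sub_cancel_left, ← mul_smul_comm, hyA] at this
  rw [hyA, ← mul_smul_comm] at hB
  have e1 : stack (1 + infMat (Pi.single A 1) η y) vo =
      stack 1 (vo + infMat (fun F => vo F A) (-η) y) * (1 + infMat (Pi.single A 1) η y) := by
    rw [stack_mul, Matrix.one_mul]
    congr 1
    have e2 : infMat (fun F => vo F A) (-η) y = -infMat (fun F => vo F A) η y := by
      ext F k
      simp [infMat_apply]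
    have e3 : vo.mulVec (Pi.single A 1) = fun F => vo F A := by
      ext F
      simp [Matrix.mulVec, dotProduct, Pi.single_apply]
    rw [e2, Matrix.mul_add, Matrix.mul_one, Matrix.add_mul, mul_infMat, e3, Matrix.neg_mul,
      infMat_mul_infMat hη]
    abel
  rw [value_tauInv hp, value_tauInv hp'] at hdiff
  rw [e1, hL.ber_right _ _ _ (isPoint_stack_one.2 hp') hE, hB]
  set T := crossD (straightDom n m (r + 1) s) (newIdx r s) A (addVec (tauInv L))
  set X := value L (stack 1 vo)
  set Y := value L (stack 1 (vo + infMat (fun F => vo F A) (-η) y))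
  have h1 : Y - X = η * (sg (par A) • (value T v - y A * X)) := by
    have h5 : sg (par A) • (Y - X) = η * (value T v - y A * X) := by
      have h6 : sg (par A) • (Y - X) = -η * y A * X - -η * value T v := by
        rw [hdiff]; abel
      rw [h6]
      noncomm_ring
    rw [mul_smul_comm, ← h5, smul_smul, sg_mul_self, one_smul]
  rw [mul_one_add_sub hη h1 hev, mul_smul_comm, mul_smul_comm, smul_mul_assoc, ← smul_add,
    smul_smul, sg_mul_self, one_smul]
  noncomm_ring

end Tau

/-! ### The stability isomorphisms -/

section Split
variable {p q k l p' q' : ℕ} (hp : p' = p + k) (hq : q' = q + l)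

/-- The first `p|q` of `p+k|q+l` indices. -/
abbrev fstI : Fin p ⊕ Fin q → Fin p' ⊕ Fin q' := Sum.map (firstIdx hp) (firstIdx hq)

/-- The last `k|l` of `p+k|q+l` indices. -/
abbrev lstI : Fin k ⊕ Fin l → Fin p' ⊕ Fin q' := Sum.map (lastIdx hp) (lastIdx hq)

theorem splitIdx_firstIdx (i : Fin p) : splitIdx hp (firstIdx hp i) = .inl i := by
  subst hp
  simp [splitIdx, firstIdx]

theorem splitIdx_lastIdx (i : Fin k) : splitIdx hp (lastIdx hp i) = .inr i := by
  subst hp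
  simp [splitIdx, lastIdx]

/-- The division of `p + k` indices into the first `p` and the last `k`. -/
def splitEquiv : Fin p ⊕ Fin k ≃ Fin p' := finSumFinEquiv.trans (finCongr hp.symm)

theorem idx_cases (K : Fin p' ⊕ Fin q') :
    (∃ i, K = fstI hp hq i) ∨ ∃ j, K = lstI hp hq j := by
  rcases K with K | K
  · obtain ⟨i | i, rfl⟩ := (splitEquiv hp).surjective K
    · exact .inl ⟨.inl i, rfl⟩
    · exact .inr ⟨.inl i, rfl⟩
  · obtain ⟨i | i, rfl⟩ := (splitEquiv hq).surjective K
    · exact .inl ⟨.inr i, rfl⟩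
    · exact .inr ⟨.inr i, rfl⟩

theorem sum_split {V : Type} [AddCommMonoid V] (f : Fin p' ⊕ Fin q' → V) :
    ∑ K, f K = ∑ i, f (fstI hp hq i) + ∑ j, f (lstI hp hq j) := by
  subst hp hq
  simp only [Fintype.sum_sum_type, Fin.sum_univ_add]
  simp only [Sum.map_inl, Sum.map_inr, firstIdx, lastIdx, Fin.cast_refl, id]
  abel

/-- The inverse of the division of `p+k|q+l` indices into `p|q` and `k|l` ones. -/
def idxSplit : Fin p' ⊕ Fin q' → (Fin p ⊕ Fin q) ⊕ (Fin k ⊕ Fin l)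
  | .inl i => Sum.map .inl .inl (splitIdx hp i)
  | .inr i => Sum.map .inr .inr (splitIdx hq i)

theorem idxSplit_fstI (i : Fin p ⊕ Fin q) : idxSplit hp hq (fstI hp hq i) = .inl i := by
  rcases i with i | i <;> simp [idxSplit, splitIdx_firstIdx]

theorem idxSplit_lstI (i : Fin k ⊕ Fin l) : idxSplit hp hq (lstI hp hq i) = .inr i := by
  rcases i with i | i <;> simp [idxSplit, splitIdx_lastIdx]

variable {N : ℕ} (A : Matrix (Fin p ⊕ Fin q) (Fin p ⊕ Fin q) (Gr N))
  (B : Matrix (Fin p ⊕ Fin q) (Fin k ⊕ Fin l) (Gr N))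
  (C : Matrix (Fin k ⊕ Fin l) (Fin p ⊕ Fin q) (Gr N))
  (D : Matrix (Fin k ⊕ Fin l) (Fin k ⊕ Fin l) (Gr N))

/-- The supermatrix of size `p+k|q+l` with the blocks `A`, `B`, `C`, `D`. -/
def glue : Matrix (Fin p' ⊕ Fin q') (Fin p' ⊕ Fin q') (Gr N) :=
  (Matrix.fromBlocks A B C D).submatrix (idxSplit hp hq) (idxSplit hp hq)

theorem glue_ff (i j) : glue hp hq A B C D (fstI hp hq i) (fstI hp hq j) = A i j := by
  rw [glue, Matrix.submatrix_apply, idxSplit_fstI, idxSplit_fstI]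
  rfl

theorem glue_fl (i j) : glue hp hq A B C D (fstI hp hq i) (lstI hp hq j) = B i j := by
  rw [glue, Matrix.submatrix_apply, idxSplit_fstI, idxSplit_lstI]
  rfl

theorem glue_lf (i j) : glue hp hq A B C D (lstI hp hq i) (fstI hp hq j) = C i j := by
  rw [glue, Matrix.submatrix_apply, idxSplit_fstI, idxSplit_lstI]
  rfl

theorem glue_ll (i j) : glue hp hq A B C D (lstI hp hq i) (lstI hp hq j) = D i j := by
  rw [glue, Matrix.submatrix_apply, idxSplit_lstI, idxSplit_lstI]
  rfl

variable {A B C D}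

theorem isSuper_glue (hA : IsSuper A) (hB : IsSuper B) (hC : IsSuper C) (hD : IsSuper D) :
    IsSuper (glue hp hq A B C D) := by
  intro a b
  rcases idx_cases hp hq a with ⟨a, rfl⟩ | ⟨a, rfl⟩ <;>
    rcases idx_cases hp hq b with ⟨b, rfl⟩ | ⟨b, rfl⟩
  · rw [glue_ff, par_map, par_map]; exact hA a b
  · rw [glue_fl, par_map, par_map]; exact hB a b
  · rw [glue_lf, par_map, par_map]; exact hC a b
  · rw [glue_ll, par_map, par_map]; exact hD a b

theorem glue_lower (hA : IsGL A) (hC : IsSuper C) (hD : IsGL D) :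
    IsGL (glue hp hq A 0 C D) ∧ Ber (glue hp hq A 0 C D) = Ber A * Ber D := by
  have hs := isSuper_glue hp hq hA.1 IsSuper.zero hC hD.1
  have h0 : ∀ i j, glue hp hq A 0 C D (fstIdx (splitEquiv hp) (splitEquiv hq) i)
      (sndIdx (splitEquiv hp) (splitEquiv hq) j) = 0 := fun i j => glue_fl hp hq A 0 C D i j
  have e1 : (glue hp hq A 0 C D).submatrix (fstIdx (splitEquiv hp) (splitEquiv hq))
      (fstIdx (splitEquiv hp) (splitEquiv hq)) = A := by
    ext i j; exact glue_ff hp hq A 0 C D i j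
  have e2 : (glue hp hq A 0 C D).submatrix (sndIdx (splitEquiv hp) (splitEquiv hq))
      (sndIdx (splitEquiv hp) (splitEquiv hq)) = D := by
    ext i j; exact glue_ll hp hq A 0 C D i j
  have h1 := (isGL_lower_blocks _ _ hs h0).2 (by rw [e1, e2]; exact ⟨hA, hD⟩)
  refine ⟨h1, ?_⟩
  rw [ber_lower_blocks _ _ h1 h0, e1, e2]

theorem glue_upper (hA : IsGL A) (hB : IsSuper B) (hD : IsGL D) :
    IsGL (glue hp hq A B 0 D) ∧ Ber (glue hp hq A B 0 D) = Ber A * Ber D := by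
  have hs := isSuper_glue hp hq hA.1 hB IsSuper.zero hD.1
  have h0 : ∀ i j, glue hp hq A B 0 D (sndIdx (splitEquiv hp) (splitEquiv hq) i)
      (fstIdx (splitEquiv hp) (splitEquiv hq) j) = 0 := fun i j => glue_lf hp hq A B 0 D i j
  have e1 : (glue hp hq A B 0 D).submatrix (fstIdx (splitEquiv hp) (splitEquiv hq))
      (fstIdx (splitEquiv hp) (splitEquiv hq)) = A := by
    ext i j; exact glue_ff hp hq A B 0 D i j
  have e2 : (glue hp hq A B 0 D).submatrix (sndIdx (splitEquiv hp) (splitEquiv hq))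
      (sndIdx (splitEquiv hp) (splitEquiv hq)) = D := by
    ext i j; exact glue_ll hp hq A B 0 D i j
  have h1 := (isGL_upper_blocks _ _ hs h0).2 (by rw [e1, e2]; exact ⟨hA, hD⟩)
  refine ⟨h1, ?_⟩
  rw [ber_upper_blocks _ _ h1 h0, e1, e2]

end Split

section Sigma
variable {n m p q r s k l p' q' r' s' N : ℕ} (hp : p' = p + k) (hq : q' = q + l) (hr : r' = r + k)
  (hs : s' = s + l)

/-- The rows of `(p, w)`, without the last `k|l` rows of `w`. -/
abbrev fstRow : MRow n m r s → MRow n m r' s' :=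
  Sum.map (Sum.map id (firstIdx hr)) (Sum.map id (firstIdx hs))

/-- The last `k|l` rows of `w`. -/
abbrev lstRow : Fin k ⊕ Fin l → MRow n m r' s' :=
  Sum.map (fun i => .inr (lastIdx hr i)) (fun i => .inr (lastIdx hs i))

theorem fstRow_pRow (A : Fin n ⊕ Fin m) : fstRow hr hs (pRow A) = pRow A := by
  rcases A with A | A <;> rfl

theorem fstRow_wRow (F : Fin r ⊕ Fin s) :
    fstRow (n := n) (m := m) hr hs (wRow F) = wRow (fstI hr hs F) := by
  rcases F with A | A <;> rfl

theorem lstRow_eq (F : Fin k ⊕ Fin l) :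
    lstRow (n := n) (m := m) hr hs F = wRow (lstI hr hs F) := by
  rcases F with A | A <;> rfl

theorem row_cases (a : MRow n m r' s') :
    (∃ b, a = fstRow hr hs b) ∨ ∃ i, a = lstRow hr hs i := by
  rcases mrow_cases a with ⟨A, rfl⟩ | ⟨F, rfl⟩
  · exact .inl ⟨pRow A, (fstRow_pRow hr hs A).symm⟩
  · rcases idx_cases hr hs F with ⟨i, rfl⟩ | ⟨i, rfl⟩
    · exact .inl ⟨wRow i, (fstRow_wRow hr hs i).symm⟩
    · exact .inr ⟨i, (lstRow_eq hr hs i).symm⟩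

/-- The matrix `(M 0; 0 1)`. -/
abbrev sigmaMat (M : Matrix (MRow n m r s) (Fin p ⊕ Fin q) (Gr N)) :
    Matrix (MRow n m r' s') (Fin p' ⊕ Fin q') (Gr N) := (sigmaSubst n m hp hq hr hs).app M

variable (M : Matrix (MRow n m r s) (Fin p ⊕ Fin q) (Gr N))

theorem sigmaMat_ff (a K) : sigmaMat hp hq hr hs M (fstRow hr hs a) (fstI hp hq K) = M a K := by
  rcases a with (a | a) | (a | a) <;> rcases K with K | K <;>
    simp [sigmaMat, Subst.app, sigmaSubst, splitRow, splitIdx_firstIdx, blockDiag, blockOff]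

theorem sigmaMat_fl (a j) : sigmaMat hp hq hr hs M (fstRow hr hs a) (lstI hp hq j) = 0 := by
  rcases a with (a | a) | (a | a) <;> rcases j with K | K <;>
    simp [sigmaMat, Subst.app, sigmaSubst, splitRow, splitIdx_firstIdx, splitIdx_lastIdx, blockDiag,
      blockOff]

theorem sigmaMat_lf (i K) : sigmaMat hp hq hr hs M (lstRow hr hs i) (fstI hp hq K) = 0 := by
  rcases i with i | i <;> rcases K with K | K <;>
    simp [sigmaMat, Subst.app, sigmaSubst, splitRow, splitIdx_firstIdx, splitIdx_lastIdx, blockDiag,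
      blockOff]

theorem sigmaMat_ll (i j) : sigmaMat hp hq hr hs M (lstRow hr hs i) (lstI hp hq j) =
    (1 : Matrix (Fin k ⊕ Fin l) (Fin k ⊕ Fin l) (Gr N)) i j := by
  rcases i with i | i <;> rcases j with j | j
  · by_cases h : i = j <;>
    simp [sigmaMat, Subst.app, sigmaSubst, splitRow, splitIdx_firstIdx, splitIdx_lastIdx, blockDiag,
      blockOff, Matrix.one_apply, h]
  · simp [sigmaMat, Subst.app, sigmaSubst, splitRow, splitIdx_firstIdx, splitIdx_lastIdx, blockDiag,
      blockOff, Matrix.one_apply]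
  · simp [sigmaMat, Subst.app, sigmaSubst, splitRow, splitIdx_firstIdx, splitIdx_lastIdx, blockDiag,
      blockOff, Matrix.one_apply]
  · by_cases h : i = j <;>
    simp [sigmaMat, Subst.app, sigmaSubst, splitRow, splitIdx_firstIdx, splitIdx_lastIdx, blockDiag,
      blockOff, Matrix.one_apply, h]

variable {M}

theorem value_sigmaInv (hM : IsPoint (mixedDom n m p q r s) M) (L : MixedFun n m p' q' r' s') :
    value (sigmaInv hp hq hr hs L) M = value L (sigmaMat hp hq hr hs M) :=
  Subst.value_pull _ (sigmaSubst_mem hp hq hr hs) hM L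

theorem isPoint_sigmaMat_iff : IsPoint (mixedDom n m p' q' r' s') (sigmaMat hp hq hr hs M) ↔
    IsPoint (mixedDom n m p q r s) M := by
  refine ⟨fun h => ?_, Subst.isPoint_app _ (sigmaSubst_mem hp hq hr hs)⟩
  have hS : IsSuper M := fun a K => by
    have := h.1 (fstRow hr hs a) (fstI hp hq K)
    rwa [sigmaMat_ff, par_map, par_map] at this
  rw [← stack_eta M] at hS ⊢
  rw [← stack_eta (sigmaMat hp hq hr hs M), isPoint_mixed_iff] at h
  rw [isPoint_mixed_iff]
  obtain ⟨-, h1, h2⟩ := h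
  refine ⟨isSuper_stack_iff.1 hS, fun v hv hv' => ?_, fun v hv => ?_⟩
  · let v' : Fin q' → ℝ := fun K => Sum.elim v 0 (splitIdx hq K)
    have e1 : ∀ i, v' (firstIdx hq i) = v i := fun i => by simp [v', splitIdx_firstIdx]
    have e2 : ∀ i, v' (lastIdx hq i) = 0 := fun i => by simp [v', splitIdx_lastIdx]
    have es : ∀ f : Fin q' → ℝ, ∑ K, f K * v' K = ∑ i, f (firstIdx hq i) * v i := by
      intro f
      rw [← (splitEquiv hq).sum_comp, Fintype.sum_sum_type]
      change ∑ i, f (firstIdx hq i) * v' (firstIdx hq i) +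
        ∑ i, f (lastIdx hq i) * v' (lastIdx hq i) = _
      simp only [e1, e2, mul_zero, Finset.sum_const_zero, add_zero]
    have h3 := h1 v' ?_ ?_
    · funext i
      rw [← e1, h3]
      rfl
    · funext a
      refine (es _).trans (Eq.trans ?_ (congrFun hv a))
      refine Finset.sum_congr rfl fun i _ => ?_
      exact congrArg (· * v i)
        (congrArg body (sigmaMat_ff hp hq hr hs M (pRow (.inr a)) (.inr i)))
    · funext F
      refine (es _).trans ?_
      rcases idx_cases hr hs (.inr F) with ⟨a | a, ha⟩ | ⟨a | a, ha⟩
      · cases ha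
      · obtain rfl : F = firstIdx hs a := Sum.inr_injective ha
        refine Eq.trans ?_ (congrFun hv' a)
        refine Finset.sum_congr rfl fun i _ => ?_
        exact congrArg (· * v i)
          (congrArg body (sigmaMat_ff hp hq hr hs M (wRow (.inr a)) (.inr i)))
      · cases ha
      · obtain rfl : F = lastIdx hs a := Sum.inr_injective ha
        refine Finset.sum_eq_zero fun i _ => ?_
        have := sigmaMat_lf hp hq hr hs M (.inr a) (.inr i)
        refine mul_eq_zero_of_left ?_ _
        exact (congrArg body this).trans (map_zero _)
  · let v' : Fin s' → ℝ := fun K => Sum.elim v 0 (splitIdx hs K)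
    have e1 : ∀ i, v' (firstIdx hs i) = v i := fun i => by simp [v', splitIdx_firstIdx]
    have e2 : ∀ i, v' (lastIdx hs i) = 0 := fun i => by simp [v', splitIdx_lastIdx]
    have es : ∀ f : Fin s' → ℝ, ∑ K, v' K * f K = ∑ i, v i * f (firstIdx hs i) := by
      intro f
      rw [← (splitEquiv hs).sum_comp, Fintype.sum_sum_type]
      change ∑ i, v' (firstIdx hs i) * f (firstIdx hs i) +
        ∑ i, v' (lastIdx hs i) * f (lastIdx hs i) = _
      simp only [e1, e2, zero_mul, Finset.sum_const_zero, add_zero]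
    have h3 := h2 v' ?_
    · funext i
      rw [← e1, h3]
      rfl
    · funext K
      refine (es _).trans ?_
      rcases idx_cases hp hq (.inr K) with ⟨a | a, ha⟩ | ⟨a | a, ha⟩
      · cases ha
      · obtain rfl : K = firstIdx hq a := Sum.inr_injective ha
        refine Eq.trans ?_ (congrFun hv a)
        refine Finset.sum_congr rfl fun i _ => ?_
        exact congrArg (v i * ·)
          (congrArg body (sigmaMat_ff hp hq hr hs M (wRow (.inr i)) (.inr a)))
      · cases ha
      · obtain rfl : K = lastIdx hq a := Sum.inr_injective ha
        refine Finset.sum_eq_zero fun i _ => ?_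
        have := sigmaMat_fl hp hq hr hs M (wRow (.inr i)) (.inr a)
        refine mul_eq_zero_of_right _ ?_
        exact (congrArg body this).trans (map_zero _)

variable {hp hq hr hs}

/-- At `(M 0; 0 1)` the defining relation of `σ` reduces to `L M = L' (M 0; 0 1)`. -/
theorem IsSigma.eq_sigmaInv {L : MixedFun n m p q r s} {L' : MixedFun n m p' q' r' s'}
    (h : IsSigma hp hq hr hs L L') : L = sigmaInv hp hq hr hs L' := by
  refine eq_of_value fun N M hM => ?_
  have e : ((sigmaMat hp hq hr hs M).submatrix (lstRow hr hs) (lstI hp hq)) = 1 := by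
    ext i j; exact sigmaMat_ll hp hq hr hs M i j
  have e1 : ((sigmaMat hp hq hr hs M).submatrix (fstRow hr hs) (lstI hp hq)) = 0 := by
    ext i j; exact sigmaMat_fl hp hq hr hs M i j
  have e2 : ((sigmaMat hp hq hr hs M).submatrix (fstRow hr hs) (fstI hp hq)) = M := by
    ext i j; exact sigmaMat_ff hp hq hr hs M i j
  have := h N (sigmaMat hp hq hr hs M) ((isPoint_sigmaMat_iff hp hq hr hs).2 hM)
    (by rw [e]; exact isUnit_one)
  rw [e, e1, e2, Matrix.zero_mul, Matrix.zero_mul, sub_zero, ber_one, mul_one] at this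
  rw [value_sigmaInv hp hq hr hs hM, this]

/-- A mixed form is recovered from its values at the matrices `(M 0; 0 1)`: if `w₂₂` is invertible,
then subtracting multiples of the last rows, and then multiplying by `(1 0; w₂₁ w₂₂)` on the right,
connects such a matrix with the given one. -/
theorem isSigma_sigmaInv {L' : MixedFun n m p' q' r' s'} (hL' : IsMixed L') :
    IsSigma hp hq hr hs (sigmaInv hp hq hr hs L') L' := by
  intro N M hM hu
  let row₁ : MRow n m r s → MRow n m r' s' := fstRow hr hs
  let row₂ : Fin k ⊕ Fin l → MRow n m r' s' := lstRow hr hs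
  let col₁ : Fin p ⊕ Fin q → Fin p' ⊕ Fin q' := fstI hp hq
  let col₂ : Fin k ⊕ Fin l → Fin p' ⊕ Fin q' := lstI hp hq
  change IsUnit (M.submatrix row₂ col₂) at hu
  change value L' M = value (sigmaInv hp hq hr hs L') (M.submatrix row₁ col₁ -
    M.submatrix row₁ col₂ * Ring.inverse (M.submatrix row₂ col₂) * M.submatrix row₂ col₁) *
      Ber (M.submatrix row₂ col₂)
  have hMs := hM.1
  set M₁₁ := M.submatrix row₁ col₁ with h11
  set M₁₂ := M.submatrix row₁ col₂ with h12
  set M₂₁ := M.submatrix row₂ col₁ with h21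
  set D := M.submatrix row₂ col₂ with hD
  have s11 : IsSuper M₁₁ := hMs.submatrix _ _ _ _
  have s12 : IsSuper M₁₂ := hMs.submatrix _ _ _ _
  have s21 : IsSuper M₂₁ := hMs.submatrix _ _ _ _
  have s22 : IsSuper D := hMs.submatrix _ _ _ _
  have hDg : IsGL D := ⟨s22, hu⟩
  have s22' := s22.inverse hu
  set S := M₁₁ - M₁₂ * Ring.inverse D * M₂₁ with hS
  have hX : IsSuper (M₁₂ * Ring.inverse D) := s12.mul s22'
  -- subtraction of multiples of the last rows clears the block `M₁₂`
  let a : Matrix (Fin n ⊕ Fin m) (Fin r' ⊕ Fin s') (Gr N) := Matrix.of fun B F =>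
    Sum.elim (fun _ => 0) (fun j => -(M₁₂ * Ring.inverse D) (pRow B) j) (idxSplit hr hs F)
  let X : Matrix (Fin r ⊕ Fin s) (Fin k ⊕ Fin l) (Gr N) :=
    -(M₁₂ * Ring.inverse D).submatrix wRow id
  let G := glue hr hs 1 X 0 1
  have hXs : IsSuper X := by
    have := (hX.submatrix (.inr : Fin r → _) (.inr : Fin s → _) id id).neg
    rwa [Sum.map_id_id] at this
  obtain ⟨hG, hBG⟩ := glue_upper hr hs IsGL.one hXs (IsGL.one (N := N) (a := k) (b := l))
  have ha : IsSuper a := by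
    intro B F
    rcases idx_cases hr hs F with ⟨F, rfl⟩ | ⟨F, rfl⟩
    · simp only [a, Matrix.of_apply, idxSplit_fstI, Sum.elim_inl]
      exact zero_mem _
    · simp only [a, Matrix.of_apply, idxSplit_lstI, Sum.elim_inr]
      have := hX (pRow B) F
      rw [par_pRow] at this
      rw [par_map]
      exact neg_mem this
  rw [← stack_eta M] at hM ⊢
  set P := M.submatrix pRow id with hP
  set W := M.submatrix wRow id with hW
  have hM' := isPoint_left hM ha hG
  have hval := hL'.ber_left _ _ _ _ _ hM ha hG
  rw [hBG, ber_one, ber_one, mul_one, mul_one] at hval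
  have hH := glue_lower hp hq IsGL.one s21 hDg
  set H := glue hp hq 1 0 M₂₁ D with hHdef
  have hsum : ∀ (b : MRow n m r s) K, (stack (P + a * W) (G * W)) (fstRow hr hs b) K =
      M (row₁ b) K - ∑ j, (M₁₂ * Ring.inverse D) b j * M (row₂ j) K := by
    intro b K
    rcases mrow_cases b with ⟨B, rfl⟩ | ⟨F, rfl⟩
    · rw [fstRow_pRow, stack_pRow, Matrix.add_apply, Matrix.mul_apply, sum_split hr hs]
      simp only [a, Matrix.of_apply, idxSplit_fstI, idxSplit_lstI, Sum.elim_inl, Sum.elim_inr,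
        zero_mul, Finset.sum_const_zero, zero_add, neg_mul, Finset.sum_neg_distrib]
      rw [← sub_eq_add_neg]
      congr 1
      · exact congrArg (M · K) (fstRow_pRow hr hs B).symm
      · refine Finset.sum_congr rfl fun j _ => ?_
        rw [hW, Matrix.submatrix_apply, ← lstRow_eq]
        rfl
    · rw [fstRow_wRow, stack_wRow, Matrix.mul_apply, sum_split hr hs]
      simp only [G, glue_ff, glue_fl, X, Matrix.neg_apply, Matrix.submatrix_apply, id, neg_mul,
        Finset.sum_neg_distrib]
      rw [← sub_eq_add_neg]
      congr 1
      · simp only [Matrix.one_apply, ite_mul, one_mul, zero_mul, Finset.sum_ite_eq,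
          Finset.mem_univ, if_true]
        rw [hW, Matrix.submatrix_apply, ← fstRow_wRow]
        rfl
      · refine Finset.sum_congr rfl fun j _ => ?_
        rw [hW, Matrix.submatrix_apply, ← lstRow_eq]
        rfl
  have hlst : ∀ j K, (stack (P + a * W) (G * W)) (lstRow hr hs j) K = M (row₂ j) K := by
    intro j K
    rw [lstRow_eq, stack_wRow, Matrix.mul_apply, sum_split hr hs]
    simp only [G, glue_lf, glue_ll, Matrix.zero_apply, zero_mul, Finset.sum_const_zero, zero_add,
      Matrix.one_apply, ite_mul, one_mul, Finset.sum_ite_eq, Finset.mem_univ, if_true]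
    rw [hW, Matrix.submatrix_apply, ← lstRow_eq]
    rfl
  have key : stack (P + a * W) (G * W) = sigmaMat hp hq hr hs S * H := by
    ext b K
    rcases row_cases hr hs b with ⟨b, rfl⟩ | ⟨b, rfl⟩
    · rw [hsum, Matrix.mul_apply, sum_split hp hq]
      simp only [sigmaMat_ff, sigmaMat_fl, zero_mul, Finset.sum_const_zero, add_zero]
      rcases idx_cases hp hq K with ⟨K, rfl⟩ | ⟨K, rfl⟩
      · simp only [hHdef, glue_ff, Matrix.one_apply, mul_ite, mul_one, mul_zero, Finset.sum_ite_eq',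
          Finset.mem_univ, if_true]
        rfl
      · simp only [hHdef, glue_fl, Matrix.zero_apply, mul_zero, Finset.sum_const_zero]
        rw [sub_eq_zero]
        have : M₁₂ * Ring.inverse D * D = M₁₂ := by
          rw [Matrix.mul_assoc, Ring.inverse_mul_cancel _ hu, Matrix.mul_one]
        exact (congrFun (congrFun this b) K).symm
    · rw [hlst, Matrix.mul_apply, sum_split hp hq]
      simp only [sigmaMat_lf, sigmaMat_ll, zero_mul, Finset.sum_const_zero, zero_add,
        Matrix.one_apply, ite_mul, one_mul, Finset.sum_ite_eq, Finset.mem_univ, if_true]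
      rcases idx_cases hp hq K with ⟨K, rfl⟩ | ⟨K, rfl⟩
      · rw [hHdef, glue_lf]; rfl
      · rw [hHdef, glue_ll]; rfl
  have hHi : IsGL (Ring.inverse H) := ⟨hH.1.1.inverse hH.1.2, hH.1.2.ringInverse⟩
  have hpt : IsPoint (mixedDom n m p' q' r' s') (sigmaMat hp hq hr hs S) := by
    have := isPoint_mul_right hM' hHi
    rwa [key, Matrix.mul_assoc, Ring.mul_inverse_cancel _ hH.1.2, Matrix.mul_one] at this
  rw [← hval, key, hL'.ber_right _ _ _ hpt hH.1, hH.2, ber_one, one_mul,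
    value_sigmaInv hp hq hr hs ((isPoint_sigmaMat_iff hp hq hr hs).1 hpt)]

end Sigma

/-! ### Stability of the operators on mixed forms -/

section Perm
variable {a b N : ℕ} {κ : Type} (σ : Equiv.Perm (Fin a))

/-- The matrix of a permutation of the even indices: row `i` of `permMat a b N σ * W` is row `σ i` of
`W`. -/
abbrev permMat (a b N : ℕ) (σ : Equiv.Perm (Fin a)) :
    Matrix (Fin a ⊕ Fin b) (Fin a ⊕ Fin b) (Gr N) :=
  Matrix.fromBlocks ((1 : Matrix (Fin a) (Fin a) (Gr N)).submatrix σ id) 0 0 1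

theorem permMat_eq : permMat a b N σ =
    (1 : Matrix (Fin a ⊕ Fin b) (Fin a ⊕ Fin b) (Gr N)).submatrix (Sum.map σ id) id := by
  ext i j
  rcases i with i | i <;> rcases j with j | j <;> simp [permMat, Matrix.one_apply]

theorem permMat_mul (W : Matrix (Fin a ⊕ Fin b) κ (Gr N)) :
    permMat a b N σ * W = W.submatrix (Sum.map σ id) id := by
  rw [permMat_eq]
  ext i j
  simp [Matrix.mul_apply, Matrix.one_apply]

theorem mul_permMat (W : Matrix κ (Fin a ⊕ Fin b) (Gr N)) :
    W * permMat a b N σ⁻¹ = W.submatrix id (Sum.map σ id) := by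
  rw [permMat_eq]
  ext i j
  have : ∀ x : Fin a ⊕ Fin b, Sum.map (σ⁻¹ : Equiv.Perm (Fin a)) id x = j ↔ x = Sum.map σ id j := by
    intro x
    rcases x with x | x <;> rcases j with j | j <;> simp [Equiv.symm_apply_eq]
  simp only [Matrix.mul_apply, Matrix.submatrix_apply, id, Matrix.one_apply, this, mul_ite, mul_one,
    mul_zero, Finset.sum_ite_eq', Finset.mem_univ, if_true]

theorem isUnit_perm :
    IsUnit ((1 : Matrix (Fin a) (Fin a) (Gr N)).submatrix σ id) := by
  have h : ∀ τ ρ : Equiv.Perm (Fin a), τ * ρ = 1 →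
      (1 : Matrix (Fin a) (Fin a) (Gr N)).submatrix ρ id *
        (1 : Matrix (Fin a) (Fin a) (Gr N)).submatrix τ id = 1 := by
    intro τ ρ h
    ext i j
    have : τ (ρ i) = i := by rw [← Equiv.Perm.mul_apply, h, Equiv.Perm.one_apply]
    rw [Matrix.mul_apply, Finset.sum_eq_single (ρ i)]
    · simp [Matrix.one_apply, this]
    · intro x _ hx
      simp [Matrix.one_apply, hx.symm]
    · simp
  exact ⟨⟨_, (1 : Matrix (Fin a) (Fin a) (Gr N)).submatrix (σ⁻¹ : Equiv.Perm (Fin a)) id,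
    h σ⁻¹ σ (inv_mul_cancel σ), h σ σ⁻¹ (mul_inv_cancel σ)⟩, rfl⟩

theorem isGL_permMat : IsGL (permMat a b N σ) :=
  isGL_diag (fun i j => EvenMat.one (σ i) j) EvenMat.one (isUnit_perm σ) isUnit_one

/-- A permutation of even indices has its sign as Berezinian. -/
theorem ber_permMat : Ber (permMat a b N σ) = (((Equiv.Perm.sign σ : ℤˣ) : ℤ) : ℝ) • 1 := by
  have hs : EvenMat ((1 : Matrix (Fin a) (Fin a) (Gr N)).submatrix σ id) :=
    fun i j => EvenMat.one (σ i) j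
  rw [permMat, ber_diag hs EvenMat.one (isUnit_perm σ) isUnit_one, edet_one,
    Ring.inverse_one, mul_one, edet]
  have : ((1 : Matrix (Fin a) (Fin a) (Gr N)).submatrix σ id).map evl =
      (1 : Matrix (Fin a) (Fin a) (EvRing N)).submatrix σ id := by
    rw [← Matrix.submatrix_map, Matrix.map_one _ evl_zero evl_one]
  rw [this, Matrix.det_permute, Matrix.det_one, mul_one]
  rcases Int.units_eq_one_or (Equiv.Perm.sign σ) with h | h <;> rw [h] <;> simp

variable {n m p q r s : ℕ}

theorem IsMixed.value_row_perm {L : MixedFun n m p q r s} (hL : IsMixed L)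
    {P : Matrix (Fin n ⊕ Fin m) (Fin p ⊕ Fin q) (Gr N)}
    {W : Matrix (Fin r ⊕ Fin s) (Fin p ⊕ Fin q) (Gr N)}
    (h : IsPoint (mixedDom n m p q r s) (stack P W)) (σ : Equiv.Perm (Fin r)) :
    value L (stack P (W.submatrix (Sum.map σ id) id)) =
      (((Equiv.Perm.sign σ : ℤˣ) : ℤ) : ℝ) • value L (stack P W) := by
  have := hL.ber_left N P W 0 _ h IsSuper.zero (isGL_permMat σ)
  rwa [Matrix.zero_mul, add_zero, permMat_mul, ber_permMat, mul_smul_comm, mul_one] at this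

theorem IsMixed.value_col_perm {L : MixedFun n m p q r s} (hL : IsMixed L)
    {M : Matrix (MRow n m r s) (Fin p ⊕ Fin q) (Gr N)}
    (h : IsPoint (mixedDom n m p q r s) M) (σ : Equiv.Perm (Fin p)) :
    value L (M.submatrix id (Sum.map σ id)) =
      (((Equiv.Perm.sign σ : ℤˣ) : ℤ) : ℝ) • value L M := by
  have := hL.ber_right N M _ h (isGL_permMat σ⁻¹)
  rwa [mul_permMat, ber_permMat, mul_smul_comm, mul_one, Equiv.Perm.sign_inv] at this

end Perm

section Cycle

/-- The permutation of `r + 1 + k` indices that inserts the last one in place `r`. -/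
def insertLast {r k r' : ℕ} (hr : r' = r + k) : Equiv.Perm (Fin (r' + 1)) :=
  Fin.cycleIcc ⟨r, by omega⟩ (Fin.last r')

variable {r k l s r' s' : ℕ} (hr : r' = r + k)

theorem sign_insertLast :
    (((Equiv.Perm.sign (insertLast hr) : ℤˣ) : ℤ) : ℝ) = sg k := by
  rw [insertLast, Fin.sign_cycleIcc_of_le (Fin.le_last _)]
  have : (Fin.last r' : ℕ) - r = k := by rw [Fin.val_last]; omega
  rw [this]
  simp

variable (hs : s' = s + l) (hr1 : r' + 1 = r + 1 + k)

theorem insertLast_new :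
    Sum.map (insertLast hr) id (newIdx r' s') = fstI hr1 hs (newIdx r s) := by
  refine congrArg Sum.inl ?_
  rw [insertLast, Fin.cycleIcc_of_last (Fin.le_last _)]
  rfl

theorem insertLast_fst (i : Fin r ⊕ Fin s) :
    Sum.map (insertLast hr) id (oldIdx r' s' (fstI hr hs i)) =
      fstI hr1 hs (oldIdx r s i) := by
  rcases i with i | i
  · refine congrArg Sum.inl ?_
    rw [insertLast, Fin.cycleIcc_of_lt]
    · rfl
    · rw [Fin.lt_def]
      exact i.2
  · rfl

theorem insertLast_lst (i : Fin k ⊕ Fin l) :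
    Sum.map (insertLast hr) id (oldIdx r' s' (lstI hr hs i)) = lstI hr1 hs i := by
  rcases i with i | i
  · refine congrArg Sum.inl ?_
    rw [insertLast, Fin.cycleIcc_of_ge_of_lt]
    · refine Fin.ext ?_
      rw [Fin.val_add_one_of_lt]
      · simp [lastIdx, id]
        omega
      · exact Fin.castSucc_lt_last _
    · rw [Fin.le_def]
      simp [lastIdx, id]
    · exact Fin.castSucc_lt_last _
  · rfl

end Cycle

section Stab
variable {n m p q r s k l p' q' r' s' N : ℕ} {hp : p' = p + k} {hq : q' = q + l} {hr : r' = r + k}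
  {hs : s' = s + l}

theorem splitIdx_eq_inl {x y z : ℕ} (h : z = x + y) (i : Fin z) (j : Fin x) :
    splitIdx h i = .inl j ↔ i = firstIdx h j := by
  rw [← splitIdx_firstIdx h j]
  refine ⟨fun e => ?_, fun e => e ▸ rfl⟩
  simpa [splitIdx] using e

theorem splitRow_eq_inl {x y z : ℕ} (h : z = x + y) (a : Fin n ⊕ Fin z) (b : Fin n ⊕ Fin x) :
    splitRow h a = .inl b ↔ a = Sum.map id (firstIdx h) b := by
  rcases a with a | a
  · rcases b with b | b <;> simp [splitRow]
  · rcases b with b | b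
    · rcases hh : splitIdx h a with j | j <;> simp [splitRow, hh]
    · have := splitIdx_eq_inl h a b
      rcases hh : splitIdx h a with j | j <;> rw [hh] at this <;> simp_all [splitRow]

theorem blockDiag_eq_inl {α β κ : Type} [DecidableEq κ] (x : α ⊕ κ) (y : β ⊕ κ) (c : α × β) :
    blockDiag x y = .inl c ↔ x = .inl c.1 ∧ y = .inl c.2 := by
  obtain ⟨a, b⟩ := c
  rcases x with x | x <;> rcases y with y | y <;> simp [blockDiag]

theorem blockOff_eq_some {α β κ κ' : Type} (x : α ⊕ κ) (y : β ⊕ κ') (c : α × β) :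
    blockOff x y = some c ↔ x = .inl c.1 ∧ y = .inl c.2 := by
  obtain ⟨a, b⟩ := c
  rcases x with x | x <;> rcases y with y | y <;> simp [blockOff]

theorem elim_single_apply {ι κ : Type} [DecidableEq ι] [DecidableEq κ] {f : ι → κ}
    (hf : Function.Injective f) (o : Option ι) (c : ι) :
    (o.elim (0 : κ →₀ ℝ) (fun c => Finsupp.single (f c) 1)) (f c) = if o = some c then 1 else 0 := by
  rcases o with _ | o <;> simp [Finsupp.single_apply, hf.eq_iff]

theorem elim_single_apply_ne {ι κ : Type} {f : ι → κ} {d : κ} (hf : ∀ i, f i ≠ d) (o : Option ι) :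
    (o.elim (0 : κ →₀ ℝ) (fun c => Finsupp.single (f c) 1)) d = 0 := by
  classical
  rcases o with _ | o <;> simp [Finsupp.single_apply, hf]

theorem pd_sigmaInv (a : MRow n m r s) (K : Fin p ⊕ Fin q) (L : MixedFun n m p' q' r' s') :
    pd (mixedDom n m p q r s) a K (sigmaInv hp hq hr hs L) =
      sigmaInv hp hq hr hs (pd (mixedDom n m p' q' r' s') (fstRow hr hs a) (fstI hp hq K) L) := by
  refine Subst.pd_pull _ (sigmaSubst_mem hp hq hr hs) ?_ L
  have hev : ∀ {α β : Type} (x : α ⊕ ℝ) (f : α → β) (hf : Function.Injective f) (c : α),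
      (Sum.map f id x : β ⊕ ℝ) = .inl (f c) ↔ x = .inl c := by
    intro α β x f hf c
    rcases x with x | x <;> simp [hf.eq_iff]
  have hev' : ∀ {α β : Type} (x : α ⊕ ℝ) (f : α → β) (d : β) (hf : ∀ i, f i ≠ d),
      (Sum.map f id x : β ⊕ ℝ) ≠ .inl d := by
    intro α β x f d hf
    rcases x with x | x <;> simp [hf]
  rcases a with a | a <;> rcases K with K | K
  · rintro (⟨b, k⟩ | ⟨b, k⟩)
    · refine (hev _ _ Sum.inl_injective _).trans ((blockDiag_eq_inl _ _ _).trans ?_)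
      rw [splitRow_eq_inl, splitIdx_eq_inl, Sum.inl.injEq, Prod.mk.injEq]
    · exact iff_of_false (hev' _ _ _ fun _ h => nomatch h) (fun h => nomatch h)
  · have h0 : blockOff (splitRow hr (Sum.map id (firstIdx hr) a)) (splitIdx hq (firstIdx hq K)) =
        some (a, K) :=
      (blockOff_eq_some _ _ _).2 ⟨(splitRow_eq_inl _ _ _).2 rfl, (splitIdx_eq_inl _ _ _).2 rfl⟩
    refine ⟨?_, (elim_single_apply Sum.inl_injective _ _).trans (if_pos h0)⟩
    rintro (⟨b, k⟩ | ⟨b, k⟩) hi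
    · refine (elim_single_apply Sum.inl_injective _ _).trans (if_neg fun h => hi ?_)
      obtain ⟨h1, h2⟩ := (blockOff_eq_some _ _ _).1 h
      exact congrArg Sum.inl (Prod.ext ((splitRow_eq_inl _ _ _).1 h1) ((splitIdx_eq_inl _ _ _).1 h2))
    · exact elim_single_apply_ne (f := Sum.inr) (d := Sum.inl (a, K)) (fun _ h => by cases h) _
  · have h0 : blockOff (splitRow hs (Sum.map id (firstIdx hs) a)) (splitIdx hp (firstIdx hp K)) =
        some (a, K) :=
      (blockOff_eq_some _ _ _).2 ⟨(splitRow_eq_inl _ _ _).2 rfl, (splitIdx_eq_inl _ _ _).2 rfl⟩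
    refine ⟨?_, (elim_single_apply Sum.inr_injective _ _).trans (if_pos h0)⟩
    rintro (⟨b, k⟩ | ⟨b, k⟩) hi
    · exact elim_single_apply_ne (f := Sum.inl) (d := Sum.inr (a, K)) (fun _ h => by cases h) _
    · refine (elim_single_apply Sum.inr_injective _ _).trans (if_neg fun h => hi ?_)
      obtain ⟨h1, h2⟩ := (blockOff_eq_some _ _ _).1 h
      exact congrArg Sum.inr (Prod.ext ((splitRow_eq_inl _ _ _).1 h1) ((splitIdx_eq_inl _ _ _).1 h2))
  · rintro (⟨b, k⟩ | ⟨b, k⟩)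
    · exact iff_of_false (hev' _ _ _ fun _ h => nomatch h) (fun h => nomatch h)
    · refine (hev _ _ Sum.inr_injective _).trans ((blockDiag_eq_inl _ _ _).trans ?_)
      rw [splitRow_eq_inl, splitIdx_eq_inl, Sum.inr.injEq, Prod.mk.injEq]

theorem value_eCov (α : Fin n ⊕ Fin m → ℝ) (L : MixedFun n m p q r s)
    {P : Matrix (Fin n ⊕ Fin m) (Fin p ⊕ Fin q) (Gr N)}
    {W : Matrix (Fin (r + 1) ⊕ Fin s) (Fin p ⊕ Fin q) (Gr N)}
    (hM : IsPoint (mixedDom n m p q (r + 1) s) (stack P W)) :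
    value (eCov α L) (stack P W) = sg r • ∑ A, (α A * sg (par A)) • ∑ K, W (newIdx r s) K *
      value (pd (mixedDom n m p q r s) (pRow A) K L) (stack P (W.submatrix (oldIdx r s) id)) := by
  rw [eCov_eq]
  simp only [value_smul, value_sum]
  congr 1
  refine Finset.sum_congr rfl fun A _ => ?_
  rw [value_rowD hM]
  congr 1
  refine Finset.sum_congr rfl fun K _ => ?_
  have h := pd_addRow (pRow A) K L
  rw [oldRow_pRow] at h
  rw [h, value_addRow hM, stack_wRow]

theorem value_eVec (u : Fin n ⊕ Fin m → ℝ) (L : MixedFun n m p q r s)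
    {M : Matrix (MRow n m r s) (Fin (p + 1) ⊕ Fin q) (Gr N)}
    (hM : IsPoint (mixedDom n m (p + 1) q r s) M) :
    value (eVec u L) M = sg r • ∑ A, u A • (M (pRow A) (newIdx p q) *
      value L (M.submatrix id (oldIdx p q)) - ∑ K, M (pRow A) (oldIdx p q K) *
        ∑ b, sg (par b * par K) • (M b (newIdx p q) *
          value (pd (mixedDom n m p q r s) b K L) (M.submatrix id (oldIdx p q)))) := by
  rw [eVec_eq]
  simp only [value_smul, value_sum]
  congr 1
  refine Finset.sum_congr rfl fun A _ => ?_
  congr 1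
  refine (value_crossD hM _ _).trans ?_
  rw [value_addCol hM, sum_oldIdx]
  have h0 : value (colD (mixedDom n m (p + 1) q r s) (newIdx p q) (newIdx p q) (addCol L)) M = 0 := by
    refine (value_colD hM _ _).trans (Finset.sum_eq_zero fun b _ => ?_)
    have := congrArg (fun f => value f M) (pd_addCol_new b L)
    refine (congrArg (_ • ·) (congrArg (_ * ·) this)).trans ?_
    simp only [value_zero, mul_zero, smul_zero]
  refine congrArg (fun x => M (pRow A) (newIdx p q) * value L (M.submatrix id (oldIdx p q)) - x) ?_
  refine (congrArg (fun x => _ + _ * x) h0).trans ?_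
  rw [mul_zero, add_zero]
  refine Finset.sum_congr rfl fun K _ => congrArg (_ * ·) ?_
  refine (value_colD hM _ _).trans (Finset.sum_congr rfl fun b _ => ?_)
  have h1 := (congrArg (fun f => value f M) (pd_addCol b K L)).trans (value_addCol hM _)
  refine congrArg₂ (· • ·) ?_ (congrArg (_ * ·) h1)
  rw [oldIdx, par_map]
  simp [newIdx, par]

/-- The additional row of `e(α)` stands after the last `k` even rows on one side and before them on
the other. The sign `(-1)^k` of its cyclic permutation accounts for the difference between the
factors `(-1)^(r+k)` and `(-1)^r`. The entries of this row in the
last `k|l` columns vanish. -/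
theorem sigmaInv_eCov (hr1 : r' + 1 = r + 1 + k) (α : Fin n ⊕ Fin m → ℝ)
    {L' : MixedFun n m p' q' r' s'} (hL' : IsMixed L') :
    sigmaInv hp hq hr1 hs (eCov α L') = eCov α (sigmaInv hp hq hr hs L') := by
  refine eq_of_value fun N X hX => ?_
  obtain ⟨P, W, rfl⟩ : ∃ P W, X = stack P W := ⟨_, _, (stack_eta X).symm⟩
  have hX' := (isPoint_sigmaMat_iff hp hq hr1 hs).2 hX
  rw [value_sigmaInv hp hq hr1 hs hX, value_eCov α _ hX]
  have hXo := (isPoint_oldRow.1 hX).2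
  have hXo' := (isPoint_sigmaMat_iff hp hq hr hs).2 hXo
  -- the new row is moved from place `r` to the end
  set P1 := (sigmaMat hp hq hr1 hs (stack P W)).submatrix pRow id with hP1
  set W1 := (sigmaMat hp hq hr1 hs (stack P W)).submatrix wRow id with hW1
  have he : sigmaMat hp hq hr1 hs (stack P W) = stack P1 W1 := (stack_eta _).symm
  rw [he] at hX' ⊢
  have hperm := (isMixed_eCov α hL').value_row_perm hX' (insertLast hr)
  rw [sign_insertLast] at hperm
  have hY : stack P1 ((W1.submatrix (Sum.map (insertLast hr) id) id).submatrix (oldIdx r' s') id) =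
      sigmaMat hp hq hr hs (stack P (W.submatrix (oldIdx r s) id)) := by
    refine mrow_ext (fun A => ?_) (fun F => ?_)
    · rw [stack_pRow]
      funext K
      change sigmaMat hp hq hr1 hs (stack P W) (pRow A) K = _
      rw [← fstRow_pRow hr1 hs, ← fstRow_pRow hr hs]
      rcases idx_cases hp hq K with ⟨K, rfl⟩ | ⟨K, rfl⟩
      · rw [sigmaMat_ff, sigmaMat_ff, stack_pRow, stack_pRow]
      · rw [sigmaMat_fl, sigmaMat_fl]
    · rw [stack_wRow]
      funext K
      change sigmaMat hp hq hr1 hs (stack P W)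
        (wRow (Sum.map (insertLast hr) id (oldIdx r' s' F))) K = _
      rcases idx_cases hr hs F with ⟨F, rfl⟩ | ⟨F, rfl⟩
      · rw [insertLast_fst hr hs hr1, ← fstRow_wRow, ← fstRow_wRow]
        rcases idx_cases hp hq K with ⟨K, rfl⟩ | ⟨K, rfl⟩
        · rw [sigmaMat_ff, sigmaMat_ff, stack_wRow, stack_wRow]
          rfl
        · rw [sigmaMat_fl, sigmaMat_fl]
      · rw [insertLast_lst hr hs hr1, ← lstRow_eq, ← lstRow_eq]
        rcases idx_cases hp hq K with ⟨K, rfl⟩ | ⟨K, rfl⟩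
        · rw [sigmaMat_lf, sigmaMat_lf]
        · rw [sigmaMat_ll, sigmaMat_ll]
  have hnew : ∀ K, (W1.submatrix (Sum.map (insertLast hr) id) id) (newIdx r' s') K =
      sigmaMat hp hq hr1 hs (stack P W) (fstRow hr1 hs (wRow (newIdx r s))) K := by
    intro K
    rw [Matrix.submatrix_apply, insertLast_new hr hs hr1, fstRow_wRow]
    rfl
  have hpt : IsPoint (mixedDom n m p' q' (r' + 1) s')
      (stack P1 (W1.submatrix (Sum.map (insertLast hr) id) id)) := by
    rw [isPoint_oldRow, hY]
    refine ⟨?_, hXo'⟩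
    have := (isSuper_stack_iff.1 hX'.1).2.submatrix (insertLast hr) id id id
    rwa [Sum.map_id_id] at this
  rw [value_eCov α _ hpt, hY] at hperm
  have h2 : value (eCov α L') (stack P1 W1) = sg k • (sg k • value (eCov α L') (stack P1 W1)) := by
    rw [smul_smul, sg_mul_self, one_smul]
  rw [h2, ← hperm, smul_smul]
  refine congrArg₂ (· • ·) ?_ ?_
  · rw [hr, sg, sg, sg, ← pow_add, show k + (r + k) = r + 2 * k by ring, pow_add, pow_mul]
    simp
  · refine Finset.sum_congr rfl fun A _ => congrArg (_ • ·) ?_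
    rw [sum_split hp hq]
    simp only [hnew, sigmaMat_ff, sigmaMat_fl, zero_mul, Finset.sum_const_zero, add_zero]
    refine Finset.sum_congr rfl fun K _ => ?_
    rw [pd_sigmaInv, fstRow_pRow, value_sigmaInv hp hq hr hs hXo, stack_wRow]

end Stab

section Stab
variable {n m p q r s k l p' q' r' s' N : ℕ} {hp : p' = p + k} {hq : q' = q + l} {hr : r' = r + k}
  {hs : s' = s + l}

theorem sum_row_split (hr : r' = r + k) (hs : s' = s + l) {V : Type} [AddCommMonoid V]
    (f : MRow n m r' s' → V) :
    ∑ b, f b = ∑ b, f (fstRow hr hs b) + ∑ j, f (lstRow hr hs j) := by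
  rw [sum_mrow, sum_mrow, sum_split hr hs, add_assoc]
  simp only [fstRow_pRow, fstRow_wRow, lstRow_eq]

/-- As for `e(α)`, the additional column is moved past the last `k` even columns. At `(M 0; 0 1)`
the rows of `p` vanish in the last `k|l` columns and the additional column vanishes in the last
`k|l` rows, so only derivatives with respect to entries of `M` remain. -/
theorem sigmaInv_eVec (hp1 : p' + 1 = p + 1 + k) (u : Fin n ⊕ Fin m → ℝ)
    {L' : MixedFun n m p' q' r' s'} (hL' : IsMixed L') :
    sigmaInv hp1 hq hr hs (eVec u L') = eVec u (sigmaInv hp hq hr hs L') := by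
  refine eq_of_value fun N X hX => ?_
  have hX' := (isPoint_sigmaMat_iff hp1 hq hr hs).2 hX
  rw [value_sigmaInv hp1 hq hr hs hX, value_eVec u _ hX]
  have hXo := (isPoint_oldCol.1 hX).2
  have hXo' := (isPoint_sigmaMat_iff hp hq hr hs).2 hXo
  have hff := sigmaMat_ff hp1 hq hr hs X
  have hfl := sigmaMat_fl hp1 hq hr hs X
  have hlf := sigmaMat_lf hp1 hq hr hs X
  have hll := sigmaMat_ll hp1 hq hr hs X
  -- the new column is moved from place `p` to the end
  generalize sigmaMat hp1 hq hr hs X = M at *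
  have hperm := (isMixed_eVec u hL').value_col_perm hX' (insertLast hp)
  rw [sign_insertLast] at hperm
  have hY : (M.submatrix id (Sum.map (insertLast hp) id)).submatrix id (oldIdx p' q') =
      sigmaMat hp hq hr hs (X.submatrix id (oldIdx p q)) := by
    ext b K
    change M b (Sum.map (insertLast hp) id (oldIdx p' q' K)) = _
    rcases idx_cases hp hq K with ⟨K, rfl⟩ | ⟨K, rfl⟩
    · rw [insertLast_fst hp hq hp1]
      rcases row_cases hr hs b with ⟨b, rfl⟩ | ⟨b, rfl⟩
      · rw [sigmaMat_ff, hff]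
        rfl
      · rw [sigmaMat_lf, hlf]
    · rw [insertLast_lst hp hq hp1]
      rcases row_cases hr hs b with ⟨b, rfl⟩ | ⟨b, rfl⟩
      · rw [sigmaMat_fl, hfl]
      · rw [sigmaMat_ll, hll]
  have hnew : ∀ b, (M.submatrix id (Sum.map (insertLast hp) id)) b (newIdx p' q') =
      M b (fstI hp1 hq (newIdx p q)) := by
    intro b
    rw [Matrix.submatrix_apply, insertLast_new hp hq hp1]
    rfl
  have hold : ∀ b K, (M.submatrix id (Sum.map (insertLast hp) id)) b (oldIdx p' q' K) =
      sigmaMat hp hq hr hs (X.submatrix id (oldIdx p q)) b K :=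
    fun b K => congrFun (congrFun hY b) K
  have hpt : IsPoint (mixedDom n m (p' + 1) q' r' s')
      (M.submatrix id (Sum.map (insertLast hp) id)) := by
    rw [isPoint_oldCol, hY]
    refine ⟨?_, hXo'⟩
    have := hX'.1.submatrix id id (insertLast hp) id
    rwa [Sum.map_id_id] at this
  rw [value_eVec u _ hpt, hY] at hperm
  have h2 : value (eVec u L') M = sg k • (sg k • value (eVec u L') M) := by
    rw [smul_smul, sg_mul_self, one_smul]
  rw [h2, ← hperm, smul_smul]
  refine congrArg₂ (· • ·) ?_ ?_
  · rw [hr, sg, sg, sg, ← pow_add, show k + (r + k) = r + 2 * k by ring, pow_add, pow_mul]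
    simp
  · refine Finset.sum_congr rfl fun A _ => congrArg (_ • ·) ?_
    rw [sum_split hp hq]
    have hpA : (pRow A : MRow n m r' s') = fstRow hr hs (pRow A) := (fstRow_pRow hr hs A).symm
    simp only [hnew, hold, hpA, sigmaMat_fl, sigmaMat_ff, hff, zero_mul, Finset.sum_const_zero,
      add_zero]
    rw [value_sigmaInv hp hq hr hs hXo]
    congr 1
    refine Finset.sum_congr rfl fun K _ => congrArg (_ * ·) ?_
    rw [sum_row_split hr hs]
    simp only [hff, hlf, zero_mul, smul_zero, Finset.sum_const_zero, add_zero]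
    refine Finset.sum_congr rfl fun b _ => ?_
    rw [pd_sigmaInv, value_sigmaInv hp hq hr hs hXo, par_map, par_map]

theorem IsSigma.eCov (hr1 : r' + 1 = r + 1 + k) (α : Fin n ⊕ Fin m → ℝ) {L : MixedFun n m p q r s}
    {L' : MixedFun n m p' q' r' s'} (hL' : IsMixed L') (h : IsSigma hp hq hr hs L L') :
    IsSigma hp hq hr1 hs (eCov α L) (eCov α L') := by
  rw [h.eq_sigmaInv, ← sigmaInv_eCov hr1 α hL']
  exact isSigma_sigmaInv (isMixed_eCov α hL')

theorem IsSigma.eVec (hp1 : p' + 1 = p + 1 + k) (u : Fin n ⊕ Fin m → ℝ) {L : MixedFun n m p q r s}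
    {L' : MixedFun n m p' q' r' s'} (hL' : IsMixed L') (h : IsSigma hp hq hr hs L L') :
    IsSigma hp1 hq hr hs (eVec u L) (eVec u L') := by
  rw [h.eq_sigmaInv, ← sigmaInv_eVec hp1 u hL']
  exact isSigma_sigmaInv (isMixed_eVec u hL')

end Stab

/-! ### Substitution of a vector into the last even slot -/

section Insert
variable {n m r s N : ℕ}

theorem insertVec_oldIdx (v : Matrix (Fin r ⊕ Fin s) (Fin n ⊕ Fin m) (Gr N)) (c : Gr N)
    (u : Fin n ⊕ Fin m → ℝ) (F : Fin r ⊕ Fin s) (A : Fin n ⊕ Fin m) :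
    insertVec v c u (oldIdx r s F) A = v F A := by
  rcases F with F | F
  · simp [insertVec]
  · rfl

theorem insertVec_newIdx (v : Matrix (Fin r ⊕ Fin s) (Fin n ⊕ Fin m) (Gr N)) (c : Gr N)
    (u : Fin n ⊕ Fin m → ℝ) (A : Fin n ⊕ Fin m) :
    insertVec v c u (newIdx r s) A = u A • c := by
  simp [insertVec]

theorem insertVec_submatrix (v : Matrix (Fin r ⊕ Fin s) (Fin n ⊕ Fin m) (Gr N)) (c : Gr N)
    (u : Fin n ⊕ Fin m → ℝ) : (insertVec v c u).submatrix (oldIdx r s) id = v := by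
  ext F A
  exact insertVec_oldIdx v c u F A

variable {v : Matrix (Fin r ⊕ Fin s) (Fin n ⊕ Fin m) (Gr N)}

theorem isSuper_insertVec (hv : IsSuper v) {ε : ℕ} {c : Gr N} (hc : c ∈ Par N ε)
    {u : Fin n ⊕ Fin m → ℝ} (hu : ∀ A, par A ≠ ε → u A = 0) : IsSuper (insertVec v c u) := by
  intro F A
  rcases eq_newIdx_or F with rfl | ⟨F, rfl⟩
  · rw [insertVec_newIdx]
    by_cases h : par A = ε
    · rw [h, show par (newIdx r s) = 0 from rfl, zero_add]
      exact Submodule.smul_mem _ _ hc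
    · rw [hu A h, zero_smul]
      exact zero_mem _
  · rw [insertVec_oldIdx, oldIdx, par_map]
    exact hv F A

theorem isPoint_insertVec (hv : IsPoint (straightDom n m r s) v) {ε : ℕ} {c : Gr N}
    (hc : c ∈ Par N ε) {u : Fin n ⊕ Fin m → ℝ} (hu : ∀ A, par A ≠ ε → u A = 0) :
    IsPoint (straightDom n m (r + 1) s) (insertVec v c u) := by
  rw [isPoint_oldVec, insertVec_submatrix]
  exact ⟨isSuper_insertVec hv.1 hc hu, hv⟩

theorem isPoint_insertVec_zero (hv : IsPoint (straightDom n m r s) v) (u : Fin n ⊕ Fin m → ℝ) :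
    IsPoint (straightDom n m (r + 1) s) (insertVec v 0 u) := by
  have e : insertVec v 0 u = insertVec v 0 0 := by
    ext F A
    rcases eq_newIdx_or F with rfl | ⟨F, rfl⟩
    · rw [insertVec_newIdx, insertVec_newIdx, smul_zero, smul_zero]
    · rw [insertVec_oldIdx, insertVec_oldIdx]
  rw [e]
  exact isPoint_insertVec hv (zero_mem (Par N 0)) fun _ _ => rfl

theorem value_zeroVec (hv : IsPoint (straightDom n m r s) v) (u : Fin n ⊕ Fin m → ℝ)
    (L : StraightFun n m (r + 1) s) : value (zeroVec L) v = value L (insertVec v 0 u) := by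
  refine (Subst.value_pull _ (fun _ hx => hx) hv L).trans ?_
  congr 1
  ext F A
  rcases eq_newIdx_or F with rfl | ⟨F, rfl⟩
  · rw [insertVec_newIdx, smul_zero]
    rcases A with A | A <;> simp [Subst.app]
  · rw [insertVec_oldIdx]
    rcases F with F | F <;> rcases A with A | A <;> simp [Subst.app]

theorem pd_zeroVec (F : Fin r ⊕ Fin s) (A : Fin n ⊕ Fin m) (L : StraightFun n m (r + 1) s) :
    pd (straightDom n m r s) F A (zeroVec L) =
      zeroVec (pd (straightDom n m (r + 1) s) (oldIdx r s F) A L) := by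
  refine Subst.pd_pull _ (fun _ hx => hx) ?_ L
  rcases F with F | F <;> rcases A with A | A
  · rintro (⟨a, k⟩ | ⟨a, k⟩)
    · induction a using Fin.lastCases with
      | last => simp [Subst.evIdx, (Fin.castSucc_ne_last F).symm]
      | cast a => simp [Subst.evIdx]
    · simp [Subst.evIdx]
  · refine ⟨?_, by simp [Subst.odd]⟩
    rintro (⟨a, k⟩ | ⟨a, k⟩) hi
    · induction a using Fin.lastCases with
      | last => simp [Subst.odd]
      | cast a =>
        have : ¬ ((a, k) = (F, A)) := fun h => hi (by cases h; rfl)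
        simp [Subst.odd, Finsupp.single_apply, this]
    · simp [Subst.odd]
  · refine ⟨?_, by simp [Subst.odd]⟩
    rintro (⟨a, k⟩ | ⟨a, k⟩) hi
    · induction a using Fin.lastCases with
      | last => simp [Subst.odd]
      | cast a => simp [Subst.odd]
    · have : ¬ ((a, k) = (F, A)) := fun h => hi (by cases h; rfl)
      simp [Subst.odd, Finsupp.single_apply, this]
  · rintro (⟨a, k⟩ | ⟨a, k⟩)
    · induction a using Fin.lastCases with
      | last => simp [Subst.evIdx]
      | cast a => simp [Subst.evIdx]
    · simp [Subst.evIdx]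

/-- A function whose differential with respect to the last even vector is constant is affine in
it. -/
theorem value_eq_insertVec_zero_add {f : StraightFun n m (r + 1) s}
    {w : Matrix (Fin (r + 1) ⊕ Fin s) (Fin n ⊕ Fin m) (Gr N)}
    (hw : IsPoint (straightDom n m (r + 1) s) w) {d : Fin n ⊕ Fin m → StraightFun n m r s}
    (hd : ∀ A, pd (straightDom n m (r + 1) s) (newIdx r s) A f = addVec (d A)) :
    value f w = value f (insertVec (w.submatrix (oldIdx r s) id) 0 0) +
      ∑ A, w (newIdx r s) A * value (d A) (w.submatrix (oldIdx r s) id) := by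
  obtain ⟨hws, hv⟩ := isPoint_oldVec.1 hw
  set v := w.submatrix (oldIdx r s) id with hvd
  have h0 := isPoint_insertVec_zero hv 0
  have hE : IsSuper (w - insertVec v 0 0) := hws.sub h0.1
  have hold : ∀ F A, (w - insertVec v 0 0) (oldIdx r s F) A = 0 := by
    intro F A
    rw [Matrix.sub_apply, insertVec_oldIdx]
    exact sub_self _
  have hnew : ∀ A, (w - insertVec v 0 0) (newIdx r s) A = w (newIdx r s) A := by
    intro A
    rw [Matrix.sub_apply, insertVec_newIdx, smul_zero, sub_zero]
  have hline : ∀ t : ℝ, (insertVec v 0 0 + t • (w - insertVec v 0 0)).submatrix (oldIdx r s) id =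
      v := by
    intro t
    ext F A
    rw [Matrix.submatrix_apply, Matrix.add_apply, Matrix.smul_apply, id, hold, smul_zero, add_zero,
      insertVec_oldIdx]
  have hpt : ∀ t : ℝ, IsPoint (straightDom n m (r + 1) s)
      (insertVec v 0 0 + t • (w - insertVec v 0 0)) := by
    intro t
    rw [isPoint_oldVec, hline]
    exact ⟨h0.1.add (hE.smul t), hv⟩
  have := value_flow (f := f) (K := ∑ A, w (newIdx r s) A * value (d A) v) hE hpt fun t => by
    rw [dval, sum_oldIdx]
    simp only [hold, zero_mul, Finset.sum_const_zero, zero_add, hnew, hd]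
    refine Finset.sum_congr rfl fun A _ => ?_
    rw [value_addVec (hpt t), hline]
  rwa [add_sub_cancel] at this

/-- For twice the same even vector, the system says that `2 ∂²L/∂v^A∂v^B = 0`. -/
theorem SecondOrderSystem.pd_new_pd_new {L : StraightFun n m (r + 1) s} (hL : SecondOrderSystem L)
    (A B : Fin n ⊕ Fin m) :
    pd (straightDom n m (r + 1) s) (newIdx r s) A
      (pd (straightDom n m (r + 1) s) (newIdx r s) B L) = 0 := by
  have h := hL (newIdx r s) (newIdx r s) A B
  rw [show par (newIdx r s) = 0 from rfl, add_zero, zero_mul, zero_mul, add_zero, pow_zero,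
    one_smul, ← two_smul ℝ] at h
  exact (smul_eq_zero.1 h).resolve_left two_ne_zero

/-- A function whose derivatives with respect to the last even vector vanish does not depend on
it. -/
theorem addVec_zeroVec {f : StraightFun n m (r + 1) s}
    (h : ∀ A, pd (straightDom n m (r + 1) s) (newIdx r s) A f = 0) : addVec (zeroVec f) = f := by
  refine eq_of_value fun N w hw => ?_
  rw [value_addVec hw, value_zeroVec (isPoint_oldVec.1 hw).2 0,
    value_eq_insertVec_zero_add hw (d := 0) fun A => by rw [h, Pi.zero_apply, map_zero]]
  simp [value_zero]

theorem addVec_zeroVec_pd {L : StraightFun n m (r + 1) s} (hL : SecondOrderSystem L)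
    (A : Fin n ⊕ Fin m) :
    addVec (zeroVec (pd (straightDom n m (r + 1) s) (newIdx r s) A L)) =
      pd (straightDom n m (r + 1) s) (newIdx r s) A L :=
  addVec_zeroVec fun B => hL.pd_new_pd_new B A

/-- On straight forms `∂L/∂v_{r+1}` does not depend on `v_{r+1}`, so nothing is lost by putting
`v_{r+1} = 0`. -/
theorem addVec_iVec (u : Fin n ⊕ Fin m → ℝ) {L : StraightFun n m (r + 1) s}
    (hL : SecondOrderSystem L) : addVec (iVec u L) = iDeriv u L := by
  rw [iVec, iDeriv]
  simp only [map_smul, map_sum]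
  congr 1
  exact Finset.sum_congr rfl fun A _ => congrArg (_ • ·) (addVec_zeroVec_pd hL A)

/-- The matrix `(g 0; 0 c)` with an additional even row and column. -/
abbrev borderMat (g : Matrix (Fin r ⊕ Fin s) (Fin r ⊕ Fin s) (Gr N)) (c : ℝ) :
    Matrix (Fin (r + 1) ⊕ Fin s) (Fin (r + 1) ⊕ Fin s) (Gr N) :=
  glue (k := 1) (l := 0) (p' := r + 1) (q' := s) rfl rfl g 0 0 (c • 1)

theorem borderMat_mul_old (g : Matrix (Fin r ⊕ Fin s) (Fin r ⊕ Fin s) (Gr N)) (c : ℝ)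
    (w : Matrix (Fin (r + 1) ⊕ Fin s) (Fin n ⊕ Fin m) (Gr N)) (F : Fin r ⊕ Fin s)
    (A : Fin n ⊕ Fin m) :
    (borderMat g c * w) (oldIdx r s F) A = (g * w.submatrix (oldIdx r s) id) F A := by
  have e : ∀ F, oldIdx r s F = fstI (k := 1) (l := 0) (p' := r + 1) (q' := s) rfl rfl F := by
    rintro (F | F) <;> rfl
  rw [e, Matrix.mul_apply, sum_split (k := 1) (l := 0) (p' := r + 1) (q' := s) rfl rfl]
  simp only [glue_ff, glue_fl, Matrix.zero_apply, zero_mul, Finset.sum_const_zero, add_zero]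
  rw [Matrix.mul_apply]
  simp only [Matrix.submatrix_apply, e]
  rfl

theorem borderMat_mul_new (g : Matrix (Fin r ⊕ Fin s) (Fin r ⊕ Fin s) (Gr N)) (c : ℝ)
    (w : Matrix (Fin (r + 1) ⊕ Fin s) (Fin n ⊕ Fin m) (Gr N))
    (A : Fin n ⊕ Fin m) : (borderMat g c * w) (newIdx r s) A = c • w (newIdx r s) A := by
  have e : newIdx r s = lstI (k := 1) (l := 0) (p' := r + 1) (q' := s) rfl rfl (.inl 0) := rfl
  rw [e, Matrix.mul_apply, sum_split (k := 1) (l := 0) (p' := r + 1) (q' := s) rfl rfl]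
  simp only [glue_lf, glue_ll, Matrix.zero_apply, zero_mul, Finset.sum_const_zero, zero_add,
    Matrix.smul_apply, Matrix.one_apply]
  simp

theorem borderMat_ber {g : Matrix (Fin r ⊕ Fin s) (Fin r ⊕ Fin s) (Gr N)} (hg : IsGL g) {c : ℝ}
    (hc : c ≠ 0) : IsGL (borderMat g c) ∧ Ber (borderMat g c) = c • Ber g := by
  have hD : IsGL (c • (1 : Matrix (Fin 1 ⊕ Fin 0) (Fin 1 ⊕ Fin 0) (Gr N))) := by
    refine ⟨IsSuper.one.smul c, ⟨⟨_, c⁻¹ • 1, ?_, ?_⟩, rfl⟩⟩ <;>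
    rw [smul_mul_smul_comm, mul_one] <;> simp [hc]
  have := glue_lower (k := 1) (l := 0) (p' := r + 1) (q' := s) rfl rfl hg IsSuper.zero hD
  refine ⟨this.1, this.2.trans ?_⟩
  rw [ber_entry, Matrix.smul_apply, Matrix.one_apply_eq, mul_smul_comm, mul_one]

theorem borderMat_mul_insertVec (g : Matrix (Fin r ⊕ Fin s) (Fin r ⊕ Fin s) (Gr N)) (t : ℝ)
    (c : Gr N) (u : Fin n ⊕ Fin m → ℝ) :
    borderMat g t * insertVec v c u = insertVec (g * v) (t • c) u := by
  ext F A
  rcases eq_newIdx_or F with rfl | ⟨F, rfl⟩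
  · rw [borderMat_mul_new, insertVec_newIdx, insertVec_newIdx, smul_comm]
  · rw [borderMat_mul_old, insertVec_oldIdx, insertVec_submatrix]

/-- A straight form vanishes if one of its even arguments does, since it is homogeneous of degree
one in it. -/
theorem IsStraight.value_insertVec_zero {L : StraightFun n m (r + 1) s} (hL : IsStraight L)
    (hv : IsPoint (straightDom n m r s) v) (u : Fin n ⊕ Fin m → ℝ) :
    value L (insertVec v 0 u) = 0 := by
  have h2 := borderMat_ber (N := N) (IsGL.one (a := r) (b := s)) (two_ne_zero (α := ℝ))
  have := hL.ber N _ _ (isPoint_insertVec_zero hv u) h2.1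
  rw [borderMat_mul_insertVec, h2.2, ber_one, smul_zero, Matrix.one_mul, mul_smul_comm, mul_one,
    two_smul] at this
  simpa using this

/-- Substitution of `c u` into the last even slot: a straight form is affine in this slot and vanishes
at zero, so its value is given by the derivative. -/
theorem IsStraight.value_insertVec {L : StraightFun n m (r + 1) s} (hL : IsStraight L)
    (hv : IsPoint (straightDom n m r s) v) {ε : ℕ} {c : Gr N} (hc : c ∈ Par N ε)
    {u : Fin n ⊕ Fin m → ℝ} (hu : ∀ A, par A ≠ ε → u A = 0) :
    value L (insertVec v c u) = sg r • (c * value (iVec u L) v) := by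
  have h := value_eq_insertVec_zero_add (isPoint_insertVec hv hc hu)
    fun A => (addVec_zeroVec_pd hL.system A).symm
  rw [insertVec_submatrix, hL.value_insertVec_zero hv, zero_add] at h
  simp only [insertVec_newIdx] at h
  rw [h, iVec, iDeriv]
  simp only [map_smul, map_sum, value_smul, value_sum]
  rw [mul_smul_comm, smul_smul, sg_mul_self, one_smul, Finset.mul_sum]
  refine Finset.sum_congr rfl fun A _ => ?_
  rw [smul_mul_assoc, mul_smul_comm]

theorem SecondOrderSystem.pd {R0 R1 C0 C1 : Type} [Fintype R0] [Fintype R1] [Fintype C0]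
    [Fintype C1] {U : TopologicalSpace.Opens (Ev R0 R1 C0 C1 → ℝ)}
    {f : SFun U (Od R0 R1 C0 C1)} (hf : SecondOrderSystem f) (c : R0 ⊕ R1) (j : C0 ⊕ C1) :
    SecondOrderSystem (pd U c j f) := by
  rw [system_iff] at *
  intro a b k l
  have h : ∀ a b k l, SuperForms.pd U a k (SuperForms.pd U b l (SuperForms.pd U c j f)) =
      sg ((par a + par k + (par b + par l)) * (par c + par j)) •
        SuperForms.pd U c j (SuperForms.pd U a k (SuperForms.pd U b l f)) := by
    intro a b k l
    rw [pd_comm b c, map_smul, pd_comm a c, smul_smul, ← sg_add]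
    congr 2
    ring
  rw [h, h, hf a b k l, map_neg, smul_neg, map_smul, smul_smul, smul_smul, mul_comm]
  congr 4
  ring

theorem SecondOrderSystem.zeroVec {L : StraightFun n m (r + 1) s} (hL : SecondOrderSystem L) :
    SecondOrderSystem (zeroVec L) := by
  intro a b k l
  have := congrArg SuperForms.zeroVec (hL (oldIdx r s a) (oldIdx r s b) k l)
  rw [map_add, map_smul, map_zero, par_map, par_map] at this
  rwa [pd_zeroVec, pd_zeroVec, pd_zeroVec, pd_zeroVec]

theorem iVec_eq_sum (u : Fin n ⊕ Fin m → ℝ) (L : StraightFun n m (r + 1) s) :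
    iVec u L = ∑ A, u A • iVec (Pi.single A 1) L := by
  simp only [iVec, iDeriv, map_smul, map_sum, Pi.single_apply, ite_smul, one_smul, zero_smul,
    Finset.sum_ite_eq', Finset.mem_univ, if_true]
  rw [Finset.smul_sum]
  exact Finset.sum_congr rfl fun A _ => smul_comm _ _ _

/-- The Berezinian law is that of `L` for the matrices `(g 0; 0 1)`, at the points where a multiple
`η u` of a basis vector, with an infinitesimal `η`, is substituted into the last even slot. -/
theorem isStraight_iVec (u : Fin n ⊕ Fin m → ℝ) {L : StraightFun n m (r + 1) s}
    (hL : IsStraight L) : IsStraight (iVec u L) where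
  system := by
    refine SecondOrderSystem.zeroVec (SecondOrderSystem.smul (.sum _ fun A _ => ?_) _)
    exact (hL.system.pd _ _).smul _
  ber N v g hv hg := by
    rw [iVec_eq_sum]
    simp only [value_sum, value_smul, Finset.sum_mul, smul_mul_assoc]
    refine Finset.sum_congr rfl fun A _ => congrArg (_ • ·) ?_
    refine eq_of_eps_mul (par A) ?_
    rw [map_mul, ← value_ext (isPoint_straight_mul hv hg), ← value_ext hv,
      ← ber_map (ext N) (fun i x hx => ext_mem N hx) hg, Matrix.map_mul]
    replace hv := isPoint_ext hv
    replace hg := isGL_ext hg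
    generalize v.map (ext N) = v at *
    generalize g.map (ext N) = g at *
    have hu : ∀ B, par B ≠ par A → (Pi.single A 1 : Fin n ⊕ Fin m → ℝ) B = 0 := fun B hB =>
      Pi.single_eq_of_ne (fun h => hB (by rw [h])) _
    have h1 := hL.value_insertVec (isPoint_straight_mul hv hg) (eps_mem N (par A)) hu
    have h2 := hL.value_insertVec hv (eps_mem N (par A)) hu
    obtain ⟨hg1, hg2⟩ := borderMat_ber hg one_ne_zero
    have h3 := hL.ber _ _ _ (isPoint_insertVec hv (eps_mem N (par A)) hu) hg1
    rw [borderMat_mul_insertVec, hg2, one_smul, one_smul, h1, h2, smul_mul_assoc] at h3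
    have h4 := congrArg (sg r • ·) h3
    simp only [smul_smul, sg_mul_self, one_smul] at h4
    rw [h4, mul_assoc]

end Insert

/-! ### The operator `e(u)` for straight forms -/

section IVec
variable {n m p q r s k l p' q' r' s' N : ℕ} {hp : p' = p + k} {hq : q' = q + l} {hr : r' = r + k}
  {hs : s' = s + l}

theorem sigmaMat_mul (M : Matrix (MRow n m r s) (Fin p ⊕ Fin q) (Gr N))
    (h : Matrix (Fin p ⊕ Fin q) (Fin p ⊕ Fin q) (Gr N)) :
    sigmaMat hp hq hr hs (M * h) = sigmaMat hp hq hr hs M * glue hp hq h 0 0 1 := by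
  ext b K
  rw [Matrix.mul_apply, sum_split hp hq]
  rcases row_cases hr hs b with ⟨b, rfl⟩ | ⟨b, rfl⟩ <;>
    rcases idx_cases hp hq K with ⟨K, rfl⟩ | ⟨K, rfl⟩
  · simp only [sigmaMat_ff, sigmaMat_fl, glue_ff, glue_lf, zero_mul, Finset.sum_const_zero,
      add_zero, Matrix.mul_apply]
  · simp only [sigmaMat_ff, sigmaMat_fl, glue_fl, glue_ll, Matrix.zero_apply, mul_zero, zero_mul,
      Finset.sum_const_zero, add_zero]
  · simp only [sigmaMat_lf, sigmaMat_ll, glue_ff, glue_lf, Matrix.zero_apply, mul_zero, zero_mul,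
      Finset.sum_const_zero, add_zero]
  · simp only [sigmaMat_lf, sigmaMat_ll, glue_fl, glue_ll, Matrix.zero_apply, mul_zero,
      Finset.sum_const_zero, zero_add, Matrix.one_apply, ite_mul, one_mul, zero_mul,
      Finset.sum_ite_eq, Finset.mem_univ, if_true]

theorem IsMixed.sigmaInv_ber_right {L' : MixedFun n m p' q' r' s'} (hL' : IsMixed L')
    {M : Matrix (MRow n m r s) (Fin p ⊕ Fin q) (Gr N)}
    {h : Matrix (Fin p ⊕ Fin q) (Fin p ⊕ Fin q) (Gr N)} (hM : IsPoint (mixedDom n m p q r s) M)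
    (hh : IsGL h) : value (sigmaInv hp hq hr hs L') (M * h) =
      value (sigmaInv hp hq hr hs L') M * Ber h := by
  have hg := glue_lower hp hq hh IsSuper.zero (IsGL.one (N := N) (a := k) (b := l))
  rw [value_sigmaInv hp hq hr hs (isPoint_mul_right hM hh), sigmaMat_mul,
    hL'.ber_right _ _ _ ((isPoint_sigmaMat_iff hp hq hr hs).2 hM) hg.1, hg.2, ber_one, mul_one,
    value_sigmaInv hp hq hr hs hM]

/-- Only the last row of `(1 0; v 0; 0 1)` has a nonzero entry in the additional column, so that
`e(u)` reduces there to the derivative with respect to the last even row of `w`. -/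
theorem tauInv_sigmaInv_eVec (u : Fin n ⊕ Fin m → ℝ) (L' : MixedFun n m n m (r + 1) s) :
    tauInv (sigmaInv (k := 1) (l := 0) rfl (Nat.add_zero m).symm rfl (Nat.add_zero s).symm
      (eVec u L')) = iVec u (tauInv L') := by
  refine eq_of_value fun N v hv => ?_
  have hX := isPoint_stack_one.2 hv
  have hp : n + 1 = n + 1 := rfl
  have hq : m = m + 0 := rfl
  have hr : r + 1 = r + 1 := rfl
  have hs : s = s + 0 := rfl
  have hv0 := isPoint_insertVec_zero hv u
  rw [value_tauInv hv, iVec, value_zeroVec hv u, iDeriv]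
  refine (value_sigmaInv hp hq hr hs hX _).trans ?_
  refine (value_eVec u L' ((isPoint_sigmaMat_iff hp hq hr hs).2 hX)).trans ?_
  have eK : ∀ K, oldIdx n m K = fstI (k := 1) (l := 0) (p' := n + 1) (q' := m) rfl rfl K := by
    rintro (K | K) <;> rfl
  have eN : newIdx n m = lstI (k := 1) (l := 0) (p' := n + 1) (q' := m) rfl rfl (.inl 0) := rfl
  have eF : ∀ F, oldIdx r s F = fstI (k := 1) (l := 0) (p' := r + 1) (q' := s) rfl rfl F := by
    rintro (K | K) <;> rfl
  have eFN : newIdx r s = lstI (k := 1) (l := 0) (p' := r + 1) (q' := s) rfl rfl (.inl 0) := rfl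
  have eA : ∀ A, (pRow A : MRow n m (r + 1) s) = fstRow (k := 1) (l := 0) hr hs (pRow A) :=
    fun A => (fstRow_pRow _ _ A).symm
  have hff := sigmaMat_ff (n := n) (m := m) hp hq hr hs
    (stack (1 : Matrix (Fin n ⊕ Fin m) (Fin n ⊕ Fin m) (Gr N)) v)
  have hfl := sigmaMat_fl (n := n) (m := m) hp hq hr hs
    (stack (1 : Matrix (Fin n ⊕ Fin m) (Fin n ⊕ Fin m) (Gr N)) v)
  have hlf := sigmaMat_lf (n := n) (m := m) hp hq hr hs
    (stack (1 : Matrix (Fin n ⊕ Fin m) (Fin n ⊕ Fin m) (Gr N)) v)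
  have hll := sigmaMat_ll (n := n) (m := m) hp hq hr hs
    (stack (1 : Matrix (Fin n ⊕ Fin m) (Fin n ⊕ Fin m) (Gr N)) v)
  have hY : (sigmaMat hp hq hr hs
    (stack (1 : Matrix (Fin n ⊕ Fin m) (Fin n ⊕ Fin m) (Gr N)) v)).submatrix id (oldIdx n m) =
      stack 1 (insertVec v 0 u) := by
    refine mrow_ext (fun A => ?_) (fun F => ?_)
    · funext K
      rw [stack_pRow, Matrix.submatrix_apply, id, eA, eK, hff, stack_pRow]
    · funext K
      rw [Matrix.submatrix_apply, id, eK, stack_wRow]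
      rcases eq_newIdx_or F with rfl | ⟨F, rfl⟩
      · rw [insertVec_newIdx, smul_zero, eFN, ← lstRow_eq]
        exact hlf _ _
      · rw [insertVec_oldIdx, eF, ← fstRow_wRow, hff, stack_wRow]
  generalize sigmaMat hp hq hr hs
    (stack (1 : Matrix (Fin n ⊕ Fin m) (Fin n ⊕ Fin m) (Gr N)) v) = M at *
  rw [hY, value_smul, value_sum, sg, pow_succ, mul_neg_one, neg_smul, ← smul_neg,
    ← Finset.sum_neg_distrib]
  refine congrArg (_ • ·) (Finset.sum_congr rfl fun A _ => ?_)
  rw [value_smul, ← smul_neg]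
  refine congrArg (_ • ·) ?_
  rw [pd_tauInv, value_tauInv hv0, eA, eN, hfl, zero_mul, zero_sub, neg_neg]
  rw [Finset.sum_eq_single A]
  · rw [eK, hff, stack_pRow, Matrix.one_apply_eq, one_mul, sum_row_split (k := 1) (l := 0) hr hs]
    simp only [hfl, zero_mul, smul_zero, Finset.sum_const_zero, zero_add]
    rw [Finset.sum_eq_single (.inl 0)]
    · rw [hll, Matrix.one_apply_eq, one_mul, lstRow_eq, par_wRow]
      rw [← eFN, show par (newIdx r s) = 0 from rfl, zero_mul, sg_zero, one_smul]
    · intro j _ hj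
      rw [hll, Matrix.one_apply_ne hj, zero_mul, smul_zero]
    · simp
  · intro K _ hK
    rw [eK, hff, stack_pRow, Matrix.one_apply_ne hK.symm, zero_mul]
  · simp

theorem IsTau.iVec (u : Fin n ⊕ Fin m → ℝ) {L : StraightFun n m (r + 1) s}
    {L' : MixedFun n m n m (r + 1) s} (hL' : IsMixed L') (h : IsTau L L') :
    IsTau (iVec u L) (sigmaInv (k := 1) (l := 0) rfl (Nat.add_zero m).symm rfl
      (Nat.add_zero s).symm (eVec u L')) := by
  rw [h.eq_tauInv, ← tauInv_sigmaInv_eVec]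
  exact isTau_tauInv fun N M h hM hh => (isMixed_eVec u hL').sigmaInv_ber_right hM hh

theorem IsTau.eStraight (α : Fin n ⊕ Fin m → ℝ) {L : StraightFun n m r s}
    {L' : MixedFun n m n m r s} (hL' : IsMixed L') (h : IsTau L L') :
    IsTau (eStraight α L) (eCov α L') := by
  rw [h.eq_tauInv, ← tauInv_eCov α hL']
  exact isTau_tauInv (isMixed_eCov α hL').ber_right

end IVec

end SuperForms

end

theorem mainTheorem1 (n m : ℕ) (α u : Fin n ⊕ Fin m → ℝ) :
    -- `e(α)` and `e(u)` map mixed forms to mixed forms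
    (∀ (p q r s : ℕ) (L : MixedFun n m p q r s), IsMixed L →
      IsMixed (eCov α L) ∧ IsMixed (eVec u L)) ∧
    -- `e(α)` and `e(u)` commute with all `σ_{k|l}`
    (∀ (p q r s k l p' q' r' s' : ℕ) (hp : p' = p + k) (hq : q' = q + l) (hr : r' = r + k)
      (hs : s' = s + l) (L : MixedFun n m p q r s) (L' : MixedFun n m p' q' r' s'),
      IsMixed L → IsMixed L' → IsSigma hp hq hr hs L L' →
        IsSigma hp hq (show r' + 1 = r + 1 + k by omega) hs (eCov α L) (eCov α L') ∧
        IsSigma (show p' + 1 = p + 1 + k by omega) hq hr hs (eVec u L) (eVec u L')) ∧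
    -- `e(α)` and `e(u)` commute with all `σ_{k|l}⁻¹`
    (∀ (p q r s k l p' q' r' s' : ℕ) (hp : p' = p + k) (hq : q' = q + l) (hr : r' = r + k)
      (hs : s' = s + l) (L' : MixedFun n m p' q' r' s'), IsMixed L' →
        sigmaInv hp hq (show r' + 1 = r + 1 + k by omega) hs (eCov α L') =
          eCov α (sigmaInv hp hq hr hs L') ∧
        sigmaInv (show p' + 1 = p + 1 + k by omega) hq hr hs (eVec u L') =
          eVec u (sigmaInv hp hq hr hs L')) ∧
    -- `e_α` maps straight `r|s`-forms to straight `r+1|s`-forms, and `e(α)` corresponds to it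
    -- under the isomorphism `τ`
    (∀ (r s : ℕ) (L : StraightFun n m r s), IsStraight L → IsStraight (eStraight α L)) ∧
    (∀ (r s : ℕ) (L : StraightFun n m r s) (L' : MixedFun n m n m r s),
      IsStraight L → IsMixed L' → IsTau L L' → IsTau (eStraight α L) (eCov α L')) ∧
    (∀ (r s : ℕ) (L' : MixedFun n m n m r s), IsMixed L' →
      tauInv (eCov α L') = eStraight α (tauInv L')) ∧
    -- `i_u` maps straight `r+1|s`-forms to straight `r|s`-forms, and `σ_{1|0}⁻¹ e(u)` corresponds
    -- to it under the isomorphism `τ`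
    (∀ (r s : ℕ) (L : StraightFun n m (r + 1) s), IsStraight L → IsStraight (iVec u L)) ∧
    (∀ (r s : ℕ) (L : StraightFun n m (r + 1) s) (L' : MixedFun n m n m (r + 1) s),
      IsStraight L → IsMixed L' → IsTau L L' →
        IsTau (iVec u L)
          (sigmaInv (k := 1) (l := 0) rfl (Nat.add_zero m).symm rfl (Nat.add_zero s).symm
            (eVec u L'))) ∧
    (∀ (r s : ℕ) (L' : MixedFun n m n m (r + 1) s), IsMixed L' →
      tauInv (sigmaInv (k := 1) (l := 0) rfl (Nat.add_zero m).symm rfl (Nat.add_zero s).symm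
        (eVec u L')) = iVec u (tauInv L')) ∧
    -- on forms, `i_u L` is the derivative `(-1)^r u^A ∂L/∂v_{r+1}^A`, which does not depend on
    -- `v_{r+1}`, and it is the substitution of `u` into the last even slot: for `u` of parity `ε`
    -- and a parameter `c` of parity `ε`, `L(v_1, …, v_r, c u, …) = (-1)^r c (i_u L)(v_1, …, v_r, …)`
    (∀ (r s : ℕ) (L : StraightFun n m (r + 1) s), IsStraight L →
      addVec (iVec u L) = iDeriv u L ∧
      ∀ ε : ℕ, (∀ A, par A ≠ ε → u A = 0) →
        ∀ (N : ℕ) (c : Gr N) (v : Matrix (Fin r ⊕ Fin s) (Fin n ⊕ Fin m) (Gr N)),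
          c ∈ CliffordAlgebra.evenOdd (0 : QuadraticForm ℝ (Fin N → ℝ)) (ε : ZMod 2) →
          IsPoint (straightDom n m r s) v →
            value L (insertVec v c u) = ((-1 : ℝ) ^ r) • (c * value (iVec u L) v)) := by
  refine ⟨fun p q r s L hL => ⟨isMixed_eCov α hL, isMixed_eVec u hL⟩,
    fun p q r s k l p' q' r' s' hp hq hr hs L L' _ hL' h => ⟨h.eCov _ α hL', h.eVec _ u hL'⟩,
    fun p q r s k l p' q' r' s' hp hq hr hs L' hL' =>
      ⟨sigmaInv_eCov _ α hL', sigmaInv_eVec _ u hL'⟩,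
    fun r s L hL => isStraight_eStraight α hL,
    fun r s L L' _ hL' h => h.eStraight α hL',
    fun r s L' hL' => tauInv_eCov α hL',
    fun r s L hL => isStraight_iVec u hL,
    fun r s L L' _ hL' h => h.iVec u hL',
    fun r s L' _ => tauInv_sigmaInv_eVec u L',
    fun r s L hL => ⟨addVec_iVec u hL.system, fun ε hu N c v hc hv => ?_⟩⟩
  exact hL.value_insertVec hv hc hu
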